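/- **Setting.** Let $X=X^0\supset X^1\supset X^2\supset\cdots$ be a scale of real Hilbert spaces, each $X^s$ ($s\ge r$) being densely embedded in $X^r$ with $|w|_{X^r}\le |w|_{X^s}$. All indices $r$ below are integers. $X^r(u,\rho)$ is the open ball of radius $\rho$ at $u$ in $X^r$, $X^r(\rho)=X^r(0,\rho)$, $\mathbb L$ denotes bounded (multi)linear operators, and $\mathbf D$ the Fréchet derivative. An operator on $X^{n-1}$ is said to be in $\mathbb L(X^{r},X^{q})$, and similarly for multilinear operators, if it has a bounded extension there; $\mathbf D F(u)$, $\mathbf D^lF(u)$ and $\mathbf D^m_{u_0}u$ are understood in this way. Let $n\ge2$, let $\mathcal O\subset X^{n-1}$ be open, $\mathcal O_n=\mathcal O\cap X^n$ and $\mathcal O_n(R)=\{u\in\mathcal O_n:|u|_{X^n}\le R\}$ with the topology of $X^n$, let $F:\mathcal O\to X^{n-2}$, $\mathcal L:\mathcal O\to\mathbb L(X,X^*)$, $\omega_*,a\in\mathbb R$, $C_{\mathcal L},C_*\ge1$, $u_*\in\mathcal O_n$, $R_1>|u_*|_{X^n}$. Put $\mathcal A=\mathbf DF$, $\mathcal B(u)=F(u)-\omega_*u$.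 A $C^1$ bound by $C_*$ means that the map and its derivative are bounded by $C_*$ on $\mathcal O$. Assume: * (B.1) $F\in C^2(\mathcal O,X^{n-2})\cap C^2(\mathcal O_n,X^{n-1})$; for $1\le r\le n-1$, $\mathcal A\in C^1(\mathcal O,\mathbb L(X^r,X^{r-1}))$ with $C^1$ bound $C_*$; and $\sup_{\mathcal O_n(R)}|\mathcal A|_{\mathbb L(X^n,X^{n-1})}<\infty$ for every $R>0$. * (B.2) For $1\le r\le n-1$ and $u\in\mathcal O$, $\omega_*-\mathcal A(u):X^r\to X^{r-1}$ is an isomorphism, and $\omega_*-\mathcal A$ and $(\omega_*-\mathcal A)^{-1}$ have $C^1$ bound $C_*$ as maps from $\mathcal O$ to $\mathbb L(X^r,X^{r-1})$ and to $\mathbb L(X^{r-1},X^r)$. For every $u\in\mathcal O$ there is $\lambda>C_{\mathcal L}^2\big(|\omega_*|+|a|C_*(1+|\omega_*|C_*)\big)$ with $(\lambda-\mathcal A(u))(X^1)=X$. * (B.3) $\mathcal L\in C^1(\mathcal O,\mathbb L(X,X^*))$ with $|\mathbf D\mathcal L|\le C_*$, and for $u\in\mathcal O$: $\mathcal L(u)=\mathcal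 L(u)^*$; $C_{\mathcal L}^{-2}|w|_X^2-a|(\omega_*-\mathcal A(u))^{-1}w|_X^2\le\langle\mathcal L(u)w,w\rangle\le C_{\mathcal L}^2|w|_X^2$ for $w\in X$; $\langle\mathcal L(u)w,\mathcal A(u)w\rangle\le\omega_*|w|_X^2$ for $w\in X^1$. * (B.4) With $v_*=\mathcal B(u_*)\in X^{n-1}$: for every $R>|v_*|_{X^{n-1}}$ there is $\delta>0$ such that the local inverse $\mathcal B^{-1}$ (with $\mathcal B^{-1}(v_*)=u_*$) maps $X^{n-2}(v_*,\delta)\cap X^{n-1}(R)$, with the topology of $X^{n-1}$, continuously into a bounded subset of $\mathcal O_n$, with the topology of $X^n$. * (B.5) $1\le m_0\le r_0\le n-1$ are integers such that $F$ is $m_0$ times continuously differentiable on $\mathcal O$ as a map to $X$ and, for $r_0+1\le r\le n$, $m\le m_0$ and all integers $m_1,\dots,m_l\in[1,m]$ with $m_1+\dots+m_l=m$: if $2\le l\le m$, then $\mathbf D^lF\in C^0\big(\mathcal O,\mathbb L(\otimes_{j=1}^lX^{r-m_j},X^{r-m})\big)$ with norm at most $C_*$; if $1\le l\le m$, then $\mathbf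 D^lF:\mathcal O\to\mathbb L(\otimes_{j=1}^lX^{r-m_j},X^{r-m-1})$ is Lipschitz with constant $C_*$. For $\varepsilon>0$ let $I_\varepsilon=X^{n-1}(u_*,\varepsilon)\cap X^n(R_1)$. **Theorem.** (i) There are $\varepsilon,T,M_0,M_2>0$ with $X^{n-1}(u_*,2\varepsilon)\subset\mathcal O$ such that for each $u_0\in I_\varepsilon$ the problem $u_t=F(u)$, $u(0)=u_0$, has a unique solution $u(t,u_0)$, $t\in[0,T]$, in $C^0_tX^n\cap C^1_tX^{n-1}$ with values in $X^{n-1}(u_*,2\varepsilon)\cap X^n(M_0)$, and $|u(t,u_{01})-u(t,u_{02})|_{X^{n-1}}\le M_2|u_{01}-u_{02}|_{X^{n-1}}$ for $u_{01},u_{02}\in I_\varepsilon$, $t\in[0,T]$. (ii) For any $\varepsilon,T,M_0,M_2$ as in (i), $u(t,\cdot)\in C^{m,1}(I_\varepsilon,X^{n-1-m})$ for $t\in[0,T]$, $1\le m\le m_0$, where $I_\varepsilon$ carries the norm of $X^{n-1}$. Moreover there is $C>0$ such that for all $1\le m\le m_0$, $r_0\le r\le n-1$, $t\in[0,T]$ and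 $u_0\in I_\varepsilon$, the $m$-linear operator $\mathbf D^m_{u_0}u(t,u_0)\in\mathbb L(\otimes_{j=1}^mX^r,X^{r-m+1})$ is strongly continuous in $t\in[0,T]$ and satisfies $$|\mathbf D^m_{u_0}u(t,u_0)|_{\mathbb L(\otimes_{j=1}^mX^r,X^{r-m+1})}\le\begin{cases}C,&m=1,\\ Ct,&m>1;\end{cases}$$ and, except when $r=r_0<n-1$ and $m=m_0\ge2$, for all $u_{01},u_{02}\in I_\varepsilon$, $$|\mathbf D^m_{u_0}u(t,u_{01})-\mathbf D^m_{u_0}u(t,u_{02})|_{\mathbb L(\otimes_{j=1}^mX^r,X^{r-m})}\le Ct\,|u_{01}-u_{02}|_{X^{n-1}}.$$ -/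

import Mathlib

open Set Metric

universe u

/-- A scale of real Hilbert spaces `X = X 0 ⊇ X 1 ⊇ X 2 ⊇ ...`. The embeddings are injective, have
dense range and do not increase the norm. -/
structure HilbertScale (X : ℕ → Type u) [∀ r, NormedAddCommGroup (X r)]
    [∀ r, InnerProductSpace ℝ (X r)] where
  emb : ∀ {r s : ℕ}, r ≤ s → (X s →L[ℝ] X r)
  emb_refl : ∀ (r : ℕ) (x : X r), emb (le_refl r) x = x
  emb_trans : ∀ {r s t : ℕ} (hrs : r ≤ s) (hst : s ≤ t) (x : X t),
    emb hrs (emb hst x) = emb (hrs.trans hst) x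
  emb_injective : ∀ {r s : ℕ} (h : r ≤ s), Function.Injective (emb h)
  emb_denseRange : ∀ {r s : ℕ} (h : r ≤ s), DenseRange (emb h)
  norm_emb_le : ∀ {r s : ℕ} (h : r ≤ s) (x : X s), ‖emb h x‖ ≤ ‖x‖

namespace HilbertScale

variable {X : ℕ → Type u} [∀ r, NormedAddCommGroup (X r)] [∀ r, InnerProductSpace ℝ (X r)]

/-- The inclusion of `X r` in the base space `X = X 0`. -/
def incl (S : HilbertScale X) (r : ℕ) : X r →L[ℝ] X 0 := S.emb (Nat.zero_le r)

/-- The bounded multilinear operator `G`, on `X (p 0) × ... × X (p (l-1))` with values in `X q`,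
and the multilinear operator `D`, on `(X s)^l` with values in `X q'`, agree on all arguments on which
both are defined (everything being regarded as an element of `X 0`). When `p j ≤ s` for all `j`,
this says that `G` is the extension of `D` to the larger spaces `X (p j)`; that extension is unique,
since `X s` is dense in each of them. -/
def Extends (S : HilbertScale X) {l s q q' : ℕ} {p : Fin l → ℕ}
    (G : ContinuousMultilinearMap ℝ (fun j : Fin l => X (p j)) (X q))
    (D : ContinuousMultilinearMap ℝ (fun _ : Fin l => X s) (X q')) : Prop :=
  ∀ (v : (j : Fin l) → X (p j)) (w : Fin l → X s),
    (∀ j, S.incl (p j) (v j) = S.incl s (w j)) → S.incl q (G v) = S.incl q' (D w)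

end HilbertScale

/-- `f` is `C^1` on the open set `O`, and `f` and its derivative are bounded by `C` on `O`. -/
def C1BoundedOn {E G : Type*} [NormedAddCommGroup E] [NormedSpace ℝ E] [NormedAddCommGroup G]
    [NormedSpace ℝ G] (f : E → G) (O : Set E) (C : ℝ) : Prop :=
  ContDiffOn ℝ 1 f O ∧ ∀ u ∈ O, ‖f u‖ ≤ C ∧ ‖fderiv ℝ f u‖ ≤ C

/-- The derivative of `f` is bounded by `C` on the open set `O`. -/
def DerivBoundedOn {E G : Type*} [NormedAddCommGroup E] [NormedSpace ℝ E] [NormedAddCommGroup G]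
    [NormedSpace ℝ G] (f : E → G) (O : Set E) (C : ℝ) : Prop :=
  ∀ u ∈ O, ‖fderiv ℝ f u‖ ≤ C

/-- The objects and constants that occur in the assumptions on the equation `u_t = F(u)`.
Only the values of `F`, `A`, `L` on `O` matter. -/
structure EvolutionData (X : ℕ → Type u) [∀ r, NormedAddCommGroup (X r)]
    [∀ r, InnerProductSpace ℝ (X r)] where
  n : ℕ
  two_le_n : 2 ≤ n
  /-- The domain of `F`. -/
  O : Set (X (n - 1))
  F : X (n - 1) → X (n - 2)
  /-- `A r u` is the operator `DF(u)`, acting from `X r` to `X (r - 1)`, for `1 ≤ r ≤ n - 1`. -/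
  A : (r : ℕ) → X (n - 1) → (X r →L[ℝ] X (r - 1))
  /-- The quadratic forms: `L u v w = ⟨L(u) v, w⟩`. -/
  L : X (n - 1) → (X 0 →L[ℝ] X 0 →L[ℝ] ℝ)
  ω : ℝ
  a : ℝ
  CL : ℝ
  one_le_CL : 1 ≤ CL
  C : ℝ
  one_le_C : 1 ≤ C

namespace EvolutionData

variable {X : ℕ → Type u} [∀ r, NormedAddCommGroup (X r)] [∀ r, InnerProductSpace ℝ (X r)]

/-- The inclusion of `X n` in `X (n - 1)`. -/
def down (E : EvolutionData X) (S : HilbertScale X) : X E.n →L[ℝ] X (E.n - 1) :=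
  S.emb (Nat.sub_le E.n 1)

/-- The inclusion of `X (n - 1)` in `X (n - 2)`. -/
def down' (E : EvolutionData X) (S : HilbertScale X) : X (E.n - 1) →L[ℝ] X (E.n - 2) :=
  S.emb (Nat.sub_le_sub_left (by norm_num) E.n)

/-- `O_n = O ∩ X n`, as a subset of `X n`. -/
def On (E : EvolutionData X) (S : HilbertScale X) : Set (X E.n) := E.down S ⁻¹' E.O

/-- The operator `c - A(u)` from `X r` to `X (r - 1)`. -/
def shift (E : EvolutionData X) (S : HilbertScale X) (c : ℝ) (r : ℕ) (u : X (E.n - 1)) :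
    X r →L[ℝ] X (r - 1) :=
  c • S.emb (Nat.sub_le r 1) - E.A r u

/-- The map `B(u) = F(u) - ω u`. -/
def B (E : EvolutionData X) (S : HilbertScale X) (u : X (E.n - 1)) : X (E.n - 2) :=
  E.F u - E.ω • E.down' S u

/-- Regularity of `F`, on `O` and on `O_n`, and of `A = DF`. -/
structure B1 (E : EvolutionData X) (S : HilbertScale X) : Prop where
  isOpen : IsOpen E.O
  contDiffOn : ContDiffOn ℝ 2 E.F E.O
  /-- `A r u` is the extension of `DF(u)` to `X r`. -/
  A_eq : ∀ r, 1 ≤ r → r ≤ E.n - 1 → ∀ u ∈ E.O, ∀ (v : X r) (w : X (E.n - 1)),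
    S.incl r v = S.incl (E.n - 1) w →
      S.incl (r - 1) (E.A r u v) = S.incl (E.n - 2) (fderiv ℝ E.F u w)
  A_bound : ∀ r, 1 ≤ r → r ≤ E.n - 1 → C1BoundedOn (E.A r) E.O E.C
  /-- `F` maps `O_n` to `X (n - 1)`, it is `C^2` there, and its derivative is bounded on the
  part of `O_n` in each ball of `X n`. -/
  top : ∃ Fn : X E.n → X (E.n - 1),
    (∀ u ∈ E.On S, E.down' S (Fn u) = E.F (E.down S u)) ∧
    ContDiffOn ℝ 2 Fn (E.On S) ∧
    ∀ R : ℝ, 0 < R → ∃ K : ℝ, ∀ u ∈ E.On S, ‖u‖ ≤ R → ‖fderiv ℝ Fn u‖ ≤ K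

/-- Non-degeneracy of `ω - A(u)`, and surjectivity of `lam - A(u)` for a large `lam`. -/
structure B2 (E : EvolutionData X) (S : HilbertScale X) : Prop where
  invertible : ∀ r, 1 ≤ r → r ≤ E.n - 1 → ∀ u ∈ E.O, (E.shift S E.ω r u).IsInvertible
  bound : ∀ r, 1 ≤ r → r ≤ E.n - 1 → C1BoundedOn (fun u => E.shift S E.ω r u) E.O E.C
  bound_inverse : ∀ r, 1 ≤ r → r ≤ E.n - 1 →
    C1BoundedOn (fun u => (E.shift S E.ω r u).inverse) E.O E.C
  surjective : ∀ u ∈ E.O, ∃ lam : ℝ,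
    E.CL ^ 2 * (|E.ω| + |E.a| * E.C * (1 + |E.ω| * E.C)) < lam ∧
      Function.Surjective (E.shift S lam 1 u)

/-- Coercivity and smoothness of the quadratic forms, and dissipativity of `A` with respect to
them. -/
structure B3 (E : EvolutionData X) (S : HilbertScale X) : Prop where
  contDiffOn : ContDiffOn ℝ 1 E.L E.O
  bound : DerivBoundedOn E.L E.O E.C
  symm : ∀ u ∈ E.O, ∀ v w : X 0, E.L u v w = E.L u w v
  lower : ∀ u ∈ E.O, ∀ w : X 0,
    (E.CL ^ 2)⁻¹ * ‖w‖ ^ 2 - E.a * ‖S.incl 1 ((E.shift S E.ω 1 u).inverse w)‖ ^ 2 ≤ E.L u w w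
  upper : ∀ u ∈ E.O, ∀ w : X 0, E.L u w w ≤ E.CL ^ 2 * ‖w‖ ^ 2
  dissipative : ∀ u ∈ E.O, ∀ w : X 1,
    E.L u (S.incl 1 w) (E.A 1 u w) ≤ E.ω * ‖S.incl 1 w‖ ^ 2

/-- The local inverse of `B` near `u_*` maps `{v ∈ X (n - 1) : |v - v_*|_{n-2} < δ, |v|_{n-1} < R}`
continuously to a bounded set of `O_n`, for each `R` and some `δ`. (`G` is that local inverse: a
continuous right inverse of `B` on this connected set, with `G v_* = u_*`.) -/
def B4 (E : EvolutionData X) (S : HilbertScale X) (us : X E.n) : Prop :=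
  ∃ vs : X (E.n - 1), E.down' S vs = E.B S (E.down S us) ∧
    ∀ R : ℝ, ‖vs‖ < R → ∃ δ : ℝ, 0 < δ ∧ ∃ G : X (E.n - 1) → X E.n,
      ContinuousOn G {v | ‖E.down' S v - E.down' S vs‖ < δ ∧ ‖v‖ < R} ∧
      G vs = us ∧
      (∀ v, ‖E.down' S v - E.down' S vs‖ < δ → ‖v‖ < R →
        G v ∈ E.On S ∧ E.B S (E.down S (G v)) = E.down' S v) ∧
      ∃ K : ℝ, ∀ v, ‖E.down' S v - E.down' S vs‖ < δ → ‖v‖ < R → ‖G v‖ ≤ K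

/-- The `l`-th derivative of `F` at `u`, with `F` regarded as a map to the base space `X 0`. -/
noncomputable def DF (E : EvolutionData X) (S : HilbertScale X) (l : ℕ) (u : X (E.n - 1)) :
    ContinuousMultilinearMap ℝ (fun _ : Fin l => X (E.n - 1)) (X 0) :=
  iteratedFDeriv ℝ l (fun x => S.incl (E.n - 2) (E.F x)) u

/-- Boundedness, continuity and Lipschitz continuity of the derivatives of `F`, as multilinear
operators on the spaces of the scale. -/
structure B5 (E : EvolutionData X) (S : HilbertScale X) (m₀ r₀ : ℕ) : Prop where
  one_le : 1 ≤ m₀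
  m₀_le : m₀ ≤ r₀
  r₀_le : r₀ ≤ E.n - 1
  contDiffOn : ContDiffOn ℝ m₀ (fun x => S.incl (E.n - 2) (E.F x)) E.O
  bound : ∀ r l m : ℕ, r₀ + 1 ≤ r → r ≤ E.n → 2 ≤ l → l ≤ m → m ≤ m₀ →
    ∀ k : Fin l → ℕ, (∀ j, 1 ≤ k j ∧ k j ≤ m) → ∑ j, k j = m →
      ∃ G : X (E.n - 1) → ContinuousMultilinearMap ℝ (fun j : Fin l => X (r - k j)) (X (r - m)),
        ContinuousOn G E.O ∧ ∀ u ∈ E.O, S.Extends (G u) (E.DF S l u) ∧ ‖G u‖ ≤ E.C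
  lipschitz : ∀ r l m : ℕ, r₀ + 1 ≤ r → r ≤ E.n → 1 ≤ l → l ≤ m → m ≤ m₀ →
    ∀ k : Fin l → ℕ, (∀ j, 1 ≤ k j ∧ k j ≤ m) → ∑ j, k j = m →
      ∃ G : X (E.n - 1) →
          ContinuousMultilinearMap ℝ (fun j : Fin l => X (r - k j)) (X (r - m - 1)),
        (∀ u ∈ E.O, S.Extends (G u) (E.DF S l u)) ∧
        ∀ u ∈ E.O, ∀ v ∈ E.O, ‖G u - G v‖ ≤ E.C * ‖u - v‖

/-- `u : [0, T] → X n` is a solution of `u_t = F(u)` in `C^0([0,T], X n) ∩ C^1([0,T], X (n - 1))`. -/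
structure IsSolution (E : EvolutionData X) (S : HilbertScale X) (T : ℝ) (u : ℝ → X E.n) :
    Prop where
  continuousOn : ContinuousOn u (Icc 0 T)
  contDiffOn : ContDiffOn ℝ 1 (fun t => E.down S (u t)) (Icc 0 T)
  mem : ∀ t ∈ Icc 0 T, u t ∈ E.On S
  eq : ∀ t ∈ Icc 0 T, HasDerivWithinAt (fun s => E.down' S (E.down S (u s)))
    (E.F (E.down S (u t))) (Icc 0 T) t

/-- The set of initial values: the ball of radius `ε` at `u_*` in `X (n - 1)`, intersected with the
ball of radius `R₁` at `0` in `X n`, as a subset of `X (n - 1)`. -/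
def initialSet (E : EvolutionData X) (S : HilbertScale X) (us : X E.n) (ε R₁ : ℝ) :
    Set (X (E.n - 1)) :=
  ball (E.down S us) ε ∩ E.down S '' ball 0 R₁

/-- Local well-posedness with constants `ε, T, M₀, M₂` and solution map `U`: for each initial value
`x` in the above set, `t ↦ U t x` is the unique solution on `[0, T]` with values in the `2ε`-ball
at `u_*` in `X (n - 1)` (which lies in `O`) and in the ball of radius `M₀` in `X n`; it is
Lipschitz in `x` in the norm of `X (n - 1)`. -/
structure IsSolutionMap (E : EvolutionData X) (S : HilbertScale X) (us : X E.n)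
    (R₁ ε T M₀ M₂ : ℝ) (U : ℝ → X (E.n - 1) → X E.n) : Prop where
  ε_pos : 0 < ε
  T_pos : 0 < T
  M₀_pos : 0 < M₀
  M₂_pos : 0 < M₂
  ball_subset : ball (E.down S us) (2 * ε) ⊆ E.O
  isSolution : ∀ x ∈ E.initialSet S us ε R₁, E.IsSolution S T (fun t => U t x)
  initial : ∀ x ∈ E.initialSet S us ε R₁, E.down S (U 0 x) = x
  mem : ∀ x ∈ E.initialSet S us ε R₁, ∀ t ∈ Icc 0 T,
    E.down S (U t x) ∈ ball (E.down S us) (2 * ε) ∧ ‖U t x‖ < M₀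
  unique : ∀ x ∈ E.initialSet S us ε R₁, ∀ w : ℝ → X E.n, E.IsSolution S T w →
    E.down S (w 0) = x →
    (∀ t ∈ Icc 0 T, E.down S (w t) ∈ ball (E.down S us) (2 * ε) ∧ ‖w t‖ < M₀) →
    ∀ t ∈ Icc 0 T, w t = U t x
  lipschitz : ∀ x ∈ E.initialSet S us ε R₁, ∀ y ∈ E.initialSet S us ε R₁, ∀ t ∈ Icc 0 T,
    ‖E.down S (U t x) - E.down S (U t y)‖ ≤ M₂ * ‖x - y‖

/-- The solution map at time `t`, as a map from `X (n - 1)` to `X (n - 1 - m)`. -/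
def solutionMap (E : EvolutionData X) (S : HilbertScale X) (U : ℝ → X (E.n - 1) → X E.n) (m : ℕ)
    (t : ℝ) (x : X (E.n - 1)) : X (E.n - 1 - m) :=
  S.emb (Nat.sub_le (E.n - 1) m) (E.down S (U t x))

/-- The `m`-th derivative of the solution map at time `t` with respect to the initial value, on the
set `I` of initial values, in the norm of `X (n - 1)`. -/
noncomputable def DU (E : EvolutionData X) (S : HilbertScale X) (U : ℝ → X (E.n - 1) → X E.n)
    (I : Set (X (E.n - 1))) (m : ℕ) (t : ℝ) (x : X (E.n - 1)) :
    ContinuousMultilinearMap ℝ (fun _ : Fin m => X (E.n - 1)) (X (E.n - 1 - m)) :=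
  iteratedFDerivWithin ℝ m (E.solutionMap S U m t) I x

end EvolutionData

open Filter Topology

/-! ### Scalar differential inequalities -/

theorem le_of_hasDerivWithinAt_nonpos {T : ℝ} {h h' : ℝ → ℝ}
    (hd : ∀ t ∈ Icc 0 T, HasDerivWithinAt h (h' t) (Icc 0 T) t)
    (hn : ∀ t ∈ Icc 0 T, h' t ≤ 0) {t : ℝ} (ht : t ∈ Icc 0 T) : h t ≤ h 0 := by
  have hanti : AntitoneOn h (Icc 0 T) := by
    refine antitoneOn_of_deriv_nonpos (convex_Icc 0 T) (fun t ht => (hd t ht).continuousWithinAt)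
      ?_ ?_
    · intro t ht
      rw [interior_Icc] at ht
      exact ((hd t (Ioo_subset_Icc_self ht)).hasDerivAt
        (Icc_mem_nhds ht.1 ht.2)).differentiableAt.differentiableWithinAt
    · intro t ht
      rw [interior_Icc] at ht
      rw [((hd t (Ioo_subset_Icc_self ht)).hasDerivAt (Icc_mem_nhds ht.1 ht.2)).deriv]
      exact hn t (Ioo_subset_Icc_self ht)
  exact hanti ⟨le_rfl, ht.1.trans ht.2⟩ ht ht.1

theorem gronwall_with_source {T K : ℝ} (hK : 0 ≤ K) {φ φ' G g : ℝ → ℝ}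
    (hφ : ∀ t ∈ Icc 0 T, HasDerivWithinAt φ (φ' t) (Icc 0 T) t)
    (hG : ∀ t ∈ Icc 0 T, HasDerivWithinAt G (g t) (Icc 0 T) t)
    (hg : ∀ t ∈ Icc 0 T, 0 ≤ g t)
    (hle : ∀ t ∈ Icc 0 T, φ' t ≤ K * φ t + g t) {t : ℝ} (ht : t ∈ Icc 0 T) :
    φ t ≤ Real.exp (K * t) * (φ 0 + (G t - G 0)) := by
  have key := le_of_hasDerivWithinAt_nonpos (T := T)
    (h := fun t => Real.exp (-(K * t)) * φ t - G t)
    (h' := fun t => Real.exp (-(K * t)) * (-(K * 1)) * φ t + Real.exp (-(K * t)) * φ' t - g t)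
    (fun t ht => by
      have h1 : HasDerivWithinAt (fun t : ℝ => Real.exp (-(K * t)))
          (Real.exp (-(K * t)) * (-(K * 1))) (Icc 0 T) t :=
        (((hasDerivAt_id t).const_mul K).neg.exp).hasDerivWithinAt
      exact (h1.mul (hφ t ht)).sub (hG t ht))
    (fun t ht => by
      have h1 : Real.exp (-(K * t)) ≤ 1 := by
        rw [Real.exp_le_one_iff]; nlinarith [mul_nonneg hK ht.1]
      have h2 := Real.exp_pos (-(K * t))
      have h3 := hle t ht
      nlinarith [mul_le_mul_of_nonneg_left h3 h2.le, mul_le_mul_of_nonneg_right h1 (hg t ht)]) ht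
  simp only [mul_zero, neg_zero, Real.exp_zero, one_mul] at key
  have h2 := Real.exp_pos (K * t)
  have h3 : Real.exp (K * t) * Real.exp (-(K * t)) = 1 := by
    rw [← Real.exp_add]; simp
  calc φ t = Real.exp (K * t) * (Real.exp (-(K * t)) * φ t) := by rw [← mul_assoc, h3, one_mul]
    _ ≤ Real.exp (K * t) * (φ 0 + (G t - G 0)) := by
      apply mul_le_mul_of_nonneg_left _ h2.le; linarith

theorem gronwall_const {T K η : ℝ} (hK : 0 ≤ K) (hη : 0 ≤ η) {φ φ' : ℝ → ℝ}
    (hφ : ∀ t ∈ Icc 0 T, HasDerivWithinAt φ (φ' t) (Icc 0 T) t)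
    (hle : ∀ t ∈ Icc 0 T, φ' t ≤ K * φ t + η) {t : ℝ} (ht : t ∈ Icc 0 T) :
    φ t ≤ Real.exp (K * t) * (φ 0 + η * t) := by
  have := gronwall_with_source hK hφ (G := fun t => η * t) (g := fun _ => η * 1)
    (fun t _ => ((hasDerivAt_id t).const_mul η).hasDerivWithinAt) (fun _ _ => by simpa using hη)
    (fun t ht => by simpa using hle t ht) ht
  simpa using this

theorem sqrt_gronwall {T K : ℝ} (hK : 0 ≤ K) {φ φ' G g : ℝ → ℝ}
    (hφ : ∀ t ∈ Icc 0 T, HasDerivWithinAt φ (φ' t) (Icc 0 T) t)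
    (hpos : ∀ t ∈ Icc 0 T, 0 ≤ φ t)
    (hG : ∀ t ∈ Icc 0 T, HasDerivWithinAt G (g t) (Icc 0 T) t)
    (hg : ∀ t ∈ Icc 0 T, 0 ≤ g t)
    (hle : ∀ t ∈ Icc 0 T, φ' t ≤ 2 * K * φ t + 2 * g t * √(φ t)) {t : ℝ} (ht : t ∈ Icc 0 T) :
    √(φ t) ≤ Real.exp (K * t) * (√(φ 0) + (G t - G 0)) := by
  have h0 : (0 : ℝ) ∈ Icc 0 T := ⟨le_rfl, ht.1.trans ht.2⟩
  have key : ∀ ε : ℝ, 0 < ε → √(φ t) ≤ Real.exp (K * t) * (√(φ 0) + (G t - G 0))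
      + Real.exp (K * t) * ε := by
    intro ε hε
    have hp : ∀ t ∈ Icc 0 T, 0 < φ t + ε ^ 2 := fun t ht => by
      have := hpos t ht; positivity
    have := gronwall_with_source (φ := fun t => √(φ t + ε ^ 2))
      (φ' := fun t => φ' t / (2 * √(φ t + ε ^ 2))) hK
      (fun t ht => ((hφ t ht).add_const (ε ^ 2)).sqrt (hp t ht).ne') hG hg (fun t ht => by
        have h1 := Real.sqrt_pos.2 (hp t ht)
        rw [div_le_iff₀ (by positivity)]
        have h2 := Real.sq_sqrt (hp t ht).le
        have h3 : √(φ t) ≤ √(φ t + ε ^ 2) := Real.sqrt_le_sqrt (by nlinarith)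
        have h4 := hle t ht
        nlinarith [mul_le_mul_of_nonneg_left h3 (hg t ht), mul_nonneg hK (sq_nonneg ε)]) ht
    have h5 : √(φ 0 + ε ^ 2) ≤ √(φ 0) + ε := by
      rw [Real.sqrt_le_left (by positivity)]
      nlinarith [Real.sq_sqrt (hpos 0 h0), mul_nonneg (Real.sqrt_nonneg (φ 0)) hε.le]
    calc √(φ t) ≤ √(φ t + ε ^ 2) := Real.sqrt_le_sqrt (by nlinarith)
      _ ≤ _ := this
      _ ≤ Real.exp (K * t) * (√(φ 0) + ε + (G t - G 0)) := by gcongr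
      _ = _ := by ring
  refine le_of_forall_pos_le_add fun δ hδ => ?_
  have := key (δ / Real.exp (K * t)) (div_pos hδ (Real.exp_pos _))
  rwa [mul_div_cancel₀ _ (Real.exp_pos _).ne'] at this

/-! ### Uniform convergence -/

section Uniform

variable {ι H : Type*} [NormedAddCommGroup H] {p : Filter ι} {s : Set ℝ} {F : ι → ℝ → H}
  {g : ℝ → H}

theorem tendstoUniformlyOn_of_tendsto_prod (hs : IsCompact s) (hg : ContinuousOn g s)
    (h : ∀ x ∈ s, Tendsto (fun q : ι × ℝ => F q.1 q.2) (p ×ˢ 𝓝[s] x) (𝓝 (g x))) :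
    TendstoUniformlyOn F g p s := by
  rw [← tendstoLocallyUniformlyOn_iff_tendstoUniformlyOn_of_compact hs,
    tendstoLocallyUniformlyOn_iff_filter]
  intro x hx
  rw [Metric.tendstoUniformlyOnFilter_iff]
  intro ε hε
  have h1 := (Metric.tendsto_nhds.1 (h x hx)) (ε / 2) (half_pos hε)
  have h2 := (Metric.tendsto_nhds.1 ((hg x hx).tendsto.comp (tendsto_snd (f := p)))) (ε / 2)
    (half_pos hε)
  filter_upwards [h1, h2] with q hq1 hq2
  calc dist (g q.2) (F q.1 q.2) ≤ dist (g q.2) (g x) + dist (F q.1 q.2) (g x) :=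
        dist_triangle_right _ _ _
    _ < ε := by simp only [Function.comp] at hq2; linarith

theorem TendstoUniformlyOn.tendsto_prod (h : TendstoUniformlyOn F g p s) (hg : ContinuousOn g s)
    {x : ℝ} (hx : x ∈ s) :
    Tendsto (fun q : ι × ℝ => F q.1 q.2) (p ×ˢ 𝓝[s] x) (𝓝 (g x)) := by
  rw [Metric.tendsto_nhds]
  intro ε hε
  have h1 := (Metric.tendstoUniformlyOn_iff.1 h) (ε / 2) (half_pos hε)
  have h2 := (Metric.tendsto_nhds.1 (hg x hx).tendsto) (ε / 2) (half_pos hε)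
  have h3 := h1.prod_mk (h2.and self_mem_nhdsWithin)
  filter_upwards [h3] with q hq
  have := hq.1 q.2 hq.2.2
  calc dist (F q.1 q.2) (g x) ≤ dist (g q.2) (F q.1 q.2) + dist (g q.2) (g x) :=
        dist_triangle_left _ _ _
    _ < ε := by linarith [hq.2.1]

end Uniform

theorem continuousOn_comp_of_lipschitz {s : Set ℝ} {H H' : Type*} [NormedAddCommGroup H]
    [NormedAddCommGroup H']
    {v : ℝ → H → H'} {K : ℝ}
    (hc : ∀ x, ContinuousOn (fun t => v t x) s)
    (hL : ∀ t ∈ s, ∀ x y, ‖v t x - v t y‖ ≤ K * ‖x - y‖) {f : ℝ → H} (hf : ContinuousOn f s) :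
    ContinuousOn (fun t => v t (f t)) s := by
  intro t ht
  rw [ContinuousWithinAt, tendsto_iff_norm_sub_tendsto_zero]
  have h1 : Tendsto (fun r => K * ‖f r - f t‖ + ‖v r (f t) - v t (f t)‖) (𝓝[s] t)
      (𝓝 (K * 0 + 0)) :=
    ((tendsto_iff_norm_sub_tendsto_zero.1 (hf t ht).tendsto).const_mul K).add
      (tendsto_iff_norm_sub_tendsto_zero.1 (hc (f t) t ht).tendsto)
  rw [mul_zero, add_zero] at h1
  refine squeeze_zero' (Eventually.of_forall fun _ => norm_nonneg _) ?_ h1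
  filter_upwards [self_mem_nhdsWithin] with r hr
  calc ‖v r (f r) - v t (f t)‖ ≤ ‖v r (f r) - v r (f t)‖ + ‖v r (f t) - v t (f t)‖ :=
        norm_sub_le_norm_sub_add_norm_sub _ _ _
    _ ≤ _ := by gcongr; exact hL r hr _ _

section Banach

variable {H : Type*} [NormedAddCommGroup H] [NormedSpace ℝ H]

theorem norm_sub_le_of_hasDerivWithinAt {T M : ℝ} {y y' : ℝ → H}
    (hd : ∀ t ∈ Icc 0 T, HasDerivWithinAt y (y' t) (Icc 0 T) t)
    (hM : ∀ t ∈ Icc 0 T, ‖y' t‖ ≤ M) {s t : ℝ} (hs : s ∈ Icc 0 T) (ht : t ∈ Icc 0 T) :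
    ‖y t - y s‖ ≤ M * |t - s| :=
  (convex_Icc 0 T).norm_image_sub_le_of_norm_hasDerivWithin_le hd hM hs ht

theorem hasDerivWithinAt_of_tendstoUniformlyOn {ι : Type*} {l : Filter ι} [l.NeBot] {T : ℝ}
    {F F' : ι → ℝ → H} {g g' : ℝ → H}
    (hd : ∀ᶠ j in l, ∀ t ∈ Icc 0 T, HasDerivWithinAt (F j) (F' j t) (Icc 0 T) t)
    (hF : ∀ t ∈ Icc 0 T, Tendsto (fun j => F j t) l (𝓝 (g t)))
    (hF' : TendstoUniformlyOn F' g' l (Icc 0 T)) (hg' : ContinuousOn g' (Icc 0 T)) :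
    ∀ t ∈ Icc 0 T, HasDerivWithinAt g (g' t) (Icc 0 T) t := by
  intro t ht
  rw [hasDerivWithinAt_iff_isLittleO, Asymptotics.isLittleO_iff]
  intro ε hε
  have h1 := (Metric.tendstoUniformlyOn_iff.1 hF') (ε / 2) (half_pos hε)
  obtain ⟨δ, hδ, hδ'⟩ := Metric.continuousWithinAt_iff.1 (hg' t ht) (ε / 2) (half_pos hε)
  have hmem : Icc 0 T ∩ ball t δ ∈ 𝓝[Icc 0 T] t :=
    inter_mem self_mem_nhdsWithin (mem_nhdsWithin_of_mem_nhds (ball_mem_nhds t hδ))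
  filter_upwards [hmem] with s hs
  have hlim : Tendsto (fun j => ‖F j s - F j t - (s - t) • g' t‖) l
      (𝓝 ‖g s - g t - (s - t) • g' t‖) :=
    (((hF s hs.1).sub (hF t ht)).sub tendsto_const_nhds).norm
  refine le_of_tendsto hlim ?_
  filter_upwards [h1, hd] with j hj hdj
  have hcv : Convex ℝ (Icc 0 T ∩ ball t δ) := (convex_Icc 0 T).inter (convex_ball t δ)
  have := hcv.norm_image_sub_le_of_norm_hasDerivWithin_le
    (f := fun s => F j s - (s - t) • g' t) (f' := fun s => F' j s - (1 : ℝ) • g' t) (C := ε)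
    (fun s hs => ((hdj s hs.1).mono inter_subset_left).sub
      ((((hasDerivAt_id s).sub_const t).smul_const (g' t)).hasDerivWithinAt))
    (fun s hs => by
      have h2 := hj s hs.1
      have h3 := hδ' hs.1 (mem_ball.1 hs.2)
      rw [one_smul, ← dist_eq_norm]
      calc dist (F' j s) (g' t) ≤ dist (g' s) (F' j s) + dist (g' s) (g' t) :=
            dist_triangle_left _ _ _
        _ ≤ ε := by linarith) ⟨ht, mem_ball_self hδ⟩ hs
  simpa [sub_right_comm] using this

theorem exists_fixedPoint_of_weighted_contraction [CompleteSpace H] {T κ : ℝ} (hT : 0 ≤ T)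
    (Φ : (ℝ → H) → ℝ → H)
    (hc : ∀ f, ContinuousOn f (Icc 0 T) → ContinuousOn (Φ f) (Icc 0 T))
    (hΦ : ∀ f g, ContinuousOn f (Icc 0 T) → ContinuousOn g (Icc 0 T) → ∀ D : ℝ, 0 ≤ D →
      (∀ s ∈ Icc 0 T, ‖f s - g s‖ ≤ D * Real.exp (κ * s)) →
      ∀ t ∈ Icc 0 T, ‖Φ f t - Φ g t‖ ≤ D / 2 * Real.exp (κ * t)) :
    ∃ f, ContinuousOn f (Icc 0 T) ∧ ∀ t ∈ Icc 0 T, f t = Φ f t := by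
  have hne : Nonempty (Icc (0 : ℝ) T) := ⟨⟨0, le_rfl, hT⟩⟩
  let ext : C(Icc (0 : ℝ) T, H) → ℝ → H := fun f t =>
    Real.exp (κ * t) • f (projIcc 0 T hT t)
  have hext : ∀ f, Continuous (ext f) := fun f => by
    have := f.continuous.comp (continuous_projIcc (h := hT))
    exact (by fun_prop : Continuous fun t : ℝ => Real.exp (κ * t)).smul this
  let Ψ : C(Icc (0 : ℝ) T, H) → C(Icc (0 : ℝ) T, H) := fun f =>
    ⟨fun t => Real.exp (-(κ * t)) • Φ (ext f) t, by
      have h1 := continuousOn_iff_continuous_domRestrict.1 (hc _ (hext f).continuousOn)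
      exact (by fun_prop : Continuous fun t : Icc (0 : ℝ) T => Real.exp (-(κ * t))).smul h1⟩
  have hΨ : ContractingWith (1 / 2 : NNReal) Ψ := by
    refine ⟨by rw [div_lt_one] <;> norm_num, LipschitzWith.of_dist_le_mul fun f g => ?_⟩
    refine (ContinuousMap.dist_le (by positivity)).2 fun t => ?_
    have h1 := hΦ (ext f) (ext g) (hext f).continuousOn (hext g).continuousOn (dist f g)
      dist_nonneg (fun s hs => by
        change ‖Real.exp (κ * s) • f (projIcc 0 T hT s) - Real.exp (κ * s) • g _‖ ≤ _
        rw [← smul_sub, norm_smul, Real.norm_eq_abs, abs_of_pos (Real.exp_pos _), mul_comm,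
          ← dist_eq_norm]
        gcongr
        exact ContinuousMap.dist_apply_le_dist _) t t.2
    change dist (Real.exp (-(κ * t)) • Φ (ext f) t) (Real.exp (-(κ * t)) • Φ (ext g) t) ≤ _
    rw [dist_eq_norm, ← smul_sub, norm_smul, Real.norm_eq_abs, abs_of_pos (Real.exp_pos _)]
    calc _ ≤ Real.exp (-(κ * t)) * (dist f g / 2 * Real.exp (κ * t)) := by gcongr
      _ = (Real.exp (-(κ * t)) * Real.exp (κ * t)) * (dist f g / 2) := by ring
      _ = _ := by rw [← Real.exp_add]; simp; ring
  obtain ⟨f, hf, -⟩ := hΨ.exists_fixedPoint (0 : C(Icc (0 : ℝ) T, H))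
    (edist_ne_top _ _)
  refine ⟨ext f, (hext f).continuousOn, fun t ht => ?_⟩
  have h1 : Ψ f ⟨t, ht⟩ = f ⟨t, ht⟩ := by rw [hf]
  change Real.exp (κ * t) • f (projIcc 0 T hT t) = _
  rw [projIcc_of_mem hT ht, ← h1]
  change Real.exp (κ * t) • Real.exp (-(κ * t)) • Φ (ext f) t = Φ (ext f) t
  rw [smul_smul, ← Real.exp_add]; simp

theorem hasDerivWithinAt_integral_Icc [CompleteSpace H] {T : ℝ} {f : ℝ → H}
    (hf : ContinuousOn f (Icc 0 T)) (x₀ : H) {t : ℝ} (ht : t ∈ Icc 0 T) :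
    HasDerivWithinAt (fun t => x₀ + ∫ s in (0 : ℝ)..t, f s) (f t) (Icc 0 T) t :=
  ODE.hasDerivWithinAt_picard_Icc (f := fun _ x => x) (u := univ)
    ⟨le_rfl, ht.1.trans ht.2⟩ (continuous_snd.continuousOn) hf (fun _ _ => mem_univ _) x₀ ht

theorem exists_global_solution [CompleteSpace H] {T K : ℝ} (hT : 0 ≤ T) (v : ℝ → H → H)
    (hc : ∀ x, ContinuousOn (fun t => v t x) (Icc 0 T))
    (hL : ∀ t ∈ Icc 0 T, ∀ x y, ‖v t x - v t y‖ ≤ K * ‖x - y‖) (x₀ : H) :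
    ∃ y : ℝ → H, y 0 = x₀ ∧ ∀ t ∈ Icc 0 T, HasDerivWithinAt y (v t (y t)) (Icc 0 T) t := by
  obtain ⟨K', hK'0, hK'⟩ : ∃ K' : ℝ, 0 < K' ∧ ∀ t ∈ Icc 0 T, ∀ x y,
      ‖v t x - v t y‖ ≤ K' * ‖x - y‖ :=
    ⟨|K| + 1, by positivity, fun t ht x y => (hL t ht x y).trans (by
      gcongr; linarith [le_abs_self K])⟩
  have hcc : ∀ f, ContinuousOn f (Icc 0 T) → ContinuousOn (fun t => v t (f t)) (Icc 0 T) :=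
    fun f hf => continuousOn_comp_of_lipschitz hc hL hf
  obtain ⟨f, hf, hfix⟩ := exists_fixedPoint_of_weighted_contraction (κ := 2 * K') hT
    (fun f t => x₀ + ∫ s in (0 : ℝ)..t, v s (f s))
    (fun f hf t ht => (hasDerivWithinAt_integral_Icc (hcc f hf) x₀ ht).continuousWithinAt)
    (fun f g hf hg D hD hfg t ht => by
      have hsub : uIcc 0 t ⊆ Icc 0 T := by
        rw [uIcc_of_le ht.1]; exact Icc_subset_Icc_right ht.2
      have i1 : ∀ f, ContinuousOn f (Icc 0 T) →
          IntervalIntegrable (fun s => v s (f s)) MeasureTheory.volume 0 t :=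
        fun f hf => ((hcc f hf).mono hsub).intervalIntegrable
      rw [add_sub_add_left_eq_sub, ← intervalIntegral.integral_sub (i1 f hf) (i1 g hg)]
      have h2 : ∀ s : ℝ, HasDerivAt (fun s => D / 2 * Real.exp (2 * K' * s))
          (D / 2 * (Real.exp (2 * K' * s) * (2 * K' * 1))) s := fun s =>
        ((((hasDerivAt_id s).const_mul (2 * K')).exp).const_mul (D / 2))
      have h3 : ∫ s in (0 : ℝ)..t, D / 2 * (Real.exp (2 * K' * s) * (2 * K' * 1)) =
          D / 2 * Real.exp (2 * K' * t) - D / 2 * Real.exp (2 * K' * 0) :=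
        intervalIntegral.integral_eq_sub_of_hasDerivAt (fun s _ => h2 s)
          (Continuous.intervalIntegrable (by fun_prop) _ _)
      have h4 := intervalIntegral.norm_integral_le_of_norm_le (μ := MeasureTheory.volume) ht.1
        (f := fun s => v s (f s) - v s (g s))
        (g := fun s => D / 2 * (Real.exp (2 * K' * s) * (2 * K' * 1)))
        (by
          filter_upwards with s hs
          have hs' : s ∈ Icc 0 T := ⟨hs.1.le, hs.2.trans ht.2⟩
          calc _ ≤ K' * ‖f s - g s‖ := hK' s hs' _ _
            _ ≤ K' * (D * Real.exp (2 * K' * s)) := by gcongr; exact hfg s hs'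
            _ = _ := by ring)
        (Continuous.intervalIntegrable (by fun_prop) _ _)
      refine h4.trans ?_
      rw [h3]
      simp; positivity)
  refine ⟨fun t => x₀ + ∫ s in (0 : ℝ)..t, v s (f s), by simp, fun t ht => ?_⟩
  have := hasDerivWithinAt_integral_Icc (hcc f hf) x₀ ht
  rw [hfix t ht] at this
  exact this

/-! ### Radial retraction onto a closed ball -/

/-- The radial retraction onto the closed ball of radius `R` at the origin. -/
noncomputable def retract (R : ℝ) (x : H) : H := (R / max R ‖x‖) • x

theorem retract_eq_self {R : ℝ} (hR : 0 < R) {x : H} (hx : ‖x‖ ≤ R) : retract R x = x := by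
  rw [retract, max_eq_left hx, div_self hR.ne', one_smul]

theorem norm_retract_le {R : ℝ} (hR : 0 < R) (x : H) : ‖retract R x‖ ≤ R := by
  have hm : 0 < max R ‖x‖ := lt_max_of_lt_left hR
  rw [retract, norm_smul, Real.norm_eq_abs, abs_of_pos (by positivity), div_mul_eq_mul_div,
    div_le_iff₀ hm]
  exact mul_le_mul_of_nonneg_left (le_max_right _ _) hR.le

theorem norm_retract_sub_le {R : ℝ} (hR : 0 < R) (x y : H) :
    ‖retract R x - retract R y‖ ≤ 2 * ‖x - y‖ := by
  have hx : 0 < max R ‖x‖ := lt_max_of_lt_left hR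
  have hy : 0 < max R ‖y‖ := lt_max_of_lt_left hR
  have e : retract R x - retract R y =
      (R / max R ‖x‖) • (x - y) + (R / max R ‖x‖ - R / max R ‖y‖) • y := by
    simp only [retract, smul_sub, sub_smul]; abel
  have h1 : R / max R ‖x‖ ≤ 1 := (div_le_one hx).2 (le_max_left _ _)
  have h2 : |R / max R ‖x‖ - R / max R ‖y‖| * ‖y‖ ≤ ‖x - y‖ := by
    have h3 : R / max R ‖x‖ - R / max R ‖y‖ =
        (R / max R ‖x‖) * ((max R ‖y‖ - max R ‖x‖) / max R ‖y‖) := by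
      field_simp
    rw [h3, abs_mul, abs_of_pos (div_pos hR hx), abs_div, abs_of_pos hy]
    have h4 : |max R ‖y‖ - max R ‖x‖| ≤ ‖x - y‖ := by
      refine (abs_max_sub_max_le_max R ‖y‖ R ‖x‖).trans ?_
      rw [sub_self, abs_zero, max_eq_right (abs_nonneg _), norm_sub_rev]
      exact abs_norm_sub_norm_le y x
    have h5 : ‖y‖ / max R ‖y‖ ≤ 1 := (div_le_one hy).2 (le_max_right _ _)
    calc R / max R ‖x‖ * (|max R ‖y‖ - max R ‖x‖| / max R ‖y‖) * ‖y‖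
        = R / max R ‖x‖ * |max R ‖y‖ - max R ‖x‖| * (‖y‖ / max R ‖y‖) := by ring
      _ ≤ 1 * ‖x - y‖ * 1 := by gcongr
      _ = _ := by ring
  rw [e]
  refine (norm_add_le _ _).trans ?_
  rw [norm_smul, norm_smul, Real.norm_eq_abs, Real.norm_eq_abs, abs_of_pos (div_pos hR hx)]
  nlinarith [norm_nonneg (x - y)]

end Banach

/-! ### Maps with a `C^1` bound -/

section C1Bounded

variable {Z E F G : Type*} [NormedAddCommGroup Z] [NormedSpace ℝ Z] [NormedAddCommGroup E]
  [NormedSpace ℝ E] [NormedAddCommGroup F] [NormedSpace ℝ F] [NormedAddCommGroup G]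
  [NormedSpace ℝ G] {O : Set Z}

theorem C1BoundedOn.hasFDerivAt {f : Z → E} {C : ℝ} (hf : C1BoundedOn f O C) (hO : IsOpen O)
    {u : Z} (hu : u ∈ O) : HasFDerivAt f (fderiv ℝ f u) u :=
  ((hf.1.contDiffAt (hO.mem_nhds hu)).differentiableAt one_ne_zero).hasFDerivAt

theorem C1BoundedOn.lipschitz {f : Z → E} {C : ℝ} (hf : C1BoundedOn f O C) (hO : IsOpen O)
    {s : Set Z} (hs : Convex ℝ s) (hsO : s ⊆ O) {u v : Z} (hu : u ∈ s) (hv : v ∈ s) :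
    ‖f u - f v‖ ≤ C * ‖u - v‖ :=
  hs.norm_image_sub_le_of_norm_hasFDerivWithin_le
    (fun _ hx => (hf.hasFDerivAt hO (hsO hx)).hasFDerivWithinAt)
    (fun x hx => (hf.2 x (hsO hx)).2) hv hu

theorem C1BoundedOn.bilin {f : Z → E} {g : Z → F} {Cf Cg : ℝ} (hO : IsOpen O)
    (hf : C1BoundedOn f O Cf) (hg : C1BoundedOn g O Cg) (B : E →L[ℝ] F →L[ℝ] G) :
    C1BoundedOn (fun u => B (f u) (g u)) O (2 * ‖B‖ * |Cf| * |Cg|) := by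
  refine ⟨B.isBoundedBilinearMap.contDiff.comp_contDiffOn (hf.1.prodMk hg.1), fun u hu => ⟨?_, ?_⟩⟩
  · have h1 := (hf.2 u hu).1.trans (le_abs_self _)
    have h2 := (hg.2 u hu).1.trans (le_abs_self _)
    calc ‖B (f u) (g u)‖ ≤ ‖B‖ * ‖f u‖ * ‖g u‖ := B.le_opNorm₂ _ _
      _ ≤ ‖B‖ * |Cf| * |Cg| := by gcongr
      _ ≤ 2 * ‖B‖ * |Cf| * |Cg| := by
        have : 0 ≤ ‖B‖ * |Cf| * |Cg| := by positivity
        linarith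
  · have h1 := hf.2 u hu
    have h2 := hg.2 u hu
    have e := (B.isBoundedBilinearMap.hasFDerivAt (f u, g u)).comp u
      ((hf.hasFDerivAt hO hu).prodMk (hg.hasFDerivAt hO hu))
    have e2 : HasFDerivAt (fun u => B (f u) (g u)) _ u := e
    rw [e2.fderiv]
    refine ContinuousLinearMap.opNorm_le_bound _ (by positivity) fun x => ?_
    have e3 : ((B.isBoundedBilinearMap.deriv (f u, g u)).comp
        ((fderiv ℝ f u).prod (fderiv ℝ g u))) x =
        B (f u) (fderiv ℝ g u x) + B (fderiv ℝ f u x) (g u) := rfl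
    rw [e3]
    have a1 : ‖fderiv ℝ f u x‖ ≤ |Cf| * ‖x‖ := ((fderiv ℝ f u).le_opNorm x).trans (by
      gcongr; exact h1.2.trans (le_abs_self _))
    have a2 : ‖fderiv ℝ g u x‖ ≤ |Cg| * ‖x‖ := ((fderiv ℝ g u).le_opNorm x).trans (by
      gcongr; exact h2.2.trans (le_abs_self _))
    have a3 := h1.1.trans (le_abs_self _)
    have a4 := h2.1.trans (le_abs_self _)
    calc _ ≤ ‖B (f u) (fderiv ℝ g u x)‖ + ‖B (fderiv ℝ f u x) (g u)‖ := norm_add_le _ _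
      _ ≤ ‖B‖ * ‖f u‖ * ‖fderiv ℝ g u x‖ + ‖B‖ * ‖fderiv ℝ f u x‖ * ‖g u‖ :=
        add_le_add (B.le_opNorm₂ _ _) (B.le_opNorm₂ _ _)
      _ ≤ ‖B‖ * |Cf| * (|Cg| * ‖x‖) + ‖B‖ * (|Cf| * ‖x‖) * |Cg| := by gcongr
      _ = _ := by ring

theorem C1BoundedOn.add {f g : Z → E} {Cf Cg : ℝ} (hO : IsOpen O)
    (hf : C1BoundedOn f O Cf) (hg : C1BoundedOn g O Cg) :
    C1BoundedOn (fun u => f u + g u) O (Cf + Cg) := by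
  refine ⟨hf.1.add hg.1, fun u hu => ⟨(norm_add_le _ _).trans
    (add_le_add (hf.2 u hu).1 (hg.2 u hu).1), ?_⟩⟩
  have := ((hf.hasFDerivAt hO hu).add (hg.hasFDerivAt hO hu)).fderiv
  have e : (f + g) = fun u => f u + g u := rfl
  rw [e] at this
  rw [this]
  exact (norm_add_le _ _).trans (add_le_add (hf.2 u hu).2 (hg.2 u hu).2)

theorem C1BoundedOn.comp_left {f : Z → E} {C : ℝ} (hO : IsOpen O) (hf : C1BoundedOn f O C)
    (B : E →L[ℝ] F) : C1BoundedOn (fun u => B (f u)) O (‖B‖ * C) := by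
  refine ⟨B.contDiff.comp_contDiffOn hf.1, fun u hu => ⟨(B.le_opNorm _).trans (by
    gcongr; exact (hf.2 u hu).1), ?_⟩⟩
  have : HasFDerivAt (fun u => B (f u)) (B.comp (fderiv ℝ f u)) u :=
    B.hasFDerivAt.comp u (hf.hasFDerivAt hO hu)
  rw [this.fderiv]
  exact (ContinuousLinearMap.opNorm_comp_le _ _).trans (by gcongr; exact (hf.2 u hu).2)

theorem C1BoundedOn.clm_comp {f : Z → F →L[ℝ] G} {g : Z → E →L[ℝ] F} {Cf Cg : ℝ} (hO : IsOpen O)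
    (hf : C1BoundedOn f O Cf) (hg : C1BoundedOn g O Cg) :
    ∃ C, C1BoundedOn (fun u => (f u).comp (g u)) O C :=
  ⟨_, hf.bilin hO hg (ContinuousLinearMap.compL ℝ E F G)⟩

theorem C1BoundedOn.const (c : E) : C1BoundedOn (fun _ : Z => c) O ‖c‖ :=
  ⟨contDiffOn_const, fun u _ => ⟨le_rfl, by simp⟩⟩

end C1Bounded

/-! ### Families of dissipative operators on a Hilbert scale -/

section Scale

variable {X : ℕ → Type u} [∀ r, NormedAddCommGroup (X r)] [∀ r, InnerProductSpace ℝ (X r)]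

/-- The inclusion of `X (k + 1)` in `X k`. -/
def HilbertScale.dn (S : HilbertScale X) (k : ℕ) : X (k + 1) →L[ℝ] X k := S.emb (Nat.le_succ k)

theorem HilbertScale.dn_injective (S : HilbertScale X) (k : ℕ) : Function.Injective (S.dn k) :=
  S.emb_injective _

theorem HilbertScale.norm_dn_le (S : HilbertScale X) (k : ℕ) (y : X (k + 1)) :
    ‖S.dn k y‖ ≤ ‖y‖ := S.norm_emb_le _ _

/-- A family `A k u : X (k + 1) → X k`, `k < N`, of realizations of one operator depending on a
parameter `u ∈ O`, which is dissipative with respect to quadratic forms that are coercive up to a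
lower order term. -/
structure DissipativeFamily (S : HilbertScale X) (Z : Type*) [NormedAddCommGroup Z]
    [NormedSpace ℝ Z] where
  N : ℕ
  O : Set Z
  A : (k : ℕ) → Z → (X (k + 1) →L[ℝ] X k)
  L : Z → (X 0 →L[ℝ] X 0 →L[ℝ] ℝ)
  ω : ℝ
  a : ℝ
  CL : ℝ
  C : ℝ
  one_le_N : 1 ≤ N
  one_le_CL : 1 ≤ CL
  one_le_C : 1 ≤ C
  isOpen : IsOpen O
  convex : Convex ℝ O
  compat : ∀ k, k + 1 < N → ∀ u ∈ O, ∀ y : X (k + 1 + 1),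
    S.dn k (A (k + 1) u y) = A k u (S.dn (k + 1) y)
  A_bound : ∀ k, k < N → C1BoundedOn (A k) O C
  invertible : ∀ k, k < N → ∀ u ∈ O, (ω • S.dn k - A k u).IsInvertible
  inverse_bound : ∀ k, k < N → C1BoundedOn (fun u => (ω • S.dn k - A k u).inverse) O C
  surjective : ∀ u ∈ O, ∃ lam : ℝ, CL ^ 2 * (|ω| + |a| * C * (1 + |ω| * C)) < lam ∧
    Function.Surjective (lam • S.dn 0 - A 0 u)
  L_contDiffOn : ContDiffOn ℝ 1 L O
  L_bound : DerivBoundedOn L O C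
  symm : ∀ u ∈ O, ∀ v w : X 0, L u v w = L u w v
  lower : ∀ u ∈ O, ∀ w : X 0,
    (CL ^ 2)⁻¹ * ‖w‖ ^ 2 - a * ‖S.dn 0 ((ω • S.dn 0 - A 0 u).inverse w)‖ ^ 2 ≤ L u w w
  upper : ∀ u ∈ O, ∀ w : X 0, L u w w ≤ CL ^ 2 * ‖w‖ ^ 2
  dissipative : ∀ u ∈ O, ∀ w : X 1, L u (S.dn 0 w) (A 0 u w) ≤ ω * ‖S.dn 0 w‖ ^ 2

end Scale

/-- The real inner product as a continuous bilinear form. -/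
noncomputable def innerForm (E : Type*) [NormedAddCommGroup E] [InnerProductSpace ℝ E] :
    E →L[ℝ] E →L[ℝ] ℝ :=
  (innerₗ E).mkContinuous₂ 1 fun x y => by simpa using abs_real_inner_le_norm x y

theorem clm_norm_le_of_quadratic {E : Type*} [NormedAddCommGroup E] [InnerProductSpace ℝ E]
    (B : E →L[ℝ] E →L[ℝ] ℝ) (hs : ∀ v w, B v w = B w v) {K : ℝ} (hK : 0 ≤ K)
    (h : ∀ w, |B w w| ≤ K * ‖w‖ ^ 2) : ‖B‖ ≤ 2 * K := by
  have hp : ∀ v w : E, ‖v‖ = 1 → ‖w‖ = 1 → |B v w| ≤ 2 * K := by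
    intro v w hv hw
    have e : 4 * B v w = B (v + w) (v + w) - B (v - w) (v - w) := by
      simp only [map_add, map_sub, add_apply, sub_apply, hs w v]; ring
    have h1 := abs_le.1 (h (v + w))
    have h2 := abs_le.1 (h (v - w))
    have h3 := parallelogram_law_with_norm ℝ v w
    rw [hv, hw] at h3
    rw [abs_le]
    constructor <;> nlinarith
  refine ContinuousLinearMap.opNorm_le_bound₂ _ (by positivity) fun v w => ?_
  by_cases hv : v = 0
  · simp [hv]
  by_cases hw : w = 0
  · simp [hw]
  have nv := norm_pos_iff.2 hv
  have nw := norm_pos_iff.2 hw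
  have := hp (‖v‖⁻¹ • v) (‖w‖⁻¹ • w) (norm_smul_inv_norm hv) (norm_smul_inv_norm hw)
  simp only [map_smul, smul_apply, smul_eq_mul, abs_mul, abs_inv, abs_norm] at this
  rw [Real.norm_eq_abs]
  calc |B v w| = ‖v‖ * ‖w‖ * (‖w‖⁻¹ * (‖v‖⁻¹ * |B v w|)) := by field_simp
    _ ≤ ‖v‖ * ‖w‖ * (2 * K) := by
      apply mul_le_mul_of_nonneg_left _ (by positivity)
      linarith [mul_left_comm ‖w‖⁻¹ ‖v‖⁻¹ |B v w|]
    _ = _ := by ring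

namespace DissipativeFamily

variable {X : ℕ → Type u} [∀ r, NormedAddCommGroup (X r)] [∀ r, InnerProductSpace ℝ (X r)]
  {S : HilbertScale X} {Z : Type*} [NormedAddCommGroup Z] [NormedSpace ℝ Z]

section Defs

variable (D : DissipativeFamily S Z)

/-- The operator `c - A(u)` from `X (k + 1)` to `X k`. -/
def T (c : ℝ) (k : ℕ) (u : Z) : X (k + 1) →L[ℝ] X k := c • S.dn k - D.A k u

/-- The resolvent of `A(u)`. -/
noncomputable def R (c : ℝ) (k : ℕ) (u : Z) : X k →L[ℝ] X (k + 1) := (D.T c k u).inverse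

/-- The growth bound of the semigroups. -/
def β : ℝ := D.CL ^ 2 * (|D.ω| + |D.a| * D.C * (1 + |D.ω| * D.C))

/-- The operator `c (c - A(u))⁻¹` on `X k`, for `k ≤ N`. -/
noncomputable def J (c : ℝ) : (k : ℕ) → Z → (X k →L[ℝ] X k)
  | 0, u => c • (S.dn 0).comp (D.R c 0 u)
  | k + 1, u => c • (D.R c k u).comp (S.dn k)

/-- The Yosida approximation of `A(u)` on `X k`, for `k ≤ N`. -/
noncomputable def Y (c : ℝ) (k : ℕ) (u : Z) : X k →L[ℝ] X k :=
  c • (D.J c k u - ContinuousLinearMap.id ℝ (X k))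

/-- The operator `(ω - A(u)) ^ k`, from `X k` to `X 0`. -/
def Qpow : (k : ℕ) → Z → (X k →L[ℝ] X 0)
  | 0, _ => ContinuousLinearMap.id ℝ (X 0)
  | k + 1, u => (Qpow k u).comp (D.T D.ω k u)

/-- The coercive form on `X 0`. -/
noncomputable def form0 (u : Z) : X 0 →L[ℝ] X 0 →L[ℝ] ℝ :=
  D.L u + D.a • (innerForm (X 0)).bilinearComp
    ((S.dn 0).comp (D.R D.ω 0 u)) ((S.dn 0).comp (D.R D.ω 0 u))

/-- The coercive form on `X k`. -/
noncomputable def form (k : ℕ) (u : Z) : X k →L[ℝ] X k →L[ℝ] ℝ :=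
  (D.form0 u).bilinearComp (D.Qpow k u) (D.Qpow k u)

end Defs

variable {D : DissipativeFamily S Z}

theorem β_nonneg : 0 ≤ D.β := by
  have := D.one_le_C
  unfold β; positivity

theorem T_apply (c : ℝ) (k : ℕ) (u : Z) (y : X (k + 1)) :
    D.T c k u y = c • S.dn k y - D.A k u y := rfl

theorem T_dn {k : ℕ} (hk : k + 1 < D.N) {u : Z} (hu : u ∈ D.O) (c : ℝ) (y : X (k + 1 + 1)) :
    S.dn k (D.T c (k + 1) u y) = D.T c k u (S.dn (k + 1) y) := by
  simp only [T_apply, map_sub, map_smul, D.compat k hk u hu]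

theorem Q_R {k : ℕ} (hk : k < D.N) {u : Z} (hu : u ∈ D.O) (y : X k) :
    D.T D.ω k u (D.R D.ω k u y) = y := (D.invertible k hk u hu).self_apply_inverse y

theorem R_Q {k : ℕ} (hk : k < D.N) {u : Z} (hu : u ∈ D.O) (y : X (k + 1)) :
    D.R D.ω k u (D.T D.ω k u y) = y := (D.invertible k hk u hu).inverse_apply_self y

theorem Y_apply (c : ℝ) (k : ℕ) (u : Z) (y : X k) : D.Y c k u y = c • (D.J c k u y - y) := rfl

theorem form0_apply (u : Z) (v w : X 0) : D.form0 u v w =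
    D.L u v w + D.a * inner ℝ (S.dn 0 (D.R D.ω 0 u v)) (S.dn 0 (D.R D.ω 0 u w)) := rfl

theorem form_apply (k : ℕ) (u : Z) (v w : X k) :
    D.form k u v w = D.form0 u (D.Qpow k u v) (D.Qpow k u w) := rfl

theorem form0_symm {u : Z} (hu : u ∈ D.O) (v w : X 0) : D.form0 u v w = D.form0 u w v := by
  rw [form0_apply, form0_apply, D.symm u hu, real_inner_comm]

theorem form_symm {k : ℕ} {u : Z} (hu : u ∈ D.O) (v w : X k) :
    D.form k u v w = D.form k u w v := form0_symm hu _ _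

theorem form0_lower {u : Z} (hu : u ∈ D.O) (w : X 0) :
    (D.CL ^ 2)⁻¹ * ‖w‖ ^ 2 ≤ D.form0 u w w := by
  have := D.lower u hu w
  rw [form0_apply, real_inner_self_eq_norm_sq]
  change _ - D.a * ‖S.dn 0 (D.R D.ω 0 u w)‖ ^ 2 ≤ _ at this
  linarith

theorem form0_nonneg {u : Z} (hu : u ∈ D.O) (w : X 0) : 0 ≤ D.form0 u w w :=
  (by have := D.one_le_CL; positivity : 0 ≤ (D.CL ^ 2)⁻¹ * ‖w‖ ^ 2).trans (form0_lower hu w)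

theorem norm_R_ω_le {k : ℕ} (hk : k < D.N) {u : Z} (hu : u ∈ D.O) : ‖D.R D.ω k u‖ ≤ D.C :=
  ((D.inverse_bound k hk).2 u hu).1

theorem norm_A_le {k : ℕ} (hk : k < D.N) {u : Z} (hu : u ∈ D.O) : ‖D.A k u‖ ≤ D.C :=
  ((D.A_bound k hk).2 u hu).1

theorem norm_sq_le_form0 {u : Z} (hu : u ∈ D.O) (w : X 0) :
    ‖w‖ ^ 2 ≤ D.CL ^ 2 * D.form0 u w w := by
  have h := form0_lower hu w
  have h1 : 0 < D.CL ^ 2 := by have := D.one_le_CL; positivity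
  rwa [inv_mul_le_iff₀ h1] at h

theorem form0_dissipative {u : Z} (hu : u ∈ D.O) (w : X 1) :
    D.form0 u (D.A 0 u w) (S.dn 0 w) ≤ D.β * D.form0 u (S.dn 0 w) (S.dn 0 w) := by
  have hN : 0 < D.N := D.one_le_N
  have hC := D.one_le_C
  set x := S.dn 0 w with hx
  have e : S.dn 0 (D.R D.ω 0 u (D.A 0 u w)) = D.ω • S.dn 0 (D.R D.ω 0 u x) - x := by
    have h1 : D.A 0 u w = D.ω • x - D.T D.ω 0 u w := by rw [T_apply]; abel
    rw [h1, map_sub, map_smul, R_Q hN hu, map_sub, map_smul]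
  have hR : ‖S.dn 0 (D.R D.ω 0 u x)‖ ≤ D.C * ‖x‖ := (S.norm_dn_le _ _).trans
    (((D.R D.ω 0 u).le_opNorm x).trans (by gcongr; exact norm_R_ω_le hN hu))
  have h2 : |inner ℝ (S.dn 0 (D.R D.ω 0 u (D.A 0 u w))) (S.dn 0 (D.R D.ω 0 u x))| ≤
      D.C * (1 + |D.ω| * D.C) * ‖x‖ ^ 2 := by
    refine (abs_real_inner_le_norm _ _).trans ?_
    rw [e]
    calc _ ≤ (|D.ω| * (D.C * ‖x‖) + ‖x‖) * (D.C * ‖x‖) := by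
          gcongr
          refine (norm_sub_le _ _).trans ?_
          rw [norm_smul, Real.norm_eq_abs]; gcongr
      _ = _ := by ring
  have h3 := D.dissipative u hu w
  rw [D.symm u hu] at h3
  have h4 : D.a * inner ℝ (S.dn 0 (D.R D.ω 0 u (D.A 0 u w))) (S.dn 0 (D.R D.ω 0 u x)) ≤
      |D.a| * (D.C * (1 + |D.ω| * D.C) * ‖x‖ ^ 2) := by
    refine (le_abs_self _).trans ?_
    rw [abs_mul]; gcongr
  have h5 := norm_sq_le_form0 hu x
  have h6 : D.ω * ‖x‖ ^ 2 ≤ |D.ω| * ‖x‖ ^ 2 := by gcongr; exact le_abs_self _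
  rw [form0_apply]
  have h7 : 0 ≤ |D.ω| + |D.a| * D.C * (1 + |D.ω| * D.C) := by positivity
  have h8 := mul_le_mul_of_nonneg_left h5 h7
  have h9 : (|D.ω| + |D.a| * D.C * (1 + |D.ω| * D.C)) * (D.CL ^ 2 * D.form0 u x x) =
    D.β * D.form0 u x x := by unfold β; ring
  rw [h9, form0_apply] at h8
  rw [form0_apply]
  nlinarith

/-- The resolvent parameters for which the estimates below hold uniformly. -/
def lam₀ (D : DissipativeFamily S Z) : ℝ := 4 * D.β + 1

theorem β_lt {c : ℝ} (hc : D.lam₀ ≤ c) : D.β < c := by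
  have := D.β_nonneg; unfold lam₀ at hc; linarith

theorem lam_pos {c : ℝ} (hc : D.lam₀ ≤ c) : 1 ≤ c := by
  have := D.β_nonneg; unfold lam₀ at hc; linarith

/-! #### Resolvents -/

section Resolvent

theorem norm_le_norm_T {u : Z} (hu : u ∈ D.O) {c : ℝ} (hc : D.β < c) (w : X 1) :
    ‖S.dn 0 w‖ ≤ D.CL ^ 2 * ‖D.form0 u‖ / (c - D.β) * ‖D.T c 0 u w‖ := by
  have hc' : 0 < c - D.β := sub_pos.2 hc
  have hCL : 0 < D.CL ^ 2 := by have := D.one_le_CL; positivity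
  rcases eq_or_ne (S.dn 0 w) 0 with h0 | h0
  · rw [h0, norm_zero]; positivity
  have hn := norm_pos_iff.2 h0
  have h1 := form0_dissipative hu w
  have h2 : D.form0 u (D.T c 0 u w) (S.dn 0 w) = c * D.form0 u (S.dn 0 w) (S.dn 0 w) -
      D.form0 u (D.A 0 u w) (S.dn 0 w) := by
    simp [T_apply]
  have h3 := (le_abs_self _).trans ((D.form0 u).le_opNorm₂ (D.T c 0 u w) (S.dn 0 w))
  have h4 := norm_sq_le_form0 hu (S.dn 0 w)
  rw [div_mul_eq_mul_div, le_div_iff₀ hc']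
  have h5 : (c - D.β) * ‖S.dn 0 w‖ ^ 2 ≤
      D.CL ^ 2 * (‖D.form0 u‖ * ‖D.T c 0 u w‖ * ‖S.dn 0 w‖) := by
    calc _ ≤ (c - D.β) * (D.CL ^ 2 * D.form0 u (S.dn 0 w) (S.dn 0 w)) := by gcongr
      _ = D.CL ^ 2 * ((c - D.β) * D.form0 u (S.dn 0 w) (S.dn 0 w)) := by ring
      _ ≤ _ := mul_le_mul_of_nonneg_left (by linarith) hCL.le
  nlinarith

theorem T_zero_injective {u : Z} (hu : u ∈ D.O) {c : ℝ} (hc : D.β < c) :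
    Function.Injective (D.T c 0 u) := by
  rw [injective_iff_map_eq_zero]
  intro w hw
  have := norm_le_norm_T hu hc w
  rw [hw, norm_zero, mul_zero] at this
  have h0 := norm_le_zero_iff.1 this
  exact S.dn_injective 0 (by rw [h0, map_zero])

theorem norm_le_norm_T' {u : Z} (hu : u ∈ D.O) {c : ℝ} (hc : D.β < c) (w : X 1) :
    ‖w‖ ≤ D.C * (1 + |D.ω - c| * (D.CL ^ 2 * ‖D.form0 u‖ / (c - D.β))) * ‖D.T c 0 u w‖ := by
  have hC := D.one_le_C
  have e : w = D.R D.ω 0 u (D.T c 0 u w + (D.ω - c) • S.dn 0 w) := by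
    conv_lhs => rw [← R_Q D.one_le_N hu w]
    congr 1
    simp only [T_apply, sub_smul]; abel
  calc ‖w‖ ≤ D.C * (‖D.T c 0 u w‖ + |D.ω - c| * ‖S.dn 0 w‖) := by
        conv_lhs => rw [e]
        refine ((D.R D.ω 0 u).le_opNorm _).trans ?_
        gcongr
        · exact norm_R_ω_le D.one_le_N hu
        · refine (norm_add_le _ _).trans ?_
          rw [norm_smul, Real.norm_eq_abs]
    _ ≤ D.C * (‖D.T c 0 u w‖ + |D.ω - c| *
          (D.CL ^ 2 * ‖D.form0 u‖ / (c - D.β) * ‖D.T c 0 u w‖)) := by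
        gcongr; exact norm_le_norm_T hu hc w
    _ = _ := by ring

variable [∀ r, CompleteSpace (X r)]

theorem surjective_of_near {u : Z} {c c' K : ℝ}
    (hinj : Function.Injective (D.T c 0 u)) (hsurj : Function.Surjective (D.T c 0 u))
    (hK : 0 ≤ K) (hb : ∀ w, ‖w‖ ≤ K * ‖D.T c 0 u w‖) (hcc : |c' - c| * K < 1) :
    Function.Surjective (D.T c' 0 u) := by
  let e : X 1 ≃L[ℝ] X 0 := ContinuousLinearEquiv.ofBijective (D.T c 0 u)
    (LinearMap.ker_eq_bot.2 hinj) (LinearMap.range_eq_top.2 hsurj)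
  have he : ∀ w, e w = D.T c 0 u w := fun w => rfl
  let t : X 1 →L[ℝ] X 1 := -((c' - c) • (e.symm : X 0 →L[ℝ] X 1).comp (S.dn 0))
  have ht : ‖t‖ < 1 := by
    refine lt_of_le_of_lt (ContinuousLinearMap.opNorm_le_bound _ (by positivity) fun w => ?_) hcc
    change ‖-((c' - c) • e.symm (S.dn 0 w))‖ ≤ _
    rw [norm_neg, norm_smul, Real.norm_eq_abs, mul_assoc]
    gcongr
    refine (hb _).trans ?_
    rw [← he, ContinuousLinearEquiv.apply_symm_apply]
    gcongr; exact S.norm_dn_le _ _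
  intro y
  let U := Units.oneSub t ht
  refine ⟨(↑U⁻¹ : X 1 →L[ℝ] X 1) (e.symm y), ?_⟩
  have h1 : (↑U : X 1 →L[ℝ] X 1) ((↑U⁻¹ : X 1 →L[ℝ] X 1) (e.symm y)) = e.symm y := by
    have : (↑U * ↑U⁻¹ : X 1 →L[ℝ] X 1) = 1 := U.mul_inv
    exact congrArg (fun f : X 1 →L[ℝ] X 1 => f (e.symm y)) this
  set z := (↑U⁻¹ : X 1 →L[ℝ] X 1) (e.symm y)
  have h2 : z + (c' - c) • e.symm (S.dn 0 z) = e.symm y := by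
    rw [← h1]
    change _ = z - (-((c' - c) • e.symm (S.dn 0 z)))
    rw [sub_neg_eq_add]
  have h3 := congrArg e h2
  rw [map_add, map_smul, e.apply_symm_apply, e.apply_symm_apply, he] at h3
  rw [← h3, T_apply, T_apply, sub_smul]; abel

theorem T_zero_surjective {u : Z} (hu : u ∈ D.O) {c : ℝ} (hc : D.β < c) :
    Function.Surjective (D.T c 0 u) := by
  obtain ⟨c₁, hc₁, hs⟩ := D.surjective u hu
  change D.β < c₁ at hc₁
  change Function.Surjective (D.T c₁ 0 u) at hs
  have hCL := D.one_le_CL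
  have hC := D.one_le_C
  set F := D.CL ^ 2 * ‖D.form0 u‖
  set m := min c c₁ - D.β
  have hm : 0 < m := sub_pos.2 (lt_min hc hc₁)
  set K := D.C * (1 + (|D.ω - c| + |D.ω - c₁|) * (F / m)) with hKdef
  have hF : 0 ≤ F := by positivity
  have hK : 0 ≤ K := by positivity
  have hb : ∀ c' ∈ uIcc c₁ c, D.β < c' ∧ ∀ w, ‖w‖ ≤ K * ‖D.T c' 0 u w‖ := by
    intro c' hc'
    have h1 : min c c₁ ≤ c' := by rw [min_comm]; exact hc'.1
    have h1' : c' ≤ max c c₁ := by rw [max_comm]; exact hc'.2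
    have h2 : D.β < c' := (lt_min hc hc₁).trans_le h1
    refine ⟨h2, fun w => (norm_le_norm_T' hu h2 w).trans ?_⟩
    have h3 : |D.ω - c'| ≤ |D.ω - c| + |D.ω - c₁| := by
      rcases le_total c c₁ with h | h
      · rw [min_eq_left h] at h1; rw [max_eq_right h] at h1'
        rw [abs_le]
        constructor <;> linarith [neg_abs_le (D.ω - c₁), le_abs_self (D.ω - c),
          abs_nonneg (D.ω - c₁), abs_nonneg (D.ω - c)]
      · rw [min_eq_right h] at h1; rw [max_eq_left h] at h1'
        rw [abs_le]
        constructor <;> linarith [neg_abs_le (D.ω - c), le_abs_self (D.ω - c₁),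
          abs_nonneg (D.ω - c₁), abs_nonneg (D.ω - c)]
    have h4 : m ≤ c' - D.β := sub_le_sub_right h1 _
    rw [hKdef]
    change D.C * (1 + |D.ω - c'| * (F / (c' - D.β))) * _ ≤ _
    gcongr
  obtain ⟨n, hn⟩ := exists_nat_gt (|c - c₁| * K)
  have hn0 : (0 : ℝ) < n := lt_of_le_of_lt (by positivity) hn
  have key : ∀ i : ℕ, i ≤ n → Function.Surjective (D.T (c₁ + i / n * (c - c₁)) 0 u) := by
    intro i
    induction i with
    | zero => intro _; simpa using hs
    | succ i ih =>
      intro hi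
      have hi' : (i : ℝ) / n ∈ Icc (0 : ℝ) 1 :=
        ⟨by positivity, (div_le_one hn0).2 (by exact_mod_cast (Nat.le_of_succ_le hi))⟩
      have hmem : c₁ + i / n * (c - c₁) ∈ uIcc c₁ c := by
        rw [← segment_eq_uIcc, segment_eq_image']
        exact ⟨_, hi', by simp [smul_eq_mul]⟩
      obtain ⟨h1, h2⟩ := hb _ hmem
      refine surjective_of_near (T_zero_injective hu h1) (ih (Nat.le_of_succ_le hi)) hK h2 ?_
      have e : c₁ + (↑(i + 1) : ℝ) / n * (c - c₁) - (c₁ + i / n * (c - c₁)) = (c - c₁) / n := by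
        push_cast; field_simp; ring
      rw [e, abs_div, abs_of_pos hn0, div_mul_eq_mul_div, div_lt_one hn0]
      exact hn
  have := key n le_rfl
  rw [div_self hn0.ne', one_mul] at this
  simpa using this

theorem T_bijective {k : ℕ} (hk : k < D.N) {u : Z} (hu : u ∈ D.O) {c : ℝ} (hc : D.β < c) :
    Function.Bijective (D.T c k u) := by
  induction k with
  | zero => exact ⟨T_zero_injective hu hc, T_zero_surjective hu hc⟩
  | succ k ih =>
    have hk' : k < D.N := Nat.lt_of_succ_lt hk
    obtain ⟨hi, hs⟩ := ih hk'
    refine ⟨fun y z h => S.dn_injective _ (hi ?_), fun f => ?_⟩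
    · rw [← T_dn hk hu, ← T_dn hk hu, h]
    · obtain ⟨w, hw⟩ := hs (S.dn k f)
      set z := D.R D.ω (k + 1) u (f + (D.ω - c) • w) with hz
      have h1 : S.dn (k + 1) z = w := by
        rw [← R_Q hk' hu (S.dn (k + 1) z), ← T_dn hk hu, hz, Q_R hk hu]
        conv_rhs => rw [← R_Q hk' hu w]
        congr 1
        rw [map_add, map_smul, ← hw, T_apply, T_apply, sub_smul]; abel
      exact ⟨z, S.dn_injective k (by rw [T_dn hk hu, h1, hw])⟩

theorem T_isInvertible {k : ℕ} (hk : k < D.N) {u : Z} (hu : u ∈ D.O) {c : ℝ} (hc : D.β < c) :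
    (D.T c k u).IsInvertible := by
  obtain ⟨hi, hs⟩ := T_bijective hk hu hc
  exact ⟨ContinuousLinearEquiv.ofBijective (D.T c k u)
    (LinearMap.ker_eq_bot.2 hi) (LinearMap.range_eq_top.2 hs), rfl⟩

theorem T_R {k : ℕ} (hk : k < D.N) {u : Z} (hu : u ∈ D.O) {c : ℝ} (hc : D.β < c) (y : X k) :
    D.T c k u (D.R c k u y) = y := (T_isInvertible hk hu hc).self_apply_inverse y

theorem R_T {k : ℕ} (hk : k < D.N) {u : Z} (hu : u ∈ D.O) {c : ℝ} (hc : D.β < c)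
    (y : X (k + 1)) : D.R c k u (D.T c k u y) = y := (T_isInvertible hk hu hc).inverse_apply_self y

theorem dn_R {k : ℕ} (hk : k + 1 < D.N) {u : Z} (hu : u ∈ D.O) {c : ℝ} (hc : D.β < c)
    (y : X (k + 1)) : S.dn (k + 1) (D.R c (k + 1) u y) = D.R c k u (S.dn k y) := by
  apply (T_bijective (Nat.lt_of_succ_lt hk) hu hc).1
  rw [← T_dn hk hu, T_R hk hu hc, T_R (Nat.lt_of_succ_lt hk) hu hc]

theorem J_eq_dn_R {k : ℕ} (hk : k < D.N) {u : Z} (hu : u ∈ D.O) {c : ℝ} (hc : D.β < c)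
    (y : X k) : D.J c k u y = S.dn k (c • D.R c k u y) := by
  cases k with
  | zero => rw [map_smul]; rfl
  | succ k =>
    rw [map_smul, dn_R hk hu hc]; rfl

theorem A_R {k : ℕ} (hk : k < D.N) {u : Z} (hu : u ∈ D.O) {c : ℝ} (hc : D.β < c)
    (y : X k) : D.A k u (c • D.R c k u y) = D.Y c k u y := by
  have h := T_R hk hu hc y
  rw [T_apply, sub_eq_iff_eq_add, ← sub_eq_iff_eq_add'] at h
  rw [map_smul, ← h, Y]
  change _ = c • (D.J c k u y - y)
  rw [J_eq_dn_R hk hu hc, map_smul]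

theorem dn_J {k : ℕ} (hk : k < D.N) {u : Z} (hu : u ∈ D.O) {c : ℝ} (hc : D.β < c)
    (y : X (k + 1)) : S.dn k (D.J c (k + 1) u y) = D.J c k u (S.dn k y) := by
  rw [J_eq_dn_R hk hu hc]; rfl

theorem dn_Y {k : ℕ} (hk : k < D.N) {u : Z} (hu : u ∈ D.O) {c : ℝ} (hc : D.β < c)
    (y : X (k + 1)) : S.dn k (D.Y c (k + 1) u y) = D.Y c k u (S.dn k y) := by
  change S.dn k (c • (D.J c (k + 1) u y - y)) = c • (D.J c k u (S.dn k y) - S.dn k y)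
  rw [map_smul, map_sub, dn_J hk hu hc]

theorem Q_J {k : ℕ} (hk : k < D.N) {u : Z} (hu : u ∈ D.O) {c : ℝ} (hc : D.β < c)
    (y : X (k + 1)) : D.T D.ω k u (D.J c (k + 1) u y) = D.J c k u (D.T D.ω k u y) := by
  set z := D.J c (k + 1) u y with hz
  have h1 : D.T c k u z = c • S.dn k y := by
    change D.T c k u (c • D.R c k u (S.dn k y)) = _
    rw [map_smul, T_R hk hu hc]
  have h2 : D.A k u z = c • S.dn k z - c • S.dn k y := by
    rw [← h1, T_apply]; abel
  have h3 : (D.ω - c) • z + c • y = c • D.R c k u (D.T D.ω k u y) := by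
    apply (T_bijective hk hu hc).1
    rw [map_add, map_smul, h1, map_smul, map_smul, T_R hk hu hc, T_apply, T_apply]
    module
  rw [J_eq_dn_R hk hu hc, ← h3, T_apply, h2, map_add, map_smul, map_smul]
  module

theorem A_J {k : ℕ} (hk : k < D.N) {u : Z} (hu : u ∈ D.O) {c : ℝ} (hc : D.β < c)
    (y : X (k + 1)) : D.A k u (D.J c (k + 1) u y) = D.J c k u (D.A k u y) := by
  have h := Q_J hk hu hc y
  rw [T_apply, T_apply, map_sub, map_smul, dn_J hk hu hc] at h
  exact sub_right_injective h

theorem A_J_eq_Y {k : ℕ} (hk : k < D.N) {u : Z} (hu : u ∈ D.O) {c : ℝ} (hc : D.β < c)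
    (y : X (k + 1)) : D.A k u (D.J c (k + 1) u y) = D.Y c k u (S.dn k y) := by
  rw [← A_R hk hu hc]; rfl

theorem Q_Y {k : ℕ} (hk : k < D.N) {u : Z} (hu : u ∈ D.O) {c : ℝ} (hc : D.β < c)
    (y : X (k + 1)) : D.T D.ω k u (D.Y c (k + 1) u y) = D.Y c k u (D.T D.ω k u y) := by
  rw [Y_apply, Y_apply, map_smul, map_sub, Q_J hk hu hc]

theorem Qpow_J {k : ℕ} (hk : k ≤ D.N) {u : Z} (hu : u ∈ D.O) {c : ℝ} (hc : D.β < c)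
    (y : X k) : D.Qpow k u (D.J c k u y) = D.J c 0 u (D.Qpow k u y) := by
  induction k with
  | zero => rfl
  | succ k ih =>
    change D.Qpow k u (D.T D.ω k u (D.J c (k + 1) u y)) = D.J c 0 u (D.Qpow k u (D.T D.ω k u y))
    rw [Q_J hk hu hc, ih (Nat.le_of_succ_le hk)]

theorem Qpow_Y {k : ℕ} (hk : k ≤ D.N) {u : Z} (hu : u ∈ D.O) {c : ℝ} (hc : D.β < c)
    (y : X k) : D.Qpow k u (D.Y c k u y) = D.Y c 0 u (D.Qpow k u y) := by
  rw [Y_apply, Y_apply, map_smul, map_sub, Qpow_J hk hu hc]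

theorem form0_J_le {u : Z} (hu : u ∈ D.O) {c : ℝ} (hc : D.lam₀ ≤ c) (y : X 0) :
    D.form0 u (D.J c 0 u y) (D.J c 0 u y) ≤ 2 * D.form0 u y y := by
  have hβ := β_lt hc
  have hβ0 := D.β_nonneg
  have hc1 := lam_pos hc
  set w := c • D.R c 0 u y
  have hj : D.J c 0 u y = S.dn 0 w := J_eq_dn_R D.one_le_N hu hβ y
  have hA : D.A 0 u w = c • (D.J c 0 u y - y) := A_R D.one_le_N hu hβ y
  have h1 := form0_dissipative hu w
  have h2 := form0_nonneg hu (y - S.dn 0 w)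
  rw [hj] at hA ⊢
  simp only [hA, map_smul, map_sub, sub_apply,
    smul_apply, smul_eq_mul] at h1 h2
  rw [form0_symm hu (S.dn 0 w) y] at h2
  have h3 := form0_nonneg hu (S.dn 0 w)
  have h4 := form0_nonneg hu y
  unfold lam₀ at hc
  nlinarith

theorem form0_Y_le {u : Z} (hu : u ∈ D.O) {c : ℝ} (hc : D.lam₀ ≤ c) (y : X 0) :
    D.form0 u (D.Y c 0 u y) y ≤ 2 * D.β * D.form0 u y y := by
  have hβ := β_lt hc
  have hβ0 := D.β_nonneg
  have hc1 := lam_pos hc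
  have hJ := form0_J_le hu hc y
  set w := c • D.R c 0 u y
  have hj : D.J c 0 u y = S.dn 0 w := J_eq_dn_R D.one_le_N hu hβ y
  have hA : D.A 0 u w = D.Y c 0 u y := A_R D.one_le_N hu hβ y
  clear_value w
  have h1 := form0_dissipative hu w
  have h5 : y = S.dn 0 w - c⁻¹ • D.Y c 0 u y := by
    change _ = _ - c⁻¹ • (c • (D.J c 0 u y - y))
    rw [smul_smul, inv_mul_cancel₀ (by positivity), one_smul, hj]; abel
  have h6 : D.form0 u (D.Y c 0 u y) y =
      D.form0 u (D.Y c 0 u y) (S.dn 0 w) - c⁻¹ * D.form0 u (D.Y c 0 u y) (D.Y c 0 u y) := by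
    have h6 := congrArg (D.form0 u (D.Y c 0 u y)) h5
    rwa [map_sub, map_smul, smul_eq_mul] at h6
  have h7 := form0_nonneg hu (D.Y c 0 u y)
  have h8 : 0 ≤ c⁻¹ := by positivity
  rw [hA, ← hj] at h1
  rw [h6, ← hj]
  nlinarith [mul_nonneg h8 h7]

theorem form_J_le {k : ℕ} (hk : k ≤ D.N) {u : Z} (hu : u ∈ D.O) {c : ℝ} (hc : D.lam₀ ≤ c)
    (y : X k) : D.form k u (D.J c k u y) (D.J c k u y) ≤ 2 * D.form k u y y := by
  rw [form_apply, Qpow_J hk hu (β_lt hc)]; exact form0_J_le hu hc _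

theorem form_Y_le {k : ℕ} (hk : k ≤ D.N) {u : Z} (hu : u ∈ D.O) {c : ℝ} (hc : D.lam₀ ≤ c)
    (y : X k) : D.form k u (D.Y c k u y) y ≤ 2 * D.β * D.form k u y y := by
  rw [form_apply, Qpow_Y hk hu (β_lt hc)]; exact form0_Y_le hu hc _

end Resolvent

end DissipativeFamily

theorem tendsto_clm_apply {ι E F : Type*} [NormedAddCommGroup E] [NormedSpace ℝ E]
    [NormedAddCommGroup F] [NormedSpace ℝ F] {l : Filter ι} {f : ι → E →L[ℝ] F} {f₀ : E →L[ℝ] F}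
    {z : ι → E} {z₀ : E} (hf : Tendsto f l (𝓝 f₀)) (hz : Tendsto z l (𝓝 z₀)) :
    Tendsto (fun i => f i (z i)) l (𝓝 (f₀ z₀)) :=
  (isBoundedBilinearMap_apply.continuous.tendsto (f₀, z₀)).comp (hf.prodMk_nhds hz)

namespace DissipativeFamily

variable {X : ℕ → Type u} [∀ r, NormedAddCommGroup (X r)] [∀ r, InnerProductSpace ℝ (X r)]
  {S : HilbertScale X} {Z : Type*} [NormedAddCommGroup Z] [NormedSpace ℝ Z]
  {D : DissipativeFamily S Z}

/-! #### Uniform bounds for the forms and the resolvents -/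

theorem T_bound {k : ℕ} (hk : k < D.N) (c : ℝ) : ∃ K, C1BoundedOn (D.T c k) D.O K := by
  have h := (C1BoundedOn.const (O := D.O) (c • S.dn k)).add D.isOpen
    ((D.A_bound k hk).comp_left D.isOpen (-ContinuousLinearMap.id ℝ (X (k + 1) →L[ℝ] X k)))
  have e : (fun u => c • S.dn k + (-ContinuousLinearMap.id ℝ (X (k + 1) →L[ℝ] X k)) (D.A k u)) =
      D.T c k := by
    funext u; simp [T, sub_eq_add_neg]
  rw [e] at h
  exact ⟨_, h⟩

theorem Qpow_bound {k : ℕ} (hk : k ≤ D.N) : ∃ K, C1BoundedOn (D.Qpow k) D.O K := by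
  induction k with
  | zero => exact ⟨_, C1BoundedOn.const _⟩
  | succ k ih =>
    obtain ⟨K, hK⟩ := ih (Nat.le_of_succ_le hk)
    obtain ⟨K', hK'⟩ := T_bound hk D.ω
    exact hK.clm_comp D.isOpen hK'

theorem Qpow_lower {k : ℕ} (hk : k ≤ D.N) {u : Z} (hu : u ∈ D.O) (y : X k) :
    ‖y‖ ≤ D.C ^ k * ‖D.Qpow k u y‖ := by
  have hC := D.one_le_C
  induction k with
  | zero => simp [Qpow]
  | succ k ih =>
    have h1 := ih (Nat.le_of_succ_le hk) (D.T D.ω k u y)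
    calc ‖y‖ = ‖D.R D.ω k u (D.T D.ω k u y)‖ := by rw [R_Q hk hu]
      _ ≤ D.C * ‖D.T D.ω k u y‖ := ((D.R D.ω k u).le_opNorm _).trans (by
        gcongr; exact norm_R_ω_le hk hu)
      _ ≤ D.C * (D.C ^ k * ‖D.Qpow k u (D.T D.ω k u y)‖) := by gcongr
      _ = _ := by rw [pow_succ]; change _ = D.C ^ k * D.C * ‖D.Qpow k u (D.T D.ω k u y)‖; ring

theorem _root_.C1BoundedOn.bilinearComp {Z E F : Type*} [NormedAddCommGroup Z] [NormedSpace ℝ Z]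
    [NormedAddCommGroup E] [NormedSpace ℝ E] [NormedAddCommGroup F] [NormedSpace ℝ F]
    {O : Set Z} (hO : IsOpen O) {B : Z → F →L[ℝ] F →L[ℝ] ℝ} {P : Z → E →L[ℝ] F} {CB CP : ℝ}
    (hB : C1BoundedOn B O CB) (hP : C1BoundedOn P O CP) :
    ∃ K, C1BoundedOn (fun u => (B u).bilinearComp (P u) (P u)) O K := by
  obtain ⟨K₁, h₁⟩ := hB.clm_comp hO hP
  have h₂ := h₁.comp_left (F := F →L[ℝ] E →L[ℝ] ℝ) hO
    (ContinuousLinearMap.flipₗᵢ ℝ E F ℝ : (E →L[ℝ] F →L[ℝ] ℝ) →L[ℝ] (F →L[ℝ] E →L[ℝ] ℝ))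
  obtain ⟨K₃, h₃⟩ := h₂.clm_comp hO hP
  have h₄ := h₃.comp_left (F := E →L[ℝ] E →L[ℝ] ℝ) hO
    (ContinuousLinearMap.flipₗᵢ ℝ E E ℝ : (E →L[ℝ] E →L[ℝ] ℝ) →L[ℝ] (E →L[ℝ] E →L[ℝ] ℝ))
  exact ⟨_, h₄⟩

theorem L_C1BoundedOn : ∃ K, C1BoundedOn D.L D.O K := by
  have hC := D.one_le_C
  have hCL := D.one_le_CL
  refine ⟨max (2 * (D.CL ^ 2 + |D.a| * D.C ^ 2)) D.C, D.L_contDiffOn, fun u hu => ⟨le_max_of_le_left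
    (clm_norm_le_of_quadratic _ (D.symm u hu) (by positivity) fun w => ?_),
    (D.L_bound u hu).trans (le_max_right _ _)⟩⟩
  have h1 := D.upper u hu w
  have h2 := D.lower u hu w
  have h3 : ‖S.dn 0 (D.R D.ω 0 u w)‖ ≤ D.C * ‖w‖ := (S.norm_dn_le _ _).trans
    (((D.R D.ω 0 u).le_opNorm w).trans (by gcongr; exact norm_R_ω_le D.one_le_N hu))
  have h4 : D.a * ‖S.dn 0 (D.R D.ω 0 u w)‖ ^ 2 ≤ |D.a| * (D.C * ‖w‖) ^ 2 :=
    mul_le_mul (le_abs_self _) (by gcongr) (by positivity) (abs_nonneg _)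
  change _ - D.a * ‖S.dn 0 (D.R D.ω 0 u w)‖ ^ 2 ≤ _ at h2
  have h5 : 0 ≤ (D.CL ^ 2)⁻¹ * ‖w‖ ^ 2 := by positivity
  have h6 : 0 ≤ D.CL ^ 2 * ‖w‖ ^ 2 := by positivity
  have h7 : 0 ≤ |D.a| * (D.C * ‖w‖) ^ 2 := by positivity
  rw [abs_le]
  constructor <;> nlinarith

theorem form0_bound : ∃ K, C1BoundedOn D.form0 D.O K := by
  obtain ⟨K₁, h₁⟩ := L_C1BoundedOn (D := D)
  have h₂ := (D.inverse_bound 0 D.one_le_N).comp_left D.isOpen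
    (ContinuousLinearMap.compL ℝ (X 0) (X 1) (X 0) (S.dn 0))
  obtain ⟨K₃, h₃⟩ := (C1BoundedOn.const (O := D.O) (innerForm (X 0))).bilinearComp D.isOpen h₂
  have h₄ := h₃.comp_left (F := X 0 →L[ℝ] X 0 →L[ℝ] ℝ) D.isOpen (D.a • ContinuousLinearMap.id ℝ (X 0 →L[ℝ] X 0 →L[ℝ] ℝ))
  exact ⟨_, h₁.add D.isOpen h₄⟩

theorem form_bound {k : ℕ} (hk : k ≤ D.N) : ∃ K, 1 ≤ K ∧ C1BoundedOn (D.form k) D.O K ∧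
    ∀ u ∈ D.O, ∀ y, ‖y‖ ^ 2 ≤ K * D.form k u y y := by
  obtain ⟨K₁, h₁⟩ := form0_bound (D := D)
  obtain ⟨K₂, h₂⟩ := Qpow_bound hk
  obtain ⟨K₃, h₃⟩ := h₁.bilinearComp D.isOpen h₂
  have hC := D.one_le_C
  have hCL := D.one_le_CL
  refine ⟨max (max 1 K₃) ((D.C ^ k) ^ 2 * D.CL ^ 2), le_max_of_le_left (le_max_left _ _),
    ⟨h₃.1, fun u hu => ⟨(h₃.2 u hu).1.trans ?_, (h₃.2 u hu).2.trans ?_⟩⟩, fun u hu y => ?_⟩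
  · exact le_max_of_le_left (le_max_right _ _)
  · exact le_max_of_le_left (le_max_right _ _)
  · have h4 := Qpow_lower hk hu y
    have h5 := norm_sq_le_form0 hu (D.Qpow k u y)
    have h6 := form0_nonneg hu (D.Qpow k u y)
    rw [form_apply]
    calc ‖y‖ ^ 2 ≤ (D.C ^ k * ‖D.Qpow k u y‖) ^ 2 := by gcongr
      _ = (D.C ^ k) ^ 2 * ‖D.Qpow k u y‖ ^ 2 := by ring
      _ ≤ (D.C ^ k) ^ 2 * (D.CL ^ 2 * D.form0 u (D.Qpow k u y) (D.Qpow k u y)) := by gcongr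
      _ = (D.C ^ k) ^ 2 * D.CL ^ 2 * D.form0 u (D.Qpow k u y) (D.Qpow k u y) := by ring
      _ ≤ _ := by gcongr; exact le_max_right _ _

theorem form_nonneg {k : ℕ} {u : Z} (hu : u ∈ D.O) (y : X k) : 0 ≤ D.form k u y y :=
  form0_nonneg hu _

theorem form_apply_le {k : ℕ} {K : ℝ} (h : C1BoundedOn (D.form k) D.O K) {u : Z}
    (hu : u ∈ D.O) (v w : X k) : D.form k u v w ≤ K * ‖v‖ * ‖w‖ :=
  (le_abs_self _).trans (((D.form k u).le_opNorm₂ v w).trans (by gcongr; exact (h.2 u hu).1))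

theorem A_lipschitz {k : ℕ} (hk : k < D.N) {u v : Z} (hu : u ∈ D.O) (hv : v ∈ D.O) :
    ‖D.A k u - D.A k v‖ ≤ D.C * ‖u - v‖ :=
  (D.A_bound k hk).lipschitz D.isOpen D.convex subset_rfl hu hv

theorem _root_.HilbertScale.norm_dn_clm_le (S : HilbertScale X) (k : ℕ) : ‖S.dn k‖ ≤ 1 :=
  ContinuousLinearMap.opNorm_le_bound _ zero_le_one fun y => by simpa using S.norm_dn_le k y

theorem A_tendsto {ι : Type*} {l : Filter ι} {k : ℕ} (hk : k < D.N) {u : ι → Z} {u₀ : Z}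
    (hu₀ : u₀ ∈ D.O) (hu : Tendsto u l (𝓝 u₀)) {z : ι → X (k + 1)} {z₀ : X (k + 1)}
    (hz : Tendsto z l (𝓝 z₀)) : Tendsto (fun i => D.A k (u i) (z i)) l (𝓝 (D.A k u₀ z₀)) :=
  tendsto_clm_apply (((D.A_bound k hk).1.continuousOn.continuousAt
    (D.isOpen.mem_nhds hu₀)).tendsto.comp hu) hz

theorem Q_tendsto {ι : Type*} {l : Filter ι} {k : ℕ} (hk : k < D.N) {u : ι → Z} {u₀ : Z}
    (hu₀ : u₀ ∈ D.O) (hu : Tendsto u l (𝓝 u₀)) {z : ι → X (k + 1)} {z₀ : X (k + 1)}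
    (hz : Tendsto z l (𝓝 z₀)) :
    Tendsto (fun i => D.T D.ω k (u i) (z i)) l (𝓝 (D.T D.ω k u₀ z₀)) :=
  ((((S.dn k).continuous.tendsto _).comp hz).const_smul D.ω).sub (A_tendsto hk hu₀ hu hz)

theorem R_tendsto {ι : Type*} {l : Filter ι} {k : ℕ} (hk : k < D.N) {u : ι → Z} {u₀ : Z}
    (hu₀ : u₀ ∈ D.O) (hu : Tendsto u l (𝓝 u₀)) {z : ι → X k} {z₀ : X k}
    (hz : Tendsto z l (𝓝 z₀)) :
    Tendsto (fun i => D.R D.ω k (u i) (z i)) l (𝓝 (D.R D.ω k u₀ z₀)) :=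
  tendsto_clm_apply (((D.inverse_bound k hk).1.continuousOn.continuousAt
    (D.isOpen.mem_nhds hu₀)).tendsto.comp hu) hz

variable [∀ r, CompleteSpace (X r)]

theorem norm_J_le {k : ℕ} (hk : k ≤ D.N) : ∃ K, 1 ≤ K ∧ ∀ u ∈ D.O, ∀ c, D.lam₀ ≤ c →
    ‖D.J c k u‖ ≤ K := by
  obtain ⟨K, hK1, hK, hl⟩ := form_bound hk
  refine ⟨2 * K, by linarith, fun u hu c hc => ?_⟩
  refine ContinuousLinearMap.opNorm_le_bound _ (by positivity) fun y => ?_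
  have h1 := form_J_le hk hu hc y
  have h2 := hl u hu (D.J c k u y)
  have h3 := form_apply_le hK hu y y
  refine abs_le_of_sq_le_sq' ?_ (by positivity) |>.2
  calc ‖D.J c k u y‖ ^ 2 ≤ K * D.form k u (D.J c k u y) (D.J c k u y) := h2
    _ ≤ K * (2 * (K * ‖y‖ * ‖y‖)) := by
      apply mul_le_mul_of_nonneg_left _ (by positivity); linarith
    _ ≤ (2 * K * ‖y‖) ^ 2 := by nlinarith [sq_nonneg (K * ‖y‖)]

theorem norm_R_le {k : ℕ} (hk : k < D.N) : ∃ K, 1 ≤ K ∧ ∀ u ∈ D.O, ∀ c, D.lam₀ ≤ c →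
    ‖D.R c k u‖ ≤ K := by
  obtain ⟨K, hK1, hK⟩ := norm_J_le hk.le (D := D)
  have hC := D.one_le_C
  refine ⟨D.C * (1 + (|D.ω| + 1) * K), one_le_mul_of_one_le_of_one_le hC
    (by nlinarith [mul_nonneg (abs_nonneg D.ω) (zero_le_one.trans hK1)]), fun u hu c hc => ?_⟩
  have hc1 := lam_pos hc
  have hβ := β_lt hc
  refine ContinuousLinearMap.opNorm_le_bound _ (by positivity) fun y => ?_
  set w := D.R c k u y with hw
  have h1 : S.dn k w = c⁻¹ • D.J c k u y := by
    rw [J_eq_dn_R hk hu hβ, map_smul, smul_smul, inv_mul_cancel₀ (by positivity), one_smul]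
  have e : w = D.R D.ω k u (y + (D.ω - c) • S.dn k w) := by
    conv_lhs => rw [← R_Q hk hu w]
    congr 1
    rw [← T_R hk hu hβ y, ← hw, T_apply, T_apply]; module
  have h2 : ‖(D.ω - c) • S.dn k w‖ ≤ (|D.ω| + 1) * (K * ‖y‖) := by
    rw [h1, smul_smul, norm_smul]
    have h3 : ‖(D.ω - c) * c⁻¹‖ ≤ |D.ω| + 1 := by
      rw [Real.norm_eq_abs, abs_mul, abs_inv, abs_of_pos (by linarith : 0 < c),
        ← div_eq_mul_inv, div_le_iff₀ (by linarith)]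
      refine (abs_sub _ _).trans ?_
      rw [abs_of_pos (by linarith : 0 < c)]
      nlinarith [abs_nonneg D.ω]
    gcongr
    exact ((D.J c k u).le_opNorm y).trans (by gcongr; exact hK u hu c hc)
  rw [e]
  refine ((D.R D.ω k u).le_opNorm _).trans ?_
  calc _ ≤ D.C * (‖y‖ + (|D.ω| + 1) * (K * ‖y‖)) := by
        gcongr
        · exact norm_R_ω_le hk hu
        · exact (norm_add_le _ _).trans (by gcongr)
    _ = _ := by ring

theorem R_lipschitz {k : ℕ} (hk : k < D.N) : ∃ K, 0 ≤ K ∧ ∀ u ∈ D.O, ∀ v ∈ D.O, ∀ c, D.lam₀ ≤ c →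
    ‖D.R c k u - D.R c k v‖ ≤ K * ‖u - v‖ := by
  obtain ⟨K, hK1, hK⟩ := norm_R_le hk (D := D)
  have hC := D.one_le_C
  refine ⟨K * D.C * K, by positivity, fun u hu v hv c hc => ?_⟩
  have e : D.R c k u - D.R c k v = (D.R c k u).comp ((D.A k u - D.A k v).comp (D.R c k v)) := by
    ext y
    have h1 : D.A k u (D.R c k v y) - D.A k v (D.R c k v y) =
        y - D.T c k u (D.R c k v y) := by
      have h2 := T_R hk hv (β_lt hc) y
      rw [T_apply, sub_eq_iff_eq_add] at h2
      rw [T_apply, h2]; abel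
    change _ = D.R c k u (D.A k u (D.R c k v y) - D.A k v (D.R c k v y))
    rw [h1, map_sub, R_T hk hu (β_lt hc)]; rfl
  rw [e]
  refine (ContinuousLinearMap.opNorm_comp_le _ _).trans ?_
  calc _ ≤ K * (‖D.A k u - D.A k v‖ * ‖D.R c k v‖) := by
        gcongr
        · exact hK u hu c hc
        · exact ContinuousLinearMap.opNorm_comp_le _ _
    _ ≤ K * (D.C * ‖u - v‖ * K) := by
        gcongr
        · exact A_lipschitz hk hu hv
        · exact hK v hv c hc
    _ = _ := by ring

theorem J_lipschitz {k : ℕ} (hk : k ≤ D.N) : ∃ K, 0 ≤ K ∧ ∀ u ∈ D.O, ∀ v ∈ D.O, ∀ c, D.lam₀ ≤ c →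
    ‖D.J c k u - D.J c k v‖ ≤ c * K * ‖u - v‖ := by
  cases k with
  | zero =>
    obtain ⟨K, hK0, hK⟩ := R_lipschitz D.one_le_N
    refine ⟨K, hK0, fun u hu v hv c hc => ?_⟩
    have hc1 := lam_pos hc
    have e : D.J c 0 u - D.J c 0 v = c • (S.dn 0).comp (D.R c 0 u - D.R c 0 v) := by
      ext y; simp [J, smul_sub]
    rw [e, norm_smul, Real.norm_eq_abs, abs_of_pos (by linarith), mul_assoc]
    gcongr
    refine (ContinuousLinearMap.opNorm_comp_le _ _).trans ?_
    calc _ ≤ 1 * (K * ‖u - v‖) := by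
          gcongr
          · exact S.norm_dn_clm_le 0
          · exact hK u hu v hv c hc
      _ = _ := one_mul _
  | succ k =>
    obtain ⟨K, hK0, hK⟩ := R_lipschitz (Nat.lt_of_succ_le hk)
    refine ⟨K, hK0, fun u hu v hv c hc => ?_⟩
    have hc1 := lam_pos hc
    have e : D.J c (k + 1) u - D.J c (k + 1) v = c • (D.R c k u - D.R c k v).comp (S.dn k) := by
      ext y; simp [J, smul_sub]
    rw [e, norm_smul, Real.norm_eq_abs, abs_of_pos (by linarith), mul_assoc]
    gcongr
    refine (ContinuousLinearMap.opNorm_comp_le _ _).trans ?_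
    calc _ ≤ (K * ‖u - v‖) * 1 := by
          gcongr
          · exact hK u hu v hv c hc
          · exact S.norm_dn_clm_le k
      _ = _ := mul_one _

theorem norm_Y_le {k : ℕ} (hk : k ≤ D.N) {c : ℝ} (hc : D.lam₀ ≤ c) : ∃ K, ∀ u ∈ D.O,
    ‖D.Y c k u‖ ≤ K := by
  obtain ⟨K, hK1, hK⟩ := norm_J_le hk (D := D)
  have hc1 := lam_pos hc
  refine ⟨c * (K + 1), fun u hu => ?_⟩
  rw [Y, norm_smul, Real.norm_eq_abs, abs_of_pos (by linarith)]
  gcongr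
  exact (norm_sub_le _ _).trans (add_le_add (hK u hu c hc) ContinuousLinearMap.norm_id_le)

theorem Y_lipschitz {k : ℕ} (hk : k ≤ D.N) {c : ℝ} (hc : D.lam₀ ≤ c) : ∃ K, 0 ≤ K ∧
    ∀ u ∈ D.O, ∀ v ∈ D.O, ‖D.Y c k u - D.Y c k v‖ ≤ K * ‖u - v‖ := by
  obtain ⟨K, hK0, hK⟩ := J_lipschitz hk (D := D)
  have hc1 := lam_pos hc
  refine ⟨c * (c * K), by positivity, fun u hu v hv => ?_⟩
  rw [Y, Y, ← smul_sub, norm_smul, Real.norm_eq_abs, abs_of_pos (by linarith), sub_sub_sub_cancel_right,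
    mul_assoc c]
  gcongr
  exact hK u hu v hv c hc

theorem J_tendsto {ι : Type*} {l : Filter ι} {k : ℕ} (hk : k ≤ D.N) {c : ι → ℝ}
    (hc : Tendsto c l atTop) {u : ι → Z} {u₀ : Z} (hu₀ : u₀ ∈ D.O) (hu : Tendsto u l (𝓝 u₀))
    {z : ι → X k} {z₀ : X k} (hz : Tendsto z l (𝓝 z₀)) :
    Tendsto (fun i => D.J (c i) k (u i) (z i)) l (𝓝 z₀) := by
  have hO : ∀ᶠ i in l, u i ∈ D.O := hu (D.isOpen.mem_nhds hu₀)
  have hc' : ∀ᶠ i in l, D.lam₀ ≤ c i := hc.eventually_ge_atTop _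
  have key : ∀ k, k < D.N → ∀ (z : ι → X k) (z₀ : X k), Tendsto z l (𝓝 z₀) →
      Tendsto (fun i => D.J (c i) k (u i) (z i)) l (𝓝 z₀) := by
    intro k hk z z₀ hz
    obtain ⟨K, hK1, hK⟩ := norm_J_le hk.le (D := D)
    have hC := D.one_le_C
    rw [Metric.tendsto_nhds]
    intro ε hε
    obtain ⟨w, hw⟩ := Metric.denseRange_iff.1 (S.emb_denseRange (Nat.le_succ k)) z₀ (ε / (4 * K))
      (by positivity)
    change dist z₀ (S.dn k w) < _ at hw
    have h1 : ∀ᶠ i in l, dist (z i) z₀ < ε / (4 * K) :=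
      Metric.tendsto_nhds.1 hz _ (by positivity)
    have h2 : ∀ᶠ i in l, 4 * K * D.C * ‖w‖ / ε + 1 ≤ c i := hc.eventually_ge_atTop _
    filter_upwards [hO, hc', h1, h2] with i hOi hci h1i h2i
    have hci1 := lam_pos hci
    have e : D.J (c i) k (u i) (z i) - z₀ = D.J (c i) k (u i) (z i - S.dn k w) +
        ((c i)⁻¹ • D.J (c i) k (u i) (D.A k (u i) w)) + (S.dn k w - z₀) := by
      rw [← A_J hk hOi (β_lt hci), A_J_eq_Y hk hOi (β_lt hci), Y_apply, smul_smul,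
        inv_mul_cancel₀ (by positivity), one_smul, map_sub]
      abel
    have hJ : ∀ x, ‖D.J (c i) k (u i) x‖ ≤ K * ‖x‖ := fun x =>
      ((D.J (c i) k (u i)).le_opNorm x).trans (by gcongr; exact hK _ hOi _ hci)
    rw [dist_eq_norm, e]
    have n1 : ‖z i - S.dn k w‖ ≤ ε / (4 * K) + ε / (4 * K) := by
      rw [← dist_eq_norm]
      exact (dist_triangle _ z₀ _).trans (add_le_add h1i.le hw.le)
    have n2 : ‖(c i)⁻¹ • D.J (c i) k (u i) (D.A k (u i) w)‖ ≤ (c i)⁻¹ * (K * (D.C * ‖w‖)) := by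
      rw [norm_smul, Real.norm_eq_abs, abs_of_pos (by positivity)]
      gcongr
      refine (hJ _).trans ?_
      gcongr
      exact ((D.A k (u i)).le_opNorm w).trans (by gcongr; exact norm_A_le hk hOi)
    have n3 : (c i)⁻¹ * (K * (D.C * ‖w‖)) < ε / 4 := by
      rw [inv_mul_lt_iff₀ (by positivity)]
      have h5 : 4 * K * D.C * ‖w‖ / ε < c i := by linarith
      rw [div_lt_iff₀ hε] at h5
      linarith
    have n4 : ‖S.dn k w - z₀‖ < ε / 4 := by
      rw [← dist_eq_norm, dist_comm]
      refine hw.trans_le ?_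
      exact div_le_div_of_nonneg_left hε.le (by norm_num) (by linarith)
    calc _ ≤ ‖D.J (c i) k (u i) (z i - S.dn k w)‖ +
          ‖(c i)⁻¹ • D.J (c i) k (u i) (D.A k (u i) w)‖ + ‖S.dn k w - z₀‖ := norm_add₃_le
      _ < K * (ε / (4 * K) + ε / (4 * K)) + ε / 4 + ε / 4 := by
        have := (hJ (z i - S.dn k w)).trans
          (mul_le_mul_of_nonneg_left n1 (by positivity : 0 ≤ K))
        linarith
      _ = ε := by field_simp; ring
  rcases hk.lt_or_eq with hk | hk
  · exact key k hk z z₀ hz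
  · cases k with
    | zero => exact absurd D.one_le_N (by omega)
    | succ k =>
      have hk' : k < D.N := by omega
      have h1 := key k hk' _ _ (Q_tendsto hk' hu₀ hu hz)
      have h2 := R_tendsto hk' hu₀ hu h1
      rw [R_Q hk' hu₀] at h2
      refine h2.congr' ?_
      filter_upwards [hO, hc'] with i hOi hci
      rw [← Q_J hk' hOi (β_lt hci), R_Q hk' hOi]

theorem form_A_le {k : ℕ} (hk : k < D.N) {u : Z} (hu : u ∈ D.O) (y : X (k + 1)) :
    D.form k u (D.A k u y) (S.dn k y) ≤ 2 * D.β * D.form k u (S.dn k y) (S.dn k y) := by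
  have h1 : Tendsto (fun c : ℝ => D.form k u (D.J c k u (D.A k u y)) (S.dn k y)) atTop
      (𝓝 (D.form k u (D.A k u y) (S.dn k y))) :=
    tendsto_clm_apply (((D.form k u).continuous.tendsto _).comp (J_tendsto hk.le tendsto_id
      hu tendsto_const_nhds tendsto_const_nhds)) tendsto_const_nhds
  refine le_of_tendsto h1 ?_
  filter_upwards [eventually_ge_atTop D.lam₀] with c hc
  rw [← A_J hk hu (β_lt hc), A_J_eq_Y hk hu (β_lt hc)]
  exact form_Y_le hk.le hu hc _

end DissipativeFamily

namespace DissipativeFamily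

variable {X : ℕ → Type u} [∀ r, NormedAddCommGroup (X r)] [∀ r, InnerProductSpace ℝ (X r)]
  {S : HilbertScale X} {Z : Type*} [NormedAddCommGroup Z] [NormedSpace ℝ Z]
  {D : DissipativeFamily S Z}

/-! #### Energy estimates -/

/-- A differentiable path of parameters whose speed is at most `M`. -/
structure IsPath (D : DissipativeFamily S Z) (T M : ℝ) (u u' : ℝ → Z) : Prop where
  mem : ∀ t ∈ Icc 0 T, u t ∈ D.O
  deriv : ∀ t ∈ Icc 0 T, HasDerivWithinAt u (u' t) (Icc 0 T) t
  bound : ∀ t ∈ Icc 0 T, ‖u' t‖ ≤ M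

theorem IsPath.continuousOn {T M : ℝ} {u u' : ℝ → Z} (h : IsPath D T M u u') :
    ContinuousOn u (Icc 0 T) := fun t ht => (h.deriv t ht).continuousWithinAt

theorem form_hasDerivWithinAt {k : ℕ} (hk : k ≤ D.N) {T M : ℝ} {u u' : ℝ → Z}
    (hu : IsPath D T M u u') {y y' : ℝ → X k} {t : ℝ} (ht : t ∈ Icc 0 T)
    (hy : HasDerivWithinAt y (y' t) (Icc 0 T) t) :
    HasDerivWithinAt (fun t => D.form k (u t) (y t) (y t))
      (fderiv ℝ (D.form k) (u t) (u' t) (y t) (y t) + 2 * D.form k (u t) (y' t) (y t))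
      (Icc 0 T) t := by
  obtain ⟨K, -, hK, -⟩ := form_bound hk
  have h1 := (hK.hasFDerivAt D.isOpen (hu.mem t ht)).comp_hasDerivWithinAt t (hu.deriv t ht)
  have h2 := (h1.clm_apply hy).clm_apply hy
  refine h2.congr_deriv ?_
  change fderiv ℝ (D.form k) (u t) (u' t) (y t) (y t) + D.form k (u t) (y' t) (y t) +
    D.form k (u t) (y t) (y' t) = _
  rw [form_symm (hu.mem t ht) (y t) (y' t)]
  ring

theorem energy_estimate {k : ℕ} (hk : k ≤ D.N) : ∃ C₀, 1 ≤ C₀ ∧ ∀ (M κ T : ℝ) (u u' : ℝ → Z),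
    0 ≤ M → 0 ≤ κ → IsPath D T M u u' → ∀ (y z f : ℝ → X k) (G g : ℝ → ℝ),
    (∀ t ∈ Icc 0 T, HasDerivWithinAt y (z t + f t) (Icc 0 T) t) →
    (∀ t ∈ Icc 0 T, D.form k (u t) (z t) (y t) ≤ κ * D.form k (u t) (y t) (y t)) →
    (∀ t ∈ Icc 0 T, HasDerivWithinAt G (g t) (Icc 0 T) t) →
    (∀ t ∈ Icc 0 T, ‖f t‖ ≤ g t) → ∀ t ∈ Icc 0 T,
    ‖y t‖ ≤ C₀ * Real.exp (C₀ * (1 + M + κ) * t) * (‖y 0‖ + (G t - G 0)) := by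
  obtain ⟨K, hK1, hK, hl⟩ := form_bound hk
  have hK0 : 0 ≤ K := zero_le_one.trans hK1
  refine ⟨K * K * √K * √K, ?_, fun M κ T u u' hM hκ hu y z f G g hy hz hG hf t ht => ?_⟩
  · have : 1 ≤ √K := Real.one_le_sqrt.2 hK1
    have h2 : 1 ≤ K * K := by nlinarith
    have h3 : 1 ≤ K * K * √K := by nlinarith
    nlinarith
  have hg : ∀ t ∈ Icc 0 T, 0 ≤ g t := fun t ht => (norm_nonneg _).trans (hf t ht)
  have h0 : (0 : ℝ) ∈ Icc 0 T := ⟨le_rfl, ht.1.trans ht.2⟩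
  have hlow : ∀ t ∈ Icc 0 T, ‖y t‖ ≤ √K * √(D.form k (u t) (y t) (y t)) := fun t ht => by
    rw [← Real.sqrt_mul hK0, ← Real.sqrt_sq (norm_nonneg (y t))]
    exact Real.sqrt_le_sqrt (hl _ (hu.mem t ht) _)
  have hsq : √K * √K = K := Real.mul_self_sqrt hK0
  have key := sqrt_gronwall (K := (K * K * M) / 2 + κ) (by positivity)
    (fun t ht => form_hasDerivWithinAt hk hu (y' := fun t => z t + f t) ht (hy t ht))
    (fun t ht => form_nonneg (hu.mem t ht) (y t))
    (G := fun t => K * √K * G t) (g := fun t => K * √K * g t)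
    (fun t ht => (hG t ht).const_mul _) (fun t ht => by have := hg t ht; positivity)
    (fun t ht => by
      have hm := hu.mem t ht
      set φ := D.form k (u t) (y t) (y t) with hφ
      have hφ0 : 0 ≤ φ := form_nonneg hm _
      have e1 : fderiv ℝ (D.form k) (u t) (u' t) (y t) (y t) ≤ K * M * (K * φ) := by
        refine (le_abs_self _).trans
          (((fderiv ℝ (D.form k) (u t) (u' t)).le_opNorm₂ (y t) (y t)).trans ?_)
        have : ‖fderiv ℝ (D.form k) (u t) (u' t)‖ ≤ K * M :=
          (ContinuousLinearMap.le_opNorm _ _).trans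
            (mul_le_mul (hK.2 _ hm).2 (hu.bound t ht) (norm_nonneg _) hK0)
        rw [mul_assoc, ← sq]
        gcongr
        exact hl _ hm _
      have e2 : D.form k (u t) (f t) (y t) ≤ K * g t * (√K * √φ) :=
        (form_apply_le hK hm _ _).trans (by
          gcongr
          · exact mul_nonneg hK0 (hg t ht)
          · exact hf t ht
          · exact hlow t ht)
      have e3 := hz t ht
      simp only [map_add, add_apply]
      have e4 : K * M * (K * φ) = 2 * (K * K * M / 2) * φ := by ring
      nlinarith) ht
  have hinit : √(D.form k (u 0) (y 0) (y 0)) ≤ √K * ‖y 0‖ := by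
    rw [← Real.sqrt_sq (norm_nonneg (y 0)), ← Real.sqrt_mul hK0]
    refine Real.sqrt_le_sqrt ?_
    rw [sq, ← mul_assoc]
    exact form_apply_le hK (hu.mem 0 h0) _ _
  have hGm : 0 ≤ G t - G 0 := by
    have := le_of_hasDerivWithinAt_nonpos (h := fun t => -G t) (h' := fun t => -g t)
      (fun t ht => (hG t ht).neg) (fun t ht => by have := hg t ht; linarith) ht
    linarith
  have hsK : 1 ≤ √K := Real.one_le_sqrt.2 hK1
  have hexp : Real.exp ((K * K * M / 2 + κ) * t) ≤
      Real.exp (K * K * √K * √K * (1 + M + κ) * t) := by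
    apply Real.exp_le_exp.2
    apply mul_le_mul_of_nonneg_right _ ht.1
    have a1 : 1 ≤ K * K * √K * √K := by rw [mul_assoc, hsq]; nlinarith [mul_le_mul hK1 hK1 zero_le_one hK0]
    have a2 : K * K ≤ K * K * √K * √K := by rw [mul_assoc, hsq]; nlinarith [mul_nonneg hK0 hK0]
    nlinarith [mul_nonneg hM hM, mul_le_mul_of_nonneg_right a2 hM, mul_le_mul_of_nonneg_right a1 hκ,
      mul_nonneg (mul_nonneg hK0 hK0) hM]
  calc ‖y t‖ ≤ √K * √(D.form k (u t) (y t) (y t)) := hlow t ht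
    _ ≤ √K * (Real.exp ((K * K * M / 2 + κ) * t) * (√(D.form k (u 0) (y 0) (y 0)) +
          (K * √K * G t - K * √K * G 0))) := by gcongr
    _ ≤ √K * (Real.exp (K * K * √K * √K * (1 + M + κ) * t) * (√K * ‖y 0‖ +
          K * √K * (G t - G 0))) := by
        gcongr
        · have : 0 ≤ K * √K * (G t - G 0) := by positivity
          have := Real.sqrt_nonneg (D.form k (u 0) (y 0) (y 0))
          linarith
        · linarith
    _ ≤ √K * (Real.exp (K * K * √K * √K * (1 + M + κ) * t) * (K * K * √K * ‖y 0‖ +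
          K * K * √K * (G t - G 0))) := by
        have b1 : √K ≤ K * K * √K := by nlinarith [mul_le_mul hK1 hK1 zero_le_one hK0]
        have b2 : K * √K ≤ K * K * √K := by nlinarith [mul_nonneg hK0 (Real.sqrt_nonneg K)]
        gcongr
    _ = _ := by ring

variable [∀ r, CompleteSpace (X r)]

theorem energy_estimate_classical {k : ℕ} (hk : k < D.N) : ∃ C₀, 1 ≤ C₀ ∧
    ∀ (M T : ℝ) (u u' : ℝ → Z),
    0 ≤ M → IsPath D T M u u' → ∀ (y : ℝ → X (k + 1)) (f : ℝ → X k) (G g : ℝ → ℝ),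
    (∀ t ∈ Icc 0 T,
      HasDerivWithinAt (fun t => S.dn k (y t)) (D.A k (u t) (y t) + f t) (Icc 0 T) t) →
    (∀ t ∈ Icc 0 T, HasDerivWithinAt G (g t) (Icc 0 T) t) →
    (∀ t ∈ Icc 0 T, ‖f t‖ ≤ g t) → ∀ t ∈ Icc 0 T,
    ‖S.dn k (y t)‖ ≤ C₀ * Real.exp (C₀ * (1 + M) * t) * (‖S.dn k (y 0)‖ + (G t - G 0)) := by
  obtain ⟨C₀, h1, h⟩ := energy_estimate hk.le (D := D)
  have hβ := D.β_nonneg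
  refine ⟨C₀ * (1 + 2 * D.β), by nlinarith, fun M T u u' hM hu y f G g hy hG hf t ht => ?_⟩
  have := h M (2 * D.β) T u u' hM (by positivity) hu _ _ f G g hy
    (fun t ht => form_A_le hk (hu.mem t ht) (y t)) hG hf t ht
  have hGm : 0 ≤ G t - G 0 := by
    have := le_of_hasDerivWithinAt_nonpos (h := fun t => -G t) (h' := fun t => -g t)
      (fun t ht => (hG t ht).neg)
      (fun t ht => by have := (norm_nonneg _).trans (hf t ht); linarith) ht
    linarith
  refine this.trans ?_
  have ht0 := ht.1
  have a1 : C₀ ≤ C₀ * (1 + 2 * D.β) := by nlinarith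
  have a2 : C₀ * (1 + M + 2 * D.β) * t ≤ C₀ * (1 + 2 * D.β) * (1 + M) * t := by
    rw [mul_assoc C₀ (1 + 2 * D.β)]
    gcongr
    nlinarith [mul_nonneg hβ hM]
  have a3 : 0 ≤ ‖S.dn k (y 0)‖ + (G t - G 0) := by positivity
  gcongr

/-! #### Yosida approximations -/

theorem komura_estimate {k : ℕ} (hk : k < D.N) : ∃ K, 0 ≤ K ∧ ∀ u ∈ D.O, ∀ v ∈ D.O, ∀ c d : ℝ,
    D.lam₀ ≤ c → D.lam₀ ≤ d → ∀ (B : ℝ) (y z : X (k + 1)), ‖y‖ ≤ B → ‖z‖ ≤ B →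
    D.form k u (D.Y c k u (S.dn k y) - D.Y d k v (S.dn k z)) (S.dn k y - S.dn k z) ≤
      K * D.form k u (S.dn k y - S.dn k z) (S.dn k y - S.dn k z) +
      K * B ^ 2 * (c⁻¹ + d⁻¹ + ‖u - v‖ ^ 2) := by
  obtain ⟨F, hF1, hF, hl⟩ := form_bound hk.le
  obtain ⟨K, hK1, hK⟩ := norm_J_le (Nat.succ_le_of_lt hk) (D := D)
  have hC := D.one_le_C
  have hβ := D.β_nonneg
  have hF0 : 0 ≤ F := zero_le_one.trans hF1
  set Q := D.C * K with hQ
  have hQ0 : 0 ≤ Q := by positivity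
  refine ⟨4 * D.β + F + 4 * F * Q ^ 2 * (1 + 2 * D.β) + F ^ 2 * Q ^ 2, by positivity,
    fun u hu v hv c d hc hd B y z hy hz => ?_⟩
  have hB : 0 ≤ B := (norm_nonneg _).trans hy
  have hc1 := lam_pos hc
  have hd1 := lam_pos hd
  have hci : c⁻¹ ≤ 1 := inv_le_one_of_one_le₀ hc1
  have hdi : d⁻¹ ≤ 1 := inv_le_one_of_one_le₀ hd1
  set η := c⁻¹ + d⁻¹ with hη
  have hη0 : 0 ≤ η := by positivity
  set yy := D.J c (k + 1) u y with hyy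
  set zz := D.J d (k + 1) v z with hzz
  have ny : ‖yy‖ ≤ K * B := ((D.J c (k + 1) u).le_opNorm y).trans (by
    gcongr; exact hK u hu c hc)
  have nz : ‖zz‖ ≤ K * B := ((D.J d (k + 1) v).le_opNorm z).trans (by
    gcongr; exact hK v hv d hd)
  have e1 : D.Y c k u (S.dn k y) = D.A k u yy := (A_J_eq_Y hk hu (β_lt hc) y).symm
  have e2 : D.Y d k v (S.dn k z) = D.A k v zz := (A_J_eq_Y hk hv (β_lt hd) z).symm
  have e3 : S.dn k yy = S.dn k y + c⁻¹ • D.A k u yy := by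
    rw [← e1, hyy, dn_J hk hu (β_lt hc), Y_apply, smul_smul, inv_mul_cancel₀ (by positivity)]
    simp
  have e4 : S.dn k zz = S.dn k z + d⁻¹ • D.A k v zz := by
    rw [← e2, hzz, dn_J hk hv (β_lt hd), Y_apply, smul_smul, inv_mul_cancel₀ (by positivity)]
    simp
  have nA : ∀ w ∈ D.O, ∀ x : X (k + 1), ‖x‖ ≤ K * B → ‖D.A k w x‖ ≤ Q * B := fun w hw x hx =>
    ((D.A k w).le_opNorm x).trans (by
      calc _ ≤ D.C * (K * B) := by gcongr; exact norm_A_le hk hw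
        _ = _ := by ring)
  set δ := S.dn k y - S.dn k z with hδ
  set e := d⁻¹ • D.A k v zz - c⁻¹ • D.A k u yy with he
  have ne : ‖e‖ ≤ η * (Q * B) := by
    refine (norm_sub_le _ _).trans ?_
    rw [norm_smul, norm_smul, Real.norm_eq_abs, Real.norm_eq_abs, abs_of_pos (by positivity),
      abs_of_pos (by positivity : 0 < c⁻¹)]
    calc _ ≤ d⁻¹ * (Q * B) + c⁻¹ * (Q * B) := by
          gcongr
          · exact nA v hv zz nz
          · exact nA u hu yy ny
      _ = _ := by ring
  have e5 : δ = S.dn k (yy - zz) + e := by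
    rw [map_sub, e3, e4, hδ, he]; abel
  have e6 : D.Y c k u (S.dn k y) - D.Y d k v (S.dn k z) =
      D.A k u (yy - zz) - (D.A k v - D.A k u) zz := by
    rw [e1, e2, map_sub, sub_apply]; abel
  rw [e6]
  have b1 : D.form k u (D.A k u (yy - zz)) δ ≤
      2 * D.β * D.form k u (S.dn k (yy - zz)) (S.dn k (yy - zz)) +
      F * (2 * (Q * B)) * (η * (Q * B)) := by
    conv_lhs => rw [e5]
    rw [map_add]
    refine add_le_add (form_A_le hk hu _) ((form_apply_le hF hu _ _).trans ?_)
    gcongr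
    rw [map_sub]
    exact (norm_sub_le _ _).trans (by linarith [nA u hu yy ny, nA u hu zz nz])
  have ee : D.form k u e e ≤ F * (2 * η * (Q * B) ^ 2) := by
    refine (form_apply_le hF hu _ _).trans ?_
    rw [mul_assoc]
    refine mul_le_mul_of_nonneg_left ?_ hF0
    calc ‖e‖ * ‖e‖ ≤ (η * (Q * B)) * (η * (Q * B)) := by gcongr
      _ = η * (η * (Q * B) ^ 2) := by ring
      _ ≤ 2 * (η * (Q * B) ^ 2) := by gcongr; linarith
      _ = _ := by ring
  have b2 : D.form k u (S.dn k (yy - zz)) (S.dn k (yy - zz)) ≤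
      2 * D.form k u δ δ + 2 * D.form k u e e := by
    have e7 : S.dn k (yy - zz) = δ - e := by rw [e5]; abel
    have h1 := form_nonneg hu (δ + e) (D := D)
    rw [e7]
    simp only [map_sub, map_add, sub_apply, add_apply] at h1 ⊢
    rw [form_symm hu e δ] at h1 ⊢
    linarith
  have b3 : -D.form k u ((D.A k v - D.A k u) zz) δ ≤
      F * D.form k u δ δ + F ^ 2 * Q ^ 2 * B ^ 2 * ‖u - v‖ ^ 2 := by
    have h1 : ‖(D.A k v - D.A k u) zz‖ ≤ Q * B * ‖u - v‖ := by
      refine (ContinuousLinearMap.le_opNorm _ _).trans ?_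
      calc _ ≤ D.C * ‖v - u‖ * (K * B) := by
            gcongr
            exact A_lipschitz hk hv hu
        _ = _ := by rw [norm_sub_rev]; ring
    have h2 : -D.form k u ((D.A k v - D.A k u) zz) δ ≤ F * (Q * B * ‖u - v‖) * ‖δ‖ := by
      refine (neg_le_abs _).trans (((D.form k u).le_opNorm₂ _ _).trans ?_)
      gcongr
      exact (hF.2 u hu).1
    have h3 := hl u hu δ
    nlinarith [sq_nonneg (F * (Q * B * ‖u - v‖) - ‖δ‖), sq_nonneg (F * (Q * B * ‖u - v‖)),
      sq_nonneg ‖δ‖]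
  have c1 : 0 ≤ D.form k u δ δ := form_nonneg hu _
  have c2 : 2 * D.β * D.form k u (S.dn k (yy - zz)) (S.dn k (yy - zz)) ≤
      2 * D.β * (2 * D.form k u δ δ + 2 * (F * (2 * η * (Q * B) ^ 2))) := by
    gcongr; linarith
  have c3 : 0 ≤ F * Q ^ 2 * B ^ 2 * η := by positivity
  have c4 : 0 ≤ F * Q ^ 2 * B ^ 2 * ‖u - v‖ ^ 2 := by positivity
  have c5 : 0 ≤ B ^ 2 * η := by positivity
  have c6 : 0 ≤ B ^ 2 * ‖u - v‖ ^ 2 := by positivity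
  have c7 : 0 ≤ F * Q ^ 2 := by positivity
  have c8 : 0 ≤ D.β * (F * Q ^ 2) := by positivity
  have tot : D.form k u (D.A k u (yy - zz)) δ - D.form k u ((D.A k v - D.A k u) zz) δ ≤
      (4 * D.β + F) * D.form k u δ δ +
      (4 * F * Q ^ 2 * (1 + 2 * D.β)) * (B ^ 2 * η) +
      (F ^ 2 * Q ^ 2) * (B ^ 2 * ‖u - v‖ ^ 2) := by nlinarith
  have e7 : D.form k u (D.A k u (yy - zz) - (D.A k v - D.A k u) zz) δ =
      D.form k u (D.A k u (yy - zz)) δ - D.form k u ((D.A k v - D.A k u) zz) δ := by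
    rw [(D.form k u).map_sub]; rfl
  rw [e7]
  refine tot.trans ?_
  have p1 : 0 ≤ F ^ 2 * Q ^ 2 := by positivity
  have p2 : 0 ≤ 4 * F * Q ^ 2 * (1 + 2 * D.β) := by positivity
  have p3 : 0 ≤ 4 * D.β + F := by positivity
  set Kt := 4 * D.β + F + 4 * F * Q ^ 2 * (1 + 2 * D.β) + F ^ 2 * Q ^ 2 with hKt
  have q1 := mul_le_mul_of_nonneg_right (show 4 * D.β + F ≤ Kt by linarith) c1
  have q2 := mul_le_mul_of_nonneg_right
    (show 4 * F * Q ^ 2 * (1 + 2 * D.β) ≤ Kt by linarith) c5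
  have q3 := mul_le_mul_of_nonneg_right (show F ^ 2 * Q ^ 2 ≤ Kt by linarith) c6
  calc _ ≤ Kt * D.form k u δ δ + Kt * (B ^ 2 * η) + Kt * (B ^ 2 * ‖u - v‖ ^ 2) := by
        linarith
    _ = _ := by ring

theorem exists_yosida_solution {k : ℕ} (hk : k ≤ D.N) {T M : ℝ} (hT : 0 ≤ T) {u u' : ℝ → Z}
    (hu : IsPath D T M u u') {c : ℝ} (hc : D.lam₀ ≤ c) (x : X k) {f : ℝ → X k}
    (hf : ContinuousOn f (Icc 0 T)) :
    ∃ y : ℝ → X k, y 0 = x ∧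
      ∀ t ∈ Icc 0 T, HasDerivWithinAt y (D.Y c k (u t) (y t) + f t) (Icc 0 T) t := by
  obtain ⟨K, hK⟩ := norm_Y_le hk hc (D := D)
  obtain ⟨K', hK'0, hK'⟩ := Y_lipschitz hk hc (D := D)
  refine exists_global_solution (K := K) hT (fun t y => D.Y c k (u t) y + f t) (fun x => ?_)
    (fun t ht x y => ?_) x
  · have h1 : ContinuousOn (fun t => D.Y c k (u t)) (Icc 0 T) := by
      have h2 : LipschitzOnWith K'.toNNReal (D.Y c k) D.O :=
        LipschitzOnWith.of_dist_le_mul fun a ha b hb => by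
          rw [dist_eq_norm, dist_eq_norm, Real.coe_toNNReal _ hK'0]; exact hK' a ha b hb
      exact h2.continuousOn.comp hu.continuousOn hu.mem
    exact (h1.clm_apply continuousOn_const).add hf
  · rw [add_sub_add_right_eq_sub, ← map_sub]
    exact (ContinuousLinearMap.le_opNorm _ _).trans (by gcongr; exact hK _ (hu.mem t ht))

end DissipativeFamily

namespace DissipativeFamily

variable {X : ℕ → Type u} [∀ r, NormedAddCommGroup (X r)] [∀ r, InnerProductSpace ℝ (X r)]
  {S : HilbertScale X} {Z : Type*} [NormedAddCommGroup Z] [NormedSpace ℝ Z]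
  {D : DissipativeFamily S Z}

/-! #### Limits of Yosida approximations -/

/-- Paths `u j` of bounded speed converging uniformly to `v`, with Yosida parameters `c j → ∞`. -/
structure IsApprox (D : DissipativeFamily S Z) (T M : ℝ) (c : ℕ → ℝ) (u u' : ℕ → ℝ → Z)
    (v : ℝ → Z) : Prop where
  T_nonneg : 0 ≤ T
  M_nonneg : 0 ≤ M
  le : ∀ j, D.lam₀ ≤ c j
  tendsto : Tendsto c atTop atTop
  path : ∀ j, IsPath D T M (u j) (u' j)
  unif : TendstoUniformlyOn u v atTop (Icc 0 T)
  mem : ∀ t ∈ Icc 0 T, v t ∈ D.O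

theorem IsApprox.continuousOn {T M : ℝ} {c : ℕ → ℝ} {u u' : ℕ → ℝ → Z} {v : ℝ → Z}
    (h : IsApprox D T M c u u' v) : ContinuousOn v (Icc 0 T) :=
  h.unif.continuousOn (Eventually.of_forall fun j => (h.path j).continuousOn).frequently

variable [∀ r, CompleteSpace (X r)]

theorem yosida_estimate {k : ℕ} (hk : k ≤ D.N) {M ℓ : ℝ} (hM : 0 ≤ M) (hℓ : 0 ≤ ℓ) (T : ℝ) :
    ∃ C, 1 ≤ C ∧ ∀ (c : ℝ) (u u' : ℝ → Z), D.lam₀ ≤ c → IsPath D T M u u' →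
    ∀ (y n f : ℝ → X k) (G g : ℝ → ℝ),
    (∀ t ∈ Icc 0 T, HasDerivWithinAt y (D.Y c k (u t) (y t) + n t + f t) (Icc 0 T) t) →
    (∀ t ∈ Icc 0 T, ‖n t‖ ≤ ℓ * ‖y t‖) →
    (∀ t ∈ Icc 0 T, HasDerivWithinAt G (g t) (Icc 0 T) t) →
    (∀ t ∈ Icc 0 T, ‖f t‖ ≤ g t) → ∀ t ∈ Icc 0 T,
    ‖y t‖ ≤ C * (‖y 0‖ + (G t - G 0)) := by
  obtain ⟨C₀, h1, h⟩ := energy_estimate hk (D := D)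
  obtain ⟨K, hK1, hK, hl⟩ := form_bound hk
  have hβ := D.β_nonneg
  have hK0 : 0 ≤ K := by linarith
  refine ⟨C₀ * Real.exp (C₀ * (1 + M + (2 * D.β + K * ℓ * K)) * |T|), ?_,
    fun c u u' hc hu y n f G g hy hn hG hf t ht => ?_⟩
  · have : 1 ≤ Real.exp (C₀ * (1 + M + (2 * D.β + K * ℓ * K)) * |T|) :=
      Real.one_le_exp (by positivity)
    nlinarith
  refine (h M (2 * D.β + K * ℓ * K) T u u' hM (by positivity) hu y
    (fun t => D.Y c k (u t) (y t) + n t) f G g hy (fun t ht => ?_) hG hf t ht).trans ?_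
  · have hm := hu.mem t ht
    rw [map_add, add_apply, add_mul]
    refine add_le_add (form_Y_le hk hm hc _) ((form_apply_le hK hm _ _).trans ?_)
    calc K * ‖n t‖ * ‖y t‖ ≤ K * (ℓ * ‖y t‖) * ‖y t‖ := by gcongr; exact hn t ht
      _ = K * ℓ * ‖y t‖ ^ 2 := by ring
      _ ≤ K * ℓ * (K * D.form k (u t) (y t) (y t)) := by gcongr; exact hl _ hm _
      _ = _ := by ring
  · have hGm : 0 ≤ G t - G 0 := by
      have := le_of_hasDerivWithinAt_nonpos (h := fun t => -G t) (h' := fun t => -g t)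
        (fun t ht => (hG t ht).neg)
        (fun t ht => by have := (norm_nonneg _).trans (hf t ht); linarith) ht
      linarith
    gcongr
    exact ht.2.trans (le_abs_self T)

theorem yosida_unique {k : ℕ} (hk : k ≤ D.N) {T M c : ℝ} {u u' : ℝ → Z} (hM : 0 ≤ M)
    (hu : IsPath D T M u u') (hc : D.lam₀ ≤ c) {y z f : ℝ → X k} (h0 : y 0 = z 0)
    (hy : ∀ t ∈ Icc 0 T, HasDerivWithinAt y (D.Y c k (u t) (y t) + f t) (Icc 0 T) t)
    (hz : ∀ t ∈ Icc 0 T, HasDerivWithinAt z (D.Y c k (u t) (z t) + f t) (Icc 0 T) t) :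
    ∀ t ∈ Icc 0 T, y t = z t := fun t ht => by
  obtain ⟨C, -, h⟩ := yosida_estimate hk hM le_rfl T (D := D)
  have := h c u u' hc hu (fun t => y t - z t) (fun _ => 0) (fun _ => 0) (fun _ => 0) (fun _ => 0)
    (fun t ht => ((hy t ht).sub (hz t ht)).congr_deriv (by rw [map_sub]; abel))
    (fun t _ => by simp) (fun t ht => hasDerivWithinAt_const t _ _) (fun t _ => by simp) t ht
  simp only [h0, sub_self, norm_zero, add_zero, mul_zero] at this
  exact sub_eq_zero.1 (norm_le_zero_iff.1 this)

theorem yosida_cauchy_of_lift {k : ℕ} (hk : k < D.N) {T M : ℝ} {c : ℕ → ℝ} {u u' : ℕ → ℝ → Z}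
    {v : ℝ → Z} (h : IsApprox D T M c u u' v) (x : X (k + 1)) {f : ℝ → X (k + 1)}
    (hf : ContinuousOn f (Icc 0 T)) {y : ℕ → ℝ → X k} (h0 : ∀ j, y j 0 = S.dn k x)
    (hy : ∀ j, ∀ t ∈ Icc 0 T,
      HasDerivWithinAt (y j) (D.Y (c j) k (u j t) (y j t) + S.dn k (f t)) (Icc 0 T) t) :
    UniformCauchySeqOn y atTop (Icc 0 T) := by
  choose z hz0 hz using fun j => exists_yosida_solution (Nat.succ_le_of_lt hk) h.T_nonneg
    (h.path j) (h.le j) x hf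
  have hyz : ∀ j, ∀ t ∈ Icc 0 T, y j t = S.dn k (z j t) := fun j => by
    refine yosida_unique hk.le h.M_nonneg (h.path j) (h.le j) (by rw [h0, hz0]) (hy j) ?_
    intro t ht
    refine ((S.dn k).hasFDerivAt.comp_hasDerivWithinAt t (hz j t ht)).congr_deriv ?_
    rw [map_add, dn_Y hk ((h.path j).mem t ht) (β_lt (h.le j))]
  obtain ⟨F, hF⟩ := isCompact_Icc.exists_bound_of_continuousOn hf
  obtain ⟨C, hC1, hC⟩ := yosida_estimate (Nat.succ_le_of_lt hk) h.M_nonneg le_rfl T (D := D)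
  obtain ⟨B, hB⟩ : ∃ B, ∀ j, ∀ t ∈ Icc 0 T, ‖z j t‖ ≤ B := by
    refine ⟨C * (‖x‖ + |F| * T), fun j t ht => ?_⟩
    have := hC (c j) (u j) (u' j) (h.le j) (h.path j) (z j) (fun _ => 0) f (fun t => F * t)
      (fun _ => F) (fun t ht => (hz j t ht).congr_deriv (by simp))
      (fun t _ => by simp) (fun t ht => by simpa using (hasDerivWithinAt_id t _).const_mul F)
      hF t ht
    rw [hz0] at this
    refine this.trans ?_
    have h1 : F * t ≤ |F| * T := mul_le_mul (le_abs_self F) ht.2 ht.1 (abs_nonneg _)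
    have : 0 ≤ C := by linarith
    gcongr
    linarith
  obtain ⟨K, hK0, hK⟩ := komura_estimate hk (D := D)
  obtain ⟨Fk, hF1, hFk, hl⟩ := form_bound hk.le
  have hT := h.T_nonneg
  have hM := h.M_nonneg
  set K₁ := Fk * M * Fk + 2 * K with hK₁
  set K₂ := Fk * (Real.exp (K₁ * T) * (2 * K * B ^ 2 * T)) with hK₂
  have hK₂0 : 0 ≤ K₂ := by positivity
  have key : ∀ i j, ∀ η, (∀ t ∈ Icc 0 T, (c i)⁻¹ + (c j)⁻¹ + ‖u i t - u j t‖ ^ 2 ≤ η) →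
      ∀ t ∈ Icc 0 T, ‖y i t - y j t‖ ^ 2 ≤ K₂ * η := by
    intro i j η hη t ht
    have hci := lam_pos (h.le i)
    have hcj := lam_pos (h.le j)
    have hη0 : 0 ≤ η := le_trans (by positivity) (hη t ht)
    have h00 : (0 : ℝ) ∈ Icc 0 T := ⟨le_rfl, hT⟩
    have := gronwall_const (K := K₁) (η := 2 * K * B ^ 2 * η) (by positivity) (by positivity)
      (fun t ht => form_hasDerivWithinAt hk.le (h.path i) (y := fun t => y i t - y j t)
        (y' := fun t => (D.Y (c i) k (u i t) (y i t) + S.dn k (f t)) -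
          (D.Y (c j) k (u j t) (y j t) + S.dn k (f t))) ht ((hy i t ht).sub (hy j t ht)))
      (fun t ht => by
        have hm := (h.path i).mem t ht
        have k1 := hK _ hm _ ((h.path j).mem t ht) _ _ (h.le i) (h.le j) B (z i t) (z j t)
          (hB i t ht) (hB j t ht)
        rw [← hyz i t ht, ← hyz j t ht] at k1
        rw [add_sub_add_right_eq_sub]
        set δ := y i t - y j t
        have k2 : K * B ^ 2 * ((c i)⁻¹ + (c j)⁻¹ + ‖u i t - u j t‖ ^ 2) ≤ K * B ^ 2 * η :=
          mul_le_mul_of_nonneg_left (hη t ht) (by positivity)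
        have e1 : fderiv ℝ (D.form k) (u i t) (u' i t) δ δ ≤
            Fk * M * (Fk * D.form k (u i t) δ δ) := by
          refine (le_abs_self _).trans
            (((fderiv ℝ (D.form k) (u i t) (u' i t)).le_opNorm₂ δ δ).trans ?_)
          rw [mul_assoc, ← sq]
          exact mul_le_mul ((ContinuousLinearMap.le_opNorm _ _).trans
            (mul_le_mul (hFk.2 _ hm).2 ((h.path i).bound t ht) (norm_nonneg _) (by linarith)))
            (hl _ hm _) (sq_nonneg _) (by positivity)
        rw [hK₁]
        nlinarith) ht
    simp only [h0, sub_self, map_zero, zero_add] at this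
    have h2 := hl _ ((h.path i).mem t ht) (y i t - y j t)
    calc _ ≤ Fk * (Real.exp (K₁ * t) * (2 * K * B ^ 2 * η * t)) :=
          h2.trans (mul_le_mul_of_nonneg_left this (by linarith))
      _ ≤ Fk * (Real.exp (K₁ * T) * (2 * K * B ^ 2 * η * T)) := by
          have : 0 ≤ K₁ := by positivity
          have := ht.1
          gcongr
          · exact ht.2
          · exact ht.2
      _ = _ := by rw [hK₂]; ring
  rw [Metric.uniformCauchySeqOn_iff]
  intro ε hε
  set η := ε ^ 2 / (2 * (K₂ + 1)) with hη
  have hη0 : 0 < η := by positivity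
  have hci : Tendsto (fun j => (c j)⁻¹) atTop (𝓝 0) := tendsto_inv_atTop_zero.comp h.tendsto
  obtain ⟨N₁, hN₁⟩ := eventually_atTop.1 (hci.eventually (gt_mem_nhds (show 0 < η / 3 by positivity)))
  obtain ⟨N₂, hN₂⟩ := (Metric.uniformCauchySeqOn_iff.1 h.unif.uniformCauchySeqOn) (√(η / 3))
    (by positivity)
  refine ⟨max N₁ N₂, fun i hi j hj t ht => ?_⟩
  have := key i j η (fun t ht => by
    have h1 := hN₁ i ((le_max_left _ _).trans hi)
    have h2 := hN₁ j ((le_max_left _ _).trans hj)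
    have h3 := hN₂ i ((le_max_right _ _).trans hi) j ((le_max_right _ _).trans hj) t ht
    rw [dist_eq_norm] at h3
    have h4 : ‖u i t - u j t‖ ^ 2 ≤ η / 3 := by
      rw [← Real.sq_sqrt (show 0 ≤ η / 3 by positivity)]
      exact pow_le_pow_left₀ (norm_nonneg _) h3.le 2
    linarith) t ht
  rw [dist_eq_norm]
  have h5 : K₂ * η < ε ^ 2 := by
    rw [hη, mul_div_assoc', div_lt_iff₀ (by positivity)]
    nlinarith [sq_nonneg ε, mul_nonneg hK₂0 (sq_nonneg ε), pow_pos hε 2]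
  exact lt_of_pow_lt_pow_left₀ 2 hε.le (this.trans_lt h5)

theorem yosida_cauchy {k : ℕ} (hk : k < D.N) {T M : ℝ} {c : ℕ → ℝ} {u u' : ℕ → ℝ → Z}
    {v : ℝ → Z} (h : IsApprox D T M c u u' v) (x : X k) {f : ℝ → X k}
    (hf : ContinuousOn f (Icc 0 T)) {y : ℕ → ℝ → X k} (h0 : ∀ j, y j 0 = x)
    (hy : ∀ j, ∀ t ∈ Icc 0 T,
      HasDerivWithinAt (y j) (D.Y (c j) k (u j t) (y j t) + f t) (Icc 0 T) t) :
    UniformCauchySeqOn y atTop (Icc 0 T) := by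
  have hT := h.T_nonneg
  have h00 : (0 : ℝ) ∈ Icc 0 T := ⟨le_rfl, hT⟩
  obtain ⟨C, hC1, hC⟩ := yosida_estimate hk.le h.M_nonneg le_rfl T (D := D)
  set w := v 0
  have hw : w ∈ D.O := h.mem 0 h00
  have hJf : TendstoUniformlyOn (fun i t => D.J (c i) k w (f t)) f atTop (Icc 0 T) :=
    tendstoUniformlyOn_of_tendsto_prod isCompact_Icc hf fun t ht => by
      refine J_tendsto hk.le (h.tendsto.comp tendsto_fst) hw tendsto_const_nhds ?_
      exact (hf t ht).tendsto.comp tendsto_snd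
  have hJx : Tendsto (fun i => D.J (c i) k w x) atTop (𝓝 x) :=
    J_tendsto hk.le h.tendsto hw tendsto_const_nhds tendsto_const_nhds
  rw [Metric.uniformCauchySeqOn_iff]
  intro ε hε
  set η := ε / (4 * C * (1 + T)) with hη
  have hη0 : 0 < η := by positivity
  obtain ⟨i, hi1, hi2⟩ := ((Metric.tendstoUniformlyOn_iff.1 hJf η hη0).and
    (Metric.tendsto_nhds.1 hJx η hη0)).exists
  have hβi := β_lt (h.le i)
  have hfi : ContinuousOn (fun t => c i • D.R (c i) k w (f t)) (Icc 0 T) :=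
    (((D.R (c i) k w).continuous.comp_continuousOn hf)).const_smul _
  have hdn : ∀ z : X k, S.dn k (c i • D.R (c i) k w z) = D.J (c i) k w z := fun z =>
    (J_eq_dn_R hk hw hβi z).symm
  have hJc : ContinuousOn (fun t => D.J (c i) k w (f t)) (Icc 0 T) :=
    (D.J (c i) k w).continuous.comp_continuousOn hf
  choose z hz0 hz using fun j => exists_yosida_solution hk.le hT
    (h.path j) (h.le j) (D.J (c i) k w x) hJc
  have hcau := yosida_cauchy_of_lift hk h (c i • D.R (c i) k w x) hfi (y := z)
    (fun j => by rw [hz0, hdn]) (fun j t ht => by simpa only [hdn] using hz j t ht)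
  obtain ⟨N, hN⟩ := Metric.uniformCauchySeqOn_iff.1 hcau (ε / 2) (by positivity)
  have hclose : ∀ j, ∀ t ∈ Icc 0 T, ‖y j t - z j t‖ ≤ ε / 4 := fun j t ht => by
    have := hC (c j) (u j) (u' j) (h.le j) (h.path j) (fun t => y j t - z j t) (fun _ => 0)
      (fun t => f t - D.J (c i) k w (f t)) (fun t => η * t) (fun _ => η)
      (fun t ht => ((hy j t ht).sub (hz j t ht)).congr_deriv (by rw [map_sub]; abel))
      (fun t _ => by simp) (fun t ht => by simpa using (hasDerivWithinAt_id t _).const_mul η)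
      (fun t ht => by rw [← dist_eq_norm]; exact (hi1 t ht).le) t ht
    simp only [h0, hz0] at this
    have h2 : ‖x - D.J (c i) k w x‖ ≤ η := by rw [← dist_eq_norm, dist_comm]; exact hi2.le
    calc _ ≤ C * (‖x - D.J (c i) k w x‖ + (η * t - η * 0)) := this
      _ ≤ C * (η + η * T) := by
          have : η * t ≤ η * T := mul_le_mul_of_nonneg_left ht.2 hη0.le
          have : 0 ≤ C := by linarith
          gcongr; linarith
      _ = ε / 4 := by rw [hη]; field_simp
  refine ⟨N, fun a ha b hb t ht => ?_⟩
  have h1 := hN a ha b hb t ht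
  have h2 := hclose a t ht
  have h3 := hclose b t ht
  rw [dist_eq_norm] at h1 ⊢
  have e : y a t - y b t = (y a t - z a t) + (z a t - z b t) - (y b t - z b t) := by abel
  rw [e]
  have h4 := norm_add_le (y a t - z a t) (z a t - z b t)
  have h5 := norm_sub_le (y a t - z a t + (z a t - z b t)) (y b t - z b t)
  linarith

theorem _root_.UniformCauchySeqOn.exists_limit {H : Type*} [NormedAddCommGroup H] [CompleteSpace H]
    {y : ℕ → ℝ → H} {s : Set ℝ} (h : UniformCauchySeqOn y atTop s)
    (hc : ∀ j, ContinuousOn (y j) s) :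
    ∃ g, TendstoUniformlyOn y g atTop s ∧ ContinuousOn g s := by
  have : ∀ t, ∃ z, t ∈ s → Tendsto (fun j => y j t) atTop (𝓝 z) := fun t => by
    by_cases ht : t ∈ s
    · obtain ⟨z, hz⟩ := cauchySeq_tendsto_of_complete (h.cauchySeq ht)
      exact ⟨z, fun _ => hz⟩
    · exact ⟨0, fun h => absurd h ht⟩
  choose g hg using this
  have h1 := h.tendstoUniformlyOn_of_tendsto (fun t ht => hg t ht)
  exact ⟨g, h1, h1.continuousOn (Eventually.of_forall hc).frequently⟩

/-- Semilinear equations: the solutions of the Yosida approximations converge. -/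
theorem semilinear_limit {k : ℕ} (hk : k < D.N) {T M ℓ : ℝ} {c : ℕ → ℝ} {u u' : ℕ → ℝ → Z}
    {v : ℝ → Z} (h : IsApprox D T M c u u' v) (hℓ : 0 ≤ ℓ) {n : ℕ → ℝ → X k → X k}
    {n₀ : ℝ → X k → X k}
    (hL : ∀ j, ∀ t ∈ Icc 0 T, ∀ x y, ‖n j t x - n j t y‖ ≤ ℓ * ‖x - y‖)
    (hc : ∀ p, ContinuousOn p (Icc 0 T) → ContinuousOn (fun t => n₀ t (p t)) (Icc 0 T))
    (hlim : ∀ p, ContinuousOn p (Icc 0 T) →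
      TendstoUniformlyOn (fun j t => n j t (p t)) (fun t => n₀ t (p t)) atTop (Icc 0 T))
    {y : ℕ → ℝ → X k} {x : X k} (h0 : Tendsto (fun j => y j 0) atTop (𝓝 x))
    (hy : ∀ j, ∀ t ∈ Icc 0 T,
      HasDerivWithinAt (y j) (D.Y (c j) k (u j t) (y j t) + n j t (y j t)) (Icc 0 T) t) :
    ∃ p, ContinuousOn p (Icc 0 T) ∧ TendstoUniformlyOn y p atTop (Icc 0 T) := by
  have hT := h.T_nonneg
  have h00 : (0 : ℝ) ∈ Icc 0 T := ⟨le_rfl, hT⟩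
  obtain ⟨C, hC1, hC⟩ := yosida_estimate hk.le h.M_nonneg hℓ T (D := D)
  have hC0 : 0 ≤ C := by linarith
  have hL₀ : ∀ t ∈ Icc 0 T, ∀ x y, ‖n₀ t x - n₀ t y‖ ≤ ℓ * ‖x - y‖ := fun t ht x y => by
    have h1 := (hlim (fun _ => x) continuousOn_const).tendsto_at ht
    have h2 := (hlim (fun _ => y) continuousOn_const).tendsto_at ht
    exact le_of_tendsto (h1.sub h2).norm (Eventually.of_forall fun j => hL j t ht x y)
  have hsol : ∀ f : ℝ → X k, ContinuousOn f (Icc 0 T) → ∃ (z : ℕ → ℝ → X k) (g : ℝ → X k),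
      (∀ j, z j 0 = x) ∧ (∀ j, ∀ t ∈ Icc 0 T, HasDerivWithinAt (z j)
        (D.Y (c j) k (u j t) (z j t) + n₀ t (f t)) (Icc 0 T) t) ∧
      TendstoUniformlyOn z g atTop (Icc 0 T) ∧ ContinuousOn g (Icc 0 T) := fun f hf => by
    choose z hz0 hz using fun j => exists_yosida_solution hk.le hT (h.path j) (h.le j) x (hc f hf)
    obtain ⟨g, hg⟩ := (yosida_cauchy hk h x (hc f hf) hz0 hz).exists_limit
      (fun j t ht => (hz j t ht).continuousWithinAt)
    exact ⟨z, g, hz0, hz, hg⟩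
  choose! z Φ hz0 hz hzΦ hΦc using hsol
  set κ := 2 * (C * ℓ) + 1 with hκ
  have hκ0 : 0 < κ := by positivity
  obtain ⟨p, hpc, hp⟩ := exists_fixedPoint_of_weighted_contraction (κ := κ) hT Φ hΦc
    (fun f g hf hg d hd hfg t ht => by
      have hlim := ((hzΦ f hf).tendsto_at ht).sub ((hzΦ g hg).tendsto_at ht)
      refine le_of_tendsto hlim.norm (Eventually.of_forall fun j => ?_)
      have := hC (c j) (u j) (u' j) (h.le j) (h.path j) (fun t => z f j t - z g j t) (fun _ => 0)
        (fun t => n₀ t (f t) - n₀ t (g t)) (fun t => ℓ * d / κ * Real.exp (κ * t))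
        (fun t => ℓ * (d * Real.exp (κ * t)))
        (fun t ht => ((hz f hf j t ht).sub (hz g hg j t ht)).congr_deriv (by rw [map_sub]; abel))
        (fun t _ => by simp only [norm_zero]; positivity)
        (fun t ht => by
          have := (((hasDerivAt_id t).const_mul κ).exp.const_mul (ℓ * d / κ)).hasDerivWithinAt
            (s := Icc 0 T)
          refine this.congr_deriv ?_
          simp only [id]
          field_simp)
        (fun t ht => (hL₀ t ht _ _).trans (mul_le_mul_of_nonneg_left (hfg t ht) hℓ)) t ht
      refine this.trans ?_
      simp only [hz0 f hf, hz0 g hg, sub_self, norm_zero, zero_add, mul_zero, Real.exp_zero, mul_one]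
      have hE := Real.exp_pos (κ * t)
      have h1 : C * ℓ / κ ≤ 1 / 2 := by
        rw [div_le_div_iff₀ hκ0 (by norm_num)]; linarith
      calc C * (ℓ * d / κ * Real.exp (κ * t) - ℓ * d / κ) ≤ C * (ℓ * d / κ * Real.exp (κ * t)) := by
            gcongr
            have : 0 ≤ ℓ * d / κ := by positivity
            linarith
        _ = C * ℓ / κ * (d * Real.exp (κ * t)) := by ring
        _ ≤ 1 / 2 * (d * Real.exp (κ * t)) := by gcongr
        _ = _ := by ring)
  refine ⟨p, hpc, ?_⟩
  have hzp : TendstoUniformlyOn (z p) p atTop (Icc 0 T) := (hzΦ p hpc).congr_right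
    fun t ht => (hp t ht).symm
  rw [Metric.tendstoUniformlyOn_iff] at hzp ⊢
  have hnp := Metric.tendstoUniformlyOn_iff.1 (hlim p hpc)
  intro ε hε
  set η := ε / (2 * (1 + C * (1 + (ℓ + 1) * T))) with hη
  have hη0 : 0 < η := by positivity
  filter_upwards [hzp η hη0, hnp η hη0, Metric.tendsto_nhds.1 h0 η hη0] with j h1 h2 h3 t ht
  have := hC (c j) (u j) (u' j) (h.le j) (h.path j) (fun t => y j t - z p j t)
    (fun t => n j t (y j t) - n j t (z p j t)) (fun t => n j t (z p j t) - n₀ t (p t))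
    (fun t => (ℓ + 1) * η * t) (fun t => (ℓ + 1) * η)
    (fun t ht => ((hy j t ht).sub (hz p hpc j t ht)).congr_deriv (by rw [map_sub]; abel))
    (fun t ht => hL j t ht _ _) (fun t ht => by
      simpa using (hasDerivWithinAt_id t _).const_mul ((ℓ + 1) * η))
    (fun t ht => by
      have e : n j t (z p j t) - n₀ t (p t) =
        (n j t (z p j t) - n j t (p t)) + (n j t (p t) - n₀ t (p t)) := by abel
      rw [e]
      refine (norm_add_le _ _).trans ?_
      have a1 := hL j t ht (z p j t) (p t)
      have a2 := h1 t ht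
      have a3 := h2 t ht
      rw [dist_comm, dist_eq_norm] at a2 a3
      have a4 : ℓ * ‖z p j t - p t‖ ≤ ℓ * η := mul_le_mul_of_nonneg_left a2.le hℓ
      linarith) t ht
  rw [hz0 p hpc] at this
  have a2 := h1 t ht
  rw [dist_comm, dist_eq_norm] at a2 ⊢
  rw [dist_eq_norm] at h3
  have e : y j t - p t = (y j t - z p j t) + (z p j t - p t) := by abel
  rw [e]
  refine (norm_add_le _ _).trans_lt ?_
  have a5 : C * (‖y j 0 - x‖ + ((ℓ + 1) * η * t - (ℓ + 1) * η * 0)) ≤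
      C * (η + (ℓ + 1) * η * T) := by
    have : (ℓ + 1) * η * t ≤ (ℓ + 1) * η * T := mul_le_mul_of_nonneg_left ht.2 (by positivity)
    gcongr; linarith
  have a6 : (1 + C * (1 + (ℓ + 1) * T)) * η = ε / 2 := by rw [hη]; field_simp
  nlinarith

/-- If solutions of Yosida approximations converge uniformly in `X (k + 1)`, the limit solves the
equation in `X k`. -/
theorem limit_hasDerivWithinAt {k : ℕ} (hk : k < D.N) {T M : ℝ} {c : ℕ → ℝ} {u u' : ℕ → ℝ → Z}
    {v : ℝ → Z} (h : IsApprox D T M c u u' v) {y : ℕ → ℝ → X (k + 1)} {p : ℝ → X (k + 1)}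
    (hp : ContinuousOn p (Icc 0 T)) (hyp : TendstoUniformlyOn y p atTop (Icc 0 T))
    {f : ℝ → X (k + 1)} (hf : ContinuousOn f (Icc 0 T)) (hy : ∀ j, ∀ t ∈ Icc 0 T,
      HasDerivWithinAt (y j) (D.Y (c j) (k + 1) (u j t) (y j t) + f t) (Icc 0 T) t) :
    ∀ t ∈ Icc 0 T, HasDerivWithinAt (fun t => S.dn k (p t))
      (D.A k (v t) (p t) + S.dn k (f t)) (Icc 0 T) t := by
  have hv := h.continuousOn
  have hc : ContinuousOn (fun t => D.A k (v t) (p t) + S.dn k (f t)) (Icc 0 T) := by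
    refine ContinuousOn.add (fun t ht => A_tendsto hk (h.mem t ht) (hv t ht) (hp t ht)) ?_
    exact (S.dn k).continuous.comp_continuousOn hf
  refine hasDerivWithinAt_of_tendstoUniformlyOn (l := atTop) (F := fun j t => S.dn k (y j t))
    (F' := fun j t => D.A k (u j t) (D.J (c j) (k + 1) (u j t) (y j t)) + S.dn k (f t))
    (Eventually.of_forall fun j t ht => ?_) (fun t ht => ?_) ?_ hc
  · refine ((S.dn k).hasFDerivAt.comp_hasDerivWithinAt t (hy j t ht)).congr_deriv ?_
    rw [map_add, A_J_eq_Y hk ((h.path j).mem t ht) (β_lt (h.le j)),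
      dn_Y hk ((h.path j).mem t ht) (β_lt (h.le j))]
  · exact ((S.dn k).continuous.tendsto _).comp (hyp.tendsto_at ht)
  · refine tendstoUniformlyOn_of_tendsto_prod isCompact_Icc hc fun t ht => ?_
    have hut := h.unif.tendsto_prod hv ht
    have hyt := hyp.tendsto_prod hp ht
    refine (A_tendsto hk (h.mem t ht) hut (J_tendsto (Nat.succ_le_of_lt hk)
      (h.tendsto.comp tendsto_fst) (h.mem t ht) hut hyt)).add ?_
    exact ((S.dn k).continuous.tendsto _).comp ((hf t ht).tendsto.comp tendsto_snd)

theorem _root_.tendstoUniformlyOn_const_index {ι H : Type*} [PseudoMetricSpace H] {l : Filter ι}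
    {s : Set ℝ} (g : ℝ → H) : TendstoUniformlyOn (fun _ : ι => g) g l s :=
  Metric.tendstoUniformlyOn_iff.2 fun ε hε => Eventually.of_forall fun _ t _ => by
    rwa [dist_self]

/-- Linear equations have solutions in `X (k + 1)`. -/
theorem exists_linear_solution {k : ℕ} (hk : k < D.N) {M : ℝ} (hM : 0 ≤ M) {T : ℝ} (hT : 0 ≤ T) :
    ∃ C, 1 ≤ C ∧ ∀ u u' : ℝ → Z, IsPath D T M u u' → ContinuousOn u' (Icc 0 T) →
    ∀ (x : X (k + 1)) (f : ℝ → X (k + 1)), ContinuousOn f (Icc 0 T) →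
    ∃ y : ℝ → X (k + 1), y 0 = x ∧ ContinuousOn y (Icc 0 T) ∧
      (∀ t ∈ Icc 0 T, HasDerivWithinAt (fun t => S.dn k (y t))
        (D.A k (u t) (y t) + S.dn k (f t)) (Icc 0 T) t) ∧
      ∀ (G g : ℝ → ℝ), (∀ t ∈ Icc 0 T, HasDerivWithinAt G (g t) (Icc 0 T) t) →
        (∀ t ∈ Icc 0 T, ‖f t‖ ≤ g t) → ∀ t ∈ Icc 0 T, ‖y t‖ ≤ C * (‖x‖ + (G t - G 0)) := by
  obtain ⟨C, hC1, hC⟩ := yosida_estimate (Nat.succ_le_of_lt hk) hM le_rfl T (D := D)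
  refine ⟨C, hC1, fun u u' hu hu' x f hf => ?_⟩
  have h00 : (0 : ℝ) ∈ Icc 0 T := ⟨le_rfl, hT⟩
  have h : IsApprox D T M (fun j : ℕ => D.lam₀ + j) (fun _ => u) (fun _ => u') u :=
    ⟨hT, hM, fun j => by simp, tendsto_atTop_add_const_left _ _ tendsto_natCast_atTop_atTop,
      fun _ => hu, tendstoUniformlyOn_const_index u, hu.mem⟩
  choose y hy0 hy using fun j => exists_yosida_solution (Nat.succ_le_of_lt hk) hT hu (h.le j) x hf
  obtain ⟨K, hK⟩ := T_bound hk D.ω (D := D)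
  have hTd : ContinuousOn (fun t => fderiv ℝ (D.T D.ω k) (u t) (u' t)) (Icc 0 T) :=
    (((hK.1.continuousOn_fderiv_of_isOpen D.isOpen le_rfl).comp hu.continuousOn
      hu.mem).clm_apply hu')
  have hTdn : ∀ t ∈ Icc 0 T, ‖fderiv ℝ (D.T D.ω k) (u t) (u' t)‖ ≤ K * M := fun t ht =>
    (ContinuousLinearMap.le_opNorm _ _).trans (mul_le_mul (hK.2 _ (hu.mem t ht)).2 (hu.bound t ht)
      (norm_nonneg _) ((norm_nonneg _).trans (hK.2 _ (hu.mem t ht)).2))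
  have hC0 : 0 ≤ D.C := zero_le_one.trans D.one_le_C
  have hKM : 0 ≤ K * M := (norm_nonneg _).trans (hTdn 0 h00)
  have hRc : ∀ p : ℝ → X k, ContinuousOn p (Icc 0 T) →
      ContinuousOn (fun t => D.R D.ω k (u t) (p t)) (Icc 0 T) := fun p hp t ht =>
    R_tendsto hk (hu.mem t ht) (hu.continuousOn t ht) (hp t ht)
  set n : ℝ → X k → X k := fun t z =>
    fderiv ℝ (D.T D.ω k) (u t) (u' t) (D.R D.ω k (u t) z) + D.T D.ω k (u t) (f t) with hn
  obtain ⟨p, hpc, hp⟩ := semilinear_limit hk h (ℓ := K * M * D.C) (by positivity)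
    (n := fun _ => n) (n₀ := n) (y := fun j t => D.T D.ω k (u t) (y j t)) (x := D.T D.ω k (u 0) x)
    (fun j t ht a b => by
      simp only [hn, add_sub_add_right_eq_sub, ← map_sub]
      refine (ContinuousLinearMap.le_opNorm _ _).trans ?_
      rw [mul_assoc]
      exact mul_le_mul (hTdn t ht) ((ContinuousLinearMap.le_opNorm _ _).trans
        (mul_le_mul_of_nonneg_right (norm_R_ω_le hk (hu.mem t ht)) (norm_nonneg _)))
        (norm_nonneg _) hKM)
    (fun p hp => (hTd.clm_apply (hRc p hp)).add fun t ht =>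
      Q_tendsto hk (hu.mem t ht) (hu.continuousOn t ht) (hf t ht))
    (fun p hp => tendstoUniformlyOn_const_index _)
    (by simp only [hy0]; exact tendsto_const_nhds)
    (fun j t ht => by
      have hm := hu.mem t ht
      have h1 := ((hK.hasFDerivAt D.isOpen hm).comp_hasDerivWithinAt t (hu.deriv t ht)).clm_apply
        (hy j t ht)
      refine h1.congr_deriv ?_
      change fderiv ℝ (D.T D.ω k) (u t) (u' t) (y j t) + D.T D.ω k (u t) _ = _
      rw [map_add, Q_Y hk hm (β_lt (h.le j))]
      simp only [hn, R_Q hk hm]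
      abel)
  have hlim : TendstoUniformlyOn y (fun t => D.R D.ω k (u t) (p t)) atTop (Icc 0 T) := by
    refine tendstoUniformlyOn_of_tendsto_prod isCompact_Icc (hRc p hpc) fun t ht => ?_
    have := R_tendsto hk (hu.mem t ht) ((hu.continuousOn t ht).tendsto.comp tendsto_snd)
      (hp.tendsto_prod hpc ht)
    refine this.congr' ?_
    filter_upwards [tendsto_snd.eventually (self_mem_nhdsWithin)] with q hq
    exact R_Q hk (hu.mem _ hq) _
  refine ⟨_, ?_, hRc p hpc, limit_hasDerivWithinAt hk h (hRc p hpc) hlim hf hy, ?_⟩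
  · exact tendsto_nhds_unique (hlim.tendsto_at h00) (by simp only [hy0]; exact tendsto_const_nhds)
  · intro G g hG hg t ht
    refine le_of_tendsto (hlim.tendsto_at ht).norm (Eventually.of_forall fun j => ?_)
    have := hC _ u u' (h.le j) hu (y j) (fun _ => 0) f G g
      (fun t ht => (hy j t ht).congr_deriv (by simp)) (fun t _ => by simp) hG hg t ht
    rwa [hy0] at this

end DissipativeFamily

namespace DissipativeFamily

variable {X : ℕ → Type u} [∀ r, NormedAddCommGroup (X r)] [∀ r, InnerProductSpace ℝ (X r)]
  {S : HilbertScale X} {p : ℕ} {D : DissipativeFamily S (X (p + 1))} {F : X (p + 1) → X p}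

/-! #### The nonlinear equation -/

/-- The nonlinear operator `F` has the derivative `D.A`. -/
structure IsDerivativeOf (D : DissipativeFamily S (X (p + 1))) (F : X (p + 1) → X p) : Prop where
  N_eq : D.N = p + 1
  hasFDerivAt : ∀ u ∈ D.O, HasFDerivAt F (D.A p u) u

/-- The path `v` solves `v' = F(v)`, and `w` is its derivative in `X (p + 1)`. -/
structure IsFlow (D : DissipativeFamily S (X (p + 1))) (F : X (p + 1) → X p) (T : ℝ)
    (v w : ℝ → X (p + 1)) : Prop where
  mem : ∀ t ∈ Icc 0 T, v t ∈ D.O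
  deriv : ∀ t ∈ Icc 0 T, HasDerivWithinAt v (w t) (Icc 0 T) t
  continuousOn : ContinuousOn w (Icc 0 T)
  eq : ∀ t ∈ Icc 0 T, F (v t) = S.dn p (w t)

theorem IsDerivativeOf.lt (hF : IsDerivativeOf D F) : p < D.N := by
  rw [hF.N_eq]; exact Nat.lt_succ_self p

theorem IsDerivativeOf.lipschitz (hF : IsDerivativeOf D F) {u v : X (p + 1)} (hu : u ∈ D.O)
    (hv : v ∈ D.O) : ‖F u - F v‖ ≤ D.C * ‖u - v‖ :=
  D.convex.norm_image_sub_le_of_norm_hasFDerivWithin_le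
    (fun x hx => (hF.hasFDerivAt x hx).hasFDerivWithinAt) (fun _ hx => norm_A_le hF.lt hx) hv hu

theorem IsFlow.isPath {T M : ℝ} {v w : ℝ → X (p + 1)} (h : IsFlow D F T v w)
    (hM : ∀ t ∈ Icc 0 T, ‖w t‖ ≤ M) : IsPath D T M v w := ⟨h.mem, h.deriv, hM⟩

/-- Comparison of two solutions of perturbed equations. -/
theorem pair_estimate (hF : IsDerivativeOf D F) {KB : ℝ}
    (hB : ∀ u ∈ D.O, ∀ v ∈ D.O,
      ‖u - v‖ ≤ KB * ‖(F u - D.ω • S.dn p u) - (F v - D.ω • S.dn p v)‖)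
    {T M K : ℝ} (hT : 0 ≤ T) (hM : 0 ≤ M) (hK : 0 ≤ K) :
    ∃ C, 0 ≤ C ∧ ∀ (u₁ u₁' u₂ : ℝ → X (p + 1)) (δ' r : ℝ → X p) (η : ℝ), 0 ≤ η →
    IsPath D T M u₁ u₁' → (∀ t ∈ Icc 0 T, u₂ t ∈ D.O) →
    (∀ t ∈ Icc 0 T, HasDerivWithinAt (fun t => F (u₁ t) - F (u₂ t)) (δ' t) (Icc 0 T) t) →
    (∀ t ∈ Icc 0 T, HasDerivWithinAt (fun t => S.dn p (u₁ t - u₂ t))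
      (F (u₁ t) - F (u₂ t) + r t) (Icc 0 T) t) →
    (∀ t ∈ Icc 0 T, ‖r t‖ ^ 2 ≤ η) →
    (∀ t ∈ Icc 0 T, D.form p (u₁ t) (δ' t) (F (u₁ t) - F (u₂ t)) ≤
      K * D.form p (u₁ t) (F (u₁ t) - F (u₂ t)) (F (u₁ t) - F (u₂ t)) +
      K * (η + ‖u₁ t - u₂ t‖ ^ 2)) →
    ∀ t ∈ Icc 0 T, ‖u₁ t - u₂ t‖ ^ 2 ≤ C * (‖u₁ 0 - u₂ 0‖ ^ 2 + η) := by
  obtain ⟨Fk, hF1, hFk, hl⟩ := form_bound hF.lt.le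
  have hC := D.one_le_C
  set K₃ := 2 * KB ^ 2 * (Fk + D.ω ^ 2) with hK₃
  have hK₃0 : 0 ≤ K₃ := by positivity
  set K₁ := Fk * M * Fk + 2 * K + 2 * K * K₃ + 2 + Fk with hK₁
  have hK₁0 : 0 ≤ K₁ := by positivity
  refine ⟨K₃ * (Real.exp (K₁ * T) * ((Fk * D.C ^ 2 + 1) + (2 * K + 1) * T)), by positivity,
    fun u₁ u₁' u₂ δ' r η hη h1 h2 hδ he hr hform t ht => ?_⟩
  have h00 : (0 : ℝ) ∈ Icc 0 T := ⟨le_rfl, hT⟩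
  set δ := fun t => F (u₁ t) - F (u₂ t) with hδdef
  set e := fun t => S.dn p (u₁ t - u₂ t) with hedef
  set ψ := fun t => D.form p (u₁ t) (δ t) (δ t) + ‖e t‖ ^ 2 with hψ
  have hu : ∀ t ∈ Icc 0 T, ‖u₁ t - u₂ t‖ ^ 2 ≤ K₃ * ψ t := fun t ht => by
    have a1 := hB _ (h1.mem t ht) _ (h2 t ht)
    have a2 : (F (u₁ t) - D.ω • S.dn p (u₁ t)) - (F (u₂ t) - D.ω • S.dn p (u₂ t)) =
        δ t - D.ω • e t := by
      simp only [hδdef, hedef, map_sub, smul_sub]; abel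
    rw [a2] at a1
    have a3 : ‖δ t - D.ω • e t‖ ^ 2 ≤ 2 * ‖δ t‖ ^ 2 + 2 * D.ω ^ 2 * ‖e t‖ ^ 2 := by
      have b1 := norm_sub_le (δ t) (D.ω • e t)
      rw [norm_smul, Real.norm_eq_abs] at b1
      have b2 := pow_le_pow_left₀ (norm_nonneg _) b1 2
      have b3 := sq_nonneg (‖δ t‖ - |D.ω| * ‖e t‖)
      have b4 : (|D.ω| * ‖e t‖) ^ 2 = D.ω ^ 2 * ‖e t‖ ^ 2 := by rw [mul_pow, sq_abs]
      nlinarith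
    have a4 := hl _ (h1.mem t ht) (δ t)
    have a5 : 0 ≤ D.form p (u₁ t) (δ t) (δ t) := form_nonneg (h1.mem t ht) _
    have a6 := pow_le_pow_left₀ (norm_nonneg _) a1 2
    calc _ ≤ KB ^ 2 * ‖δ t - D.ω • e t‖ ^ 2 := by rw [← mul_pow]; exact a6
      _ ≤ KB ^ 2 * (2 * ((Fk + D.ω ^ 2) * ψ t)) := by
          gcongr
          refine a3.trans ?_
          simp only [hψ]
          nlinarith [mul_nonneg (sq_nonneg D.ω) a5, mul_nonneg (zero_le_one.trans hF1) (sq_nonneg ‖e t‖)]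
      _ = _ := by rw [hK₃]; ring
  have key := gronwall_const (K := K₁) (η := (2 * K + 1) * η) hK₁0 (by positivity) (φ := ψ)
    (fun t ht => (form_hasDerivWithinAt hF.lt.le h1 (y' := δ') ht (hδ t ht)).add (he t ht).norm_sq)
    (fun t ht => by
      have hm := h1.mem t ht
      have e1 : fderiv ℝ (D.form p) (u₁ t) (u₁' t) (δ t) (δ t) ≤
          Fk * M * (Fk * D.form p (u₁ t) (δ t) (δ t)) := by
        refine (le_abs_self _).trans
          (((fderiv ℝ (D.form p) (u₁ t) (u₁' t)).le_opNorm₂ (δ t) (δ t)).trans ?_)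
        rw [mul_assoc, ← sq]
        exact mul_le_mul ((ContinuousLinearMap.le_opNorm _ _).trans
          (mul_le_mul (hFk.2 _ hm).2 (h1.bound t ht) (norm_nonneg _) (by linarith)))
          (hl _ hm _) (sq_nonneg _) (by positivity)
      have e2 := hform t ht
      have e3 : 2 * inner ℝ (e t) (δ t + r t) ≤
          2 * ‖e t‖ ^ 2 + Fk * D.form p (u₁ t) (δ t) (δ t) + η := by
        have c1 := real_inner_le_norm (e t) (δ t + r t)
        have c2 := mul_le_mul_of_nonneg_left (norm_add_le (δ t) (r t)) (norm_nonneg (e t))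
        have c3 := hl _ hm (δ t)
        have c4 := hr t ht
        nlinarith [sq_nonneg (‖e t‖ - ‖δ t‖), sq_nonneg (‖e t‖ - ‖r t‖)]
      have e4 := mul_le_mul_of_nonneg_left (hu t ht) hK
      have e5 : 0 ≤ D.form p (u₁ t) (δ t) (δ t) := form_nonneg hm _
      have e6 : 0 ≤ ‖e t‖ ^ 2 := sq_nonneg _
      have e7 : (Fk * M * Fk + 2 * K + Fk) * D.form p (u₁ t) (δ t) (δ t) + 2 * ‖e t‖ ^ 2 +
          2 * K * K₃ * ψ t ≤ K₁ * ψ t := by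
        have : 0 ≤ (Fk * M * Fk + 2 * K + Fk) * ‖e t‖ ^ 2 := by positivity
        simp only [hψ, hK₁]
        nlinarith
      simp only [hδdef] at e1 e2 e3 e7 ⊢
      nlinarith) ht
  have hψ0 : ψ 0 ≤ (Fk * D.C ^ 2 + 1) * ‖u₁ 0 - u₂ 0‖ ^ 2 := by
    have a1 := hF.lipschitz (h1.mem 0 h00) (h2 0 h00)
    have a2 := pow_le_pow_left₀ (norm_nonneg _) a1 2
    have a3 : D.form p (u₁ 0) (δ 0) (δ 0) ≤ Fk * ‖δ 0‖ ^ 2 := by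
      rw [sq, ← mul_assoc]; exact form_apply_le hFk (h1.mem 0 h00) _ _
    have a4 : ‖e 0‖ ^ 2 ≤ ‖u₁ 0 - u₂ 0‖ ^ 2 :=
      pow_le_pow_left₀ (norm_nonneg _) (S.norm_dn_le _ _) 2
    have a5 : Fk * ‖δ 0‖ ^ 2 ≤ Fk * (D.C * ‖u₁ 0 - u₂ 0‖) ^ 2 := by gcongr
    simp only [hψ]
    nlinarith
  refine (hu t ht).trans ?_
  rw [mul_assoc K₃]
  refine mul_le_mul_of_nonneg_left (key.trans ?_) hK₃0
  have ht0 := ht.1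
  calc Real.exp (K₁ * t) * (ψ 0 + (2 * K + 1) * η * t)
      ≤ Real.exp (K₁ * T) * ((Fk * D.C ^ 2 + 1) * ‖u₁ 0 - u₂ 0‖ ^ 2 + (2 * K + 1) * η * T) := by
        have hψn : 0 ≤ ψ 0 := add_nonneg (form_nonneg (h1.mem 0 h00) _) (sq_nonneg _)
        gcongr
        · exact ht.2
        · exact ht.2
    _ ≤ _ := by
        rw [mul_assoc (Real.exp (K₁ * T))]
        refine mul_le_mul_of_nonneg_left ?_ (Real.exp_pos _).le
        have b1 : 0 ≤ (Fk * D.C ^ 2 + 1) * η := by positivity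
        have b2 : 0 ≤ (2 * K + 1) * T * ‖u₁ 0 - u₂ 0‖ ^ 2 := by positivity
        nlinarith

theorem IsFlow.hasDerivWithinAt_F (hF : IsDerivativeOf D F) {T : ℝ} {v w : ℝ → X (p + 1)}
    (h : IsFlow D F T v w) : ∀ t ∈ Icc 0 T,
    HasDerivWithinAt (fun t => F (v t)) (D.A p (v t) (w t)) (Icc 0 T) t := fun t ht =>
  (hF.hasFDerivAt _ (h.mem t ht)).comp_hasDerivWithinAt t (h.deriv t ht)

variable [∀ r, CompleteSpace (X r)]

theorem flow_lipschitz (hF : IsDerivativeOf D F) {KB : ℝ}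
    (hB : ∀ u ∈ D.O, ∀ v ∈ D.O,
      ‖u - v‖ ≤ KB * ‖(F u - D.ω • S.dn p u) - (F v - D.ω • S.dn p v)‖)
    {T M : ℝ} (hT : 0 ≤ T) (hM : 0 ≤ M) :
    ∃ C, 0 ≤ C ∧ ∀ v₁ w₁ v₂ w₂ : ℝ → X (p + 1), IsFlow D F T v₁ w₁ → IsFlow D F T v₂ w₂ →
    (∀ t ∈ Icc 0 T, ‖w₁ t‖ ≤ M) → (∀ t ∈ Icc 0 T, ‖w₂ t‖ ≤ M) →
    ∀ t ∈ Icc 0 T, ‖v₁ t - v₂ t‖ ≤ C * ‖v₁ 0 - v₂ 0‖ := by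
  obtain ⟨Fk, hF1, hFk, hl⟩ := form_bound hF.lt.le
  have hC1 := D.one_le_C
  have hβ := D.β_nonneg
  obtain ⟨C, hC, h⟩ := pair_estimate hF hB hT hM
    (K := 2 * D.β + (Fk * D.C * M) ^ 2 + Fk) (by positivity)
  refine ⟨√C, Real.sqrt_nonneg _, fun v₁ w₁ v₂ w₂ h1 h2 hw1 hw2 t ht => ?_⟩
  have := h v₁ w₁ v₂ (fun t => D.A p (v₁ t) (w₁ t) - D.A p (v₂ t) (w₂ t)) (fun _ => 0) 0 le_rfl
    (h1.isPath hw1) h2.mem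
    (fun t ht => (h1.hasDerivWithinAt_F hF t ht).sub (h2.hasDerivWithinAt_F hF t ht))
    (fun t ht => ((S.dn p).hasFDerivAt.comp_hasDerivWithinAt t
      ((h1.deriv t ht).sub (h2.deriv t ht))).congr_deriv (by
        rw [h1.eq t ht, h2.eq t ht, map_sub, add_zero]))
    (fun t _ => by simp)
    (fun t ht => by
      have hm := h1.mem t ht
      have e1 : D.A p (v₁ t) (w₁ t) - D.A p (v₂ t) (w₂ t) =
          D.A p (v₁ t) (w₁ t - w₂ t) + (D.A p (v₁ t) - D.A p (v₂ t)) (w₂ t) := by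
        rw [map_sub, sub_apply]; abel
      have e2 : F (v₁ t) - F (v₂ t) = S.dn p (w₁ t - w₂ t) := by
        rw [h1.eq t ht, h2.eq t ht, map_sub]
      rw [e1, e2, map_add, add_apply]
      have e3 := form_A_le hF.lt hm (w₁ t - w₂ t)
      set δ := S.dn p (w₁ t - w₂ t)
      have e4 := form_apply_le hFk hm ((D.A p (v₁ t) - D.A p (v₂ t)) (w₂ t)) δ
      have e5 : ‖(D.A p (v₁ t) - D.A p (v₂ t)) (w₂ t)‖ ≤ D.C * ‖v₁ t - v₂ t‖ * M :=
        (ContinuousLinearMap.le_opNorm _ _).trans (mul_le_mul (A_lipschitz hF.lt hm (h2.mem t ht))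
          (hw2 t ht) (norm_nonneg _) (by positivity))
      have e6 : Fk * ‖(D.A p (v₁ t) - D.A p (v₂ t)) (w₂ t)‖ * ‖δ‖ ≤
          (Fk * D.C * M) * ‖v₁ t - v₂ t‖ * ‖δ‖ := by
        calc _ ≤ Fk * (D.C * ‖v₁ t - v₂ t‖ * M) * ‖δ‖ := by gcongr
          _ = _ := by ring
      have e7 := hl _ hm δ
      have e8 := sq_nonneg ((Fk * D.C * M) * ‖v₁ t - v₂ t‖ - ‖δ‖)
      have e9 : 0 ≤ D.form p (v₁ t) δ δ := form_nonneg hm _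
      have e10 : 0 ≤ (Fk * D.C * M) ^ 2 * D.form p (v₁ t) δ δ := by positivity
      have e11 : 0 ≤ (2 * D.β + Fk) * ‖v₁ t - v₂ t‖ ^ 2 := by positivity
      have e12 : 0 ≤ ((Fk * D.C * M) * ‖v₁ t - v₂ t‖) ^ 2 := sq_nonneg _
      nlinarith) t ht
  rw [add_zero] at this
  rw [← Real.sqrt_sq (norm_nonneg (v₁ 0 - v₂ 0)), ← Real.sqrt_mul hC,
    ← Real.sqrt_sq (norm_nonneg (v₁ t - v₂ t))]
  exact Real.sqrt_le_sqrt this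

/-- Solutions of the regularized system `u' = J(u) w`, `w' = Y(u) w`. -/
theorem exists_regularized_flow (hF : IsDerivativeOf D F) {b : X (p + 1)} {ρ : ℝ} (hρ : 0 < ρ)
    (hb : closedBall b ρ ⊆ D.O) {K₁ : ℝ} (hK₁ : 0 < K₁) :
    ∃ M T₀, 0 < M ∧ 0 < T₀ ∧ ∀ r T, 0 ≤ T → T ≤ T₀ → r + M * T ≤ ρ →
    ∀ x w₀ : X (p + 1), ‖x - b‖ ≤ r → ‖w₀‖ ≤ K₁ → F x = S.dn p w₀ → ∀ c, D.lam₀ ≤ c →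
    ∃ u w : ℝ → X (p + 1), u 0 = x ∧ w 0 = w₀ ∧
      (∀ t ∈ Icc 0 T, HasDerivWithinAt u (D.J c (p + 1) (u t) (w t)) (Icc 0 T) t) ∧
      (∀ t ∈ Icc 0 T, HasDerivWithinAt w (D.Y c (p + 1) (u t) (w t)) (Icc 0 T) t) ∧
      ∀ t ∈ Icc 0 T, ‖w t‖ ≤ M ∧ ‖D.J c (p + 1) (u t) (w t)‖ ≤ M ∧ ‖u t - b‖ ≤ r + M * t ∧
        F (u t) = S.dn p (w t) := by
  have hN : p + 1 ≤ D.N := hF.N_eq.ge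
  obtain ⟨C₀, hC₀, hen⟩ := energy_estimate hN (D := D)
  obtain ⟨KJ, hKJ1, hKJ⟩ := norm_J_le hN (D := D)
  obtain ⟨KL, hKL0, hKL⟩ := J_lipschitz hN (D := D)
  have hβ := D.β_nonneg
  set m := 3 * C₀ * K₁ with hm
  have hm0 : 0 < m := by positivity
  have hmM : m ≤ KJ * m := by nlinarith
  refine ⟨KJ * m, (C₀ * (1 + KJ * m + 2 * D.β))⁻¹, by positivity, by positivity,
    fun r T hT hT₀ hrT x w₀ hx hw₀ hxw c hc => ?_⟩
  obtain ⟨KY, hKY⟩ := norm_Y_le hN hc (D := D)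
  obtain ⟨KYL, hKYL0, hKYL⟩ := Y_lipschitz hN hc (D := D)
  have hc0 : 0 ≤ c := zero_le_one.trans (lam_pos hc)
  set q : X (p + 1) → X (p + 1) := fun y => b + retract ρ (y - b) with hq
  have hqO : ∀ y, q y ∈ D.O := fun y => hb (by
    rw [mem_closedBall, dist_eq_norm, hq]
    simpa using norm_retract_le hρ (y - b))
  have hqL : ∀ y z, ‖q y - q z‖ ≤ 2 * ‖y - z‖ := fun y z => by
    have := norm_retract_sub_le hρ (y - b) (z - b)
    simpa [hq] using this
  have hKY0 : 0 ≤ KY := (norm_nonneg _).trans (hKY _ (hqO b))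
  set s : X (p + 1) → X (p + 1) := retract m with hs
  set vf : X (p + 1) × X (p + 1) → X (p + 1) × X (p + 1) := fun y =>
    (D.J c (p + 1) (q y.1) (s y.2), D.Y c (p + 1) (q y.1) (s y.2)) with hvf
  have hlip : ∀ (P : X (p + 1) → X (p + 1) →L[ℝ] X (p + 1)) (KP LP : ℝ), 0 ≤ KP → 0 ≤ LP →
      (∀ u ∈ D.O, ‖P u‖ ≤ KP) → (∀ u ∈ D.O, ∀ v ∈ D.O, ‖P u - P v‖ ≤ LP * ‖u - v‖) →
      ∀ y z : X (p + 1) × X (p + 1), ‖P (q y.1) (s y.2) - P (q z.1) (s z.2)‖ ≤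
        (2 * LP * m + 2 * KP) * ‖y - z‖ := by
    intro P KP LP hKP hLP hP1 hP2 y z
    have e : P (q y.1) (s y.2) - P (q z.1) (s z.2) =
        (P (q y.1) - P (q z.1)) (s y.2) + P (q z.1) (s y.2 - s z.2) := by
      rw [map_sub, sub_apply]; abel
    rw [e]
    have n1 : ‖y.1 - z.1‖ ≤ ‖y - z‖ := norm_fst_le (y - z)
    have n2 : ‖y.2 - z.2‖ ≤ ‖y - z‖ := norm_snd_le (y - z)
    have a1 : ‖(P (q y.1) - P (q z.1)) (s y.2)‖ ≤ (LP * (2 * ‖y - z‖)) * m := by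
      refine (ContinuousLinearMap.le_opNorm _ _).trans (mul_le_mul ?_ (norm_retract_le hm0 _)
        (norm_nonneg _) (by positivity))
      exact (hP2 _ (hqO _) _ (hqO _)).trans (mul_le_mul_of_nonneg_left
        ((hqL _ _).trans (by linarith)) hLP)
    have a2 : ‖P (q z.1) (s y.2 - s z.2)‖ ≤ KP * (2 * ‖y - z‖) :=
      (ContinuousLinearMap.le_opNorm _ _).trans (mul_le_mul (hP1 _ (hqO _))
        ((norm_retract_sub_le hm0 _ _).trans (by linarith)) (norm_nonneg _) hKP)
    exact (norm_add_le _ _).trans (by linarith)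
  obtain ⟨y, hy0, hy⟩ := exists_global_solution hT (fun _ => vf) (fun _ => continuousOn_const)
    (K := max (2 * (c * KL) * m + 2 * KJ) (2 * KYL * m + 2 * KY)) (fun t _ y z => by
      have a1 := hlip (D.J c (p + 1)) KJ (c * KL) (by linarith) (by positivity)
        (fun u hu => hKJ u hu c hc) (fun u hu v hv => hKL u hu v hv c hc) y z
      have a2 := hlip (D.Y c (p + 1)) KY KYL hKY0 hKYL0 hKY hKYL y z
      exact max_le (a1.trans (mul_le_mul_of_nonneg_right (le_max_left _ _) (norm_nonneg _)))
        (a2.trans (mul_le_mul_of_nonneg_right (le_max_right _ _) (norm_nonneg _)))) (x, w₀)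
  set u := fun t => (y t).1 with hu
  set w := fun t => (y t).2 with hw
  have du : ∀ t ∈ Icc 0 T, HasDerivWithinAt u (D.J c (p + 1) (q (u t)) (s (w t))) (Icc 0 T) t :=
    fun t ht => (ContinuousLinearMap.fst ℝ (X (p + 1)) (X (p + 1))).hasFDerivAt.comp_hasDerivWithinAt
      t (hy t ht)
  have dw : ∀ t ∈ Icc 0 T, HasDerivWithinAt w (D.Y c (p + 1) (q (u t)) (s (w t))) (Icc 0 T) t :=
    fun t ht => (ContinuousLinearMap.snd ℝ (X (p + 1)) (X (p + 1))).hasFDerivAt.comp_hasDerivWithinAt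
      t (hy t ht)
  have u0 : u 0 = x := by simp [hu, hy0]
  have w0 : w 0 = w₀ := by simp [hw, hy0]
  have nJ : ∀ t, ‖D.J c (p + 1) (q (u t)) (s (w t))‖ ≤ KJ * m := fun t =>
    (ContinuousLinearMap.le_opNorm _ _).trans (mul_le_mul (hKJ _ (hqO _) c hc)
      (norm_retract_le hm0 _) (norm_nonneg _) (by linarith))
  have hub : ∀ t ∈ Icc 0 T, ‖u t - b‖ ≤ r + KJ * m * t := fun t ht => by
    have h1 := norm_sub_le_of_hasDerivWithinAt du (fun t _ => nJ t) ⟨le_rfl, hT⟩ ht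
    rw [u0, sub_zero, abs_of_nonneg ht.1] at h1
    have h2 := norm_add_le (u t - x) (x - b)
    rw [sub_add_sub_cancel] at h2
    linarith
  have hqu : ∀ t ∈ Icc 0 T, q (u t) = u t := fun t ht => by
    have : ‖u t - b‖ ≤ ρ := (hub t ht).trans (le_trans (by
      have := mul_le_mul_of_nonneg_left ht.2 (show 0 ≤ KJ * m by positivity)
      linarith) hrT)
    rw [hq]
    simp only [retract_eq_self hρ this, add_sub_cancel]
  have huO : ∀ t ∈ Icc 0 T, u t ∈ D.O := fun t ht => hqu t ht ▸ hqO (u t)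
  have hpath : IsPath D T (KJ * m) u fun t => D.J c (p + 1) (q (u t)) (s (w t)) :=
    ⟨huO, du, fun t _ => nJ t⟩
  have hwb : ∀ t ∈ Icc 0 T, ‖w t‖ ≤ m := fun t ht => by
    have := hen (KJ * m) (2 * D.β) T u _ (by positivity) (by positivity) hpath w
      (fun t => D.Y c (p + 1) (q (u t)) (s (w t))) (fun _ => 0) (fun _ => 0) (fun _ => 0)
      (fun t ht => by simpa using dw t ht)
      (fun t ht => by
        rw [hqu t ht, hs, retract, map_smul, map_smul, smul_apply, smul_eq_mul]
        have hmx : 0 < max m ‖w t‖ := lt_max_of_lt_left hm0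
        have h1 := form_Y_le hN (huO t ht) hc (w t)
        have h2 : m / max m ‖w t‖ ≤ 1 := (div_le_one hmx).2 (le_max_left _ _)
        have h3 : 0 ≤ m / max m ‖w t‖ := by positivity
        have h4 : 0 ≤ D.form (p + 1) (u t) (w t) (w t) := form_nonneg (huO t ht) _
        have h5 : 0 ≤ 2 * D.β * D.form (p + 1) (u t) (w t) (w t) := by positivity
        calc _ ≤ m / max m ‖w t‖ * (2 * D.β * D.form (p + 1) (u t) (w t) (w t)) :=
              mul_le_mul_of_nonneg_left h1 h3
          _ ≤ 1 * (2 * D.β * D.form (p + 1) (u t) (w t) (w t)) := by gcongr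
          _ = _ := one_mul _)
      (fun t ht => hasDerivWithinAt_const t _ _) (fun t _ => by simp) t ht
    rw [w0] at this
    simp only [sub_self, add_zero] at this
    have h1 : C₀ * (1 + KJ * m + 2 * D.β) * t ≤ 1 := by
      have h2 : 0 < C₀ * (1 + KJ * m + 2 * D.β) := by positivity
      calc _ ≤ C₀ * (1 + KJ * m + 2 * D.β) * (C₀ * (1 + KJ * m + 2 * D.β))⁻¹ :=
            mul_le_mul_of_nonneg_left (ht.2.trans hT₀) h2.le
        _ = 1 := mul_inv_cancel₀ h2.ne'
    have h3 : Real.exp (C₀ * (1 + KJ * m + 2 * D.β) * t) ≤ 3 :=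
      (Real.exp_le_exp.2 h1).trans Real.exp_one_lt_three.le
    calc ‖w t‖ ≤ C₀ * Real.exp (C₀ * (1 + KJ * m + 2 * D.β) * t) * ‖w₀‖ := this
      _ ≤ C₀ * 3 * K₁ := by gcongr
      _ = m := by rw [hm]; ring
  have hsw : ∀ t ∈ Icc 0 T, s (w t) = w t := fun t ht => retract_eq_self hm0 (hwb t ht)
  have du' : ∀ t ∈ Icc 0 T, HasDerivWithinAt u (D.J c (p + 1) (u t) (w t)) (Icc 0 T) t :=
    fun t ht => by simpa only [hqu t ht, hsw t ht] using du t ht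
  have dw' : ∀ t ∈ Icc 0 T, HasDerivWithinAt w (D.Y c (p + 1) (u t) (w t)) (Icc 0 T) t :=
    fun t ht => by simpa only [hqu t ht, hsw t ht] using dw t ht
  refine ⟨u, w, u0, w0, du', dw', fun t ht => ⟨(hwb t ht).trans hmM, ?_, hub t ht, ?_⟩⟩
  · simpa only [hqu t ht, hsw t ht] using nJ t
  · have := norm_sub_le_of_hasDerivWithinAt (y := fun t => F (u t) - S.dn p (w t))
      (y' := fun _ => 0) (M := 0) (T := T) (fun t ht => by
        refine (((hF.hasFDerivAt _ (huO t ht)).comp_hasDerivWithinAt t (du' t ht)).sub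
          ((S.dn p).hasFDerivAt.comp_hasDerivWithinAt t (dw' t ht))).congr_deriv ?_
        rw [A_J_eq_Y hF.lt (huO t ht) (β_lt hc), dn_Y hF.lt (huO t ht) (β_lt hc), sub_self])
      (fun t _ => by simp) ⟨le_rfl, hT⟩ ht
    rw [u0, w0, hxw, sub_self, sub_zero, zero_mul, norm_le_zero_iff, sub_eq_zero] at this
    exact this

end DissipativeFamily

namespace DissipativeFamily

variable {X : ℕ → Type u} [∀ r, NormedAddCommGroup (X r)] [∀ r, InnerProductSpace ℝ (X r)]
  {S : HilbertScale X} {p : ℕ} {D : DissipativeFamily S (X (p + 1))} {F : X (p + 1) → X p}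
  [∀ r, CompleteSpace (X r)]

/-- Existence of solutions for initial values near `b`. -/
theorem exists_flow (hF : IsDerivativeOf D F) {KB : ℝ}
    (hB : ∀ u ∈ D.O, ∀ v ∈ D.O,
      ‖u - v‖ ≤ KB * ‖(F u - D.ω • S.dn p u) - (F v - D.ω • S.dn p v)‖)
    {b : X (p + 1)} {ρ : ℝ} (hρ : 0 < ρ)
    (hb : closedBall b ρ ⊆ D.O) {K₁ : ℝ} (hK₁ : 0 < K₁) :
    ∃ M T₀, 0 < M ∧ 0 < T₀ ∧ ∀ r T, 0 ≤ T → T ≤ T₀ → r + M * T ≤ ρ →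
    ∀ x w₀ : X (p + 1), ‖x - b‖ ≤ r → ‖w₀‖ ≤ K₁ → F x = S.dn p w₀ →
    ∃ v w : ℝ → X (p + 1), IsFlow D F T v w ∧ v 0 = x ∧
      ∀ t ∈ Icc 0 T, ‖w t‖ ≤ M ∧ ‖v t - b‖ ≤ r + M * t := by
  obtain ⟨M, T₀, hM, hT₀, hreg⟩ := exists_regularized_flow hF hρ hb hK₁
  refine ⟨M, T₀, hM, hT₀, fun r T hT hTT hrT x w₀ hx hw₀ hxw => ?_⟩
  have hk := hF.lt
  have hN : p + 1 ≤ D.N := hF.N_eq.ge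
  set c : ℕ → ℝ := fun j => D.lam₀ + j with hcdef
  have hc : ∀ j, D.lam₀ ≤ c j := fun j => by simp [hcdef]
  have hct : Tendsto c atTop atTop :=
    tendsto_atTop_add_const_left _ _ tendsto_natCast_atTop_atTop
  choose u w u0 w0 du dw hbd using fun j => hreg r T hT hTT hrT x w₀ hx hw₀ hxw (c j) (hc j)
  have h00 : (0 : ℝ) ∈ Icc 0 T := ⟨le_rfl, hT⟩
  have hball : ∀ j, ∀ t ∈ Icc 0 T, u j t ∈ closedBall b ρ := fun j t ht => by
    rw [mem_closedBall, dist_eq_norm]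
    have := mul_le_mul_of_nonneg_left ht.2 hM.le
    linarith [(hbd j t ht).2.2.1]
  have hpath : ∀ j, IsPath D T M (u j) fun t => D.J (c j) (p + 1) (u j t) (w j t) := fun j =>
    ⟨fun t ht => hb (hball j t ht), du j, fun t ht => (hbd j t ht).2.1⟩
  have hm : ∀ j, ∀ t ∈ Icc 0 T, u j t ∈ D.O := fun j => (hpath j).mem
  have hC1 := D.one_le_C
  -- the paths form a Cauchy sequence
  obtain ⟨K, hK0, hK⟩ := komura_estimate hk (D := D)
  obtain ⟨C, hC0, hC⟩ := pair_estimate hF hB hT hM.le (K := K + K * M ^ 2) (by positivity)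
  set Q := (D.C * M) ^ 2 with hQ
  have hpair : ∀ i j, ∀ t ∈ Icc 0 T, ‖u i t - u j t‖ ^ 2 ≤
      C * ((Q + 1) * ((c i)⁻¹ + (c j)⁻¹) * 2) := fun i j t ht => by
    have hci := lam_pos (hc i)
    have hcj := lam_pos (hc j)
    have hci' : (c i)⁻¹ ≤ 1 := inv_le_one_of_one_le₀ hci
    have hcj' : (c j)⁻¹ ≤ 1 := inv_le_one_of_one_le₀ hcj
    have hci0 : 0 < (c i)⁻¹ := by positivity
    have hcj0 : 0 < (c j)⁻¹ := by positivity
    set η := (Q + 1) * ((c i)⁻¹ + (c j)⁻¹) * 2 with hη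
    have hQ0 : 0 ≤ Q := by positivity
    have hη1 : (c i)⁻¹ + (c j)⁻¹ ≤ η := by nlinarith
    have hη0 : 0 ≤ η := by linarith
    have hYn : ∀ j, ∀ t ∈ Icc 0 T, ‖D.Y (c j) p (u j t) (S.dn p (w j t))‖ ≤ D.C * M :=
      fun j t ht => by
        rw [← A_J_eq_Y hk (hm j t ht) (β_lt (hc j))]
        exact (ContinuousLinearMap.le_opNorm _ _).trans (mul_le_mul (norm_A_le hk (hm j t ht))
          (hbd j t ht).2.1 (norm_nonneg _) (by linarith))
    have hF' : ∀ j, ∀ t ∈ Icc 0 T, HasDerivWithinAt (fun t => F (u j t))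
        (D.Y (c j) p (u j t) (S.dn p (w j t))) (Icc 0 T) t := fun j t ht => by
      refine ((hF.hasFDerivAt _ (hm j t ht)).comp_hasDerivWithinAt t (du j t ht)).congr_deriv ?_
      rw [A_J_eq_Y hk (hm j t ht) (β_lt (hc j))]
    have := hC (u i) _ (u j)
      (fun t => D.Y (c i) p (u i t) (S.dn p (w i t)) - D.Y (c j) p (u j t) (S.dn p (w j t)))
      (fun t => (c i)⁻¹ • D.Y (c i) p (u i t) (S.dn p (w i t)) -
        (c j)⁻¹ • D.Y (c j) p (u j t) (S.dn p (w j t)))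
      η hη0 (hpath i) (hm j) (fun t ht => (hF' i t ht).sub (hF' j t ht))
      (fun t ht => by
        refine ((S.dn p).hasFDerivAt.comp_hasDerivWithinAt t
          ((du i t ht).sub (du j t ht))).congr_deriv ?_
        have e : ∀ j, S.dn p (D.J (c j) (p + 1) (u j t) (w j t)) =
            F (u j t) + (c j)⁻¹ • D.Y (c j) p (u j t) (S.dn p (w j t)) := fun j => by
          have hcj := lam_pos (hc j)
          rw [(hbd j t ht).2.2.2, dn_J hk (hm j t ht) (β_lt (hc j)), Y_apply, smul_smul,
            inv_mul_cancel₀ (by positivity), one_smul]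
          abel
        rw [map_sub, e i, e j]; abel)
      (fun t ht => by
        have a1 := hYn i t ht
        have a2 := hYn j t ht
        have a3 : ‖(c i)⁻¹ • D.Y (c i) p (u i t) (S.dn p (w i t)) -
            (c j)⁻¹ • D.Y (c j) p (u j t) (S.dn p (w j t))‖ ≤
            ((c i)⁻¹ + (c j)⁻¹) * (D.C * M) := by
          refine (norm_sub_le _ _).trans ?_
          rw [norm_smul, norm_smul, Real.norm_eq_abs, Real.norm_eq_abs, abs_of_pos hci0,
            abs_of_pos hcj0, add_mul]
          gcongr
        refine (pow_le_pow_left₀ (norm_nonneg _) a3 2).trans ?_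
        rw [mul_pow, ← hQ]
        have : ((c i)⁻¹ + (c j)⁻¹) ^ 2 ≤ 2 * ((c i)⁻¹ + (c j)⁻¹) := by nlinarith
        nlinarith [mul_le_mul_of_nonneg_right this hQ0])
      (fun t ht => by
        have a1 := hK _ (hm i t ht) _ (hm j t ht) (c i) (c j) (hc i) (hc j) M (w i t) (w j t)
          (hbd i t ht).1 (hbd j t ht).1
        rw [← (hbd i t ht).2.2.2, ← (hbd j t ht).2.2.2] at a1 ⊢
        refine a1.trans ?_
        have a2 : 0 ≤ D.form p (u i t) (F (u i t) - F (u j t)) (F (u i t) - F (u j t)) :=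
          form_nonneg (hm i t ht) _
        have a3 : 0 ≤ K * M ^ 2 := by positivity
        have a4 : K * M ^ 2 * ((c i)⁻¹ + (c j)⁻¹ + ‖u i t - u j t‖ ^ 2) ≤
            K * M ^ 2 * (η + ‖u i t - u j t‖ ^ 2) := by gcongr
        have a5 : 0 ≤ K * (η + ‖u i t - u j t‖ ^ 2) := by positivity
        nlinarith [mul_nonneg a3 a2]) t ht
    rw [u0, u0, sub_self, norm_zero] at this
    simpa using this
  have hcau : UniformCauchySeqOn u atTop (Icc 0 T) := by
    rw [Metric.uniformCauchySeqOn_iff]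
    intro ε hε
    have hlim : Tendsto (fun j => (c j)⁻¹) atTop (𝓝 0) := tendsto_inv_atTop_zero.comp hct
    set η := ε ^ 2 / (4 * C * (Q + 1) + 1) / 2 with hη
    have hQ0 : 0 ≤ Q := by positivity
    have hη0 : 0 < η := by positivity
    obtain ⟨n, hn⟩ := eventually_atTop.1 (hlim.eventually (gt_mem_nhds hη0))
    refine ⟨n, fun i hi j hj t ht => ?_⟩
    rw [dist_eq_norm]
    refine lt_of_pow_lt_pow_left₀ 2 hε.le ((hpair i j t ht).trans_lt ?_)
    have h1 := hn i hi
    have h2 := hn j hj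
    have h3 : (4 * C * (Q + 1) + 1) * (2 * η) = ε ^ 2 := by rw [hη]; field_simp
    have h4 : C * ((Q + 1) * ((c i)⁻¹ + (c j)⁻¹) * 2) ≤ C * ((Q + 1) * (2 * η) * 2) := by
      gcongr; linarith
    nlinarith
  obtain ⟨v, huv, hv⟩ := hcau.exists_limit fun j => (hpath j).continuousOn
  have hvball : ∀ t ∈ Icc 0 T, v t ∈ closedBall b ρ := fun t ht =>
    isClosed_closedBall.mem_of_tendsto (huv.tendsto_at ht) (Eventually.of_forall fun j => hball j t ht)
  have happ : IsApprox D T M c u (fun j t => D.J (c j) (p + 1) (u j t) (w j t)) v :=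
    ⟨hT, hM.le, hc, hct, hpath, huv, fun t ht => hb (hvball t ht)⟩
  -- convergence of the derivatives
  obtain ⟨KT, hKT⟩ := T_bound hk D.ω (D := D)
  have hKT0 : 0 ≤ KT := (norm_nonneg _).trans (hKT.2 _ (hm 0 0 h00)).1
  obtain ⟨KJ, hKJ1, hKJ⟩ := norm_J_le hN (D := D)
  set s : X (p + 1) → X (p + 1) := retract M with hs
  have hsL : LipschitzWith 2 s := LipschitzWith.of_dist_le_mul fun y z => by
    rw [dist_eq_norm, dist_eq_norm]; exact norm_retract_sub_le hM y z
  set n₀ : ℝ → X p → X p := fun t z => fderiv ℝ (D.T D.ω p) (v t)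
    (s (D.R D.ω p (v t) z)) (s (D.R D.ω p (v t) z)) with hn₀
  set n : ℕ → ℝ → X p → X p := fun j t z => fderiv ℝ (D.T D.ω p) (u j t)
    (D.J (c j) (p + 1) (u j t) (s (D.R D.ω p (u j t) z))) (s (D.R D.ω p (u j t) z)) with hn
  have hfd : ∀ u₀ ∈ D.O, ContinuousAt (fderiv ℝ (D.T D.ω p)) u₀ := fun u₀ hu₀ =>
    (hKT.1.continuousOn_fderiv_of_isOpen D.isOpen le_rfl).continuousAt (D.isOpen.mem_nhds hu₀)
  have hRc : ∀ q : ℝ → X p, ContinuousOn q (Icc 0 T) →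
      ContinuousOn (fun t => D.R D.ω p (v t) (q t)) (Icc 0 T) := fun q hq t ht =>
    R_tendsto hk (happ.mem t ht) (hv t ht) (hq t ht)
  have hn₀c : ∀ q, ContinuousOn q (Icc 0 T) → ContinuousOn (fun t => n₀ t (q t)) (Icc 0 T) := by
    intro q hq t ht
    have h1 := (hsL.continuous.tendsto _).comp (hRc q hq t ht)
    exact tendsto_clm_apply (tendsto_clm_apply ((hfd _ (happ.mem t ht)).tendsto.comp (hv t ht)) h1) h1
  obtain ⟨P, hPc, hP⟩ := semilinear_limit hk happ (ℓ := KT * (KJ * M) * (2 * D.C) +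
      KT * (KJ * (2 * D.C)) * M) (by positivity) (n := n) (n₀ := n₀)
    (y := fun j t => D.T D.ω p (u j t) (w j t)) (x := D.T D.ω p x w₀)
    (fun j t ht a a' => by
      have hmt := hm j t ht
      have e : n j t a - n j t a' = fderiv ℝ (D.T D.ω p) (u j t)
          (D.J (c j) (p + 1) (u j t) (s (D.R D.ω p (u j t) a)))
            (s (D.R D.ω p (u j t) a) - s (D.R D.ω p (u j t) a')) +
          fderiv ℝ (D.T D.ω p) (u j t) (D.J (c j) (p + 1) (u j t)
            (s (D.R D.ω p (u j t) a) - s (D.R D.ω p (u j t) a'))) (s (D.R D.ω p (u j t) a')) := by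
        simp only [hn, map_sub, sub_apply]; abel
      have h1 : ‖s (D.R D.ω p (u j t) a) - s (D.R D.ω p (u j t) a')‖ ≤ 2 * D.C * ‖a - a'‖ := by
        refine (norm_retract_sub_le hM _ _).trans ?_
        rw [← map_sub, mul_assoc]
        exact mul_le_mul_of_nonneg_left ((ContinuousLinearMap.le_opNorm _ _).trans
          (mul_le_mul_of_nonneg_right (norm_R_ω_le hk hmt) (norm_nonneg _))) (by norm_num)
      have h2 : ∀ z z', ‖fderiv ℝ (D.T D.ω p) (u j t) (D.J (c j) (p + 1) (u j t) z) z'‖ ≤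
          KT * (KJ * ‖z‖) * ‖z'‖ := fun z z' => by
        refine (ContinuousLinearMap.le_opNorm₂ _ _ _).trans ?_
        refine mul_le_mul_of_nonneg_right (mul_le_mul (hKT.2 _ hmt).2 ?_ (norm_nonneg _) hKT0)
          (norm_nonneg _)
        exact (ContinuousLinearMap.le_opNorm _ _).trans
          (mul_le_mul_of_nonneg_right (hKJ _ hmt _ (hc j)) (norm_nonneg _))
      rw [e]
      refine (norm_add_le _ _).trans ?_
      have h3 := norm_retract_le hM (D.R D.ω p (u j t) a)
      have h4 := norm_retract_le hM (D.R D.ω p (u j t) a')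
      calc _ ≤ KT * (KJ * M) * (2 * D.C * ‖a - a'‖) + KT * (KJ * (2 * D.C * ‖a - a'‖)) * M := by
            refine add_le_add ((h2 _ _).trans ?_) ((h2 _ _).trans ?_)
            · gcongr
            · gcongr
        _ = _ := by ring)
    hn₀c
    (fun q hq => tendstoUniformlyOn_of_tendsto_prod isCompact_Icc (hn₀c q hq) fun t ht => by
      have hut := huv.tendsto_prod hv ht
      have h1 := (hsL.continuous.tendsto _).comp (R_tendsto hk (happ.mem t ht) hut
        ((hq t ht).tendsto.comp tendsto_snd))
      exact tendsto_clm_apply (tendsto_clm_apply ((hfd _ (happ.mem t ht)).tendsto.comp hut)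
        (J_tendsto hN (hct.comp tendsto_fst) (happ.mem t ht) hut h1)) h1)
    (by simp only [u0, w0]; exact tendsto_const_nhds)
    (fun j t ht => by
      have hmt := hm j t ht
      have h1 := ((hKT.hasFDerivAt D.isOpen hmt).comp_hasDerivWithinAt t (du j t ht)).clm_apply
        (dw j t ht)
      refine h1.congr_deriv ?_
      change fderiv ℝ (D.T D.ω p) (u j t) _ (w j t) + D.T D.ω p (u j t) _ = _
      rw [Q_Y hk hmt (β_lt (hc j))]
      have h2 : s (w j t) = w j t := retract_eq_self hM (hbd j t ht).1
      simp only [hn, R_Q hk hmt, h2]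
      abel)
  have hw : TendstoUniformlyOn w (fun t => D.R D.ω p (v t) (P t)) atTop (Icc 0 T) := by
    refine tendstoUniformlyOn_of_tendsto_prod isCompact_Icc (hRc P hPc) fun t ht => ?_
    have := R_tendsto hk (happ.mem t ht) (huv.tendsto_prod hv ht) (hP.tendsto_prod hPc ht)
    refine this.congr' ?_
    filter_upwards [tendsto_snd.eventually (self_mem_nhdsWithin)] with q hq
    exact R_Q hk (hm _ _ hq) _
  have hwc := hRc P hPc
  refine ⟨v, _, ⟨happ.mem, ?_, hwc, fun t ht => ?_⟩, ?_, fun t ht => ⟨?_, ?_⟩⟩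
  · refine hasDerivWithinAt_of_tendstoUniformlyOn (Eventually.of_forall du)
      (fun t ht => huv.tendsto_at ht) ?_ hwc
    exact tendstoUniformlyOn_of_tendsto_prod isCompact_Icc hwc fun t ht =>
      J_tendsto hN (hct.comp tendsto_fst) (happ.mem t ht) (huv.tendsto_prod hv ht)
        (hw.tendsto_prod hwc ht)
  · have h1 := ((hF.hasFDerivAt _ (happ.mem t ht)).continuousAt.tendsto).comp (huv.tendsto_at ht)
    have h2 := ((S.dn p).continuous.tendsto _).comp (hw.tendsto_at ht)
    refine tendsto_nhds_unique h1 (h2.congr fun j => ?_)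
    exact ((hbd j t ht).2.2.2).symm
  · exact tendsto_nhds_unique (huv.tendsto_at h00) (by simp only [u0]; exact tendsto_const_nhds)
  · exact le_of_tendsto (hw.tendsto_at ht).norm (Eventually.of_forall fun j => (hbd j t ht).1)
  · exact le_of_tendsto ((huv.tendsto_at ht).sub_const b).norm
      (Eventually.of_forall fun j => (hbd j t ht).2.2.1)

end DissipativeFamily

variable {X : ℕ → Type u} [∀ r, NormedAddCommGroup (X r)] [∀ r, InnerProductSpace ℝ (X r)]

/-- The assumptions (B.1)-(B.3), for `n = p + 2`. -/
structure QuasilinearEquation (S : HilbertScale X) (p : ℕ) where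
  O : Set (X (p + 1))
  F : X (p + 1) → X p
  A : (k : ℕ) → X (p + 1) → (X (k + 1) →L[ℝ] X k)
  L : X (p + 1) → (X 0 →L[ℝ] X 0 →L[ℝ] ℝ)
  ω : ℝ
  a : ℝ
  CL : ℝ
  C : ℝ
  one_le_CL : 1 ≤ CL
  one_le_C : 1 ≤ C
  isOpen : IsOpen O
  hasFDerivAt : ∀ u ∈ O, HasFDerivAt F (A p u) u
  compat : ∀ k, k + 1 < p + 1 → ∀ u ∈ O, ∀ y : X (k + 1 + 1),
    S.dn k (A (k + 1) u y) = A k u (S.dn (k + 1) y)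
  A_bound : ∀ k, k < p + 1 → C1BoundedOn (A k) O C
  invertible : ∀ k, k < p + 1 → ∀ u ∈ O, (ω • S.dn k - A k u).IsInvertible
  inverse_bound : ∀ k, k < p + 1 → C1BoundedOn (fun u => (ω • S.dn k - A k u).inverse) O C
  surjective : ∀ u ∈ O, ∃ lam : ℝ, CL ^ 2 * (|ω| + |a| * C * (1 + |ω| * C)) < lam ∧
    Function.Surjective (lam • S.dn 0 - A 0 u)
  L_contDiffOn : ContDiffOn ℝ 1 L O
  L_bound : DerivBoundedOn L O C
  symm : ∀ u ∈ O, ∀ v w : X 0, L u v w = L u w v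
  lower : ∀ u ∈ O, ∀ w : X 0,
    (CL ^ 2)⁻¹ * ‖w‖ ^ 2 - a * ‖S.dn 0 ((ω • S.dn 0 - A 0 u).inverse w)‖ ^ 2 ≤ L u w w
  upper : ∀ u ∈ O, ∀ w : X 0, L u w w ≤ CL ^ 2 * ‖w‖ ^ 2
  dissipative : ∀ u ∈ O, ∀ w : X 1, L u (S.dn 0 w) (A 0 u w) ≤ ω * ‖S.dn 0 w‖ ^ 2
  Fn : X (p + 2) → X (p + 1)
  dn_Fn : ∀ u, S.dn (p + 1) u ∈ O → S.dn p (Fn u) = F (S.dn (p + 1) u)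
  Fn_contDiffOn : ContDiffOn ℝ 2 Fn (S.dn (p + 1) ⁻¹' O)
  Fn_bound : ∀ R : ℝ, 0 < R → ∃ K : ℝ, ∀ u, S.dn (p + 1) u ∈ O → ‖u‖ ≤ R → ‖fderiv ℝ Fn u‖ ≤ K

namespace QuasilinearEquation

variable {S : HilbertScale X} {p : ℕ}

/-- The operators `DF(u)` on a convex set of parameters. -/
def family (Q : QuasilinearEquation S p) (B : Set (X (p + 1))) (hB : IsOpen B) (hc : Convex ℝ B)
    (hBO : B ⊆ Q.O) : DissipativeFamily S (X (p + 1)) where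
  N := p + 1
  O := B
  A := Q.A
  L := Q.L
  ω := Q.ω
  a := Q.a
  CL := Q.CL
  C := Q.C
  one_le_N := Nat.succ_le_succ (Nat.zero_le p)
  one_le_CL := Q.one_le_CL
  one_le_C := Q.one_le_C
  isOpen := hB
  convex := hc
  compat k hk u hu := Q.compat k hk u (hBO hu)
  A_bound k hk := ⟨(Q.A_bound k hk).1.mono hBO, fun u hu => (Q.A_bound k hk).2 u (hBO hu)⟩
  invertible k hk u hu := Q.invertible k hk u (hBO hu)
  inverse_bound k hk :=
    ⟨(Q.inverse_bound k hk).1.mono hBO, fun u hu => (Q.inverse_bound k hk).2 u (hBO hu)⟩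
  surjective u hu := Q.surjective u (hBO hu)
  L_contDiffOn := Q.L_contDiffOn.mono hBO
  L_bound u hu := Q.L_bound u (hBO hu)
  symm u hu := Q.symm u (hBO hu)
  lower u hu := Q.lower u (hBO hu)
  upper u hu := Q.upper u (hBO hu)
  dissipative u hu := Q.dissipative u (hBO hu)

theorem family_isDerivativeOf (Q : QuasilinearEquation S p) {B : Set (X (p + 1))} (hB : IsOpen B)
    (hc : Convex ℝ B) (hBO : B ⊆ Q.O) :
    DissipativeFamily.IsDerivativeOf (Q.family B hB hc hBO) Q.F :=
  ⟨rfl, fun u hu => Q.hasFDerivAt u (hBO hu)⟩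

/-- `F(u) - ω u` is bi-Lipschitz near each point. -/
theorem norm_sub_le_of_ball (Q : QuasilinearEquation S p) {b : X (p + 1)} {ρ : ℝ}
    (hb : ball b ρ ⊆ Q.O) (hρ : Q.C ^ 2 * ρ ≤ 1 / 2) {u v : X (p + 1)} (hu : u ∈ ball b ρ)
    (hv : v ∈ ball b ρ) :
    ‖u - v‖ ≤ 2 * Q.C * ‖(Q.F u - Q.ω • S.dn p u) - (Q.F v - Q.ω • S.dn p v)‖ := by
  have hρ0 : 0 < ρ := pos_of_mem_ball hu
  have hbO := hb (mem_ball_self hρ0)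
  have hC := Q.one_le_C
  set T := Q.ω • S.dn p - Q.A p b with hT
  set g : X (p + 1) → X p := fun u => Q.F u - Q.ω • S.dn p u + T u with hg
  have h1 : ‖g u - g v‖ ≤ Q.C * ρ * ‖u - v‖ := by
    refine (convex_ball b ρ).norm_image_sub_le_of_norm_hasFDerivWithin_le
      (f' := fun x => Q.A p x - Q.ω • S.dn p + T) (fun x hx => ?_) (fun x hx => ?_) hv hu
    · exact (((Q.hasFDerivAt x (hb hx)).sub ((S.dn p).hasFDerivAt.const_smul Q.ω)).add
        T.hasFDerivAt).hasFDerivWithinAt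
    · have e : Q.A p x - Q.ω • S.dn p + T = Q.A p x - Q.A p b := by rw [hT]; abel
      rw [e]
      refine ((Q.A_bound p (Nat.lt_succ_self p)).lipschitz Q.isOpen (convex_ball b ρ) hb hx
        (mem_ball_self hρ0)).trans ?_
      rw [← dist_eq_norm]
      exact mul_le_mul_of_nonneg_left (mem_ball.1 hx).le (by linarith)
  have h2 : ‖u - v‖ ≤ Q.C * ‖T (u - v)‖ := by
    have h3 := (Q.invertible p (Nat.lt_succ_self p) b hbO).inverse_apply_self (u - v)
    calc ‖u - v‖ = ‖T.inverse (T (u - v))‖ := by rw [hT, h3]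
      _ ≤ _ := (ContinuousLinearMap.le_opNorm _ _).trans (mul_le_mul_of_nonneg_right
        ((Q.inverse_bound p (Nat.lt_succ_self p)).2 b hbO).1 (norm_nonneg _))
  have e : T (u - v) = (g u - g v) -
      ((Q.F u - Q.ω • S.dn p u) - (Q.F v - Q.ω • S.dn p v)) := by
    simp only [hg, map_sub]; abel
  rw [e] at h2
  have h4 := norm_sub_le (g u - g v) ((Q.F u - Q.ω • S.dn p u) - (Q.F v - Q.ω • S.dn p v))
  set z := (Q.F u - Q.ω • S.dn p u) - (Q.F v - Q.ω • S.dn p v)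
  have h5 : Q.C * ‖g u - g v‖ ≤ 1 / 2 * ‖u - v‖ := by
    calc _ ≤ Q.C * (Q.C * ρ * ‖u - v‖) := by gcongr
      _ = Q.C ^ 2 * ρ * ‖u - v‖ := by ring
      _ ≤ _ := by gcongr
  nlinarith

/-- `F` is bounded in `X (p + 1)` on bounded convex subsets of `X (p + 2)`. -/
theorem exists_bound_Fn (Q : QuasilinearEquation S p) {b : X (p + 1)} {ρ : ℝ}
    (hb : ball b ρ ⊆ Q.O) (R : ℝ) : ∃ K, 0 < K ∧ ∀ u : X (p + 2),
    S.dn (p + 1) u ∈ ball b ρ → ‖u‖ < R → ‖Q.Fn u‖ ≤ K := by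
  by_cases hne : ∃ u₀ : X (p + 2), S.dn (p + 1) u₀ ∈ ball b ρ ∧ ‖u₀‖ < R
  swap
  · push Not at hne
    exact ⟨1, one_pos, fun u hu hR => absurd hR (hne u hu).not_gt⟩
  obtain ⟨u₀, hu₀, hR₀⟩ := hne
  have hR : 0 < R := (norm_nonneg _).trans_lt hR₀
  obtain ⟨K, hK⟩ := Q.Fn_bound R hR
  have hconv : Convex ℝ (S.dn (p + 1) ⁻¹' ball b ρ ∩ ball 0 R) :=
    ((convex_ball b ρ).linear_preimage (S.dn (p + 1)).toLinearMap).inter (convex_ball _ _)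
  have hopen : IsOpen (S.dn (p + 1) ⁻¹' Q.O) := Q.isOpen.preimage (S.dn (p + 1)).continuous
  have hK0 : 0 ≤ K := (norm_nonneg _).trans (hK u₀ (hb hu₀) hR₀.le)
  refine ⟨‖Q.Fn u₀‖ + K * (2 * R) + 1, by positivity, fun u hu huR => ?_⟩
  have := hconv.norm_image_sub_le_of_norm_hasFDerivWithin_le (f := Q.Fn)
    (f' := fderiv ℝ Q.Fn) (C := K)
    (fun x hx => ((Q.Fn_contDiffOn.differentiableOn (by norm_num)).differentiableAt
      (hopen.mem_nhds (hb hx.1))).hasFDerivAt.hasFDerivWithinAt)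
    (fun x hx => hK x (hb hx.1) (mem_ball_zero_iff.1 hx.2).le)
    ⟨hu₀, mem_ball_zero_iff.2 hR₀⟩ ⟨hu, mem_ball_zero_iff.2 huR⟩
  have h1 : ‖u - u₀‖ ≤ 2 * R := (norm_sub_le _ _).trans (by linarith)
  have h2 : K * ‖u - u₀‖ ≤ K * (2 * R) := mul_le_mul_of_nonneg_left h1 hK0
  have h3 := norm_sub_norm_le (Q.Fn u) (Q.Fn u₀)
  linarith

/-- The local inverse of `F - ω` stays in a small ball. -/
theorem localInverse_mem (Q : QuasilinearEquation S p) {b : X (p + 1)} {ρ δ R : ℝ}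
    (hb : ball b ρ ⊆ Q.O) (hρ : Q.C ^ 2 * ρ ≤ 1 / 2) (hρ0 : 0 < ρ) {us : X (p + 2)}
    (hus : S.dn (p + 1) us = b) {vs : X (p + 1)} (hvs : S.dn p vs = Q.F b - Q.ω • S.dn p b)
    (hR : ‖vs‖ < R) {G : X (p + 1) → X (p + 2)}
    (hG : ContinuousOn G {v | ‖S.dn p v - S.dn p vs‖ < δ ∧ ‖v‖ < R}) (hGv : G vs = us)
    (hGB : ∀ v, ‖S.dn p v - S.dn p vs‖ < δ → ‖v‖ < R →
      Q.F (S.dn (p + 1) (G v)) - Q.ω • S.dn p (S.dn (p + 1) (G v)) = S.dn p v)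
    (hδ : 2 * Q.C * δ ≤ ρ / 2) {v : X (p + 1)} (hv1 : ‖S.dn p v - S.dn p vs‖ < δ)
    (hv2 : ‖v‖ < R) : S.dn (p + 1) (G v) ∈ ball b ρ := by
  have hC := Q.one_le_C
  have hV : Convex ℝ {v | ‖S.dn p v - S.dn p vs‖ < δ ∧ ‖v‖ < R} := by
    have : {v | ‖S.dn p v - S.dn p vs‖ < δ ∧ ‖v‖ < R} =
        (S.dn p ⁻¹' ball (S.dn p vs) δ) ∩ ball 0 R := by
      ext v; simp [dist_eq_norm]
    rw [this]
    exact ((convex_ball _ δ).linear_preimage (S.dn p).toLinearMap).inter (convex_ball _ _)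
  have hδ0 : 0 < δ := (norm_nonneg _).trans_lt hv1
  have hvsV : vs ∈ {v | ‖S.dn p v - S.dn p vs‖ < δ ∧ ‖v‖ < R} := ⟨by simpa using hδ0, hR⟩
  have hcont : ContinuousOn (fun v => ‖S.dn (p + 1) (G v) - b‖)
      {v | ‖S.dn p v - S.dn p vs‖ < δ ∧ ‖v‖ < R} :=
    (((S.dn (p + 1)).continuous.comp_continuousOn hG).sub continuousOn_const).norm
  have hgap : ∀ v ∈ {v | ‖S.dn p v - S.dn p vs‖ < δ ∧ ‖v‖ < R},
      ‖S.dn (p + 1) (G v) - b‖ < ρ → ‖S.dn (p + 1) (G v) - b‖ < ρ / 2 := fun v hv hlt => by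
    have h1 := Q.norm_sub_le_of_ball hb hρ (u := S.dn (p + 1) (G v)) (v := b)
      (by rwa [mem_ball, dist_eq_norm]) (mem_ball_self hρ0)
    rw [hGB v hv.1 hv.2, ← hvs] at h1
    have : 2 * Q.C * ‖S.dn p v - S.dn p vs‖ < 2 * Q.C * δ :=
      mul_lt_mul_of_pos_left hv.1 (by linarith)
    linarith
  rw [mem_ball, dist_eq_norm]
  by_contra hcon
  push Not at hcon
  have h0 : ‖S.dn (p + 1) (G vs) - b‖ ≤ ρ / 2 := by rw [hGv, hus, sub_self, norm_zero]; positivity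
  obtain ⟨z, hz, hz'⟩ := hV.isPreconnected.intermediate_value hvsV
    (show v ∈ _ from ⟨hv1, hv2⟩) hcont (show ρ / 2 ∈ Icc _ _ from ⟨h0, by linarith⟩)
  replace hz' : ‖S.dn (p + 1) (G z) - b‖ = ρ / 2 := hz'
  have := hgap z hz (by rw [hz']; linarith)
  linarith

end QuasilinearEquation

variable {X : ℕ → Type u} [∀ r, NormedAddCommGroup (X r)] [∀ r, InnerProductSpace ℝ (X r)]

namespace QuasilinearEquation

variable {S : HilbertScale X} {p : ℕ}

/-- The family of operators with parameters in a ball. -/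
abbrev ballFamily (Q : QuasilinearEquation S p) (b : X (p + 1)) (ρ : ℝ) (hb : ball b ρ ⊆ Q.O) :
    DissipativeFamily S (X (p + 1)) :=
  Q.family (ball b ρ) isOpen_ball (convex_ball b ρ) hb

variable [∀ r, CompleteSpace (X r)]

theorem exists_local_solution (Q : QuasilinearEquation S p) {b : X (p + 1)} (hbO : b ∈ Q.O)
    {us : X (p + 2)} (hus : S.dn (p + 1) us = b) (R₁ : ℝ) {vs : X (p + 1)}
    (hvs : S.dn p vs = Q.F b - Q.ω • S.dn p b)
    (hG : ∀ R : ℝ, ‖vs‖ < R → ∃ δ : ℝ, 0 < δ ∧ ∃ G : X (p + 1) → X (p + 2),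
      ContinuousOn G {v | ‖S.dn p v - S.dn p vs‖ < δ ∧ ‖v‖ < R} ∧ G vs = us ∧
      (∀ v, ‖S.dn p v - S.dn p vs‖ < δ → ‖v‖ < R →
        Q.F (S.dn (p + 1) (G v)) - Q.ω • S.dn p (S.dn (p + 1) (G v)) = S.dn p v) ∧
      ∃ K : ℝ, ∀ v, ‖S.dn p v - S.dn p vs‖ < δ → ‖v‖ < R → ‖G v‖ ≤ K) :
    ∃ (ε T M₀ M₂ : ℝ) (hb : ball b (2 * ε) ⊆ Q.O) (U : ℝ → X (p + 1) → X (p + 2)),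
      0 < ε ∧ 0 < T ∧ 0 < M₀ ∧ 0 < M₂ ∧
      (∀ x ∈ ball b ε ∩ S.dn (p + 1) '' ball 0 R₁, S.dn (p + 1) (U 0 x) = x ∧
        ContinuousOn (fun t => U t x) (Icc 0 T) ∧
        (∃ w, (Q.ballFamily b (2 * ε) hb).IsFlow Q.F T (fun t => S.dn (p + 1) (U t x)) w) ∧
        ∀ t ∈ Icc 0 T, ‖U t x‖ < M₀) ∧
      (∀ x ∈ ball b ε ∩ S.dn (p + 1) '' ball 0 R₁, ∀ y ∈ ball b ε ∩ S.dn (p + 1) '' ball 0 R₁,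
        ∀ t ∈ Icc 0 T, ‖S.dn (p + 1) (U t x) - S.dn (p + 1) (U t y)‖ ≤ M₂ * ‖x - y‖) ∧
      ∀ x ∈ ball b ε ∩ S.dn (p + 1) '' ball 0 R₁, ∀ (z : ℝ → X (p + 2)) (w : ℝ → X (p + 1)),
        (Q.ballFamily b (2 * ε) hb).IsFlow Q.F T (fun t => S.dn (p + 1) (z t)) w →
        S.dn (p + 1) (z 0) = x → ∀ t ∈ Icc 0 T, z t = U t x := by
  have hC := Q.one_le_C
  obtain ⟨ρ₀, hρ₀, hρ₀O⟩ := Metric.isOpen_iff.1 Q.isOpen b hbO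
  set ρ := min ρ₀ (1 / (2 * Q.C ^ 2)) with hρdef
  have hρ : 0 < ρ := by positivity
  have hρO : ball b ρ ⊆ Q.O := (ball_subset_ball (min_le_left _ _)).trans hρ₀O
  have hρC : Q.C ^ 2 * ρ ≤ 1 / 2 := by
    calc Q.C ^ 2 * ρ ≤ Q.C ^ 2 * (1 / (2 * Q.C ^ 2)) := by gcongr; exact min_le_right _ _
      _ = 1 / 2 := by field_simp
  have hB : ∀ u ∈ ball b ρ, ∀ v ∈ ball b ρ, ‖u - v‖ ≤
      2 * Q.C * ‖(Q.F u - Q.ω • S.dn p u) - (Q.F v - Q.ω • S.dn p v)‖ := fun u hu v hv =>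
    Q.norm_sub_le_of_ball hρO hρC hu hv
  obtain ⟨K₁, hK₁, hFn⟩ := Q.exists_bound_Fn hρO R₁
  have hF := Q.family_isDerivativeOf isOpen_ball (convex_ball b ρ) hρO
  obtain ⟨M, T₀, hM, hT₀, hflow⟩ := DissipativeFamily.exists_flow hF hB
    (b := b) (ρ := ρ / 2) (by positivity)
    ((closedBall_subset_ball (by linarith) : closedBall b (ρ / 2) ⊆ ball b ρ)) hK₁
  set R := max (‖vs‖ + 1) (M + |Q.ω| * (‖b‖ + ρ) + 1) with hRdef
  have hR : ‖vs‖ < R := (lt_add_one _).trans_le (le_max_left _ _)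
  obtain ⟨δ₀, hδ₀, G, hGc, hGv, hGB, KG, hKG⟩ := hG R hR
  set δ := min δ₀ (ρ / (4 * Q.C)) with hδdef
  have hδ : 0 < δ := by positivity
  have hδρ : 2 * Q.C * δ ≤ ρ / 2 := by
    calc _ ≤ 2 * Q.C * (ρ / (4 * Q.C)) := by gcongr; exact min_le_right _ _
      _ = _ := by field_simp; norm_num
  have hδδ : δ ≤ δ₀ := min_le_left _ _
  have hGc' : ContinuousOn G {v | ‖S.dn p v - S.dn p vs‖ < δ ∧ ‖v‖ < R} :=
    hGc.mono fun v hv => ⟨hv.1.trans_le hδδ, hv.2⟩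
  have hGmem : ∀ v, ‖S.dn p v - S.dn p vs‖ < δ → ‖v‖ < R → S.dn (p + 1) (G v) ∈ ball b ρ :=
    fun v h1 h2 => Q.localInverse_mem hρO hρC hρ hus hvs hR hGc' hGv
      (fun v h1 h2 => hGB v (h1.trans_le hδδ) h2) hδρ h1 h2
  have hCω : 0 < Q.C + |Q.ω| := by positivity
  set ε := min (ρ / 4) (δ / (2 * (Q.C + |Q.ω|))) with hεdef
  have hε : 0 < ε := by positivity
  have hερ : ε ≤ ρ / 4 := min_le_left _ _
  have hεδ : (Q.C + |Q.ω|) * (2 * ε) ≤ δ := by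
    calc _ ≤ (Q.C + |Q.ω|) * (2 * (δ / (2 * (Q.C + |Q.ω|)))) := by
          gcongr; exact min_le_right _ _
      _ = δ := by field_simp
  have h2ε : ball b (2 * ε) ⊆ ball b ρ := ball_subset_ball (by linarith)
  set T := min T₀ (ε / M) with hTdef
  have hT : 0 < T := by positivity
  have hMT : M * T ≤ ε := by
    calc M * T ≤ M * (ε / M) := by gcongr; exact min_le_right _ _
      _ = ε := by field_simp
  set I := ball b ε ∩ S.dn (p + 1) '' ball 0 R₁ with hI
  have hsol : ∀ x, ∃ v w : ℝ → X (p + 1), x ∈ I →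
      ((Q.ballFamily b ρ hρO).IsFlow Q.F T v w ∧ v 0 = x ∧
        ∀ t ∈ Icc 0 T, ‖w t‖ ≤ M ∧ ‖v t - b‖ < 2 * ε) := fun x => by
    by_cases hx : x ∈ I
    · obtain ⟨hx1, x', hx', rfl⟩ := hx
      have hxε : ‖S.dn (p + 1) x' - b‖ < ε := by rw [← dist_eq_norm]; exact hx1
      have hxρ : S.dn (p + 1) x' ∈ ball b ρ := ball_subset_ball (by linarith) hx1
      obtain ⟨v, w, h1, h2, h3⟩ := hflow ‖S.dn (p + 1) x' - b‖ T hT.le (min_le_left _ _)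
        (by linarith) (S.dn (p + 1) x') (Q.Fn x') le_rfl
        (hFn x' hxρ (mem_ball_zero_iff.1 hx')) (Q.dn_Fn x' (hρO hxρ)).symm
      refine ⟨v, w, fun _ => ⟨h1, h2, fun t ht => ⟨(h3 t ht).1, ?_⟩⟩⟩
      have := mul_le_mul_of_nonneg_left ht.2 hM.le
      linarith [(h3 t ht).2]
    · exact ⟨fun _ => 0, fun _ => 0, fun h => absurd h hx⟩
  choose v w hvw using hsol
  have hvball : ∀ x ∈ I, ∀ t ∈ Icc 0 T, v x t ∈ ball b (2 * ε) := fun x hx t ht => by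
    rw [mem_ball, dist_eq_norm]; exact ((hvw x hx).2.2 t ht).2
  have hdn : ∀ x ∈ I, ∀ t ∈ Icc 0 T, S.dn p (w x t - Q.ω • v x t) =
      Q.F (v x t) - Q.ω • S.dn p (v x t) := fun x hx t ht => by
    rw [map_sub, map_smul, ← (hvw x hx).1.eq t ht]
  have hV : ∀ x ∈ I, ∀ t ∈ Icc 0 T, ‖S.dn p (w x t - Q.ω • v x t) - S.dn p vs‖ < δ ∧
      ‖w x t - Q.ω • v x t‖ < R := fun x hx t ht => by
    have h1 := ((hvw x hx).2.2 t ht).2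
    have h0 := hvball x hx t ht
    constructor
    · rw [hdn x hx t ht, hvs]
      have h2 := hF.lipschitz (h2ε h0) (mem_ball_self hρ)
      have h3 : Q.F (v x t) - Q.ω • S.dn p (v x t) - (Q.F b - Q.ω • S.dn p b) =
          (Q.F (v x t) - Q.F b) - Q.ω • S.dn p (v x t - b) := by
        rw [map_sub, smul_sub]; abel
      rw [h3]
      refine (norm_sub_le _ _).trans_lt ?_
      rw [norm_smul, Real.norm_eq_abs]
      have h4 : |Q.ω| * ‖S.dn p (v x t - b)‖ ≤ |Q.ω| * ‖v x t - b‖ :=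
        mul_le_mul_of_nonneg_left (S.norm_dn_le _ _) (abs_nonneg _)
      have h5 : ‖Q.F (v x t) - Q.F b‖ ≤ Q.C * ‖v x t - b‖ := h2
      have h6 := mul_lt_mul_of_pos_left h1 hCω
      linarith
    · refine (norm_sub_le _ _).trans_lt (lt_of_lt_of_le ?_ (le_max_right _ _))
      rw [norm_smul, Real.norm_eq_abs]
      have h2 := ((hvw x hx).2.2 t ht).1
      have h3 : ‖v x t‖ ≤ ‖b‖ + ρ := by
        have := norm_add_le (v x t - b) b
        rw [sub_add_cancel] at this
        linarith
      have h4 := mul_le_mul_of_nonneg_left h3 (abs_nonneg Q.ω)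
      linarith
  set U : ℝ → X (p + 1) → X (p + 2) := fun t x => G (w x t - Q.ω • v x t) with hU
  have hdnU : ∀ x ∈ I, ∀ t ∈ Icc 0 T, S.dn (p + 1) (U t x) = v x t := fun x hx t ht => by
    obtain ⟨h1, h2⟩ := hV x hx t ht
    have h3 := hB _ (hGmem _ h1 h2) (v x t) (h2ε (hvball x hx t ht))
    rw [hGB _ (h1.trans_le hδδ) h2, hdn x hx t ht, sub_self, norm_zero, mul_zero] at h3
    exact sub_eq_zero.1 (norm_le_zero_iff.1 h3)
  have h00 : (0 : ℝ) ∈ Icc 0 T := ⟨le_rfl, hT.le⟩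
  have hb : ball b (2 * ε) ⊆ Q.O := h2ε.trans hρO
  have hF2 := Q.family_isDerivativeOf isOpen_ball (convex_ball b (2 * ε)) hb
  have hB2 : ∀ u ∈ ball b (2 * ε), ∀ v ∈ ball b (2 * ε), ‖u - v‖ ≤
      2 * Q.C * ‖(Q.F u - Q.ω • S.dn p u) - (Q.F v - Q.ω • S.dn p v)‖ := fun u hu v hv =>
    hB u (h2ε hu) v (h2ε hv)
  have hflow2 : ∀ x ∈ I, (Q.ballFamily b (2 * ε) hb).IsFlow Q.F T (v x) (w x) := fun x hx =>
    ⟨hvball x hx, (hvw x hx).1.deriv, (hvw x hx).1.continuousOn, (hvw x hx).1.eq⟩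
  obtain ⟨CL, hCL0, hCL⟩ := DissipativeFamily.flow_lipschitz hF2 hB2 hT.le hM.le
  refine ⟨ε, T, max KG 0 + 1, CL + 1, hb, U, hε, hT, by positivity, by positivity,
    fun x hx => ⟨?_, ?_, ⟨w x, ?_⟩, fun t ht => ?_⟩, fun x hx y hy t ht => ?_,
    fun x hx z wz hz hz0 t ht => ?_⟩
  · rw [hdnU x hx 0 h00, (hvw x hx).2.1]
  · refine hGc'.comp (((hvw x hx).1.continuousOn).sub (ContinuousOn.const_smul ?_ _))
      fun t ht => hV x hx t ht
    exact fun t ht => ((hvw x hx).1.deriv t ht).continuousWithinAt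
  · have h := hflow2 x hx
    exact ⟨fun t ht => by rw [hdnU x hx t ht]; exact h.mem t ht,
      fun t ht => (h.deriv t ht).congr (fun s hs => hdnU x hx s hs) (hdnU x hx t ht),
      h.continuousOn, fun t ht => by rw [hdnU x hx t ht]; exact h.eq t ht⟩
  · obtain ⟨h1, h2⟩ := hV x hx t ht
    exact ((hKG _ (h1.trans_le hδδ) h2).trans (le_max_left _ _)).trans_lt (lt_add_one _)
  · rw [hdnU x hx t ht, hdnU y hy t ht]
    have := hCL _ _ _ _ (hflow2 x hx) (hflow2 y hy) (fun t ht => ((hvw x hx).2.2 t ht).1)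
      (fun t ht => ((hvw y hy).2.2 t ht).1) t ht
    rw [(hvw x hx).2.1, (hvw y hy).2.1] at this
    nlinarith [norm_nonneg (x - y)]
  · obtain ⟨Mz, hMz⟩ := isCompact_Icc.exists_bound_of_continuousOn hz.continuousOn
    obtain ⟨CL', -, hCL'⟩ := DissipativeFamily.flow_lipschitz hF2 hB2 hT.le
      (hM.le.trans (le_max_left M Mz))
    have := hCL' _ _ _ _ hz (hflow2 x hx) (fun t ht => (hMz t ht).trans (le_max_right _ _))
      (fun t ht => ((hvw x hx).2.2 t ht).1.trans (le_max_left _ _)) t ht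
    rw [(hvw x hx).2.1, hz0, sub_self, norm_zero, mul_zero] at this
    apply S.dn_injective (p + 1)
    rw [hdnU x hx t ht]
    exact sub_eq_zero.1 (norm_le_zero_iff.1 this)

end QuasilinearEquation

variable {X : ℕ → Type u} [∀ r, NormedAddCommGroup (X r)] [∀ r, InnerProductSpace ℝ (X r)]

section Translation

variable {S : HilbertScale X} {p : ℕ} {two_le_n : 2 ≤ p + 2} {O : Set (X (p + 1))}
  {F : X (p + 1) → X p} {A : (r : ℕ) → X (p + 1) → (X r →L[ℝ] X (r - 1))}
  {L : X (p + 1) → (X 0 →L[ℝ] X 0 →L[ℝ] ℝ)} {ω a CL : ℝ} {one_le_CL : 1 ≤ CL} {C : ℝ}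
  {one_le_C : 1 ≤ C}

theorem EvolutionData.compat_of_B1
    (h : (⟨p + 2, two_le_n, O, F, A, L, ω, a, CL, one_le_CL, C, one_le_C⟩ : EvolutionData X).B1 S)
    (k : ℕ) (hk : k + 1 < p + 1) (u : X (p + 1)) (hu : u ∈ O) (y : X (k + 1 + 1)) :
    S.dn k (A (k + 1 + 1) u y) = A (k + 1) u (S.dn (k + 1) y) := by
  have hk2 : k + 2 ≤ p + 1 := hk
  have hc1 : Continuous fun y : X (k + 1 + 1) => S.dn k (A (k + 1 + 1) u y) :=
    (S.dn k).continuous.comp (A (k + 1 + 1) u).continuous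
  have hc2 : Continuous fun y : X (k + 1 + 1) =>
      (A (k + 1) u (S.dn (k + 1) y) : X k) :=
    (A (k + 1) u).continuous.comp (S.dn (k + 1)).continuous
  refine congrFun (DenseRange.equalizer (S.emb_denseRange hk2) hc1 hc2 ?_) y
  funext w
  apply S.emb_injective (Nat.zero_le k)
  have h1 := h.A_eq (k + 2) (by omega) hk2 u hu (S.emb hk2 w) w (S.emb_trans _ _ _)
  have h2 := h.A_eq (k + 1) (by omega) (show k + 1 ≤ p + 1 by omega) u hu
    (S.dn (k + 1) (S.emb hk2 w)) w
    ((congrArg _ (S.emb_trans _ _ _)).trans (S.emb_trans _ _ _))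
  exact ((S.emb_trans _ _ _).trans h1).trans h2.symm

/-- The assumptions (B.1)-(B.3) for `n = p + 2`. -/
noncomputable def EvolutionData.toQuasilinearEquation
    (h1 : (⟨p + 2, two_le_n, O, F, A, L, ω, a, CL, one_le_CL, C, one_le_C⟩ : EvolutionData X).B1 S)
    (h2 : (⟨p + 2, two_le_n, O, F, A, L, ω, a, CL, one_le_CL, C, one_le_C⟩ : EvolutionData X).B2 S)
    (h3 : (⟨p + 2, two_le_n, O, F, A, L, ω, a, CL, one_le_CL, C, one_le_C⟩ : EvolutionData X).B3 S) :
    QuasilinearEquation S p where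
  O := O
  F := F
  A k := A (k + 1)
  L := L
  ω := ω
  a := a
  CL := CL
  C := C
  one_le_CL := one_le_CL
  one_le_C := one_le_C
  isOpen := h1.isOpen
  hasFDerivAt u hu := by
    have hd : HasFDerivAt F (fderiv ℝ F u) u :=
      ((h1.contDiffOn.differentiableOn (by norm_num)).differentiableAt
        (h1.isOpen.mem_nhds hu)).hasFDerivAt
    refine hd.congr_fderiv (ContinuousLinearMap.ext fun w => ?_)
    apply S.emb_injective (Nat.zero_le p)
    exact (h1.A_eq (p + 1) (by omega) le_rfl u hu w w rfl).symm
  compat := compat_of_B1 h1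
  A_bound k hk := h1.A_bound (k + 1) (by omega) hk
  invertible k hk := h2.invertible (k + 1) (by omega) hk
  inverse_bound k hk := h2.bound_inverse (k + 1) (by omega) hk
  surjective := h2.surjective
  L_contDiffOn := h3.contDiffOn
  L_bound := h3.bound
  symm := h3.symm
  lower := h3.lower
  upper := h3.upper
  dissipative := h3.dissipative
  Fn := h1.top.choose
  dn_Fn := h1.top.choose_spec.1
  Fn_contDiffOn := h1.top.choose_spec.2.1
  Fn_bound R hR := by
    obtain ⟨K, hK⟩ := h1.top.choose_spec.2.2 R hR
    exact ⟨K, fun u hu hu' => hK u hu hu'⟩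

theorem QuasilinearEquation.isFlow_of_C1 (Q : QuasilinearEquation S p) {b : X (p + 1)} {ρ : ℝ}
    (hb : ball b ρ ⊆ Q.O) {T : ℝ} (hT : 0 < T) {v : ℝ → X (p + 1)}
    (hmem : ∀ t ∈ Icc 0 T, v t ∈ ball b ρ) (hv : ContDiffOn ℝ 1 v (Icc 0 T))
    (heq : ∀ t ∈ Icc 0 T, HasDerivWithinAt (fun s => S.dn p (v s)) (Q.F (v t)) (Icc 0 T) t) :
    (Q.ballFamily b ρ hb).IsFlow Q.F T v (derivWithin v (Icc 0 T)) := by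
  have hU := uniqueDiffOn_Icc hT
  have hd : ∀ t ∈ Icc 0 T, HasDerivWithinAt v (derivWithin v (Icc 0 T) t) (Icc 0 T) t :=
    fun t ht => (hv.differentiableOn (by norm_num) t ht).hasDerivWithinAt
  refine ⟨hmem, hd, hv.continuousOn_derivWithin hU le_rfl, fun t ht => ?_⟩
  exact (hU t ht).eq_deriv _ (heq t ht) ((S.dn p).hasFDerivAt.comp_hasDerivWithinAt t (hd t ht))

theorem DissipativeFamily.IsFlow.contDiffOn {D : DissipativeFamily S (X (p + 1))} {T : ℝ}
    (hT : 0 < T) {v w : ℝ → X (p + 1)} (h : D.IsFlow F T v w) : ContDiffOn ℝ 1 v (Icc 0 T) := by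
  have hU := uniqueDiffOn_Icc hT
  rw [contDiffOn_one_iff_derivWithin hU]
  exact ⟨fun t ht => (h.deriv t ht).differentiableWithinAt,
    h.continuousOn.congr fun t ht => (h.deriv t ht).derivWithin (hU t ht)⟩

variable [∀ r, CompleteSpace (X r)]

theorem EvolutionData.exists_solutionMap {us : X (p + 2)} {R₁ : ℝ}
    (h1 : (⟨p + 2, two_le_n, O, F, A, L, ω, a, CL, one_le_CL, C, one_le_C⟩ : EvolutionData X).B1 S)
    (h2 : (⟨p + 2, two_le_n, O, F, A, L, ω, a, CL, one_le_CL, C, one_le_C⟩ : EvolutionData X).B2 S)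
    (h3 : (⟨p + 2, two_le_n, O, F, A, L, ω, a, CL, one_le_CL, C, one_le_C⟩ : EvolutionData X).B3 S)
    (h4 : (⟨p + 2, two_le_n, O, F, A, L, ω, a, CL, one_le_CL, C, one_le_C⟩ : EvolutionData X).B4 S us)
    (hus : S.dn (p + 1) us ∈ O) :
    ∃ (ε T M₀ M₂ : ℝ) (U : ℝ → X (p + 1) → X (p + 2)),
      (⟨p + 2, two_le_n, O, F, A, L, ω, a, CL, one_le_CL, C, one_le_C⟩ :
        EvolutionData X).IsSolutionMap S us R₁ ε T M₀ M₂ U := by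
  set Q := toQuasilinearEquation h1 h2 h3 with hQ
  obtain ⟨vs, hvs, hG⟩ := h4
  obtain ⟨ε, T, M₀, M₂, hb, U, hε, hT, hM₀, hM₂, hU, hlip, huniq⟩ :=
    Q.exists_local_solution (b := S.dn (p + 1) us) hus rfl R₁ (vs := vs) hvs (fun R hR => by
      obtain ⟨δ, hδ, G, g1, g2, g3, K, hK⟩ := hG R hR
      exact ⟨δ, hδ, G, g1, g2, fun v a b => (g3 v a b).2, K, hK⟩)
  refine ⟨ε, T, M₀, M₂, U, ⟨hε, hT, hM₀, hM₂, hb, fun x hx => ?_, fun x hx => (hU x hx).1,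
    fun x hx t ht => ?_, fun x hx z hz hz0 hzm => ?_, hlip⟩⟩
  · obtain ⟨-, hc, ⟨w, hw⟩, -⟩ := hU x hx
    refine ⟨hc, hw.contDiffOn hT, fun t ht => hb (hw.mem t ht), fun t ht => ?_⟩
    have := (S.dn p).hasFDerivAt.comp_hasDerivWithinAt t (hw.deriv t ht)
    rw [← hw.eq t ht] at this
    exact this
  · obtain ⟨-, -, ⟨w, hw⟩, hbd⟩ := hU x hx
    exact ⟨hw.mem t ht, hbd t ht⟩
  · exact huniq x hx z _ (Q.isFlow_of_C1 hb hT (fun t ht => (hzm t ht).1) hz.contDiffOn hz.eq) hz0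

end Translation

/-! ### Norms of the scale on the base space -/

namespace HilbertScale

variable {X : ℕ → Type u} [∀ r, NormedAddCommGroup (X r)] [∀ r, InnerProductSpace ℝ (X r)]
  {S : HilbertScale X}

/-- `z` belongs to `X q` and its norm there is at most `c`. -/
def NormLE (S : HilbertScale X) (q : ℕ) (z : X 0) (c : ℝ) : Prop :=
  ∃ v : X q, S.incl q v = z ∧ ‖v‖ ≤ c

/-- `f` is a continuous path in `X q`. -/
def ContLift (S : HilbertScale X) (q : ℕ) (f : ℝ → X 0) (s : Set ℝ) : Prop :=
  ∃ φ : ℝ → X q, ContinuousOn φ s ∧ ∀ t ∈ s, S.incl q (φ t) = f t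

theorem incl_injective (q : ℕ) : Function.Injective (S.incl q) := S.emb_injective _

theorem incl_emb {q r : ℕ} (h : q ≤ r) (v : X r) : S.incl q (S.emb h v) = S.incl r v :=
  S.emb_trans _ _ _

theorem incl_dn (k : ℕ) (v : X (k + 1)) : S.incl k (S.dn k v) = S.incl (k + 1) v :=
  S.emb_trans _ _ _

theorem incl_zero (v : X 0) : S.incl 0 v = v := S.emb_refl 0 v

theorem normLE_incl {q : ℕ} {v : X q} {c : ℝ} : S.NormLE q (S.incl q v) c ↔ ‖v‖ ≤ c :=
  ⟨fun ⟨_, h, hc⟩ => S.incl_injective q h ▸ hc, fun h => ⟨v, rfl, h⟩⟩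

theorem NormLE.of_le {q : ℕ} {z : X 0} {c c' : ℝ} (h : S.NormLE q z c) (hc : c ≤ c') :
    S.NormLE q z c' := let ⟨v, hv, hvc⟩ := h; ⟨v, hv, hvc.trans hc⟩

theorem NormLE.nonneg {q : ℕ} {z : X 0} {c : ℝ} (h : S.NormLE q z c) : 0 ≤ c :=
  let ⟨_, _, hvc⟩ := h; (norm_nonneg _).trans hvc

theorem NormLE.down {q q' : ℕ} {z : X 0} {c : ℝ} (h : S.NormLE q z c) (hq : q' ≤ q) :
    S.NormLE q' z c :=
  let ⟨v, hv, hvc⟩ := h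
  ⟨S.emb hq v, (S.incl_emb hq v).trans hv, (S.norm_emb_le hq v).trans hvc⟩

theorem NormLE.add {q : ℕ} {y z : X 0} {c d : ℝ} (hy : S.NormLE q y c) (hz : S.NormLE q z d) :
    S.NormLE q (y + z) (c + d) :=
  let ⟨v, hv, hvc⟩ := hy
  let ⟨w, hw, hwd⟩ := hz
  ⟨v + w, by rw [map_add, hv, hw], (norm_add_le _ _).trans (add_le_add hvc hwd)⟩

theorem NormLE.sub {q : ℕ} {y z : X 0} {c d : ℝ} (hy : S.NormLE q y c) (hz : S.NormLE q z d) :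
    S.NormLE q (y - z) (c + d) :=
  let ⟨v, hv, hvc⟩ := hy
  let ⟨w, hw, hwd⟩ := hz
  ⟨v - w, by rw [map_sub, hv, hw], (norm_sub_le _ _).trans (add_le_add hvc hwd)⟩

theorem NormLE.smul {q : ℕ} {y : X 0} {c : ℝ} (hy : S.NormLE q y c) (a : ℝ) :
    S.NormLE q (a • y) (|a| * c) :=
  let ⟨v, hv, hvc⟩ := hy
  ⟨a • v, by rw [map_smul, hv], by
    rw [norm_smul, Real.norm_eq_abs]; exact mul_le_mul_of_nonneg_left hvc (abs_nonneg _)⟩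

theorem normLE_zero (q : ℕ) {c : ℝ} (hc : 0 ≤ c) : S.NormLE q 0 c :=
  ⟨0, map_zero _, by rwa [norm_zero]⟩

theorem normLE_sum {ι : Type*} (s : Finset ι) {q : ℕ} {z : ι → X 0} {c : ι → ℝ}
    (h : ∀ i ∈ s, S.NormLE q (z i) (c i)) : S.NormLE q (∑ i ∈ s, z i) (∑ i ∈ s, c i) := by
  classical
  induction s using Finset.induction_on with
  | empty => simpa using normLE_zero q le_rfl
  | insert a s ha ih =>
    rw [Finset.sum_insert ha, Finset.sum_insert ha]
    exact (h a (Finset.mem_insert_self a s)).add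
      (ih fun i hi => h i (Finset.mem_insert_of_mem hi))

theorem ContLift.add {q : ℕ} {f g : ℝ → X 0} {s : Set ℝ} (hf : S.ContLift q f s)
    (hg : S.ContLift q g s) : S.ContLift q (fun t => f t + g t) s :=
  let ⟨φ, hφ, hφf⟩ := hf
  let ⟨γ, hγ, hγg⟩ := hg
  ⟨fun t => φ t + γ t, hφ.add hγ, fun t ht => by rw [map_add, hφf t ht, hγg t ht]⟩

theorem contLift_const {q : ℕ} {s : Set ℝ} (v : X q) : S.ContLift q (fun _ => S.incl q v) s :=
  ⟨fun _ => v, continuousOn_const, fun _ _ => rfl⟩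

theorem contLift_sum {ι : Type*} (I : Finset ι) {q : ℕ} {f : ι → ℝ → X 0} {s : Set ℝ}
    (h : ∀ i ∈ I, S.ContLift q (f i) s) : S.ContLift q (fun t => ∑ i ∈ I, f i t) s := by
  classical
  induction I using Finset.induction_on with
  | empty => exact ⟨fun _ => 0, continuousOn_const, fun t _ => by simp⟩
  | insert a I ha ih =>
    simp only [Finset.sum_insert ha]
    exact (h a (Finset.mem_insert_self a I)).add
      (ih fun i hi => h i (Finset.mem_insert_of_mem hi))

/-- A sequence of operators from `X 0` to `X N` that converges strongly to the identity on each
`X q`, `q ≤ N`. -/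
structure IsSmoothing (S : HilbertScale X) (N : ℕ) (P : ℕ → X 0 →L[ℝ] X N) (K : ℝ) : Prop where
  one_le : 1 ≤ K
  bound : ∀ q, q ≤ N → ∀ i z c, S.NormLE q z c → S.NormLE q (S.incl N (P i z)) (K * c)
  tendsto : ∀ q (hq : q ≤ N) (w : X q),
    Tendsto (fun i => S.emb hq (P i (S.incl q w))) atTop (𝓝 w)

/-- Norm bounds in `X q` pass to limits in `X 0` that belong to `X q`. -/
theorem IsSmoothing.normLE_of_tendsto {N : ℕ} {P : ℕ → X 0 →L[ℝ] X N} {K : ℝ}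
    (hP : S.IsSmoothing N P K) {q : ℕ} (hq : q ≤ N) {ι : Type*} {l : Filter ι} [l.NeBot]
    {z : ι → X 0} {z₀ : X q} {c : ℝ} (hz : Tendsto z l (𝓝 (S.incl q z₀)))
    (h : ∀ᶠ i in l, S.NormLE q (z i) c) : S.NormLE q (S.incl q z₀) (K * c) := by
  rw [normLE_incl]
  refine le_of_tendsto (hP.tendsto q hq z₀).norm (Eventually.of_forall fun i => ?_)
  have h1 : Tendsto (fun j => S.emb hq (P i (z j))) l (𝓝 (S.emb hq (P i (S.incl q z₀)))) :=
    ((S.emb hq).continuous.tendsto _).comp (((P i).continuous.tendsto _).comp hz)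
  refine le_of_tendsto h1.norm (h.mono fun j hj => ?_)
  have h2 := hP.bound q hq i _ _ hj
  rwa [← S.incl_emb hq, normLE_incl] at h2

/-- A path in `X 0` whose derivative is a continuous bounded path in `X q`. -/
theorem normLE_of_hasDerivWithinAt {q : ℕ} [CompleteSpace (X q)] {g : ℝ → X 0} {γ : ℝ → X q}
    {c : ℝ} (hγ : ContinuousOn γ (Icc 0 1))
    (hg : ∀ s ∈ Icc (0 : ℝ) 1, HasDerivWithinAt g (S.incl q (γ s)) (Icc 0 1) s)
    (hc : ∀ s ∈ Icc (0 : ℝ) 1, ‖γ s‖ ≤ c) : S.NormLE q (g 1 - g 0) c := by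
  have h0 : (0 : ℝ) ∈ Icc (0 : ℝ) 1 := ⟨le_rfl, zero_le_one⟩
  have h1 : (1 : ℝ) ∈ Icc (0 : ℝ) 1 := ⟨zero_le_one, le_rfl⟩
  set Γ : ℝ → X q := fun t => 0 + ∫ s in (0 : ℝ)..t, γ s with hΓ
  have hΓd : ∀ s ∈ Icc (0 : ℝ) 1, HasDerivWithinAt Γ (γ s) (Icc 0 1) s := fun s hs =>
    hasDerivWithinAt_integral_Icc hγ 0 hs
  have hΓ0 : Γ 0 = 0 := by simp [hΓ]
  refine ⟨Γ 1, ?_, ?_⟩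
  · have := norm_sub_le_of_hasDerivWithinAt (y := fun s => g s - S.incl q (Γ s))
      (y' := fun _ => 0) (M := 0) (T := 1)
      (fun s hs => ((hg s hs).sub ((S.incl q).hasFDerivAt.comp_hasDerivWithinAt s
        (hΓd s hs))).congr_deriv (sub_self _)) (fun s _ => by simp) h0 h1
    rw [zero_mul, norm_le_zero_iff, hΓ0, map_zero, sub_zero] at this
    rw [eq_comm, ← sub_eq_zero, ← this]
    abel
  · have := norm_sub_le_of_hasDerivWithinAt hΓd hc h0 h1
    simpa [hΓ0] using this

end HilbertScale

namespace DissipativeFamily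

variable {X : ℕ → Type u} [∀ r, NormedAddCommGroup (X r)] [∀ r, InnerProductSpace ℝ (X r)]
  {S : HilbertScale X} {Z : Type*} [NormedAddCommGroup Z] [NormedSpace ℝ Z]
  {D : DissipativeFamily S Z}

/-- The operator `(c (c - A(u))⁻¹) ^ k`, from `X 0` to `X k`. -/
noncomputable def smooth (D : DissipativeFamily S Z) (c : ℝ) (u : Z) : (k : ℕ) → (X 0 →L[ℝ] X k)
  | 0 => ContinuousLinearMap.id ℝ (X 0)
  | k + 1 => c • (D.R c k u).comp (smooth D c u k)

variable [∀ r, CompleteSpace (X r)]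

theorem incl_J {k : ℕ} (hk : k ≤ D.N) {u : Z} (hu : u ∈ D.O) {c : ℝ} (hc : D.β < c) (y : X k) :
    S.incl k (D.J c k u y) = D.J c 0 u (S.incl k y) := by
  induction k with
  | zero => rw [S.incl_zero, S.incl_zero]
  | succ k ih =>
    rw [← S.incl_dn, dn_J hk hu hc, ih (Nat.le_of_succ_le hk), S.incl_dn]

theorem incl_J_iterate {k : ℕ} (hk : k ≤ D.N) {u : Z} (hu : u ∈ D.O) {c : ℝ} (hc : D.β < c)
    (m : ℕ) (y : X k) :
    S.incl k ((D.J c k u)^[m] y) = (D.J c 0 u)^[m] (S.incl k y) := by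
  induction m with
  | zero => rfl
  | succ m ih =>
    rw [Function.iterate_succ_apply', Function.iterate_succ_apply', incl_J hk hu hc, ih]

theorem incl_smooth {k : ℕ} (hk : k ≤ D.N) {u : Z} (hu : u ∈ D.O) {c : ℝ} (hc : D.β < c)
    (y : X 0) : S.incl k (D.smooth c u k y) = (D.J c 0 u)^[k] y := by
  induction k with
  | zero => exact S.incl_zero y
  | succ k ih =>
    rw [Function.iterate_succ_apply', ← ih (Nat.le_of_succ_le hk),
      ← incl_J (Nat.le_of_succ_le hk) hu hc, J_eq_dn_R hk hu hc, S.incl_dn]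
    rfl

theorem exists_isSmoothing (D : DissipativeFamily S Z) {u : Z} (hu : u ∈ D.O) :
    ∃ (P : ℕ → X 0 →L[ℝ] X D.N) (K : ℝ), S.IsSmoothing D.N P K := by
  have hK : ∀ k, ∃ K, 1 ≤ K ∧ (k ≤ D.N → ∀ c, D.lam₀ ≤ c → ‖D.J c k u‖ ≤ K) := fun k => by
    by_cases hk : k ≤ D.N
    · obtain ⟨K, h1, h2⟩ := norm_J_le hk (D := D)
      exact ⟨K, h1, fun _ c hc => h2 u hu c hc⟩
    · exact ⟨1, le_rfl, fun h => absurd h hk⟩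
  choose K hK1 hK using hK
  set K₀ := ∑ k ∈ Finset.range (D.N + 1), K k with hK₀
  have hKle : ∀ k, k ≤ D.N → K k ≤ K₀ := fun k hk =>
    Finset.single_le_sum (f := K) (fun i _ => zero_le_one.trans (hK1 i))
      (Finset.mem_range.2 (Nat.lt_succ_of_le hk))
  have hK₀1 : 1 ≤ K₀ := (hK1 0).trans (hKle 0 (Nat.zero_le _))
  set c : ℕ → ℝ := fun j => D.lam₀ + j with hcdef
  have hc : ∀ j, D.lam₀ ≤ c j := fun j => by simp [hcdef]
  have hct : Tendsto c atTop atTop :=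
    tendsto_atTop_add_const_left _ _ tendsto_natCast_atTop_atTop
  have key : ∀ q (hq : q ≤ D.N) i (w : X q),
      S.emb hq (D.smooth (c i) u D.N (S.incl q w)) = (D.J (c i) q u)^[D.N] w := fun q hq i w => by
    apply S.incl_injective q
    rw [S.incl_emb, incl_smooth le_rfl hu (β_lt (hc i)), incl_J_iterate hq hu (β_lt (hc i))]
  refine ⟨fun i => D.smooth (c i) u D.N, K₀ ^ D.N, one_le_pow₀ hK₀1, ?_, fun q hq w => ?_⟩
  · rintro q hq i _ b ⟨w, rfl, hw⟩
    rw [← S.incl_emb hq, key, S.normLE_incl]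
    have : ∀ m, ‖(D.J (c i) q u)^[m] w‖ ≤ K₀ ^ m * ‖w‖ := fun m => by
      induction m with
      | zero => simp
      | succ m ih =>
        rw [Function.iterate_succ_apply', pow_succ', mul_assoc]
        exact (ContinuousLinearMap.le_opNorm _ _).trans (mul_le_mul
          ((hK q hq _ (hc i)).trans (hKle q hq)) ih (norm_nonneg _) (by linarith))
    exact (this _).trans (mul_le_mul_of_nonneg_left hw (by positivity))
  · simp only [key]
    have : ∀ m, Tendsto (fun i => (D.J (c i) q u)^[m] w) atTop (𝓝 w) := fun m => by
      induction m with
      | zero => exact tendsto_const_nhds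
      | succ m ih =>
        simp only [Function.iterate_succ_apply']
        exact J_tendsto hq hct hu tendsto_const_nhds ih
    exact this _

end DissipativeFamily

/-! ### Derivatives of the nonlinear operator -/

variable {X : ℕ → Type u} [∀ r, NormedAddCommGroup (X r)] [∀ r, InnerProductSpace ℝ (X r)]

/-- The `l`-th derivative of `F`, with `F` regarded as a map to the base space. -/
noncomputable def HilbertScale.derivs (S : HilbertScale X) {p : ℕ} (F : X (p + 1) → X p) (l : ℕ)
    (u : X (p + 1)) : ContinuousMultilinearMap ℝ (fun _ : Fin l => X (p + 1)) (X 0) :=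
  iteratedFDeriv ℝ l (fun x => S.incl p (F x)) u

/-- The assumption (B.5), for `n = p + 2`. -/
structure SmoothField (S : HilbertScale X) {p : ℕ} (F : X (p + 1) → X p) (O : Set (X (p + 1)))
    (C : ℝ) (m₀ r₀ : ℕ) : Prop where
  isOpen : IsOpen O
  one_le_C : 1 ≤ C
  one_le : 1 ≤ m₀
  m₀_le : m₀ ≤ r₀
  r₀_le : r₀ ≤ p + 1
  contDiffOn : ContDiffOn ℝ m₀ (fun x => S.incl p (F x)) O
  bound : ∀ r l m : ℕ, r₀ + 1 ≤ r → r ≤ p + 2 → 2 ≤ l → l ≤ m → m ≤ m₀ →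
    ∀ k : Fin l → ℕ, (∀ j, 1 ≤ k j ∧ k j ≤ m) → ∑ j, k j = m →
      ∃ G : X (p + 1) → ContinuousMultilinearMap ℝ (fun j : Fin l => X (r - k j)) (X (r - m)),
        ContinuousOn G O ∧ ∀ u ∈ O, S.Extends (G u) (S.derivs F l u) ∧ ‖G u‖ ≤ C
  lipschitz : ∀ r l m : ℕ, r₀ + 1 ≤ r → r ≤ p + 2 → 1 ≤ l → l ≤ m → m ≤ m₀ →
    ∀ k : Fin l → ℕ, (∀ j, 1 ≤ k j ∧ k j ≤ m) → ∑ j, k j = m →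
      ∃ G : X (p + 1) →
          ContinuousMultilinearMap ℝ (fun j : Fin l => X (r - k j)) (X (r - m - 1)),
        (∀ u ∈ O, S.Extends (G u) (S.derivs F l u)) ∧
        ∀ u ∈ O, ∀ v ∈ O, ‖G u - G v‖ ≤ C * ‖u - v‖

/-- The `l`-th derivative of `F` is bounded from `X (e 0) × ... × X (e (l - 1))` to `X q`,
uniformly on `O`. -/
def LevelBound (S : HilbertScale X) {p : ℕ} (F : X (p + 1) → X p) (O : Set (X (p + 1))) (l : ℕ)
    (e : Fin l → ℕ) (q : ℕ) : Prop :=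
  ∃ K, 0 ≤ K ∧ ∀ u ∈ O, ∀ (w : Fin l → X (p + 1)) (a : Fin l → ℝ),
    (∀ j, S.NormLE (e j) (S.incl (p + 1) (w j)) (a j)) →
      S.NormLE q (S.derivs F l u w) (K * ∏ j, a j)

theorem HilbertScale.normLE_of_extends {S : HilbertScale X} {l s q : ℕ} {e : Fin l → ℕ}
    {G : ContinuousMultilinearMap ℝ (fun j : Fin l => X (e j)) (X q)}
    {D : ContinuousMultilinearMap ℝ (fun _ : Fin l => X s) (X 0)} (h : S.Extends G D)
    {w : Fin l → X s} {a : Fin l → ℝ} (hw : ∀ j, S.NormLE (e j) (S.incl s (w j)) (a j)) {K : ℝ}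
    (hK : ‖G‖ ≤ K) : S.NormLE q (D w) (K * ∏ j, a j) := by
  choose v hv hva using hw
  refine ⟨G v, by rw [h v w hv, S.incl_zero], (G.le_opNorm v).trans ?_⟩
  exact mul_le_mul hK (Finset.prod_le_prod (fun _ _ => norm_nonneg _) fun j _ => hva j)
    (Finset.prod_nonneg fun _ _ => norm_nonneg _) ((norm_nonneg _).trans hK)

theorem HilbertScale.normLE_sub_of_extends {S : HilbertScale X} {l s q : ℕ} {e : Fin l → ℕ}
    {G G' : ContinuousMultilinearMap ℝ (fun j : Fin l => X (e j)) (X q)}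
    {D D' : ContinuousMultilinearMap ℝ (fun _ : Fin l => X s) (X 0)} (h : S.Extends G D)
    (h' : S.Extends G' D')
    {w : Fin l → X s} {a : Fin l → ℝ} (hw : ∀ j, S.NormLE (e j) (S.incl s (w j)) (a j)) {K : ℝ}
    (hK : ‖G - G'‖ ≤ K) : S.NormLE q (D w - D' w) (K * ∏ j, a j) := by
  refine normLE_of_extends (G := G - G') (D := D - D') (fun v w hvw => ?_) hw hK
  rw [sub_apply, sub_apply, map_sub, map_sub, h v w hvw, h' v w hvw]

theorem LevelBound.mono {S : HilbertScale X} {p : ℕ} {F : X (p + 1) → X p} {O : Set (X (p + 1))}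
    {l : ℕ} {e e' : Fin l → ℕ} {q q' : ℕ} (h : LevelBound S F O l e q) (he : ∀ j, e j ≤ e' j)
    (hq : q' ≤ q) : LevelBound S F O l e' q' :=
  let ⟨K, hK, hb⟩ := h
  ⟨K, hK, fun u hu w a hw => (hb u hu w a fun j => (hw j).down (he j)).down hq⟩

namespace SmoothField

variable {S : HilbertScale X} {p : ℕ} {F : X (p + 1) → X p} {O : Set (X (p + 1))}
    {C : ℝ} {m₀ r₀ : ℕ}

theorem mono (h : SmoothField S F O C m₀ r₀) {O' : Set (X (p + 1))} (hO : IsOpen O')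
    (hOO : O' ⊆ O) : SmoothField S F O' C m₀ r₀ where
  isOpen := hO
  one_le_C := h.one_le_C
  one_le := h.one_le
  m₀_le := h.m₀_le
  r₀_le := h.r₀_le
  contDiffOn := h.contDiffOn.mono hOO
  bound r l m h1 h2 h3 h4 h5 k h6 h7 := by
    obtain ⟨G, hG, hG'⟩ := h.bound r l m h1 h2 h3 h4 h5 k h6 h7
    exact ⟨G, hG.mono hOO, fun u hu => hG' u (hOO hu)⟩
  lipschitz r l m h1 h2 h3 h4 h5 k h6 h7 := by
    obtain ⟨G, hG, hG'⟩ := h.lipschitz r l m h1 h2 h3 h4 h5 k h6 h7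
    exact ⟨G, fun u hu => hG u (hOO hu), fun u hu v hv => hG' u (hOO hu) v (hOO hv)⟩

theorem contDiffAt (h : SmoothField S F O C m₀ r₀) {u : X (p + 1)} (hu : u ∈ O) :
    ContDiffAt ℝ m₀ (fun x => S.incl p (F x)) u :=
  h.contDiffOn.contDiffAt (h.isOpen.mem_nhds hu)

theorem hasFDerivAt_derivs (h : SmoothField S F O C m₀ r₀) {l : ℕ} (hl : l + 1 ≤ m₀)
    {u : X (p + 1)} (hu : u ∈ O) (w : Fin l → X (p + 1)) :
    ∃ g : X (p + 1) →L[ℝ] X 0, HasFDerivAt (fun x => S.derivs F l x w) g u ∧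
      ∀ δ, g δ = S.derivs F (l + 1) u (Fin.cons δ w) := by
  have h1 : DifferentiableAt ℝ (iteratedFDeriv ℝ l fun x => S.incl p (F x)) u :=
    (h.contDiffAt hu).differentiableAt_iteratedFDeriv (by exact_mod_cast hl)
  refine ⟨_, (ContinuousMultilinearMap.apply ℝ (fun _ : Fin l => X (p + 1)) (X 0)
    w).hasFDerivAt.comp u h1.hasFDerivAt, fun δ => ?_⟩
  rw [HilbertScale.derivs, iteratedFDeriv_succ_apply_left]
  simp

theorem hasDerivAt_derivs (h : SmoothField S F O C m₀ r₀) {l : ℕ} (hl : l + 1 ≤ m₀)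
    {u δ : X (p + 1)} {s : ℝ} (hu : u + s • δ ∈ O) (w : Fin l → X (p + 1)) :
    HasDerivAt (fun s : ℝ => S.derivs F l (u + s • δ) w)
      (S.derivs F (l + 1) (u + s • δ) (Fin.cons δ w)) s := by
  obtain ⟨g, hg, hg'⟩ := h.hasFDerivAt_derivs hl hu w
  have h2 : HasDerivAt (fun s : ℝ => u + s • δ) δ s := by
    simpa using ((hasDerivAt_id s).smul_const δ).const_add u
  exact (hg.comp_hasDerivAt s h2).congr_deriv (hg' δ)

theorem derivs_cons_congr (h : SmoothField S F O C m₀ r₀) {l : ℕ} (hl : l + 1 ≤ m₀)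
    {w w' : Fin l → X (p + 1)} (hw : ∀ u ∈ O, S.derivs F l u w = S.derivs F l u w')
    {u : X (p + 1)} (hu : u ∈ O) (δ : X (p + 1)) :
    S.derivs F (l + 1) u (Fin.cons δ w) = S.derivs F (l + 1) u (Fin.cons δ w') := by
  obtain ⟨g, hg, hg'⟩ := h.hasFDerivAt_derivs hl hu w
  obtain ⟨k, hk, hk'⟩ := h.hasFDerivAt_derivs hl hu w'
  have : g = k := hg.unique (hk.congr_of_eventuallyEq (by
    filter_upwards [h.isOpen.mem_nhds hu] with x hx using hw x hx))
  rw [← hg', ← hk', this]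

theorem derivs_cons_cons (h : SmoothField S F O C m₀ r₀) {l : ℕ} (hl : l + 2 ≤ m₀)
    (w : Fin l → X (p + 1)) {u : X (p + 1)} (hu : u ∈ O) (a b : X (p + 1)) :
    S.derivs F (l + 2) u (Fin.cons a (Fin.cons b w)) =
      S.derivs F (l + 2) u (Fin.cons b (Fin.cons a w)) := by
  have hg2 : ContDiffAt ℝ 2 (fun x => S.derivs F l x w) u := by
    have h1 : ContDiffAt ℝ 2 (iteratedFDeriv ℝ l fun x => S.incl p (F x)) u :=
      (h.contDiffAt hu).iteratedFDeriv_right (by rw [add_comm]; exact_mod_cast hl)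
    exact (ContinuousMultilinearMap.apply ℝ (fun _ : Fin l => X (p + 1)) (X 0)
      w).contDiff.contDiffAt.comp u h1
  have hfd : ∀ x ∈ O, ∀ b, fderiv ℝ (fun x => S.derivs F l x w) x b =
      S.derivs F (l + 1) x (Fin.cons b w) := fun x hx b => by
    obtain ⟨g, hg, hg'⟩ := h.hasFDerivAt_derivs (show l + 1 ≤ m₀ by omega) hx w
    rw [hg.fderiv, hg']
  have hfd2 : ∀ a b, fderiv ℝ (fderiv ℝ (fun x => S.derivs F l x w)) u a b =
      S.derivs F (l + 2) u (Fin.cons a (Fin.cons b w)) := fun a b => by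
    obtain ⟨g, hg, hg'⟩ := h.hasFDerivAt_derivs hl hu (Fin.cons b w)
    have h1 : DifferentiableAt ℝ (fderiv ℝ (fun x => S.derivs F l x w)) u :=
      (hg2.fderiv_right (m := 1) (by norm_num)).differentiableAt (by norm_num)
    have h2 := (ContinuousLinearMap.apply ℝ (X 0) b).hasFDerivAt.comp u h1.hasFDerivAt
    have h3 := h2.unique (hg.congr_of_eventuallyEq (by
      filter_upwards [h.isOpen.mem_nhds hu] with x hx using hfd x hx b))
    rw [← hg', ← h3]
    rfl
  have hs : IsSymmSndFDerivAt ℝ (fun x => S.derivs F l x w) u :=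
    hg2.isSymmSndFDerivAt (by rw [minSmoothness_of_isRCLikeNormedField])
  rw [← hfd2, ← hfd2]
  exact hs a b

/-- The derivatives of `F` are symmetric. -/
theorem derivs_swap (h : SmoothField S F O C m₀ r₀) {l : ℕ} (hl : l ≤ m₀) (i j : Fin l)
    {u : X (p + 1)} (hu : u ∈ O) (w : Fin l → X (p + 1)) :
    S.derivs F l u (w ∘ Equiv.swap i j) = S.derivs F l u w := by
  induction l generalizing u with
  | zero => exact i.elim0
  | succ l ih =>
    have htail : ∀ (i j : Fin l) (u) (_ : u ∈ O) (w : Fin (l + 1) → X (p + 1)),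
        S.derivs F (l + 1) u (w ∘ Equiv.swap i.succ j.succ) = S.derivs F (l + 1) u w := by
      intro i j u hu w
      have e : w ∘ Equiv.swap i.succ j.succ = Fin.cons (w 0) (Fin.tail w ∘ Equiv.swap i j) := by
        funext x
        refine Fin.cases ?_ (fun y => ?_) x
        · simp [Equiv.swap_apply_of_ne_of_ne (Fin.succ_ne_zero i).symm (Fin.succ_ne_zero j).symm]
        · simp only [Function.comp_apply, Fin.cons_succ, Fin.tail]
          rw [(Fin.succ_injective l).swap_apply]
      rw [e, h.derivs_cons_congr hl (fun u hu => ih (by omega) i j hu (Fin.tail w)) hu,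
        Fin.cons_self_tail]
    have hzero : ∀ (j : Fin l) (u) (_ : u ∈ O) (w : Fin (l + 1) → X (p + 1)),
        S.derivs F (l + 1) u (w ∘ Equiv.swap 0 j.succ) = S.derivs F (l + 1) u w := by
      intro j u hu w
      obtain ⟨l, rfl⟩ : ∃ l', l = l' + 1 := ⟨l - 1, by have := j.2; omega⟩
      have h01 : ∀ w : Fin (l + 2) → X (p + 1), S.derivs F (l + 2) u (w ∘ Equiv.swap 0 1) =
          S.derivs F (l + 2) u w := fun w => by
        have e : w = Fin.cons (w 0) (Fin.cons (w 1) (Fin.tail (Fin.tail w))) := by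
          funext x
          refine Fin.cases rfl (fun y => Fin.cases rfl (fun z => rfl) y) x
        have e' : w ∘ Equiv.swap 0 1 = Fin.cons (w 1) (Fin.cons (w 0) (Fin.tail (Fin.tail w))) := by
          funext x
          refine Fin.cases (by simp) (fun y => Fin.cases ?_ (fun z => ?_) y) x
          · simp
          · have : Equiv.swap (0 : Fin (l + 2)) 1 z.succ.succ = z.succ.succ := by
              refine Equiv.swap_apply_of_ne_of_ne (Fin.succ_ne_zero _) ?_
              rw [← Fin.succ_zero_eq_one]
              exact fun h => Fin.succ_ne_zero z (Fin.succ_injective _ h)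
            simp [this, Fin.tail]
        rw [e', h.derivs_cons_cons hl _ hu, ← e]
      rcases Fin.eq_zero_or_eq_succ j with rfl | ⟨j, rfl⟩
      · exact h01 w
      · have hne : (j.succ.succ : Fin (l + 2)) ≠ 1 := by
          rw [← Fin.succ_zero_eq_one]
          exact fun h => Fin.succ_ne_zero j (Fin.succ_injective _ h)
        have e := Equiv.swap_mul_swap_mul_swap (x := (0 : Fin (l + 2))) (y := 1)
          (z := j.succ.succ) (by simp) (Fin.succ_ne_zero _).symm
        rw [Equiv.swap_comm 0, ← e, Equiv.Perm.coe_mul, Equiv.Perm.coe_mul, ← Function.comp_assoc,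
          ← Function.comp_assoc]
        have h1 := fun w => htail 0 j.succ u hu w
        simp only [Fin.succ_zero_eq_one] at h1
        rw [h1, h01, h1]
    rcases Fin.eq_zero_or_eq_succ i with rfl | ⟨i, rfl⟩
    · rcases Fin.eq_zero_or_eq_succ j with rfl | ⟨j, rfl⟩
      · simp
      · exact hzero j u hu w
    · rcases Fin.eq_zero_or_eq_succ j with rfl | ⟨j, rfl⟩
      · rw [Equiv.swap_comm]; exact hzero i u hu w
      · exact htail i j u hu w

theorem levelBound (h : SmoothField S F O C m₀ r₀) {r l m : ℕ} (h1 : r₀ + 1 ≤ r) (h2 : r ≤ p + 2)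
    (h3 : 2 ≤ l) (h5 : m ≤ m₀) {k : Fin l → ℕ} (h6 : ∀ j, 1 ≤ k j) (h7 : ∑ j, k j = m) :
    LevelBound S F O l (fun j => r - k j) (r - m) := by
  have h4 : l ≤ m := by
    have := Finset.card_nsmul_le_sum Finset.univ k 1 (fun j _ => h6 j)
    simpa [h7] using this
  obtain ⟨G, -, hG⟩ := h.bound r l m h1 h2 h3 h4 h5 k
    (fun j => ⟨h6 j, h7 ▸ Finset.single_le_sum (fun _ _ => Nat.zero_le _) (Finset.mem_univ j)⟩) h7
  exact ⟨C, by linarith [h.one_le_C], fun u hu w a hw =>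
    S.normLE_of_extends (hG u hu).1 hw (hG u hu).2⟩

theorem derivs_lipschitz (h : SmoothField S F O C m₀ r₀) {r l m : ℕ} (h1 : r₀ + 1 ≤ r)
    (h2 : r ≤ p + 2) (h3 : 1 ≤ l) (h5 : m ≤ m₀) {k : Fin l → ℕ} (h6 : ∀ j, 1 ≤ k j)
    (h7 : ∑ j, k j = m) {u v : X (p + 1)} (hu : u ∈ O) (hv : v ∈ O) {w : Fin l → X (p + 1)}
    {a : Fin l → ℝ} (hw : ∀ j, S.NormLE (r - k j) (S.incl (p + 1) (w j)) (a j)) :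
    S.NormLE (r - m - 1) (S.derivs F l u w - S.derivs F l v w) (C * ‖u - v‖ * ∏ j, a j) := by
  have h4 : l ≤ m := by
    have := Finset.card_nsmul_le_sum Finset.univ k 1 (fun j _ => h6 j)
    simpa [h7] using this
  obtain ⟨G, hG, hGL⟩ := h.lipschitz r l m h1 h2 h3 h4 h5 k
    (fun j => ⟨h6 j, h7 ▸ Finset.single_le_sum (fun _ _ => Nat.zero_le _) (Finset.mem_univ j)⟩) h7
  exact S.normLE_sub_of_extends (hG u hu) (hG v hv) hw (hGL u hu v hv)

/-- The derivatives of `F` at smooth arguments. -/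
theorem derivs_mem (h : SmoothField S F O C m₀ r₀) {l q : ℕ} (hl : 2 ≤ l) (hlm : l ≤ m₀)
    (hq : q + l ≤ p + 2) {u : X (p + 1)} (hu : u ∈ O) (w : Fin l → X (p + 1)) :
    ∃ z : X q, S.incl q z = S.derivs F l u w := by
  obtain ⟨K, -, hK⟩ := h.levelBound (r := p + 2) (l := l) (m := l) (by have := h.r₀_le; omega)
    le_rfl hl hlm (k := fun _ => 1) (fun _ => le_rfl) (by simp)
  obtain ⟨z, hz, -⟩ := (hK u hu w (fun j => ‖w j‖)
    (fun j => S.normLE_incl.2 le_rfl)).down (q' := q) (by omega)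
  exact ⟨z, hz⟩

/-- A bound with one argument in `X (p + 1)`, from the Lipschitz continuity of the previous
derivative. -/
theorem levelBound_cons (h : SmoothField S F O C m₀ r₀) {N : ℕ} (hN : N = p + 1)
    {P : ℕ → X 0 →L[ℝ] X N} {KP : ℝ} (hP : S.IsSmoothing N P KP) {r l m : ℕ} (h1 : r₀ + 1 ≤ r)
    (h2 : r ≤ p + 2) (h3 : 1 ≤ l) (hl : l + 1 ≤ m₀) (h5 : m ≤ m₀) {k : Fin l → ℕ}
    (h6 : ∀ j, 1 ≤ k j) (h7 : ∑ j, k j = m) :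
    LevelBound S F O (l + 1) (Fin.cons (p + 1) fun j => r - k j) (r - m - 1) := by
  have h4 : l ≤ m := by
    have := Finset.card_nsmul_le_sum Finset.univ k 1 (fun j _ => h6 j)
    simpa [h7] using this
  have hC := h.one_le_C
  have hKP := hP.one_le
  have hm₀ := h.m₀_le
  refine ⟨KP * C, by positivity, fun u hu w a hw => ?_⟩
  obtain ⟨z, hz⟩ := h.derivs_mem (q := r - m - 1) (show 2 ≤ l + 1 by omega) hl (by omega) hu w
  have hw0 : ‖w 0‖ ≤ a 0 := S.normLE_incl.1 (by simpa using hw 0)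
  have hwt : ∀ j : Fin l, S.NormLE (r - k j) (S.incl (p + 1) (w j.succ)) (a j.succ) := fun j => by
    simpa using hw j.succ
  have hcons : w = Fin.cons (w 0) (Fin.tail w) := (Fin.cons_self_tail w).symm
  have hd := h.hasDerivAt_derivs (s := 0) (δ := w 0) hl (by simpa using hu) (Fin.tail w)
  rw [zero_smul, add_zero, ← hcons] at hd
  have ht := hd.tendsto_slope_zero_right
  simp only [zero_add, zero_smul, add_zero] at ht
  rw [← hz] at ht ⊢
  have := hP.normLE_of_tendsto (q := r - m - 1) (by omega) ht (c := C * ∏ j, a j) ?_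
  · rwa [mul_assoc]
  have hcont : Tendsto (fun s : ℝ => u + s • w 0) (𝓝[>] 0) (𝓝 u) := by
    have : Continuous fun s : ℝ => u + s • w 0 := by fun_prop
    simpa using (this.tendsto 0).mono_left nhdsWithin_le_nhds
  filter_upwards [hcont.eventually (h.isOpen.mem_nhds hu), self_mem_nhdsWithin] with s hs hs0
  have hs0 : 0 < s := hs0
  have := (h.derivs_lipschitz h1 h2 h3 h5 h6 h7 hs hu (w := Fin.tail w) (a := Fin.tail a)
    hwt).smul s⁻¹
  refine this.of_le ?_
  have hpr : 0 ≤ ∏ j, Fin.tail a j := Finset.prod_nonneg fun j _ => (hwt j).nonneg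
  rw [add_sub_cancel_left, norm_smul, Real.norm_eq_abs, abs_inv, Fin.prod_univ_succ]
  have e : |s|⁻¹ * (C * (|s| * ‖w 0‖) * ∏ j, Fin.tail a j) =
      C * (‖w 0‖ * ∏ j, Fin.tail a j) := by
    have : |s| ≠ 0 := by positivity
    field_simp
  rw [e]
  exact mul_le_mul_of_nonneg_left (mul_le_mul_of_nonneg_right hw0 hpr) (by linarith)

theorem levelBound_swap (h : SmoothField S F O C m₀ r₀) {l q : ℕ} (hl : l ≤ m₀) {e : Fin l → ℕ}
    (i j : Fin l) (hb : LevelBound S F O l (e ∘ Equiv.swap i j) q) : LevelBound S F O l e q := by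
  obtain ⟨K, hK, hb⟩ := hb
  refine ⟨K, hK, fun u hu w a hw => ?_⟩
  have := hb u hu (w ∘ Equiv.swap i j) (a ∘ Equiv.swap i j) fun x => hw (Equiv.swap i j x)
  rwa [h.derivs_swap hl i j hu, Function.comp_def a, Equiv.prod_comp (Equiv.swap i j)] at this

/-- A bound with one argument in `X (p + 1)`, in any position. -/
theorem levelBound_of_one (h : SmoothField S F O C m₀ r₀) {N : ℕ} (hN : N = p + 1)
    {P : ℕ → X 0 →L[ℝ] X N} {KP : ℝ} (hP : S.IsSmoothing N P KP) {l : ℕ}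
    (h3 : 2 ≤ l) (hl : l ≤ m₀) {d : Fin l → ℕ} (h6 : ∀ j, 1 ≤ d j)
    (h7 : ∑ j, d j = m₀ + 1) {j₀ : Fin l} (hj : d j₀ = 1) :
    LevelBound S F O l (fun j => p + 2 - d j) (p + 2 - (m₀ + 1)) := by
  obtain ⟨l, rfl⟩ : ∃ l', l = l' + 1 := ⟨l - 1, by omega⟩
  refine h.levelBound_swap hl 0 j₀ ?_
  set k : Fin l → ℕ := fun j => d (Equiv.swap 0 j₀ j.succ) with hk
  have hsum : ∑ j, k j = m₀ := by
    have := Equiv.sum_comp (Equiv.swap 0 j₀) d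
    rw [h7, Fin.sum_univ_succ, Equiv.swap_apply_left, hj] at this
    simp only [hk]
    omega
  have := h.levelBound_cons hN hP (r := p + 2) (l := l) (m := m₀) (by have := h.r₀_le; omega) le_rfl
    (by omega) hl le_rfl (k := k) (fun j => h6 _) hsum
  refine this.mono (fun j => ?_) (by omega)
  refine Fin.cases ?_ (fun i => ?_) j
  · simp [hj]
  · simp [hk]

variable [∀ r, CompleteSpace (X r)]

/-- Second order Taylor expansion of the derivatives of `F`, at smooth arguments. -/
theorem derivs_taylor (h : SmoothField S F O C m₀ r₀) (hc : Convex ℝ O) {l m : ℕ}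
    (h3 : 1 ≤ l) (h5 : m + 1 ≤ m₀) {k : Fin l → ℕ} (h6 : ∀ j, 1 ≤ k j)
    (h7 : ∑ j, k j = m) {u v : X (p + 1)} (hu : u ∈ O) (hv : v ∈ O) {w : Fin l → X (p + 1)}
    {a : Fin l → ℝ} (hw : ∀ j, S.NormLE (p + 2 - k j) (S.incl (p + 1) (w j)) (a j)) :
    S.NormLE (p + 2 - (m + 1) - 1)
      (S.derivs F l v w - S.derivs F l u w - S.derivs F (l + 1) u (Fin.cons (v - u) w))
      (C * ‖v - u‖ ^ 2 * ∏ j, a j) := by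
  have h4 : l ≤ m := by
    have := Finset.card_nsmul_le_sum Finset.univ k 1 (fun j _ => h6 j)
    simpa [h7] using this
  have hC := h.one_le_C
  set δ := v - u with hδ
  set k' : Fin (l + 1) → ℕ := Fin.cons 1 k with hk'
  have hk'1 : ∀ j, 1 ≤ k' j := Fin.cases (by simp [hk']) fun j => by simpa [hk'] using h6 j
  have hk's : ∑ j, k' j = m + 1 := by
    rw [Fin.sum_univ_succ]; simp [hk', h7, add_comm]
  obtain ⟨G, hG, hGL⟩ := h.lipschitz (p + 2) (l + 1) (m + 1) (by have := h.r₀_le; omega) le_rfl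
    (by omega) (by omega) h5 k' (fun j => ⟨hk'1 j, hk's ▸
      Finset.single_le_sum (fun _ _ => Nat.zero_le _) (Finset.mem_univ j)⟩) hk's
  have hkle : ∀ j, p + 2 - k' j ≤ p + 1 := fun j => by have := hk'1 j; omega
  set x : (j : Fin (l + 1)) → X (p + 2 - k' j) := fun j =>
    S.emb (hkle j) ((Fin.cons δ w : Fin (l + 1) → X (p + 1)) j) with hx
  have hxi : ∀ j, S.incl (p + 2 - k' j) (x j) =
      S.incl (p + 1) ((Fin.cons δ w : Fin (l + 1) → X (p + 1)) j) := fun j => S.incl_emb _ _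
  have hpr : ∏ j, ‖x j‖ ≤ ‖δ‖ * ∏ j, a j := by
    rw [Fin.prod_univ_succ]
    refine mul_le_mul (S.norm_emb_le _ _) (Finset.prod_le_prod (fun _ _ => norm_nonneg _)
      fun j _ => ?_) (Finset.prod_nonneg fun _ _ => norm_nonneg _) (norm_nonneg _)
    refine S.normLE_incl.1 ?_
    rw [hxi]
    simpa [hk'] using hw j
  have hseg : ∀ s ∈ Icc (0 : ℝ) 1, u + s • δ ∈ O := fun s hs =>
    hc.add_smul_sub_mem hu hv hs
  have hGx : ∀ z ∈ O, S.incl _ (G z x) = S.derivs F (l + 1) z (Fin.cons δ w) := fun z hz => by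
    rw [hG z hz x _ hxi, S.incl_zero]
  have hGc : ContinuousOn G O := by
    have : LipschitzOnWith C.toNNReal G O := LipschitzOnWith.of_dist_le_mul fun y hy z hz => by
      rw [dist_eq_norm, dist_eq_norm, Real.coe_toNNReal _ (by linarith)]
      exact hGL y hy z hz
    exact this.continuousOn
  have key := S.normLE_of_hasDerivWithinAt
    (g := fun s => S.derivs F l (u + s • δ) w - s • S.derivs F (l + 1) u (Fin.cons δ w))
    (γ := fun s => G (u + s • δ) x - G u x) (c := C * ‖δ‖ * (‖δ‖ * ∏ j, a j)) ?_ ?_ ?_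
  · have e1 : u + δ = v := by rw [hδ]; abel
    simp only [one_smul, zero_smul, add_zero, sub_zero, e1] at key
    rw [sub_right_comm] at key
    refine key.of_le (le_of_eq ?_)
    ring
  · refine ContinuousOn.sub ?_ continuousOn_const
    have h1 : ContinuousOn (fun s : ℝ => u + s • δ) (Icc 0 1) := by fun_prop
    exact (ContinuousMultilinearMap.apply ℝ _ _ x).continuous.comp_continuousOn
      (hGc.comp h1 hseg)
  · intro s hs
    rw [map_sub, hGx _ (hseg s hs), hGx u hu]
    refine ((h.hasDerivAt_derivs (by omega) (hseg s hs) w).sub ?_).hasDerivWithinAt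
    simpa using (hasDerivAt_id s).smul_const (S.derivs F (l + 1) u (Fin.cons δ w))
  · intro s hs
    rw [← sub_apply]
    refine ((G (u + s • δ) - G u).le_opNorm x).trans (mul_le_mul ?_ hpr
      (Finset.prod_nonneg fun _ _ => norm_nonneg _) (by positivity))
    refine (hGL _ (hseg s hs) u hu).trans (mul_le_mul_of_nonneg_left ?_ (by linarith))
    rw [add_sub_cancel_left, norm_smul, Real.norm_eq_abs, abs_of_nonneg hs.1]
    exact mul_le_of_le_one_left (norm_nonneg _) hs.2

end SmoothField

/-! ### Interpolation of bilinear maps -/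

section Ring

theorem interpolation_identity_left {A : Type*} [CommRing A] (r k : A) (hk : (1 + r) * k = 1)
    (n i e : ℕ) :
    r ^ (i + e + 2) * (n *
      ((1 - k ^ (i + e + 2)) ^ (i + e + 1) * (k ^ (i + e + 1) * ((1 - k) * k)))) =
    n * (1 - k) ^ (i + e + 1 + (e + 1)) *
      (∑ j ∈ Finset.range (i + e + 2), k ^ j) ^ (i + e + 1) * k ^ i *
      (k * (1 - k)) * r ^ (i + 1) := by
  rw [← mul_neg_geom_sum]
  have h : r * k = 1 - k := by linear_combination hk
  generalize (∑ j ∈ Finset.range (i + e + 2), k ^ j) = v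
  generalize 1 - k = j at h ⊢
  calc _ = n * (j ^ (i + e + 1) * (r * k) ^ (e + 1)) *
      v ^ (i + e + 1) * k ^ i * (k * j) * r ^ (i + 1) := by ring
    _ = _ := by rw [h, ← pow_add]

theorem interpolation_identity_right {A : Type*} [CommRing A] (r k : A) (hk : (1 + r) * k = 1)
    (i e : ℕ) :
    (1 - k ^ (i + e + 2)) ^ (i + e + 2) =
    (∑ j ∈ Finset.range (i + e + 2), k ^ j) ^ (i + e + 2) * (1 - k) ^ i * k ^ e *
      (k * (1 - k)) * r ^ (e + 1) := by
  rw [← mul_neg_geom_sum]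
  have h : r * k = 1 - k := by linear_combination hk
  generalize (∑ j ∈ Finset.range (i + e + 2), k ^ j) = v
  generalize 1 - k = j at h ⊢
  calc _ = v ^ (i + e + 2) * j ^ (i + 1) * j ^ (e + 1) := by ring
    _ = v ^ (i + e + 2) * j ^ (i + 1) * (r * k) ^ (e + 1) := by rw [h]
    _ = _ := by ring

variable {𝔅 : Type u} [Ring 𝔅]

/-- An identity between polynomials in two commuting elements of a ring can be checked in
commutative rings. -/
theorem exists_commRing_of_commute {r k : 𝔅} (h : Commute r k) :
    ∃ (A : Type u) (_ : CommRing A) (f : A →+* 𝔅) (a b : A), f a = r ∧ f b = k ∧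
      Function.Injective f := by
  have hc : ∀ a ∈ ({r, k} : Set 𝔅), ∀ b ∈ ({r, k} : Set 𝔅), a * b = b * a := by
    rintro a (rfl | rfl) b (rfl | rfl)
    exacts [rfl, h, h.symm, rfl]
  have := Algebra.isMulCommutative_adjoin ℤ hc
  open scoped IsMulCommutative in
  exact ⟨Algebra.adjoin ℤ {r, k}, inferInstance, (Algebra.adjoin ℤ {r, k}).val.toRingHom,
    ⟨r, Algebra.subset_adjoin (by simp)⟩, ⟨k, Algebra.subset_adjoin (by simp)⟩, rfl, rfl,
    Subtype.val_injective⟩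

theorem Commute.interpolation_identity_left {r k : 𝔅} (h : Commute r k) (hk : (1 + r) * k = 1)
    (n i e : ℕ) :
    r ^ (i + e + 2) * (n *
      ((1 - k ^ (i + e + 2)) ^ (i + e + 1) * (k ^ (i + e + 1) * ((1 - k) * k)))) =
    n * (1 - k) ^ (i + e + 1 + (e + 1)) *
      (∑ j ∈ Finset.range (i + e + 2), k ^ j) ^ (i + e + 1) * k ^ i *
      (k * (1 - k)) * r ^ (i + 1) := by
  obtain ⟨A, _, f, a, b, rfl, rfl, hf⟩ := exists_commRing_of_commute h
  have := congrArg f (_root_.interpolation_identity_left a b (hf (by simpa using hk)) n i e)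
  simpa using this

theorem Commute.interpolation_identity_right {r k : 𝔅} (h : Commute r k) (hk : (1 + r) * k = 1)
    (i e : ℕ) :
    (1 - k ^ (i + e + 2)) ^ (i + e + 2) =
    (∑ j ∈ Finset.range (i + e + 2), k ^ j) ^ (i + e + 2) * (1 - k) ^ i * k ^ e *
      (k * (1 - k)) * r ^ (e + 1) := by
  obtain ⟨A, _, f, a, b, rfl, rfl, hf⟩ := exists_commRing_of_commute h
  have := congrArg f (_root_.interpolation_identity_right a b (hf (by simpa using hk)) i e)
  simpa using this

end Ring

theorem HasDerivAt.pow_of_commute {𝔸 : Type*} [NormedRing 𝔸] [NormedAlgebra ℝ 𝔸] {f : ℝ → 𝔸}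
    {f' : 𝔸} {t : ℝ} (hf : HasDerivAt f f' t) (h : Commute (f t) f') (n : ℕ) :
    HasDerivAt (fun t => f t ^ (n + 1)) ((n + 1) * (f t ^ n * f')) t := by
  induction n with
  | zero => simpa using hf
  | succ n ih =>
    have e : f t ^ n * f' * f t = f t ^ (n + 1) * f' := by
      rw [mul_assoc, ← h.eq, ← mul_assoc, pow_succ]
    have e' : (n + 1) * (f t ^ n * f') * f t + f t ^ (n + 1) * f' =
        ((n + 1 : ℕ) + 1) * (f t ^ (n + 1) * f') := by
      push_cast
      rw [mul_assoc, e]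
      noncomm_ring
    rw [← e']
    exact (ih.mul hf).congr_of_eventuallyEq (Eventually.of_forall fun t => pow_succ _ _)

section Abstract

variable {H Z : Type*} [NormedAddCommGroup H] [NormedSpace ℝ H]
  [NormedAddCommGroup Z] [NormedSpace ℝ Z]

theorem hasDerivAt_resolvent [CompleteSpace H] {R : H →L[ℝ] H} {K : ℝ → H →L[ℝ] H}
    (hl : ∀ τ, K τ * (1 + Real.exp τ • R) = 1) (hr : ∀ τ, (1 + Real.exp τ • R) * K τ = 1) (τ : ℝ) :
    HasDerivAt K (-((1 - K τ) * K τ)) τ := by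
  have e : K = fun τ => Ring.inverse (1 + Real.exp τ • R) := by
    funext τ
    exact (Ring.inverse_unit (⟨_, K τ, hr τ, hl τ⟩ : (H →L[ℝ] H)ˣ)).symm
  have h1 : HasDerivAt (fun τ => 1 + Real.exp τ • R) (Real.exp τ • R) τ :=
    ((Real.hasDerivAt_exp τ).smul_const R).const_add 1
  have h2 := (hasFDerivAt_ringInverse (𝕜 := ℝ)
    (⟨_, K τ, hr τ, hl τ⟩ : (H →L[ℝ] H)ˣ)).comp_hasDerivAt τ h1
  have h2' : HasDerivAt K _ τ := h2.congr_of_eventuallyEq (Eventually.of_forall fun τ => by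
    conv_lhs => rw [e]
    rfl)
  refine h2'.congr_deriv ?_
  have h3 : K τ * Real.exp τ • R = 1 - K τ := by
    have := hl τ
    rw [mul_add, mul_one] at this
    rw [eq_sub_iff_add_eq', this]
  simp only [neg_apply, ContinuousLinearMap.mulLeftRight_apply]
  rw [← h3]
  rfl

/-- The resolvents `K τ = (1 + exp τ • R)⁻¹` satisfy a square function estimate. -/
structure SquareFunctionEstimate (R : H →L[ℝ] H) (K : ℝ → H →L[ℝ] H) (κ : ℝ) : Prop where
  one_le : 1 ≤ κ
  inv_left : ∀ τ, K τ * (1 + Real.exp τ • R) = 1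
  inv_right : ∀ τ, (1 + Real.exp τ • R) * K τ = 1
  bound : ∀ τ, ‖K τ‖ ≤ κ
  tendsto : ∀ ξ, Tendsto (fun τ => K τ ξ) atTop (𝓝 0)
  square : ∀ ξ, ∃ ψ ψ' : ℝ → ℝ, (∀ τ, HasDerivAt ψ (ψ' τ) τ) ∧ (∀ τ, 0 ≤ ψ τ) ∧
    (∀ τ, ψ τ ≤ κ * ‖ξ‖ ^ 2) ∧ ∀ τ, ‖(K τ * (1 - K τ)) ξ‖ ^ 2 ≤ ψ' τ

namespace SquareFunctionEstimate

variable {R : H →L[ℝ] H} {K : ℝ → H →L[ℝ] H} {κ : ℝ}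

theorem commute (h : SquareFunctionEstimate R K κ) (τ : ℝ) :
    Commute (Real.exp τ • R) (K τ) := by
  have h1 := (h.inv_right τ).trans (h.inv_left τ).symm
  rw [add_mul, mul_add, one_mul, mul_one] at h1
  exact add_left_cancel h1

theorem hasDerivAt [CompleteSpace H] (h : SquareFunctionEstimate R K κ) (τ : ℝ) :
    HasDerivAt K (-((1 - K τ) * K τ)) τ := hasDerivAt_resolvent h.inv_left h.inv_right τ

/-- The regularization `(1 - K ^ s) ^ s`. -/
noncomputable def _root_.regularize (K : ℝ → H →L[ℝ] H) (s : ℕ) (τ : ℝ) : H →L[ℝ] H :=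
  (1 - K τ ^ s) ^ s

theorem hasDerivAt_regularize [CompleteSpace H] (h : SquareFunctionEstimate R K κ) (s : ℕ)
    (τ : ℝ) : HasDerivAt (regularize K (s + 1))
      ((((s + 1) * (s + 1) : ℕ) : H →L[ℝ] H) * ((1 - K τ ^ (s + 1)) ^ s * (K τ ^ s * ((1 - K τ) * K τ)))) τ := by
  have hc : Commute (K τ) (-((1 - K τ) * K τ)) :=
    (((Commute.one_right _).sub_right (Commute.refl _)).mul_right (Commute.refl _)).neg_right
  have h1 := ((h.hasDerivAt τ).pow_of_commute hc s).const_sub 1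
  have hc' : Commute (K τ) (-((s + 1) * (K τ ^ s * -((1 - K τ) * K τ)))) :=
    (((Nat.cast_commute s (K τ)).symm.add_right (Commute.one_right _)).mul_right
      (((Commute.refl _).pow_right s).mul_right hc)).neg_right
  have h2 := h1.pow_of_commute (((Commute.one_left _).sub_left (hc'.pow_left (s + 1)))) s
  refine h2.congr_deriv ?_
  have hs : Commute ((1 - K τ ^ (s + 1)) ^ s) ((s : H →L[ℝ] H) + 1) :=
    ((Nat.cast_commute s _).symm.add_right (Commute.one_right _))
  simp only [mul_neg, neg_neg, Nat.cast_mul, Nat.cast_add, Nat.cast_one]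
  rw [mul_assoc, ← mul_assoc _ ((s : H →L[ℝ] H) + 1), hs.eq, mul_assoc]

end SquareFunctionEstimate

/-- A family of operators that is bounded uniformly in the parameter. -/
def UnifBdd (f : ℝ → H →L[ℝ] H) : Prop := ∃ C, 0 ≤ C ∧ ∀ τ, ‖f τ‖ ≤ C

theorem UnifBdd.mul {f g : ℝ → H →L[ℝ] H} (hf : UnifBdd f) (hg : UnifBdd g) :
    UnifBdd fun τ => f τ * g τ :=
  let ⟨C, hC, hf⟩ := hf
  let ⟨C', _, hg⟩ := hg
  ⟨C * C', by positivity, fun τ => (norm_mul_le _ _).trans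
    (mul_le_mul (hf τ) (hg τ) (norm_nonneg _) hC)⟩

theorem UnifBdd.const (f : H →L[ℝ] H) : UnifBdd fun _ : ℝ => f := ⟨‖f‖, norm_nonneg _, fun _ => le_rfl⟩

theorem UnifBdd.add {f g : ℝ → H →L[ℝ] H} (hf : UnifBdd f) (hg : UnifBdd g) :
    UnifBdd fun τ => f τ + g τ :=
  let ⟨C, _, hf⟩ := hf
  let ⟨C', _, hg⟩ := hg
  ⟨C + C', by positivity, fun τ => (norm_add_le _ _).trans (add_le_add (hf τ) (hg τ))⟩

theorem UnifBdd.one_sub {f : ℝ → H →L[ℝ] H} (hf : UnifBdd f) : UnifBdd fun τ => 1 - f τ :=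
  let ⟨C, _, hf⟩ := hf
  ⟨‖(1 : H →L[ℝ] H)‖ + C, by positivity, fun τ => (norm_sub_le _ _).trans
    (add_le_add le_rfl (hf τ))⟩

theorem UnifBdd.pow {f : ℝ → H →L[ℝ] H} (hf : UnifBdd f) (n : ℕ) : UnifBdd fun τ => f τ ^ n := by
  induction n with
  | zero => simpa using UnifBdd.const 1
  | succ n ih => simp only [pow_succ]; exact ih.mul hf

theorem UnifBdd.sum {f : ℕ → ℝ → H →L[ℝ] H} (hf : ∀ j, UnifBdd (f j)) (n : ℕ) :
    UnifBdd fun τ => ∑ j ∈ Finset.range n, f j τ := by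
  induction n with
  | zero => simpa using UnifBdd.const 0
  | succ n ih => simp only [Finset.sum_range_succ]; exact ih.add (hf n)

namespace SquareFunctionEstimate

variable {R : H →L[ℝ] H} {K : ℝ → H →L[ℝ] H} {κ : ℝ}

theorem unifBdd (h : SquareFunctionEstimate R K κ) : UnifBdd K :=
  ⟨κ, zero_le_one.trans h.one_le, h.bound⟩

theorem regularize_eq (h : SquareFunctionEstimate R K κ) (i e : ℕ) : ∃ U, UnifBdd U ∧ ∀ τ,
    regularize K (i + e + 2) τ = Real.exp τ ^ (e + 1) • (U τ * (K τ * (1 - K τ)) * R ^ (e + 1)) := by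
  refine ⟨fun τ => (∑ j ∈ Finset.range (i + e + 2), K τ ^ j) ^ (i + e + 2) * (1 - K τ) ^ i *
    K τ ^ e, ?_, fun τ => ?_⟩
  · exact (((UnifBdd.sum (fun j => h.unifBdd.pow j) _).pow _).mul (h.unifBdd.one_sub.pow _)).mul
      (h.unifBdd.pow _)
  · rw [regularize, (h.commute τ).interpolation_identity_right (h.inv_right τ), smul_pow,
      mul_smul_comm]

theorem deriv_regularize_eq [CompleteSpace H] (h : SquareFunctionEstimate R K κ) (i e : ℕ) :
    ∃ U : ℝ → H →L[ℝ] H, UnifBdd U ∧ ∀ τ,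
    Real.exp τ ^ (e + 1) • (R ^ (i + e + 2) * deriv (regularize K (i + e + 2)) τ) =
      U τ * (K τ * (1 - K τ)) * R ^ (i + 1) := by
  refine ⟨fun τ => ((i + e + 1 + 1) * (i + e + 1 + 1) : ℕ) * (1 - K τ) ^ (i + e + 1 + (e + 1)) *
      (∑ j ∈ Finset.range (i + e + 2), K τ ^ j) ^ (i + e + 1) * K τ ^ i, ?_, fun τ => ?_⟩
  · exact (((UnifBdd.const _).mul (h.unifBdd.one_sub.pow _)).mul
      ((UnifBdd.sum (fun j => h.unifBdd.pow j) _).pow _)).mul (h.unifBdd.pow _)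
  · rw [(h.hasDerivAt_regularize (i + e + 1) τ).deriv]
    have := (h.commute τ).interpolation_identity_left (h.inv_right τ)
      ((i + e + 1 + 1) * (i + e + 1 + 1)) i e
    rw [smul_pow, smul_pow, mul_smul_comm, smul_mul_assoc] at this
    have h2 : Real.exp τ ^ (i + e + 2) = Real.exp τ ^ (i + 1) * Real.exp τ ^ (e + 1) := by ring
    rw [h2, mul_smul] at this
    exact smul_right_injective (H →L[ℝ] H) (pow_pos (Real.exp_pos τ) (i + 1)).ne' this

theorem regularize_commute (h : SquareFunctionEstimate R K κ) (s : ℕ) (τ : ℝ) :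
    Commute R (regularize K s τ) := by
  have h1 : Commute R (K τ) := by
    have h2 := (h.commute τ).smul_left (Real.exp τ)⁻¹
    rwa [smul_smul, inv_mul_cancel₀ (Real.exp_pos τ).ne', one_smul] at h2
  exact ((Commute.one_right _).sub_right (h1.pow_right _)).pow_right _

theorem regularize_tendsto (h : SquareFunctionEstimate R K κ) (s : ℕ) (ξ : H) :
    Tendsto (fun τ => regularize K (s + 1) τ ξ) atTop (𝓝 ξ) := by
  obtain ⟨C, -, hC⟩ := h.unifBdd.pow s
  obtain ⟨U, ⟨C', -, hC'⟩, hU⟩ : ∃ U, UnifBdd U ∧ ∀ τ,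
      regularize K (s + 1) τ = 1 - U τ * K τ ^ (s + 1) := by
    refine ⟨fun τ => ∑ j ∈ Finset.range (s + 1), (1 - K τ ^ (s + 1)) ^ j,
      UnifBdd.sum (fun j => (h.unifBdd.pow _).one_sub.pow _) _, fun τ => ?_⟩
    have := geom_sum_mul_neg (1 - K τ ^ (s + 1)) (s + 1)
    rw [sub_sub_cancel] at this
    rw [this, regularize, sub_sub_cancel]
  have h0 : Tendsto (fun τ => C' * (C * ‖K τ ξ‖)) atTop (𝓝 0) := by
    simpa using ((h.tendsto ξ).norm.const_mul C).const_mul C'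
  rw [tendsto_iff_norm_sub_tendsto_zero]
  refine squeeze_zero (fun _ => norm_nonneg _) (fun τ => ?_) h0
  rw [hU, sub_apply, one_apply_eq_self, sub_sub_cancel_left, norm_neg, pow_succ]
  simp only [mul_apply_eq_comp]
  have h1 : ‖(K τ ^ s) (K τ ξ)‖ ≤ C * ‖K τ ξ‖ := ContinuousLinearMap.le_of_opNorm_le _ (hC τ) _
  refine ((U τ).le_opNorm _).trans (mul_le_mul (hC' τ) h1 (norm_nonneg _) ?_)
  exact (norm_nonneg _).trans (hC' τ)

theorem _root_.norm_bilin_le_of_sq {B : H →L[ℝ] H →L[ℝ] Z} {R₁ R₂ : H →L[ℝ] H} {C : ℝ}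
    (h : ∀ ξ η, ‖B ξ η‖ ≤ C * (‖R₁ ξ‖ ^ 2 + ‖R₂ η‖ ^ 2)) (ξ η : H) :
    ‖B ξ η‖ ≤ 2 * |C| * ‖R₁ ξ‖ * ‖R₂ η‖ := by
  have key : ∀ δ : ℝ, 0 < δ → ‖B ξ η‖ ≤ 2 * |C| * (‖R₁ ξ‖ + δ) * (‖R₂ η‖ + δ) := fun δ hδ => by
    have ha : 0 < ‖R₁ ξ‖ + δ := by positivity
    have hb : 0 < ‖R₂ η‖ + δ := by positivity
    have h1 := h ((‖R₁ ξ‖ + δ)⁻¹ • ξ) ((‖R₂ η‖ + δ)⁻¹ • η)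
    simp only [map_smul, smul_apply, norm_smul, norm_inv, Real.norm_eq_abs, abs_of_pos ha,
      abs_of_pos hb] at h1
    have ha1 : (‖R₁ ξ‖ + δ)⁻¹ * ‖R₁ ξ‖ ≤ 1 := by
      rw [inv_mul_le_iff₀ ha]; linarith
    have hb1 : (‖R₂ η‖ + δ)⁻¹ * ‖R₂ η‖ ≤ 1 := by
      rw [inv_mul_le_iff₀ hb]; linarith
    have h2 : C * (((‖R₁ ξ‖ + δ)⁻¹ * ‖R₁ ξ‖) ^ 2 + ((‖R₂ η‖ + δ)⁻¹ * ‖R₂ η‖) ^ 2) ≤ |C| * 2 := by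
      refine mul_le_mul (le_abs_self C) ?_ (by positivity) (abs_nonneg C)
      have := pow_le_one₀ (n := 2) (by positivity) ha1
      have := pow_le_one₀ (n := 2) (by positivity) hb1
      linarith
    have h3 := h1.trans h2
    rw [inv_mul_le_iff₀ (by positivity), inv_mul_le_iff₀ (by positivity)] at h3
    linarith
  have hlim : Tendsto (fun δ : ℝ => 2 * |C| * (‖R₁ ξ‖ + δ) * (‖R₂ η‖ + δ)) (𝓝[>] 0)
      (𝓝 (2 * |C| * (‖R₁ ξ‖ + 0) * (‖R₂ η‖ + 0))) := by
    have : Continuous fun δ : ℝ => 2 * |C| * (‖R₁ ξ‖ + δ) * (‖R₂ η‖ + δ) := by fun_prop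
    exact (this.tendsto 0).mono_left nhdsWithin_le_nhds
  rw [add_zero, add_zero] at hlim
  refine ge_of_tendsto hlim ?_
  filter_upwards [self_mem_nhdsWithin] with δ hδ using key δ hδ

/-- A bilinear map that is bounded by `‖ξ‖ * ‖R ^ (i + e + 2) η‖` and by
`‖R ^ (i + e + 2) ξ‖ * ‖η‖` is bounded by the intermediate products. -/
theorem interpolate [CompleteSpace H] (h : SquareFunctionEstimate R K κ) (i e : ℕ) :
    ∃ C, 0 ≤ C ∧ ∀ c, 0 ≤ c → ∀ B : H →L[ℝ] H →L[ℝ] Z,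
      (∀ ξ η, ‖B ξ η‖ ≤ c * (‖ξ‖ * ‖(R ^ (i + e + 2)) η‖)) →
      (∀ ξ η, ‖B ξ η‖ ≤ c * (‖(R ^ (i + e + 2)) ξ‖ * ‖η‖)) →
      ∀ ξ η, ‖B ξ η‖ ≤ C * c * ‖(R ^ (i + 1)) ξ‖ * ‖(R ^ (e + 1)) η‖ := by
  obtain ⟨U₁, ⟨C₁, hC₁, hU₁⟩, e₁⟩ := h.regularize_eq i e
  obtain ⟨U₂, ⟨C₂, hC₂, hU₂⟩, e₂⟩ := h.regularize_eq e i
  obtain ⟨V₁, ⟨D₁, hD₁, hV₁⟩, f₁⟩ := h.deriv_regularize_eq i e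
  obtain ⟨V₂, ⟨D₂, hD₂, hV₂⟩, f₂⟩ := h.deriv_regularize_eq e i
  obtain ⟨C₃, hC₃, hKJ⟩ := h.unifBdd.mul h.unifBdd.one_sub
  obtain ⟨C₄, hC₄, hP⟩ : UnifBdd (regularize K (i + e + 2)) := (h.unifBdd.pow _).one_sub.pow _
  rw [add_comm e i] at e₂ f₂
  set s := i + e + 2 with hs
  set P := regularize K s with hPdef
  have hd : ∀ τ, HasDerivAt P (deriv P τ) τ := fun τ =>
    (h.hasDerivAt_regularize (i + e + 1) τ).differentiableAt.hasDerivAt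
  set κ' := D₁ * C₁ + C₂ * D₂ with hκ'
  set M := C₂ * C₃ * (‖R ^ (i + 1)‖ * C₄) with hM
  have hκ := h.one_le
  refine ⟨2 * (M + κ' * κ), by positivity, fun c hc B hB₁ hB₂ ξ η => ?_⟩
  have key : ∀ ξ η, ‖B ξ η‖ ≤ (c * (M + κ' * κ)) *
      (‖(R ^ (i + 1)) ξ‖ ^ 2 + ‖(R ^ (e + 1)) η‖ ^ 2) := by
    intro ξ η
    set ξ₁ := (R ^ (i + 1)) ξ with hξ₁
    set η₁ := (R ^ (e + 1)) η with hη₁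
    obtain ⟨ψ, ψ', hψ, hψ0, hψκ, hψs⟩ := h.square ξ₁
    obtain ⟨φ, φ', hφ, hφ0, hφκ, hφs⟩ := h.square η₁
    have hE : ∀ τ n, 0 < Real.exp τ ^ n := fun τ n => pow_pos (Real.exp_pos τ) n
    have hUn : ∀ (U : H →L[ℝ] H) (c : ℝ) (z : H), ‖U‖ ≤ c → ‖U z‖ ≤ c * ‖z‖ := fun U c z h =>
      ContinuousLinearMap.le_of_opNorm_le _ h _
    have b₁ : ∀ τ, ‖P τ η‖ ≤ Real.exp τ ^ (e + 1) * (C₁ * ‖(K τ * (1 - K τ)) η₁‖) := fun τ => by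
      rw [e₁, smul_apply, norm_smul, Real.norm_eq_abs, abs_of_pos (hE _ _)]
      exact mul_le_mul_of_nonneg_left (hUn _ _ _ (hU₁ τ)) (hE _ _).le
    have b₂ : ∀ τ, ‖P τ ξ‖ ≤ Real.exp τ ^ (i + 1) * (C₂ * ‖(K τ * (1 - K τ)) ξ₁‖) := fun τ => by
      rw [e₂, smul_apply, norm_smul, Real.norm_eq_abs, abs_of_pos (hE _ _)]
      exact mul_le_mul_of_nonneg_left (hUn _ _ _ (hU₂ τ)) (hE _ _).le
    have d₁ : ∀ τ, Real.exp τ ^ (e + 1) * ‖(R ^ s) (deriv P τ ξ)‖ ≤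
        D₁ * ‖(K τ * (1 - K τ)) ξ₁‖ := fun τ => by
      have := congrArg (fun T : H →L[ℝ] H => ‖T ξ‖) (f₁ τ)
      simp only [smul_apply, norm_smul, Real.norm_eq_abs, abs_of_pos (hE _ _)] at this
      refine (le_of_eq this).trans (hUn _ _ _ (hV₁ τ))
    have d₂ : ∀ τ, Real.exp τ ^ (i + 1) * ‖(R ^ s) (deriv P τ η)‖ ≤
        D₂ * ‖(K τ * (1 - K τ)) η₁‖ := fun τ => by
      have := congrArg (fun T : H →L[ℝ] H => ‖T η‖) (f₂ τ)
      simp only [smul_apply, norm_smul, Real.norm_eq_abs, abs_of_pos (hE _ _)] at this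
      refine (le_of_eq this).trans (hUn _ _ _ (hV₂ τ))
    have hΦ : ∀ τ, HasDerivAt (fun τ => B (P τ ξ) (P τ η))
        (B (deriv P τ ξ) (P τ η) + B (P τ ξ) (deriv P τ η)) τ := fun τ => by
      have h1 : HasDerivAt (fun τ => P τ ξ) (deriv P τ ξ) τ := (ContinuousLinearMap.apply ℝ H ξ).hasFDerivAt.comp_hasDerivAt τ (hd τ)
      have h2 : HasDerivAt (fun τ => P τ η) (deriv P τ η) τ := (ContinuousLinearMap.apply ℝ H η).hasFDerivAt.comp_hasDerivAt τ (hd τ)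
      exact (B.hasFDerivAt.comp_hasDerivAt τ h1).clm_apply h2
    have hΦ' : ∀ τ, ‖B (deriv P τ ξ) (P τ η) + B (P τ ξ) (deriv P τ η)‖ ≤
        c * κ' * (ψ' τ + φ' τ) := fun τ => by
      set x := ‖(K τ * (1 - K τ)) ξ₁‖
      set y := ‖(K τ * (1 - K τ)) η₁‖
      have hx : 0 ≤ x := norm_nonneg _
      have hy : 0 ≤ y := norm_nonneg _
      have g₁ : ‖(R ^ s) (deriv P τ ξ)‖ * ‖P τ η‖ ≤ (D₁ * x) * (C₁ * y) := by
        calc _ ≤ ‖(R ^ s) (deriv P τ ξ)‖ * (Real.exp τ ^ (e + 1) * (C₁ * y)) :=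
              mul_le_mul_of_nonneg_left (b₁ τ) (norm_nonneg _)
          _ = (Real.exp τ ^ (e + 1) * ‖(R ^ s) (deriv P τ ξ)‖) * (C₁ * y) := by ring
          _ ≤ _ := mul_le_mul_of_nonneg_right (d₁ τ) (by positivity)
      have g₂ : ‖P τ ξ‖ * ‖(R ^ s) (deriv P τ η)‖ ≤ (C₂ * x) * (D₂ * y) := by
        calc _ ≤ (Real.exp τ ^ (i + 1) * (C₂ * x)) * ‖(R ^ s) (deriv P τ η)‖ :=
              mul_le_mul_of_nonneg_right (b₂ τ) (norm_nonneg _)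
          _ = (C₂ * x) * (Real.exp τ ^ (i + 1) * ‖(R ^ s) (deriv P τ η)‖) := by ring
          _ ≤ _ := mul_le_mul_of_nonneg_left (d₂ τ) (by positivity)
      have hxy : x * y ≤ ψ' τ + φ' τ := by
        nlinarith [hψs τ, hφs τ, sq_nonneg (x - y), mul_nonneg hx hy]
      calc _ ≤ c * (‖(R ^ s) (deriv P τ ξ)‖ * ‖P τ η‖) + c * (‖P τ ξ‖ * ‖(R ^ s) (deriv P τ η)‖) :=
            (norm_add_le _ _).trans (add_le_add (hB₂ _ _) (hB₁ _ _))
        _ ≤ c * ((D₁ * x) * (C₁ * y)) + c * ((C₂ * x) * (D₂ * y)) :=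
            add_le_add (mul_le_mul_of_nonneg_left g₁ hc) (mul_le_mul_of_nonneg_left g₂ hc)
        _ = c * κ' * (x * y) := by rw [hκ']; ring
        _ ≤ _ := mul_le_mul_of_nonneg_left hxy (by positivity)
    have h0 : ‖B (P 0 ξ) (P 0 η)‖ ≤ c * M * (‖ξ₁‖ * ‖η₁‖) := by
      have h1 := b₂ 0
      rw [Real.exp_zero, one_pow, one_mul] at h1
      have h2 : (R ^ s) (P 0 η) = (R ^ (i + 1)) (P 0 η₁) := by
        have : R ^ s * P 0 = R ^ (i + 1) * (P 0 * R ^ (e + 1)) := by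
          rw [← ((h.regularize_commute s 0).pow_left (e + 1)).eq, ← mul_assoc, ← pow_add, hs]
          congr 2
          ring
        exact congrArg (fun T : H →L[ℝ] H => T η) this
      have h3 : ‖(R ^ s) (P 0 η)‖ ≤ ‖R ^ (i + 1)‖ * (C₄ * ‖η₁‖) := by
        rw [h2]
        exact ((R ^ (i + 1)).le_opNorm _).trans
          (mul_le_mul_of_nonneg_left (hUn _ _ _ (hP 0)) (norm_nonneg _))
      have h4 : ‖P 0 ξ‖ ≤ C₂ * (C₃ * ‖ξ₁‖) :=
        h1.trans (mul_le_mul_of_nonneg_left (hUn _ _ _ (hKJ 0)) hC₂)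
      calc _ ≤ c * (‖P 0 ξ‖ * ‖(R ^ s) (P 0 η)‖) := hB₁ _ _
        _ ≤ c * ((C₂ * (C₃ * ‖ξ₁‖)) * (‖R ^ (i + 1)‖ * (C₄ * ‖η₁‖))) := by
            refine mul_le_mul_of_nonneg_left (mul_le_mul h4 h3 (norm_nonneg _) ?_) hc
            positivity
        _ = _ := by rw [hM]; ring
    have hbd : ∀ τ, 0 ≤ τ → ‖B (P τ ξ) (P τ η)‖ ≤
        c * (M + κ' * κ) * (‖ξ₁‖ ^ 2 + ‖η₁‖ ^ 2) := fun τ hτ => by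
      have := image_norm_le_of_norm_deriv_right_le_deriv_boundary (a := 0) (b := τ)
        (f := fun τ => B (P τ ξ) (P τ η))
        (B := fun τ => c * M * (‖ξ₁‖ * ‖η₁‖) + c * κ' * (ψ τ + φ τ - (ψ 0 + φ 0)))
        (fun τ _ => (hΦ τ).continuousAt.continuousWithinAt)
        (fun τ _ => (hΦ τ).hasDerivWithinAt) (by simpa using h0)
        (fun τ => ((((hψ τ).add (hφ τ)).sub_const _).const_mul _).const_add _)
        (fun τ _ => hΦ' τ) ⟨hτ, le_rfl⟩
      refine this.trans ?_
      have h1 : ψ τ + φ τ - (ψ 0 + φ 0) ≤ κ * ‖ξ₁‖ ^ 2 + κ * ‖η₁‖ ^ 2 := by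
        linarith [hψκ τ, hφκ τ, hψ0 0, hφ0 0]
      have h2 : ‖ξ₁‖ * ‖η₁‖ ≤ ‖ξ₁‖ ^ 2 + ‖η₁‖ ^ 2 := by
        nlinarith [sq_nonneg (‖ξ₁‖ - ‖η₁‖), norm_nonneg ξ₁, norm_nonneg η₁]
      calc _ ≤ c * M * (‖ξ₁‖ ^ 2 + ‖η₁‖ ^ 2) + c * κ' * (κ * ‖ξ₁‖ ^ 2 + κ * ‖η₁‖ ^ 2) :=
            add_le_add (mul_le_mul_of_nonneg_left h2 (by positivity))
              (mul_le_mul_of_nonneg_left h1 (by positivity))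
        _ = _ := by ring
    have hlim : Tendsto (fun τ => B (P τ ξ) (P τ η)) atTop (𝓝 (B ξ η)) :=
      tendsto_clm_apply ((B.continuous.tendsto ξ).comp (h.regularize_tendsto (i + e + 1) ξ))
        (h.regularize_tendsto (i + e + 1) η)
    refine le_of_tendsto hlim.norm ?_
    filter_upwards [eventually_ge_atTop 0] with τ hτ using hbd τ hτ
  refine (norm_bilin_le_of_sq key ξ η).trans (le_of_eq ?_)
  rw [abs_of_nonneg (by positivity)]
  ring

end SquareFunctionEstimate

end Abstract

/-! ### Interpolation in the scale -/

namespace DissipativeFamily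

variable {X : ℕ → Type u} [∀ r, NormedAddCommGroup (X r)] [∀ r, InnerProductSpace ℝ (X r)]
  {S : HilbertScale X} {Z : Type*} [NormedAddCommGroup Z] [NormedSpace ℝ Z]
  {D : DissipativeFamily S Z} [∀ r, CompleteSpace (X r)]

theorem dn_R_sub_dn_R {u : Z} (hu : u ∈ D.O) {c c' : ℝ} (hc : D.β < c) (hc' : D.β < c')
    (y : X 0) : S.dn 0 (D.R c' 0 u y) - S.dn 0 (D.R c 0 u y) =
      (c - c') • S.dn 0 (D.R c' 0 u (S.dn 0 (D.R c 0 u y))) := by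
  have hN : 0 < D.N := D.one_le_N
  have h1 : D.R c' 0 u (D.T c' 0 u (D.R c 0 u y)) = D.R c 0 u y := R_T hN hu hc' _
  have h2 : D.T c' 0 u (D.R c 0 u y) = y - (c - c') • S.dn 0 (D.R c 0 u y) := by
    have h3 := T_R hN hu hc y
    rw [T_apply] at h3 ⊢
    nth_rewrite 3 [← h3]
    module
  rw [h2, map_sub, map_smul, sub_eq_iff_eq_add] at h1
  rw [← map_sub, ← map_smul]
  congr 1
  exact sub_eq_iff_eq_add.2 (h1.trans (add_comm _ _))

/-- The square function estimate for the resolvents of `A(u)`. -/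
theorem exists_squareFunctionEstimate {u : Z} (hu : u ∈ D.O) :
    ∃ K κ, SquareFunctionEstimate (D.J D.lam₀ 0 u) K κ := by
  have hN : 0 < D.N := D.one_le_N
  set c₀ := D.lam₀ with hc₀
  have hc₀1 : 1 ≤ c₀ := lam_pos le_rfl
  have hβ₀ : D.β < c₀ := β_lt le_rfl
  set c : ℝ → ℝ := fun τ => c₀ * (1 + Real.exp τ) with hcdef
  have hcc : ∀ τ, c₀ ≤ c τ := fun τ => by
    have := Real.exp_pos τ
    simp only [hcdef]; nlinarith
  have hβ : ∀ τ, D.β < c τ := fun τ => β_lt (hcc τ)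
  set r : ℝ → X 0 →L[ℝ] X 0 := fun c => (S.dn 0).comp (D.R c 0 u) with hr
  have hrr : ∀ c c', D.β < c → D.β < c' → r c' - r c = (c - c') • (r c' * r c) :=
    fun c c' hc hc' => ContinuousLinearMap.ext fun y => dn_R_sub_dn_R hu hc hc' y
  have hJ : ∀ c, D.J c 0 u = c • r c := fun c => rfl
  set K : ℝ → X 0 →L[ℝ] X 0 := fun τ => 1 - (Real.exp τ * c₀) • r (c τ) with hK
  have hl : ∀ τ, K τ * (1 + Real.exp τ • D.J c₀ 0 u) = 1 := fun τ => by
    have h1 := hrr c₀ (c τ) hβ₀ (hβ τ)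
    have e : c₀ - c τ = -(c₀ * Real.exp τ) := by simp only [hcdef]; ring
    rw [e] at h1
    rw [hJ, hK]
    simp only [mul_add, sub_mul, mul_one, one_mul, smul_mul_assoc, mul_smul_comm]
    have h2 : r c₀ = r (c τ) + (c₀ * Real.exp τ) • (r (c τ) * r c₀) := by
      rw [neg_smul] at h1
      rw [← neg_eq_iff_eq_neg.2 h1]; abel
    nth_rewrite 1 [h2]
    module
  have hr' : ∀ τ, (1 + Real.exp τ • D.J c₀ 0 u) * K τ = 1 := fun τ => by
    have h1 := hrr (c τ) c₀ (hβ τ) hβ₀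
    have e : c τ - c₀ = c₀ * Real.exp τ := by simp only [hcdef]; ring
    rw [e] at h1
    rw [hJ, hK]
    simp only [add_mul, mul_sub, mul_one, one_mul, smul_mul_assoc, mul_smul_comm]
    have h2 : r c₀ = r (c τ) + (c₀ * Real.exp τ) • (r c₀ * r (c τ)) := by rw [← h1]; abel
    nth_rewrite 1 [h2]
    module
  have hd := hasDerivAt_resolvent hl hr'
  obtain ⟨KJ, hKJ1, hKJ⟩ := norm_J_le (Nat.zero_le D.N) (D := D)
  have hJK : ∀ τ, 1 - K τ = (Real.exp τ / (1 + Real.exp τ)) • D.J (c τ) 0 u := fun τ => by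
    have := Real.exp_pos τ
    rw [hJ, smul_smul, hK, sub_sub_cancel]
    congr 1
    simp only [hcdef]
    field_simp
  have hfrac : ∀ τ : ℝ, |Real.exp τ / (1 + Real.exp τ)| ≤ 1 := fun τ => by
    have := Real.exp_pos τ
    rw [abs_of_pos (by positivity), div_le_one (by positivity)]
    linarith
  have hJb : ∀ τ, ‖1 - K τ‖ ≤ KJ := fun τ => by
    rw [hJK, norm_smul, Real.norm_eq_abs]
    exact (mul_le_mul (hfrac τ) (hKJ u hu _ (hcc τ)) (norm_nonneg _) zero_le_one).trans
      (one_mul KJ).le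
  have hcomm : ∀ τ, K τ * (1 - K τ) = (1 - K τ) * K τ := fun τ => by
    generalize K τ = k
    noncomm_ring
  have hCL := D.one_le_CL
  refine ⟨K, ‖(1 : X 0 →L[ℝ] X 0)‖ + KJ + D.CL ^ 2 * ‖D.form0 u‖ * KJ ^ 2, ?_, hl, hr', ?_, ?_, ?_⟩
  · have : 0 ≤ D.CL ^ 2 * ‖D.form0 u‖ * KJ ^ 2 := by positivity
    linarith [norm_nonneg (1 : X 0 →L[ℝ] X 0)]
  · intro τ
    have h1 : ‖K τ‖ ≤ ‖(1 : X 0 →L[ℝ] X 0)‖ + KJ := by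
      have := (norm_sub_le (1 : X 0 →L[ℝ] X 0) (1 - K τ)).trans (add_le_add le_rfl (hJb τ))
      rwa [sub_sub_cancel] at this
    have : 0 ≤ D.CL ^ 2 * ‖D.form0 u‖ * KJ ^ 2 := by positivity
    linarith
  · intro ξ
    have hct : Tendsto c atTop atTop :=
      (tendsto_atTop_add_const_left _ 1 Real.tendsto_exp_atTop).const_mul_atTop (by linarith)
    have h1 := J_tendsto (Nat.zero_le D.N) hct hu tendsto_const_nhds
      (tendsto_const_nhds (x := ξ) (f := (atTop : Filter ℝ)))
    have h2 : Tendsto (fun τ => Real.exp τ / (1 + Real.exp τ)) atTop (𝓝 1) := by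
      have h3 : Tendsto (fun τ : ℝ => 1 - (1 + Real.exp τ)⁻¹) atTop (𝓝 (1 - 0)) :=
        (tendsto_inv_atTop_zero.comp
          (tendsto_atTop_add_const_left _ 1 Real.tendsto_exp_atTop)).const_sub 1
      rw [sub_zero] at h3
      refine h3.congr fun τ => ?_
      have := Real.exp_pos τ
      field_simp
      ring
    have h3 := (h2.smul h1).const_sub ξ
    rw [one_smul, sub_self] at h3
    refine h3.congr fun τ => ?_
    have := congrArg (fun T : X 0 →L[ℝ] X 0 => T ξ) (hJK τ)
    simp only [sub_apply, one_apply_eq_self, smul_apply] at this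
    rw [← this, sub_sub_cancel]
  · intro ξ
    refine ⟨fun τ => D.CL ^ 2 * D.form0 u ((1 - K τ) ξ) ((1 - K τ) ξ),
      fun τ => D.CL ^ 2 * (D.form0 u (((1 - K τ) * K τ) ξ) ((1 - K τ) ξ) +
        D.form0 u ((1 - K τ) ξ) (((1 - K τ) * K τ) ξ)), fun τ => ?_, fun τ => ?_, fun τ => ?_,
        fun τ => ?_⟩
    · have h1 : HasDerivAt (fun τ => (1 - K τ) ξ) (((1 - K τ) * K τ) ξ) τ := by
        have := (ContinuousLinearMap.apply ℝ (X 0) ξ).hasFDerivAt.comp_hasDerivAt τ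
          ((hd τ).const_sub 1)
        rwa [neg_neg] at this
      exact ((((D.form0 u).hasFDerivAt.comp_hasDerivAt τ h1).clm_apply h1)).const_mul _
    · exact mul_nonneg (by positivity) (form0_nonneg hu _)
    · have h1 : ‖(1 - K τ) ξ‖ ≤ KJ * ‖ξ‖ := ContinuousLinearMap.le_of_opNorm_le _ (hJb τ) ξ
      have h2 := (le_abs_self _).trans ((D.form0 u).le_opNorm₂ ((1 - K τ) ξ) ((1 - K τ) ξ))
      have h3 : ‖(1 - K τ) ξ‖ * ‖(1 - K τ) ξ‖ ≤ (KJ * ‖ξ‖) * (KJ * ‖ξ‖) :=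
        mul_le_mul h1 h1 (norm_nonneg _) (by positivity)
      calc _ ≤ D.CL ^ 2 * (‖D.form0 u‖ * ((KJ * ‖ξ‖) * (KJ * ‖ξ‖))) := by
            refine mul_le_mul_of_nonneg_left (h2.trans ?_) (by positivity)
            rw [mul_assoc]
            exact mul_le_mul_of_nonneg_left h3 (norm_nonneg (D.form0 u))
        _ = D.CL ^ 2 * ‖D.form0 u‖ * KJ ^ 2 * ‖ξ‖ ^ 2 := by ring
        _ ≤ _ := by
            refine mul_le_mul_of_nonneg_right ?_ (by positivity)
            linarith [norm_nonneg (1 : X 0 →L[ℝ] X 0)]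
    · have hcz : ((1 - K τ) * K τ) ξ = K τ ((1 - K τ) ξ) := by rw [← hcomm]; rfl
      beta_reduce
      rw [hcomm, form0_symm hu ((1 - K τ) ξ), hcz]
      set z := (1 - K τ) ξ
      have hpos : 0 ≤ D.form0 u (K τ z) ((1 - K τ) z) := by
        set w := D.R (c τ) 0 u z with hw
        have hz : c τ • S.dn 0 w - D.A 0 u w = z := T_R hN hu (hβ τ) z
        have hKz : K τ z = c₀ • S.dn 0 w - D.A 0 u w := by
          have : K τ z = z - (Real.exp τ * c₀) • S.dn 0 w := rfl
          rw [this, ← hz]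
          simp only [hcdef]
          module
        have hJz : (1 - K τ) z = (Real.exp τ * c₀) • S.dn 0 w := by
          rw [hK, sub_sub_cancel]; rfl
        rw [hKz, hJz]
        simp only [map_sub, map_smul, sub_apply, smul_apply, smul_eq_mul]
        have h1 := form0_dissipative hu w
        have h2 := mul_le_mul_of_nonneg_right hβ₀.le (form0_nonneg hu (S.dn 0 w))
        have h3 := Real.exp_pos τ
        exact mul_nonneg (by positivity) (by linarith)
      have h1 := norm_sq_le_form0 hu (K τ z)
      have h2 : D.form0 u (K τ z) z = D.form0 u (K τ z) (K τ z) +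
          D.form0 u (K τ z) ((1 - K τ) z) := by
        rw [← map_add]; congr 1; simp
      have h3 := form0_nonneg hu (K τ z)
      have h4 : 0 < D.CL ^ 2 := by positivity
      nlinarith

theorem smooth_surjective {u : Z} (hu : u ∈ D.O) {k : ℕ} (hk : k ≤ D.N) :
    Function.Surjective (D.smooth D.lam₀ u k) := by
  have hc : D.β < D.lam₀ := β_lt le_rfl
  have hc1 : (1 : ℝ) ≤ D.lam₀ := lam_pos le_rfl
  induction k with
  | zero => exact fun x => ⟨x, rfl⟩
  | succ k ih =>
    intro x
    obtain ⟨ξ, hξ⟩ := ih (Nat.le_of_succ_le hk) ((D.lam₀)⁻¹ • D.T D.lam₀ k u x)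
    refine ⟨ξ, ?_⟩
    change D.lam₀ • D.R D.lam₀ k u (D.smooth D.lam₀ u k ξ) = x
    rw [hξ, map_smul, R_T hk hu hc, smul_smul, mul_inv_cancel₀ (by linarith), one_smul]

theorem exists_norm_le_smooth {u : Z} (hu : u ∈ D.O) {k : ℕ} (hk : k ≤ D.N) :
    ∃ C, 0 ≤ C ∧ ∀ ξ, ‖ξ‖ ≤ C * ‖D.smooth D.lam₀ u k ξ‖ := by
  have hc : D.β < D.lam₀ := β_lt le_rfl
  have hc1 : (1 : ℝ) ≤ D.lam₀ := lam_pos le_rfl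
  induction k with
  | zero => exact ⟨1, zero_le_one, fun ξ => (one_mul _).ge⟩
  | succ k ih =>
    obtain ⟨C, hC, h⟩ := ih (Nat.le_of_succ_le hk)
    refine ⟨C * ‖D.T D.lam₀ k u‖, by positivity, fun ξ => (h ξ).trans ?_⟩
    rw [mul_assoc]
    refine mul_le_mul_of_nonneg_left ?_ hC
    have e : D.T D.lam₀ k u (D.smooth D.lam₀ u (k + 1) ξ) = D.lam₀ • D.smooth D.lam₀ u k ξ := by
      change D.T D.lam₀ k u (D.lam₀ • D.R D.lam₀ k u (D.smooth D.lam₀ u k ξ)) = _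
      rw [map_smul, T_R hk hu hc]
    have h1 := (D.T D.lam₀ k u).le_opNorm (D.smooth D.lam₀ u (k + 1) ξ)
    rw [e, norm_smul, Real.norm_eq_abs, abs_of_pos (by linarith)] at h1
    exact (le_mul_of_one_le_left (norm_nonneg _) hc1).trans h1

theorem emb_smooth {u : Z} (hu : u ∈ D.O) (j : ℕ) (hj : j ≤ D.N) (ξ : X 0) :
    S.emb (Nat.sub_le D.N j) (D.smooth D.lam₀ u D.N ξ) =
      D.smooth D.lam₀ u (D.N - j) ((D.J D.lam₀ 0 u ^ j) ξ) := by
  have hc : D.β < D.lam₀ := β_lt le_rfl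
  apply S.incl_injective
  rw [S.incl_emb, incl_smooth le_rfl hu hc, incl_smooth (Nat.sub_le _ _) hu hc,
    FunLike.coe_pow_eq_iterate, ← Function.iterate_add_apply, Nat.sub_add_cancel hj]

/-- Interpolation of bilinear maps on `X N`. -/
theorem interpolate {Y : Type*} [NormedAddCommGroup Y] [NormedSpace ℝ Y] {u : Z} (hu : u ∈ D.O)
    (i e : ℕ) (h : i + e + 2 ≤ D.N) :
    ∃ C, 0 ≤ C ∧ ∀ c, 0 ≤ c → ∀ B : X D.N →L[ℝ] X D.N →L[ℝ] Y,
      (∀ x y, ‖B x y‖ ≤ c * (‖x‖ * ‖S.emb (Nat.sub_le D.N (i + e + 2)) y‖)) →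
      (∀ x y, ‖B x y‖ ≤ c * (‖S.emb (Nat.sub_le D.N (i + e + 2)) x‖ * ‖y‖)) →
      ∀ x y, ‖B x y‖ ≤ C * c *
        ‖S.emb (Nat.sub_le D.N (i + 1)) x‖ * ‖S.emb (Nat.sub_le D.N (e + 1)) y‖ := by
  obtain ⟨K, κ, hK⟩ := exists_squareFunctionEstimate hu
  obtain ⟨C, hC, hint⟩ := hK.interpolate (Z := Y) i e
  obtain ⟨C₁, hC₁, h₁⟩ := exists_norm_le_smooth hu (k := D.N - (i + 1)) (Nat.sub_le _ _)
  obtain ⟨C₂, hC₂, h₂⟩ := exists_norm_le_smooth hu (k := D.N - (e + 1)) (Nat.sub_le _ _)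
  set P := D.smooth D.lam₀ u D.N
  set P' := D.smooth D.lam₀ u (D.N - (i + e + 2))
  set R := D.J D.lam₀ 0 u
  refine ⟨C * (‖P‖ * ‖P'‖) * (C₁ * C₂), by positivity, fun c hc B hB₁ hB₂ x y => ?_⟩
  obtain ⟨ξ, rfl⟩ := smooth_surjective hu le_rfl x
  obtain ⟨η, rfl⟩ := smooth_surjective hu le_rfl y
  have key := hint (c * (‖P‖ * ‖P'‖)) (by positivity) (B.bilinearComp P P) (fun ξ η => ?_)
    (fun ξ η => ?_) ξ η
  · rw [emb_smooth hu _ (by omega), emb_smooth hu _ (by omega)]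
    refine key.trans ?_
    calc _ ≤ C * (c * (‖P‖ * ‖P'‖)) * (C₁ * ‖D.smooth D.lam₀ u (D.N - (i + 1)) ((R ^ (i + 1)) ξ)‖) *
        (C₂ * ‖D.smooth D.lam₀ u (D.N - (e + 1)) ((R ^ (e + 1)) η)‖) := by
          refine mul_le_mul (mul_le_mul_of_nonneg_left (h₁ _) (by positivity)) (h₂ _)
            (norm_nonneg _) (by positivity)
      _ = _ := by ring
  · refine (hB₁ (P ξ) (P η)).trans ?_
    rw [emb_smooth hu _ h]
    have h3 := P.le_opNorm ξ
    have h4 := P'.le_opNorm ((R ^ (i + e + 2)) η)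
    calc _ ≤ c * ((‖P‖ * ‖ξ‖) * (‖P'‖ * ‖(R ^ (i + e + 2)) η‖)) :=
          mul_le_mul_of_nonneg_left (mul_le_mul h3 h4 (norm_nonneg _) (by positivity)) hc
      _ = _ := by ring
  · refine (hB₂ (P ξ) (P η)).trans ?_
    rw [emb_smooth hu _ h]
    have h3 := P.le_opNorm η
    have h4 := P'.le_opNorm ((R ^ (i + e + 2)) ξ)
    calc _ ≤ c * ((‖P'‖ * ‖(R ^ (i + e + 2)) ξ‖) * (‖P‖ * ‖η‖)) :=
          mul_le_mul_of_nonneg_left (mul_le_mul h4 h3 (norm_nonneg _) (by positivity)) hc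
      _ = _ := by ring

end DissipativeFamily

/-! ### Bounds with one argument of lower regularity -/

variable {X : ℕ → Type u} [∀ r, NormedAddCommGroup (X r)] [∀ r, InnerProductSpace ℝ (X r)]

theorem DissipativeFamily.interpolate_of_eq {S : HilbertScale X} {Z : Type*}
    [NormedAddCommGroup Z] [NormedSpace ℝ Z] [∀ r, CompleteSpace (X r)]
    {D : DissipativeFamily S Z} {N : ℕ} (hN : D.N = N)
    {Y : Type*} [NormedAddCommGroup Y] [NormedSpace ℝ Y] {u : Z} (hu : u ∈ D.O)
    (i e : ℕ) (h : i + e + 2 ≤ N) :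
    ∃ C, 0 ≤ C ∧ ∀ c, 0 ≤ c → ∀ B : X N →L[ℝ] X N →L[ℝ] Y,
      (∀ x y, ‖B x y‖ ≤ c * (‖x‖ * ‖S.emb (Nat.sub_le N (i + e + 2)) y‖)) →
      (∀ x y, ‖B x y‖ ≤ c * (‖S.emb (Nat.sub_le N (i + e + 2)) x‖ * ‖y‖)) →
      ∀ x y, ‖B x y‖ ≤ C * c *
        ‖S.emb (Nat.sub_le N (i + 1)) x‖ * ‖S.emb (Nat.sub_le N (e + 1)) y‖ := by
  subst hN
  exact DissipativeFamily.interpolate hu i e h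

theorem HilbertScale.exists_bilinear_update (S : HilbertScale X) {l s q : ℕ}
    (D : ContinuousMultilinearMap ℝ (fun _ : Fin l => X s) (X 0)) {a b : Fin l} (hab : a ≠ b)
    (w : Fin l → X s) {c : ℝ}
    (h : ∀ x y, S.NormLE q (D (Function.update (Function.update w a x) b y)) (c * ‖x‖ * ‖y‖)) :
    ∃ B : X s →L[ℝ] X s →L[ℝ] X q, ∀ x y,
      S.incl q (B x y) = D (Function.update (Function.update w a x) b y) := by
  choose B hB hBc using h
  refine ⟨LinearMap.mkContinuous₂ (LinearMap.mk₂ ℝ B ?_ ?_ ?_ ?_) c (fun x y => hBc x y),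
    fun x y => hB x y⟩
  · intro x x' y
    apply S.incl_injective q
    simp only [map_add, hB, Function.update_comm hab]
    exact D.map_update_add _ _ _ _
  · intro t x y
    apply S.incl_injective q
    simp only [map_smul, hB, Function.update_comm hab]
    exact D.map_update_smul _ _ _ _
  · intro x y y'
    apply S.incl_injective q
    simp only [map_add, hB]
    exact D.map_update_add _ _ _ _
  · intro t x y
    apply S.incl_injective q
    simp only [map_smul, hB]
    exact D.map_update_smul _ _ _ _

namespace SmoothField

variable {S : HilbertScale X} {p : ℕ} {F : X (p + 1) → X p} {O : Set (X (p + 1))}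
  {C : ℝ} {m₀ r₀ : ℕ} {Z : Type*} [NormedAddCommGroup Z] [NormedSpace ℝ Z]
  {D : DissipativeFamily S Z} [∀ r, CompleteSpace (X r)]

theorem levelBound_of_two_le (h : SmoothField S F O C m₀ r₀) (hN : D.N = p + 1) {u₀ : Z}
    (hu₀ : u₀ ∈ D.O) {l : ℕ} (h3 : 2 ≤ l) (hl : l ≤ m₀) {d : Fin l → ℕ} (h6 : ∀ j, 2 ≤ d j)
    (h7 : ∑ j, d j = m₀ + 1) :
    LevelBound S F O l (fun j => p + 2 - d j) (p + 2 - (m₀ + 1)) := by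
  have hm₀ := h.m₀_le
  have hr₀ := h.r₀_le
  obtain ⟨P, KP, hP⟩ : ∃ (P : ℕ → X 0 →L[ℝ] X (p + 1)) (K : ℝ), S.IsSmoothing (p + 1) P K := by
    have := D.exists_isSmoothing hu₀
    rwa [hN] at this
  set a : Fin l := ⟨0, by omega⟩ with ha
  set b : Fin l := ⟨1, by omega⟩ with hb
  have hab : a ≠ b := by simp [ha, hb]
  obtain ⟨i, hi⟩ : ∃ i, d a = i + 2 := ⟨d a - 2, by have := h6 a; omega⟩
  obtain ⟨e, he⟩ : ∃ e, d b = e + 2 := ⟨d b - 2, by have := h6 b; omega⟩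
  have hsum : ∀ x y : ℕ, x + y = d a + d b →
      ∑ j, Function.update (Function.update d a x) b y j = m₀ + 1 := fun x y hxy => by
    rw [Finset.sum_update_of_mem (Finset.mem_univ b), Finset.sum_update_of_mem (by simpa using hab)]
    have h1 := Finset.sum_update_of_mem (Finset.mem_univ b) d (d b)
    rw [Function.update_eq_self, h7] at h1
    have h2 := Finset.sum_update_of_mem (s := Finset.univ \ {b}) (i := a) (by simpa using hab) d (d a)
    rw [Function.update_eq_self] at h2
    rw [h2] at h1
    omega
  have hle : d a + d b ≤ m₀ + 1 := by
    rw [← hsum (d a) (d b) rfl, Finset.sum_update_of_mem (Finset.mem_univ b),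
      Finset.sum_update_of_mem (by simpa using hab)]
    omega
  have hone : ∀ x y : ℕ, 1 ≤ x → 1 ≤ y → ∀ j, 1 ≤ Function.update (Function.update d a x) b y j := by
    intro x y hx hy j
    by_cases hjb : j = b
    · subst hjb; simpa using hy
    by_cases hja : j = a
    · subst hja; simpa [hjb] using hx
    · have := h6 j
      simp [hjb, hja]; omega
  obtain ⟨K₁, hK₁, hB₁⟩ := h.levelBound_of_one rfl hP h3 hl (hone 1 (i + e + 3) le_rfl (by omega))
    (hsum _ _ (by omega)) (j₀ := a) (by simp [hab])
  obtain ⟨K₂, hK₂, hB₂⟩ := h.levelBound_of_one rfl hP h3 hl (hone (i + e + 3) 1 (by omega) le_rfl)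
    (hsum _ _ (by omega)) (j₀ := b) (by simp)
  set q := p + 2 - (m₀ + 1) with hq
  obtain ⟨C₁, hC₁, hint⟩ := D.interpolate_of_eq hN (Y := X q) hu₀ i e (by omega)
  refine ⟨C₁ * (K₁ + K₂), by positivity, fun u hu w α hw => ?_⟩
  set Q := ∏ x ∈ (Finset.univ \ {b}) \ {a}, α x with hQ
  have hQ0 : 0 ≤ Q := Finset.prod_nonneg fun j _ => (hw j).nonneg
  have hprod : ∀ x y : ℝ, ∏ j, Function.update (Function.update α a x) b y j = y * (x * Q) :=
    fun x y => by
      rw [Finset.prod_update_of_mem (Finset.mem_univ b),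
        Finset.prod_update_of_mem (by simpa using hab)]
  have hlev : ∀ (dx dy : ℕ) (x y : X (p + 1)) (αx αy : ℝ),
      S.NormLE (p + 2 - dx) (S.incl (p + 1) x) αx → S.NormLE (p + 2 - dy) (S.incl (p + 1) y) αy →
      ∀ j, S.NormLE (p + 2 - Function.update (Function.update d a dx) b dy j)
        (S.incl (p + 1) (Function.update (Function.update w a x) b y j))
        (Function.update (Function.update α a αx) b αy j) := by
    intro dx dy x y αx αy hx hy j
    by_cases hjb : j = b
    · subst hjb; simpa using hy
    by_cases hja : j = a
    · subst hja; simpa [hjb] using hx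
    · simpa [hjb, hja] using hw j
  have hlow : ∀ x : X (p + 1), S.NormLE (p + 2 - (i + e + 3)) (S.incl (p + 1) x)
      ‖S.emb (Nat.sub_le (p + 1) (i + e + 2)) x‖ := fun x => by
    rw [show p + 2 - (i + e + 3) = p + 1 - (i + e + 2) by omega, ← S.incl_emb (Nat.sub_le _ _)]
    exact S.normLE_incl.2 le_rfl
  have hfull : ∀ x : X (p + 1), S.NormLE (p + 2 - 1) (S.incl (p + 1) x) ‖x‖ := fun x =>
    S.normLE_incl.2 le_rfl
  have hb1 : ∀ x y, S.NormLE q (S.derivs F l u (Function.update (Function.update w a x) b y))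
      ((K₁ + K₂) * Q * (‖x‖ * ‖S.emb (Nat.sub_le (p + 1) (i + e + 2)) y‖)) := fun x y => by
    have := hB₁ u hu _ _ (hlev 1 (i + e + 3) x y _ _ (hfull x) (hlow y))
    rw [hprod] at this
    refine this.of_le ?_
    have hy := norm_nonneg (S.emb (Nat.sub_le (p + 1) (i + e + 2)) y)
    have : 0 ≤ K₂ * (‖S.emb (Nat.sub_le (p + 1) (i + e + 2)) y‖ * (‖x‖ * Q)) := by positivity
    linarith
  have hb2 : ∀ x y, S.NormLE q (S.derivs F l u (Function.update (Function.update w a x) b y))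
      ((K₁ + K₂) * Q * (‖S.emb (Nat.sub_le (p + 1) (i + e + 2)) x‖ * ‖y‖)) := fun x y => by
    have := hB₂ u hu _ _ (hlev (i + e + 3) 1 x y _ _ (hlow x) (hfull y))
    rw [hprod] at this
    refine this.of_le ?_
    have : 0 ≤ K₁ * (‖y‖ * (‖S.emb (Nat.sub_le (p + 1) (i + e + 2)) x‖ * Q)) := by positivity
    linarith
  obtain ⟨B, hB⟩ := S.exists_bilinear_update (q := q) (S.derivs F l u) hab w
    (c := (K₁ + K₂) * Q) fun x y => (hb1 x y).of_le (by
      rw [mul_assoc _ ‖x‖]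
      exact mul_le_mul_of_nonneg_left (mul_le_mul_of_nonneg_left (S.norm_emb_le _ y)
        (norm_nonneg x)) (by positivity))
  have key := hint ((K₁ + K₂) * Q) (by positivity) B
    (fun x y => by have := hb1 x y; rwa [← hB, S.normLE_incl] at this)
    (fun x y => by have := hb2 x y; rwa [← hB, S.normLE_incl] at this) (w a) (w b)
  have e1 : Function.update (Function.update w a (w a)) b (w b) = w := by simp
  rw [← S.normLE_incl, hB, e1] at key
  refine key.of_le ?_
  have h1 : ‖S.emb (Nat.sub_le (p + 1) (i + 1)) (w a)‖ ≤ α a := by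
    have := hw a
    beta_reduce at this
    rwa [show p + 2 - d a = p + 1 - (i + 1) by omega, ← S.incl_emb (Nat.sub_le _ _),
      S.normLE_incl] at this
  have h2 : ‖S.emb (Nat.sub_le (p + 1) (e + 1)) (w b)‖ ≤ α b := by
    have := hw b
    beta_reduce at this
    rwa [show p + 2 - d b = p + 1 - (e + 1) by omega, ← S.incl_emb (Nat.sub_le _ _),
      S.normLE_incl] at this
  have h3 := hprod (α a) (α b)
  rw [Function.update_eq_self, Function.update_eq_self] at h3
  rw [h3]
  calc _ ≤ C₁ * ((K₁ + K₂) * Q) * α a * α b :=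
        mul_le_mul (mul_le_mul_of_nonneg_left h1 (by positivity)) h2 (norm_nonneg _)
          (mul_nonneg (by positivity) (hw a).nonneg)
    _ = _ := by ring

/-- The bounds of the derivatives of `F` as multilinear operators on the top part of the scale,
with a loss of up to `m₀ + 1` degrees. -/
theorem levelBound_top (h : SmoothField S F O C m₀ r₀) (hN : D.N = p + 1) {u₀ : Z}
    (hu₀ : u₀ ∈ D.O) {l : ℕ} (h3 : 2 ≤ l) (hl : l ≤ m₀) {d : Fin l → ℕ} (h6 : ∀ j, 1 ≤ d j)
    (h7 : ∑ j, d j ≤ m₀ + 1) :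
    LevelBound S F O l (fun j => p + 2 - d j) (p + 2 - ∑ j, d j) := by
  rcases Nat.lt_or_ge m₀ (∑ j, d j) with h8 | h8
  · rw [show ∑ j, d j = m₀ + 1 by omega]
    by_cases h9 : ∃ j, d j = 1
    · obtain ⟨j, hj⟩ := h9
      obtain ⟨P, KP, hP⟩ : ∃ (P : ℕ → X 0 →L[ℝ] X (p + 1)) (K : ℝ), S.IsSmoothing (p + 1) P K := by
        have := D.exists_isSmoothing hu₀
        rwa [hN] at this
      exact h.levelBound_of_one rfl hP h3 hl h6 (by omega) hj
    · push Not at h9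
      exact h.levelBound_of_two_le hN hu₀ h3 hl (fun j => by have := h6 j; have := h9 j; omega)
        (by omega)
  · exact h.levelBound (by have := h.r₀_le; omega) le_rfl h3 h8 h6 rfl

/-- The bound with one argument, the one with index `j₀`, in a space of lower regularity. -/
theorem levelBound_weak (h : SmoothField S F O C m₀ r₀) (hN : D.N = p + 1) {u₀ : Z}
    (hu₀ : u₀ ∈ D.O) {r l m : ℕ} (h1 : r₀ ≤ r) (h2 : r ≤ p + 1)
    (h3 : 2 ≤ l) (h5 : m ≤ m₀) {k : Fin l → ℕ} (h6 : ∀ j, 1 ≤ k j) (h7 : ∑ j, k j = m)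
    (hcase : m < m₀ ∨ r₀ < r ∨ r = p + 1) (j₀ : Fin l) :
    LevelBound S F O l (fun j => r + 1 - (k j + (Pi.single j₀ 1 : Fin l → ℕ) j)) (r - m) := by
  have h4 : l ≤ m := by
    have := Finset.card_nsmul_le_sum Finset.univ k 1 (fun j _ => h6 j)
    simpa [h7] using this
  have hs : ∑ j, (k j + (Pi.single j₀ 1 : Fin l → ℕ) j) = m + 1 := by
    rw [Finset.sum_add_distrib, h7, Finset.sum_pi_single']; simp
  rw [show r - m = r + 1 - (m + 1) by omega]
  rcases hcase with hc | hc | rfl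
  · exact h.levelBound (r := r + 1) (by omega) (by omega) h3 (by omega)
      (fun j => (h6 j).trans (Nat.le_add_right _ _)) hs
  · rw [show r + 1 - (m + 1) = r - m by omega]
    refine (h.levelBound (r := r) hc (by omega) h3 h5 h6 h7).mono (fun j => ?_) le_rfl
    have : (Pi.single j₀ 1 : Fin l → ℕ) j ≤ 1 := by
      by_cases hj : j = j₀
      · subst hj; simp
      · simp [hj]
    omega
  · have := h.levelBound_top hN hu₀ h3 (by omega) (d := fun j => k j + (Pi.single j₀ 1 : Fin l → ℕ) j)
      (fun j => (h6 j).trans (Nat.le_add_right _ _)) (by omega)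
    rwa [hs] at this

end SmoothField

/-! ### Expansions of multilinear maps in the scale -/

variable {X : ℕ → Type u} [∀ r, NormedAddCommGroup (X r)] [∀ r, InnerProductSpace ℝ (X r)]

namespace HilbertScale

variable {S : HilbertScale X}

/-- The subspace `X q` of the base space. -/
def level (S : HilbertScale X) (q : ℕ) : Submodule ℝ (X 0) :=
  LinearMap.range (S.incl q : X q →ₗ[ℝ] X 0)

theorem NormLE.mem {q : ℕ} {z : X 0} {c : ℝ} (h : S.NormLE q z c) : z ∈ S.level q :=
  let ⟨v, hv, _⟩ := h; ⟨v, hv⟩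

theorem incl_mem_level {q : ℕ} (v : X q) : S.incl q v ∈ S.level q := ⟨v, rfl⟩

theorem level_mono {q q' : ℕ} (h : q ≤ q') {z : X 0} (hz : z ∈ S.level q') : z ∈ S.level q :=
  let ⟨v, hv⟩ := hz
  ⟨S.emb h v, (S.incl_emb h v).trans hv⟩

theorem IsSmoothing.normLE_of_tendsto' {N : ℕ} {P : ℕ → X 0 →L[ℝ] X N} {K : ℝ}
    (hP : S.IsSmoothing N P K) {q : ℕ} (hq : q ≤ N) {ι : Type*} {l : Filter ι} [l.NeBot]
    {z : ι → X 0} {z₀ : X 0} {c : ℝ} (hz₀ : z₀ ∈ S.level q) (hz : Tendsto z l (𝓝 z₀))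
    (h : ∀ i, S.NormLE q (z i) c) : S.NormLE q z₀ (K * c) := by
  obtain ⟨v, rfl⟩ := hz₀
  exact hP.normLE_of_tendsto hq hz (Eventually.of_forall h)

variable {l s q R : ℕ} (f : ContinuousMultilinearMap ℝ (fun _ : Fin l => X s) (X 0))
  {d : Fin l → ℕ} {K η : ℝ} {w w' μ : Fin l → X s} {a : Fin l → ℝ}

theorem normLE_multilinear_sub (hK : 0 ≤ K)
    (hf : ∀ (i : Fin l) (w : Fin l → X s) (a : Fin l → ℝ),
      (∀ j, S.NormLE (R - (d j + (Pi.single i 1 : Fin l → ℕ) j)) (S.incl s (w j)) (a j)) →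
        S.NormLE q (f w) (K * ∏ j, a j)) (hη : 0 ≤ η)
    (hw : ∀ j, S.NormLE (R - d j) (S.incl s (w j)) (a j))
    (hw' : ∀ j, S.NormLE (R - d j) (S.incl s (w' j)) (a j))
    (hd : ∀ j, S.NormLE (R - (d j + 1)) (S.incl s (w' j - w j)) (η * a j)) :
    S.NormLE q (f w' - f w) (4 ^ l * K * η * ∏ j, a j) := by
  have ha : ∀ j, 0 ≤ a j := fun j => (hw j).nonneg
  have hpr : 0 ≤ ∏ j, a j := Finset.prod_nonneg fun j _ => ha j
  have e : f w' - f w = ∑ t ∈ Finset.univ.erase (Finset.univ : Finset (Fin l)),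
      f (t.piecewise w (w' - w)) := by
    have h1 := f.toMultilinearMap.map_add_univ w (w' - w)
    rw [add_sub_cancel] at h1
    rw [Finset.sum_erase_eq_sub (Finset.mem_univ _), Finset.piecewise_univ]
    exact congrArg (· - f w) h1
  have hterm : ∀ t ∈ Finset.univ.erase (Finset.univ : Finset (Fin l)),
      S.NormLE q (f (t.piecewise w (w' - w))) (K * (η * (2 ^ l * ∏ j, a j))) := by
    intro t ht
    obtain ⟨i, hi⟩ : ∃ i, i ∉ t := by
      by_contra hcon
      push Not at hcon
      exact (Finset.mem_erase.1 ht).1 (Finset.eq_univ_iff_forall.2 hcon)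
    have := hf i (t.piecewise w (w' - w)) (fun j => (if j = i then η else 1) * (2 * a j)) ?_
    · rwa [Finset.prod_mul_distrib, Finset.prod_mul_distrib, Finset.prod_ite_eq' Finset.univ i,
        if_pos (Finset.mem_univ i), Finset.prod_const, Finset.card_univ, Fintype.card_fin] at this
    intro j
    by_cases hji : j = i
    · subst hji
      simp only [Pi.single_eq_same, hi, not_false_eq_true, Finset.piecewise_eq_of_notMem, if_true,
        Pi.sub_apply]
      exact (hd j).of_le (mul_le_mul_of_nonneg_left (by linarith [ha j]) hη)
    · simp only [Pi.single_eq_of_ne hji, add_zero, if_neg hji, one_mul]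
      by_cases hjt : j ∈ t
      · rw [Finset.piecewise_eq_of_mem _ _ _ hjt]
        exact (hw j).of_le (by linarith [ha j])
      · rw [Finset.piecewise_eq_of_notMem _ _ _ hjt, Pi.sub_apply, map_sub]
        exact ((hw' j).sub (hw j)).of_le (by linarith)
  rw [e]
  refine (normLE_sum _ hterm).of_le ?_
  rw [Finset.sum_const, nsmul_eq_mul]
  have hcard : ((Finset.univ.erase (Finset.univ : Finset (Fin l))).card : ℝ) ≤ 2 ^ l := by
    have h1 : (Finset.univ.erase (Finset.univ : Finset (Fin l))).card ≤ 2 ^ l :=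
      (Finset.card_erase_le).trans (by simp)
    exact_mod_cast h1
  calc _ ≤ (2 : ℝ) ^ l * (K * (η * (2 ^ l * ∏ j, a j))) :=
        mul_le_mul_of_nonneg_right hcard (by positivity)
    _ = ((2 : ℝ) * 2) ^ l * K * η * ∏ j, a j := by rw [mul_pow]; ring
    _ = _ := by norm_num

theorem normLE_multilinear_taylor (hK : 0 ≤ K)
    (hf : ∀ (i i' : Fin l) (w : Fin l → X s) (a : Fin l → ℝ),
      (∀ j, S.NormLE (R - (d j + (Pi.single i 1 : Fin l → ℕ) j + (Pi.single i' 1 : Fin l → ℕ) j))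
        (S.incl s (w j)) (a j)) → S.NormLE q (f w) (K * ∏ j, a j)) (hη : 0 ≤ η)
    (hw : ∀ j, S.NormLE (R - d j) (S.incl s (w j)) (a j))
    (hw' : ∀ j, S.NormLE (R - d j) (S.incl s (w' j)) (a j))
    (hd : ∀ j, S.NormLE (R - (d j + 1)) (S.incl s (w' j - w j)) (η * a j))
    (hμ : ∀ j, S.NormLE (R - (d j + 2)) (S.incl s (w' j - w j - μ j)) (η ^ 2 * a j)) :
    S.NormLE q (f w' - f w - ∑ j, f (Function.update w j (μ j)))
      ((4 ^ l + l) * K * η ^ 2 * ∏ j, a j) := by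
  have ha : ∀ j, 0 ≤ a j := fun j => (hw j).nonneg
  have hpr : 0 ≤ ∏ j, a j := Finset.prod_nonneg fun j _ => ha j
  have e : f w' - f w - ∑ j, f (Function.update w j (μ j)) =
      ∑ t : Finset (Fin l) with 2 ≤ t.card, f (t.piecewise (w' - w) w) +
      ∑ j, f (Function.update w j (w' j - w j - μ j)) := by
    have h1 := f.toMultilinearMap.map_add_eq_map_add_linearDeriv_add w (w' - w)
    rw [add_sub_cancel, MultilinearMap.linearDeriv_apply] at h1
    simp only [f.map_update_sub, Finset.sum_sub_distrib]
    change f w' = f w + _ + _ at h1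
    rw [h1]
    simp only [Pi.sub_apply, ContinuousMultilinearMap.coe_coe, MultilinearMap.map_update_sub, Finset.sum_sub_distrib]
    abel
  have h1 : S.NormLE q (∑ t : Finset (Fin l) with 2 ≤ t.card, f (t.piecewise (w' - w) w))
      (∑ t : Finset (Fin l) with 2 ≤ t.card, K * (η * (η * (2 ^ l * ∏ j, a j)))) := by
    refine normLE_sum _ fun t ht => ?_
    obtain ⟨i, hi, i', hi', hii⟩ := Finset.one_lt_card.1 (Finset.mem_filter.1 ht).2
    have := hf i i' (t.piecewise (w' - w) w)
      (fun j => (if j = i then η else 1) * ((if j = i' then η else 1) * (2 * a j))) ?_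
    · rwa [Finset.prod_mul_distrib, Finset.prod_mul_distrib, Finset.prod_mul_distrib,
        Finset.prod_ite_eq' Finset.univ i, Finset.prod_ite_eq' Finset.univ i',
        if_pos (Finset.mem_univ i), if_pos (Finset.mem_univ i'), Finset.prod_const,
        Finset.card_univ, Fintype.card_fin] at this
    intro j
    have hd' : S.NormLE (R - (d j + 1)) (S.incl s (w' j - w j)) (η * (2 * a j)) :=
      (hd j).of_le (mul_le_mul_of_nonneg_left (by linarith [ha j]) hη)
    by_cases hji : j = i
    · subst hji
      simpa [Pi.single_eq_of_ne hii, hii, hi, -map_sub] using hd'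
    by_cases hji' : j = i'
    · subst hji'
      simpa [Pi.single_eq_of_ne hii.symm, hii.symm, hi', -map_sub] using hd'
    simp only [Pi.single_eq_of_ne hji, Pi.single_eq_of_ne hji', add_zero, if_neg hji, if_neg hji',
      one_mul]
    by_cases hjt : j ∈ t
    · rw [Finset.piecewise_eq_of_mem _ _ _ hjt, Pi.sub_apply, map_sub]
      exact ((hw' j).sub (hw j)).of_le (by linarith)
    · rw [Finset.piecewise_eq_of_notMem _ _ _ hjt]
      exact (hw j).of_le (by linarith [ha j])
  have h2 : S.NormLE q (∑ j, f (Function.update w j (w' j - w j - μ j)))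
      (∑ _j : Fin l, K * (η ^ 2 * ∏ j, a j)) := by
    refine normLE_sum _ fun i _ => ?_
    have := hf i i (Function.update w i (w' i - w i - μ i))
      (fun j => (if j = i then η ^ 2 else 1) * a j) ?_
    · rwa [Finset.prod_mul_distrib, Finset.prod_ite_eq' Finset.univ i,
        if_pos (Finset.mem_univ i)] at this
    intro j
    by_cases hji : j = i
    · subst hji
      simpa [-map_sub, add_assoc] using hμ j
    · simpa [hji] using hw j
  rw [e]
  refine (h1.add h2).of_le ?_
  rw [Finset.sum_const, Finset.sum_const, nsmul_eq_mul, nsmul_eq_mul, Finset.card_univ,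
    Fintype.card_fin]
  have hcard : ((Finset.univ.filter (fun t : Finset (Fin l) => 2 ≤ t.card)).card : ℝ) ≤ 2 ^ l := by
    have h1 : (Finset.univ.filter (fun t : Finset (Fin l) => 2 ≤ t.card)).card ≤ 2 ^ l :=
      (Finset.card_filter_le _ _).trans (by simp)
    exact_mod_cast h1
  have h3 : (4 : ℝ) ^ l = 2 ^ l * 2 ^ l := by rw [← mul_pow]; norm_num
  have h4 := mul_le_mul_of_nonneg_right hcard
    (show 0 ≤ K * (η * (η * (2 ^ l * ∏ j, a j))) by positivity)
  rw [h3]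
  linarith

end HilbertScale

/-! ### The extended derivatives of the nonlinear operator -/

variable {X : ℕ → Type u} [∀ r, NormedAddCommGroup (X r)] [∀ r, InnerProductSpace ℝ (X r)]

/-- The `l`-th derivative of `F`, extended to the base space as a limit along smooth arguments. -/
noncomputable def HilbertScale.derivsHat (S : HilbertScale X) {p : ℕ} (F : X (p + 1) → X p)
    (P : ℕ → X 0 →L[ℝ] X (p + 1)) (l : ℕ) (u : X (p + 1)) (w : Fin l → X 0) : X 0 :=
  limUnder atTop fun i => S.derivs F l u fun j => P i (w j)

/-- The extended derivative at these arguments exists and belongs to `X q`. -/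
def HilbertScale.DerivsConv (S : HilbertScale X) {p : ℕ} (F : X (p + 1) → X p)
    (P : ℕ → X 0 →L[ℝ] X (p + 1)) (l : ℕ) (u : X (p + 1)) (w : Fin l → X 0) (q : ℕ) : Prop :=
  S.derivsHat F P l u w ∈ S.level q ∧
    Tendsto (fun i => S.derivs F l u fun j => P i (w j)) atTop (𝓝 (S.derivsHat F P l u w))

/-- The nonlinear operator `F` with its linearizations and a smoothing. -/
structure SmoothSystem {S : HilbertScale X} {p : ℕ} (D : DissipativeFamily S (X (p + 1)))
    (F : X (p + 1) → X p) (C : ℝ) (m₀ r₀ : ℕ) (P : ℕ → X 0 →L[ℝ] X (p + 1)) (KP : ℝ) : Prop where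
  field : SmoothField S F D.O C m₀ r₀
  isDerivative : D.IsDerivativeOf F
  smoothing : S.IsSmoothing (p + 1) P KP

namespace SmoothSystem

variable {S : HilbertScale X} {p : ℕ} {D : DissipativeFamily S (X (p + 1))}
  {F : X (p + 1) → X p} {C : ℝ} {m₀ r₀ : ℕ} {P : ℕ → X 0 →L[ℝ] X (p + 1)} {KP : ℝ}

theorem tendsto_derivs_of_extends {l q : ℕ} {e : Fin l → ℕ} {u : X (p + 1)}
    {G : ContinuousMultilinearMap ℝ (fun j : Fin l => X (e j)) (X q)}
    (hG : S.Extends G (S.derivs F l u)) (he : ∀ j, e j ≤ p + 1) {x : ℕ → Fin l → X (p + 1)}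
    {v : (j : Fin l) → X (e j)}
    (hx : ∀ j, Tendsto (fun i => S.emb (he j) (x i j)) atTop (𝓝 (v j))) :
    Tendsto (fun i => S.derivs F l u (x i)) atTop (𝓝 (S.incl q (G v))) := by
  have h1 : ∀ i, S.derivs F l u (x i) = S.incl q (G fun j => S.emb (he j) (x i j)) := fun i => by
    rw [hG _ (x i) (fun j => S.incl_emb _ _), S.incl_zero]
  simp only [h1]
  exact ((S.incl q).continuous.tendsto _).comp ((G.cont.tendsto v).comp (tendsto_pi_nhds.2 hx))

theorem conv_of_extends (H : SmoothSystem D F C m₀ r₀ P KP) {l q : ℕ} {e : Fin l → ℕ}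
    {u : X (p + 1)} {G : ContinuousMultilinearMap ℝ (fun j : Fin l => X (e j)) (X q)}
    (hG : S.Extends G (S.derivs F l u)) (he : ∀ j, e j ≤ p + 1) (v : (j : Fin l) → X (e j)) :
    S.derivsHat F P l u (fun j => S.incl (e j) (v j)) = S.incl q (G v) ∧
    Tendsto (fun i => S.derivs F l u fun j => P i (S.incl (e j) (v j))) atTop
      (𝓝 (S.incl q (G v))) := by
  have := tendsto_derivs_of_extends hG he (x := fun i j => P i (S.incl (e j) (v j)))
    fun j => H.smoothing.tendsto _ (he j) (v j)
  exact ⟨this.limUnder_eq, this⟩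

theorem conv (H : SmoothSystem D F C m₀ r₀ P KP) {r l m : ℕ} (h1 : r₀ + 1 ≤ r) (h2 : r ≤ p + 2)
    (h3 : 2 ≤ l) (h5 : m ≤ m₀) {k : Fin l → ℕ} (h6 : ∀ j, 1 ≤ k j) (h7 : ∑ j, k j = m)
    {u : X (p + 1)} (hu : u ∈ D.O) {w : Fin l → X 0} (hw : ∀ j, w j ∈ S.level (r - k j)) :
    S.DerivsConv F P l u w (r - m) := by
  have h4 : l ≤ m := by
    have := Finset.card_nsmul_le_sum Finset.univ k 1 (fun j _ => h6 j)
    simpa [h7] using this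
  obtain ⟨G, -, hG⟩ := H.field.bound r l m h1 h2 h3 h4 h5 k
    (fun j => ⟨h6 j, h7 ▸ Finset.single_le_sum (fun _ _ => Nat.zero_le _) (Finset.mem_univ j)⟩) h7
  choose v hv using hw
  obtain rfl : (fun j => S.incl (r - k j) (v j)) = w := funext hv
  obtain ⟨e1, e2⟩ := H.conv_of_extends (hG u hu).1 (fun j => by have := h6 j; omega) v
  rw [← e1] at e2
  exact ⟨e1 ▸ S.incl_mem_level _, e2⟩

theorem derivsHat_bound (H : SmoothSystem D F C m₀ r₀ P KP) {r l m : ℕ} (h1 : r₀ + 1 ≤ r)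
    (h2 : r ≤ p + 2) (h3 : 2 ≤ l) (h5 : m ≤ m₀) {k : Fin l → ℕ} (h6 : ∀ j, 1 ≤ k j)
    (h7 : ∑ j, k j = m) {u : X (p + 1)} (hu : u ∈ D.O) {w : Fin l → X 0} {a : Fin l → ℝ}
    (hw : ∀ j, S.NormLE (r - k j) (w j) (a j)) :
    S.NormLE (r - m) (S.derivsHat F P l u w) (C * ∏ j, a j) := by
  have h4 : l ≤ m := by
    have := Finset.card_nsmul_le_sum Finset.univ k 1 (fun j _ => h6 j)
    simpa [h7] using this
  obtain ⟨G, -, hG⟩ := H.field.bound r l m h1 h2 h3 h4 h5 k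
    (fun j => ⟨h6 j, h7 ▸ Finset.single_le_sum (fun _ _ => Nat.zero_le _) (Finset.mem_univ j)⟩) h7
  choose v hv hva using hw
  obtain rfl : (fun j => S.incl (r - k j) (v j)) = w := funext hv
  obtain ⟨e1, e2⟩ := H.conv_of_extends (hG u hu).1 (fun j => by have := h6 j; omega) v
  rw [e1, S.normLE_incl]
  have := H.field.one_le_C
  exact ((G u).le_opNorm v).trans (mul_le_mul (hG u hu).2 (Finset.prod_le_prod
    (fun _ _ => norm_nonneg _) fun j _ => hva j) (Finset.prod_nonneg fun _ _ => norm_nonneg _)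
    (by linarith))

theorem derivsHat_contLift (H : SmoothSystem D F C m₀ r₀ P KP) {r l m : ℕ} (h1 : r₀ + 1 ≤ r)
    (h2 : r ≤ p + 2) (h3 : 2 ≤ l) (h5 : m ≤ m₀) {k : Fin l → ℕ} (h6 : ∀ j, 1 ≤ k j)
    (h7 : ∑ j, k j = m) {s : Set ℝ} {u : ℝ → X (p + 1)} (hu : ∀ t ∈ s, u t ∈ D.O)
    (huc : ContinuousOn u s) {w : ℝ → Fin l → X 0}
    (hw : ∀ j, S.ContLift (r - k j) (fun t => w t j) s) :
    S.ContLift (r - m) (fun t => S.derivsHat F P l (u t) (w t)) s := by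
  have h4 : l ≤ m := by
    have := Finset.card_nsmul_le_sum Finset.univ k 1 (fun j _ => h6 j)
    simpa [h7] using this
  obtain ⟨G, hGc, hG⟩ := H.field.bound r l m h1 h2 h3 h4 h5 k
    (fun j => ⟨h6 j, h7 ▸ Finset.single_le_sum (fun _ _ => Nat.zero_le _) (Finset.mem_univ j)⟩) h7
  choose v hvc hv using hw
  refine ⟨fun t => G (u t) fun j => v j t, ?_, fun t ht => ?_⟩
  · exact (hGc.comp huc hu).eval (continuousOn_pi.2 hvc)
  · rw [← (H.conv_of_extends (hG (u t) (hu t ht)).1 (fun j => by have := h6 j; omega)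
      fun j => v j t).1]
    congr 1
    exact funext fun j => hv j t ht

theorem prod_mul_const {l : ℕ} (c : ℝ) (a : Fin l → ℝ) : ∏ j, (c * a j) = c ^ l * ∏ j, a j := by
  rw [Finset.prod_mul_distrib, Finset.prod_const, Finset.card_univ, Fintype.card_fin]

theorem derivsHat_lipschitz_base (H : SmoothSystem D F C m₀ r₀ P KP) {r l m : ℕ} (h1 : r₀ + 1 ≤ r)
    (h2 : r ≤ p + 2) (h3 : 2 ≤ l) (h5 : m ≤ m₀) {k : Fin l → ℕ} (h6 : ∀ j, 1 ≤ k j)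
    (h7 : ∑ j, k j = m) {u v : X (p + 1)} (hu : u ∈ D.O) (hv : v ∈ D.O) {w : Fin l → X 0}
    {a : Fin l → ℝ} (hw : ∀ j, S.NormLE (r - k j) (w j) (a j)) :
    S.NormLE (r - m - 1) (S.derivsHat F P l u w - S.derivsHat F P l v w)
      (KP ^ (l + 1) * C * ‖u - v‖ * ∏ j, a j) := by
  have hl : l ≤ m := by
    have := Finset.card_nsmul_le_sum Finset.univ k 1 (fun j _ => h6 j)
    simpa [h7] using this
  have cu := H.conv h1 h2 h3 h5 h6 h7 hu fun j => (hw j).mem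
  have cv := H.conv h1 h2 h3 h5 h6 h7 hv fun j => (hw j).mem
  have := H.smoothing.normLE_of_tendsto' (q := r - m - 1) (by omega)
    (S.level_mono (Nat.sub_le _ _) (Submodule.sub_mem _ cu.1 cv.1)) (cu.2.sub cv.2)
    (c := C * ‖u - v‖ * ∏ j, (KP * a j)) fun i => ?_
  · refine this.of_le (le_of_eq ?_)
    rw [prod_mul_const]; ring
  · exact H.field.derivs_lipschitz h1 h2 (by omega) h5 h6 h7 hu hv fun j =>
      H.smoothing.bound _ (by have := h6 j; omega) i _ _ (hw j)

theorem derivsHat_update_linear {l q : ℕ} {u : X (p + 1)} {w : Fin l → X 0} {i : Fin l}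
    {y z : X 0} (c d : ℝ) (hy : S.DerivsConv F P l u (Function.update w i y) q)
    (hz : S.DerivsConv F P l u (Function.update w i z) q) :
    S.derivsHat F P l u (Function.update w i (c • y + d • z)) =
      c • S.derivsHat F P l u (Function.update w i y) +
        d • S.derivsHat F P l u (Function.update w i z) := by
  have e : ∀ (n : ℕ) (x : X 0), (fun j => P n (Function.update w i x j)) =
      Function.update (fun j => P n (w j)) i (P n x) := fun n x =>
    Function.comp_update (P n) w i x
  have := (hy.2.const_smul c).add (hz.2.const_smul d)
  simp only [e, ← ContinuousMultilinearMap.map_update_smul,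
    ← ContinuousMultilinearMap.map_update_add, ← map_smul, ← map_add] at this
  simp only [← e] at this
  exact this.limUnder_eq

theorem _root_.DissipativeFamily.incl_A {Z : Type*} [NormedAddCommGroup Z] [NormedSpace ℝ Z]
    {D : DissipativeFamily S Z} {k : ℕ} (hk : k < D.N) {u : Z} (hu : u ∈ D.O) (y : X (k + 1)) :
    S.incl k (D.A k u y) = D.A 0 u (S.emb (Nat.succ_le_succ (Nat.zero_le k)) y) := by
  induction k with
  | zero => rw [S.incl_zero, S.emb_refl]
  | succ k ih =>
    rw [← S.incl_dn, D.compat k hk u hu, ih (Nat.lt_of_succ_lt hk)]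
    congr 1
    exact S.emb_trans _ _ _

theorem incl_A_emb (H : SmoothSystem D F C m₀ r₀ P KP) {k : ℕ} (hk : k ≤ p) {u : X (p + 1)}
    (hu : u ∈ D.O) (w : X (p + 1)) :
    S.incl k (D.A k u (S.emb (Nat.succ_le_succ hk) w)) = S.incl p (D.A p u w) := by
  have hN := H.isDerivative.N_eq
  rw [DissipativeFamily.incl_A (by omega) hu, DissipativeFamily.incl_A (by omega) hu, S.emb_trans]

theorem derivs_one (H : SmoothSystem D F C m₀ r₀ P KP) {u : X (p + 1)} (hu : u ∈ D.O)
    (w : Fin 1 → X (p + 1)) : S.derivs F 1 u w = S.incl p (D.A p u (w 0)) := by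
  rw [HilbertScale.derivs, iteratedFDeriv_one_apply]
  exact congrArg (fun L : X (p + 1) →L[ℝ] X 0 => L (w 0))
    ((S.incl p).hasFDerivAt.comp u (H.isDerivative.hasFDerivAt u hu)).fderiv

/-- The first derivative of `F`, extended to `X (k + 1)`, is the operator of the family. -/
theorem conv_one (H : SmoothSystem D F C m₀ r₀ P KP) {k : ℕ} (hk : k ≤ p) {u : X (p + 1)}
    (hu : u ∈ D.O) (y : X (k + 1)) {l : ℕ} (hl : l = 1) {w : Fin l → X 0}
    (hw : ∀ i, w i = S.incl (k + 1) y) :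
    S.derivsHat F P l u w = S.incl k (D.A k u y) ∧ S.DerivsConv F P l u w k := by
  subst hl
  have h1 : Tendsto (fun i => S.derivs F 1 u fun j => P i (w j)) atTop
      (𝓝 (S.incl k (D.A k u y))) := by
    simp only [H.derivs_one hu, ← H.incl_A_emb hk hu, hw]
    exact (((S.incl k).comp (D.A k u)).continuous.tendsto _).comp
      (H.smoothing.tendsto _ (Nat.succ_le_succ hk) y)
  have h2 : S.derivsHat F P 1 u w = S.incl k (D.A k u y) := h1.limUnder_eq
  exact ⟨h2, h2 ▸ S.incl_mem_level _, h2 ▸ h1⟩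

variable [∀ r, CompleteSpace (X r)]

theorem derivsHat_sub (H : SmoothSystem D F C m₀ r₀ P KP) {r l m : ℕ} (h1 : r₀ ≤ r)
    (h2 : r ≤ p + 1) (h3 : 2 ≤ l) (h5 : m ≤ m₀) {k : Fin l → ℕ} (h6 : ∀ j, 1 ≤ k j)
    (h7 : ∑ j, k j = m) (hcase : m < m₀ ∨ r₀ < r ∨ r = p + 1) :
    ∃ K, 0 ≤ K ∧ ∀ u ∈ D.O, ∀ (w w' : Fin l → X 0) (a : Fin l → ℝ) (η : ℝ), 0 ≤ η →
      (∀ j, S.NormLE (r + 1 - k j) (w j) (a j)) → (∀ j, S.NormLE (r + 1 - k j) (w' j) (a j)) →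
      (∀ j, S.NormLE (r + 1 - (k j + 1)) (w' j - w j) (η * a j)) →
      S.NormLE (r - m) (S.derivsHat F P l u w' - S.derivsHat F P l u w) (K * η * ∏ j, a j) := by
  by_cases hO : D.O.Nonempty
  swap
  · exact ⟨0, le_rfl, fun u hu => absurd ⟨u, hu⟩ hO⟩
  obtain ⟨u₀, hu₀⟩ := hO
  choose K hK hb using fun j₀ => H.field.levelBound_weak H.isDerivative.N_eq hu₀ h1 h2 h3 h5 h6 h7
    hcase j₀
  have hKs : ∀ j, K j ≤ ∑ j, K j := fun j =>
    Finset.single_le_sum (fun i _ => hK i) (Finset.mem_univ j)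
  have hKP := H.smoothing.one_le
  refine ⟨KP ^ (l + 1) * 4 ^ l * ∑ j, K j, by
    have := Finset.sum_nonneg fun j (_ : j ∈ Finset.univ) => hK j; positivity,
    fun u hu w w' a η hη hw hw' hd => ?_⟩
  have c := H.conv (r := r + 1) (by omega) (by omega) h3 h5 h6 h7 hu fun j => (hw j).mem
  have c' := H.conv (r := r + 1) (by omega) (by omega) h3 h5 h6 h7 hu fun j => (hw' j).mem
  have := H.smoothing.normLE_of_tendsto' (q := r - m) (by omega)
    (S.level_mono (by omega) (Submodule.sub_mem _ c'.1 c.1)) (c'.2.sub c.2)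
    (c := 4 ^ l * (∑ j, K j) * η * ∏ j, (KP * a j)) fun i => ?_
  · refine this.of_le (le_of_eq ?_)
    rw [prod_mul_const]; ring
  · refine S.normLE_multilinear_sub (R := r + 1) (d := k) _
      (Finset.sum_nonneg fun j _ => hK j) (fun j₀ x b hx => ?_) hη (fun j => ?_) (fun j => ?_)
      fun j => ?_
    · refine (hb j₀ u hu x b hx).of_le (mul_le_mul_of_nonneg_right (hKs j₀) ?_)
      exact Finset.prod_nonneg fun j _ => (hx j).nonneg
    · exact H.smoothing.bound _ (by have := h6 j; omega) i _ _ (hw j)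
    · exact H.smoothing.bound _ (by have := h6 j; omega) i _ _ (hw' j)
    · have := H.smoothing.bound _ (by have := h6 j; omega) i _ _ (hd j)
      rw [map_sub (P i)] at this
      exact this.of_le (le_of_eq (by ring))

/-- Second order expansion of the extended derivatives with respect to the arguments. -/
theorem derivsHat_taylor (H : SmoothSystem D F C m₀ r₀ P KP) {l m : ℕ}
    (h3 : 2 ≤ l) (h5 : m + 1 ≤ m₀) {k : Fin l → ℕ} (h6 : ∀ j, 1 ≤ k j) (h7 : ∑ j, k j = m) :
    ∃ K, 0 ≤ K ∧ ∀ u ∈ D.O, ∀ (w w' μ : Fin l → X 0) (a : Fin l → ℝ) (η : ℝ), 0 ≤ η →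
      (∀ j, S.NormLE (p + 2 - k j) (w j) (a j)) → (∀ j, S.NormLE (p + 2 - k j) (w' j) (a j)) →
      (∀ j, μ j ∈ S.level (p + 2 - (k j + 1))) →
      (∀ j, S.NormLE (p + 2 - (k j + 1)) (w' j - w j) (η * a j)) →
      (∀ j, S.NormLE (p + 2 - (k j + 2)) (w' j - w j - μ j) (η ^ 2 * a j)) →
      S.NormLE (p - m) (S.derivsHat F P l u w' - S.derivsHat F P l u w -
        ∑ j, S.derivsHat F P l u (Function.update w j (μ j))) (K * η ^ 2 * ∏ j, a j) := by
  by_cases hO : D.O.Nonempty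
  swap
  · exact ⟨0, le_rfl, fun u hu => absurd ⟨u, hu⟩ hO⟩
  obtain ⟨u₀, hu₀⟩ := hO
  have hm₀ := H.field.m₀_le
  have hr₀ := H.field.r₀_le
  have hl : l ≤ m := by
    have := Finset.card_nsmul_le_sum Finset.univ k 1 (fun j _ => h6 j)
    simpa [h7] using this
  have hsum1 : ∀ i : Fin l, ∑ j, (k j + (Pi.single i 1 : Fin l → ℕ) j) = m + 1 := fun i => by
    rw [Finset.sum_add_distrib, h7, Finset.sum_pi_single']; simp
  have hsum : ∀ i i' : Fin l, ∑ j, (k j + (Pi.single i 1 : Fin l → ℕ) j +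
      (Pi.single i' 1 : Fin l → ℕ) j) = m + 2 := fun i i' => by
    rw [Finset.sum_add_distrib, hsum1, Finset.sum_pi_single']; simp
  choose K hK hb using fun i i' => H.field.levelBound_top H.isDerivative.N_eq hu₀ h3 (by omega)
    (d := fun j => k j + (Pi.single i 1 : Fin l → ℕ) j + (Pi.single i' 1 : Fin l → ℕ) j)
    (fun j => by have := h6 j; omega) (by rw [hsum]; omega)
  have hKs : ∀ i i', K i i' ≤ ∑ i, ∑ i', K i i' := fun i i' =>
    (Finset.single_le_sum (f := fun i' => K i i') (fun i' _ => hK i i') (Finset.mem_univ i')).trans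
    (Finset.single_le_sum (f := fun i => ∑ i', K i i')
      (fun i _ => Finset.sum_nonneg fun i' _ => hK i i') (Finset.mem_univ i))
  have hKs0 : 0 ≤ ∑ i, ∑ i', K i i' := Finset.sum_nonneg fun i _ => Finset.sum_nonneg
    fun i' _ => hK i i'
  have hKP := H.smoothing.one_le
  refine ⟨KP ^ (l + 1) * ((4 ^ l + l) * ∑ i, ∑ i', K i i'), by positivity,
    fun u hu w w' μ a η hη hw hw' hμ hd hd2 => ?_⟩
  have c := H.conv (r := p + 2) (by omega) le_rfl h3 (by omega) h6 h7 hu fun j => (hw j).mem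
  have c' := H.conv (r := p + 2) (by omega) le_rfl h3 (by omega) h6 h7 hu fun j => (hw' j).mem
  have cμ : ∀ i, S.DerivsConv F P l u (Function.update w i (μ i)) (p + 2 - (m + 1)) := fun i => by
    refine H.conv (r := p + 2) (by omega) le_rfl h3 (by omega)
      (k := fun j => k j + (Pi.single i 1 : Fin l → ℕ) j) (fun j => by have := h6 j; omega)
      (hsum1 i) hu fun j => ?_
    by_cases hji : j = i
    · subst hji; simpa using hμ j
    · simpa [hji] using (hw j).mem
  have hs : Tendsto (fun n => ∑ i, S.derivs F l u fun j => P n (Function.update w i (μ i) j)) atTop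
      (𝓝 (∑ i, S.derivsHat F P l u (Function.update w i (μ i)))) :=
    tendsto_finsetSum _ fun i _ => (cμ i).2
  have := H.smoothing.normLE_of_tendsto' (q := p - m) (by omega)
    (Submodule.sub_mem _ (S.level_mono (by omega) (Submodule.sub_mem _ c'.1 c.1))
      (Submodule.sum_mem _ fun i _ => S.level_mono (by omega) (cμ i).1)) ((c'.2.sub c.2).sub hs)
    (c := (4 ^ l + l) * (∑ i, ∑ i', K i i') * η ^ 2 * ∏ j, (KP * a j)) fun n => ?_
  · refine this.of_le (le_of_eq ?_)
    rw [prod_mul_const]; ring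
  · have e : ∀ i, (fun j => P n (Function.update w i (μ i) j)) =
        Function.update (fun j => P n (w j)) i (P n (μ i)) := fun i =>
      Function.comp_update (P n) w i (μ i)
    simp only [e]
    refine S.normLE_multilinear_taylor (R := p + 2) (d := k) (μ := fun j => P n (μ j)) _
      hKs0 (fun i i' x b hx => ?_) hη (fun j => ?_) (fun j => ?_) (fun j => ?_) fun j => ?_
    · have := hb i i' u hu x b hx
      rw [hsum, show p + 2 - (m + 2) = p - m by omega] at this
      refine this.of_le (mul_le_mul_of_nonneg_right (hKs i i') ?_)
      exact Finset.prod_nonneg fun j _ => (hx j).nonneg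
    · exact H.smoothing.bound _ (by have := h6 j; omega) n _ _ (hw j)
    · exact H.smoothing.bound _ (by have := h6 j; omega) n _ _ (hw' j)
    · have := H.smoothing.bound _ (by have := h6 j; omega) n _ _ (hd j)
      rw [map_sub (P n)] at this
      exact this.of_le (le_of_eq (by ring))
    · have := H.smoothing.bound _ (by have := h6 j; omega) n _ _ (hd2 j)
      rw [map_sub (P n), map_sub (P n)] at this
      exact this.of_le (le_of_eq (by ring))

/-- Second order expansion of the extended derivatives with respect to the base point. -/
theorem derivsHat_taylor_base (H : SmoothSystem D F C m₀ r₀ P KP) {l m : ℕ}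
    (h3 : 1 ≤ l) (h5 : m + 1 ≤ m₀) {k : Fin l → ℕ} (h6 : ∀ j, 1 ≤ k j) (h7 : ∑ j, k j = m) :
    ∃ K, 0 ≤ K ∧ ∀ u ∈ D.O, ∀ v ∈ D.O, ∀ (w w' : Fin l → X 0) (μ : X 0) (a : Fin l → ℝ) (η : ℝ),
      0 ≤ η → S.DerivsConv F P l u w' (p - m) → S.DerivsConv F P l v w' (p - m) →
      (∀ j, S.NormLE (p + 2 - k j) (w j) (a j)) → (∀ j, S.NormLE (p + 2 - k j) (w' j) (a j)) →
      (∀ j, S.NormLE (p + 2 - (k j + 1)) (w' j - w j) (η * a j)) →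
      ‖v - u‖ ≤ η → S.NormLE (p + 1) μ η → S.NormLE p (S.incl (p + 1) (v - u) - μ) (η ^ 2) →
      S.NormLE (p - m) (S.derivsHat F P l v w' - S.derivsHat F P l u w' -
        S.derivsHat F P (l + 1) u (Fin.cons μ w)) (K * η ^ 2 * ∏ j, a j) := by
  have hm₀ := H.field.m₀_le
  have hr₀ := H.field.r₀_le
  have hl : l ≤ m := by
    have := Finset.card_nsmul_le_sum Finset.univ k 1 (fun j _ => h6 j)
    simpa [h7] using this
  set k' : Fin (l + 1) → ℕ := Fin.cons 1 k with hk'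
  have hk'1 : ∀ j, 1 ≤ k' j := Fin.cases (by simp [hk']) fun j => by simpa [hk'] using h6 j
  have hk's : ∑ j, k' j = m + 1 := by
    rw [Fin.sum_univ_succ]; simp [hk', h7, add_comm]
  obtain ⟨K, hK, hb⟩ := H.derivsHat_sub (r := p + 1) hr₀ le_rfl (l := l + 1) (by omega) h5 hk'1
    hk's (Or.inr (Or.inr rfl))
  have hKP := H.smoothing.one_le
  have hC := H.field.one_le_C
  refine ⟨KP ^ (l + 1) * C + K, by positivity,
    fun u hu v hv w w' μ a η hη cu cv hw hw' hd hvu hμ hμ2 => ?_⟩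
  have ha : ∀ j, 0 ≤ a j := fun j => (hw j).nonneg
  have hpr : 0 ≤ ∏ j, a j := Finset.prod_nonneg fun j _ => ha j
  have hΔ : S.NormLE (p + 1) (S.incl (p + 1) (v - u)) η := S.normLE_incl.2 hvu
  have hcons : ∀ (x : X 0) (z : Fin l → X 0), S.NormLE (p + 1) x η →
      (∀ j, S.NormLE (p + 2 - k j) (z j) (a j)) → ∀ j, S.NormLE (p + 1 + 1 - k' j)
        ((Fin.cons x z : Fin (l + 1) → X 0) j) ((Fin.cons η a : Fin (l + 1) → ℝ) j) :=
    fun x z hx hz => Fin.cases (by simpa [hk'] using hx) fun j => by simpa [hk'] using hz j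
  have hsub := hb u hu (Fin.cons μ w) (Fin.cons (S.incl (p + 1) (v - u)) w') (Fin.cons η a) η hη
    (hcons _ _ hμ hw) (hcons _ _ hΔ hw') (Fin.cases (by simpa [hk', ← pow_two] using hμ2)
      fun j => by simpa [hk'] using hd j)
  rw [show p + 1 - (m + 1) = p - m by omega, Fin.prod_univ_succ] at hsub
  simp only [Fin.cons_zero, Fin.cons_succ] at hsub
  have hconv : S.derivsHat F P (l + 1) u (Fin.cons (S.incl (p + 1) (v - u)) w') ∈ S.level (p - m) ∧
      Tendsto (fun i => S.derivs F (l + 1) u (Fin.cons (v - u) fun j => P i (w' j))) atTop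
        (𝓝 (S.derivsHat F P (l + 1) u (Fin.cons (S.incl (p + 1) (v - u)) w'))) := by
    obtain ⟨G, -, hG⟩ := H.field.bound (p + 2) (l + 1) (m + 1) (by omega) le_rfl (by omega)
      (by omega) h5 k' (fun j => ⟨hk'1 j, hk's ▸
        Finset.single_le_sum (fun _ _ => Nat.zero_le _) (Finset.mem_univ j)⟩) hk's
    have hmem : ∀ j, (Fin.cons (S.incl (p + 1) (v - u)) w' : Fin (l + 1) → X 0) j ∈
        S.level (p + 2 - k' j) := fun j => (hcons _ _ hΔ hw' j).mem
    choose z hz using hmem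
    have hke : ∀ j, p + 2 - k' j ≤ p + 1 := fun j => by have := hk'1 j; omega
    have e1 := (H.conv_of_extends (hG u hu).1 hke z).1
    have e2 := tendsto_derivs_of_extends (hG u hu).1 hke (v := z)
      (x := fun i => Fin.cons (v - u) fun j => P i (w' j)) ?_
    · rw [← e1] at e2
      have e3 : (fun j => S.incl (p + 2 - k' j) (z j)) = Fin.cons (S.incl (p + 1) (v - u)) w' :=
        funext hz
      rw [e3] at e1 e2
      exact ⟨e1 ▸ S.level_mono (by omega) (S.incl_mem_level _), e2⟩
    · refine Fin.cases ?_ fun j => ?_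
      · have : S.emb (hke 0) (v - u) = z 0 := by
          apply S.incl_injective
          rw [S.incl_emb]
          exact (hz 0).symm
        simp only [Fin.cons_zero, this]
        exact tendsto_const_nhds
      · have := H.smoothing.tendsto _ (hke j.succ) (z j.succ)
        have e4 : S.incl (p + 2 - k' j.succ) (z j.succ) = w' j := hz j.succ
        rw [e4] at this
        exact this
  have hmain := H.smoothing.normLE_of_tendsto' (q := p - m) (by omega)
    (Submodule.sub_mem _ (Submodule.sub_mem _ cv.1 cu.1) hconv.1) ((cv.2.sub cu.2).sub hconv.2)
    (c := C * ‖v - u‖ ^ 2 * ∏ j, (KP * a j)) fun i => by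
      have := H.field.derivs_taylor D.convex h3 h5 h6 h7 hu hv fun j =>
        H.smoothing.bound _ (by have := h6 j; omega) i _ _ (hw' j)
      rwa [show p + 2 - (m + 1) - 1 = p - m by omega] at this
  have := hmain.add hsub
  rw [sub_add_sub_cancel] at this
  refine this.of_le ?_
  rw [prod_mul_const]
  have h4 : ‖v - u‖ ^ 2 ≤ η ^ 2 := pow_le_pow_left₀ (norm_nonneg _) hvu 2
  calc _ = KP ^ (l + 1) * C * ‖v - u‖ ^ 2 * ∏ j, a j + K * η ^ 2 * ∏ j, a j := by ring
    _ ≤ KP ^ (l + 1) * C * η ^ 2 * ∏ j, a j + K * η ^ 2 * ∏ j, a j := by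
        gcongr
    _ = _ := by ring

end SmoothSystem

/-! ### Partitions into ordered parts -/

namespace OrderedFinpartition

variable {α β : Type*} {n : ℕ}

/-- The values of a function of several variables on the parts of a partition. -/
def onParts (c : OrderedFinpartition n) (V : (m : ℕ) → (Fin m → α) → β) (h : Fin n → α)
    (i : Fin c.length) : β := V (c.partSize i) (h ∘ c.emb i)

theorem apply_congr (V : (m : ℕ) → (Fin m → α) → β) {m m' : ℕ} (e : m' = m) (h : Fin m → α) :
    V m' (h ∘ Fin.cast e) = V m h := by
  subst e; rfl

theorem sum_partSize (c : OrderedFinpartition n) : ∑ i, c.partSize i = n := by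
  have := c.sum_sigma_eq_sum (α := ℕ) fun _ => 1
  simpa using this

theorem partSize_lt (c : OrderedFinpartition n) (hc : 2 ≤ c.length) (i : Fin c.length) :
    c.partSize i < n := by
  obtain ⟨j, hj⟩ : ∃ j, j ≠ i := by
    have : Nontrivial (Fin c.length) := Fin.nontrivial_iff_two_le.2 hc
    exact exists_ne i
  have h1 := c.sum_partSize
  have h2 : c.partSize i + c.partSize j ≤ ∑ i, c.partSize i := by
    rw [← Finset.sum_pair hj.symm]
    exact Finset.sum_le_sum_of_subset (Finset.subset_univ _)
  have := c.partSize_pos j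
  omega

theorem onParts_of_length_eq_one (c : OrderedFinpartition n) (hc : c.length = 1)
    (V : (m : ℕ) → (Fin m → α) → β) (h : Fin n → α) (i : Fin c.length) :
    c.onParts V h i = V n h := by
  have : Subsingleton (Fin c.length) := by rw [hc]; infer_instance
  have hs : c.partSize i = n :=
    (Fintype.sum_subsingleton _ i).symm.trans c.sum_partSize
  have he : ∀ j, c.emb i j = Fin.cast hs j := by
    have hm : StrictMono (c.emb i ∘ Fin.cast hs.symm) :=
      (c.emb_strictMono i).comp fun _ _ h => h
    have := hm.range_inj (g := id) strictMono_id |>.1 (by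
      rw [range_id, Set.range_eq_univ]
      exact Finite.injective_iff_surjective.1 hm.injective)
    intro j
    exact congrFun this (Fin.cast hs j)
  rw [onParts, ← apply_congr V hs h]
  congr 1
  funext j
  simp [he]

theorem onParts_extendLeft (c : OrderedFinpartition n) (V : (m : ℕ) → (Fin m → α) → β) (x : α)
    (h : Fin n → α) : c.extendLeft.onParts V (Fin.cons x h) =
      (Fin.cons (V 1 fun _ => x) (c.onParts V h) : Fin (c.length + 1) → β) := by
  funext i
  refine Fin.cases ?_ (fun i => ?_) i
  · rfl
  · rfl

theorem onParts_extendMiddle (c : OrderedFinpartition n) (V : (m : ℕ) → (Fin m → α) → β) (x : α)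
    (h : Fin n → α) (k : Fin c.length) : (c.extendMiddle k).onParts V (Fin.cons x h) =
      Function.update (c.onParts V h) k
        (V (c.partSize k + 1) (Fin.cons x (h ∘ c.emb k))) := by
  refine funext fun i : Fin c.length => ?_
  change V ((c.extendMiddle k).partSize i) (Fin.cons x h ∘ (c.extendMiddle k).emb i) = _
  by_cases hik : i = k
  · subst hik
    have e : (c.extendMiddle i).partSize i = c.partSize i + 1 := Function.update_self ..
    have he : (c.extendMiddle i).emb i = Fin.cases 0 (Fin.succ ∘ c.emb i) ∘ Fin.cast e :=
      dif_pos rfl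
    rw [Function.update_self, ← apply_congr V e, he]
    congr 1
    funext j
    change (Fin.cons x h : Fin (n + 1) → α) (Fin.cases 0 (Fin.succ ∘ c.emb i) (Fin.cast e j)) =
      (Fin.cons x (h ∘ c.emb i) : Fin (c.partSize i + 1) → α) (Fin.cast e j)
    generalize Fin.cast e j = j'
    exact Fin.cases rfl (fun j => rfl) j'
  · have e : (c.extendMiddle k).partSize i = c.partSize i := Function.update_of_ne hik ..
    have he : (c.extendMiddle k).emb i = Fin.succ ∘ c.emb i ∘ Fin.cast e := dif_neg hik
    rw [Function.update_of_ne hik, onParts, ← apply_congr V e, he]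
    rfl

theorem onParts_update (c : OrderedFinpartition n) (V : (m : ℕ) → (Fin m → α) → β) (h : Fin n → α)
    (i : Fin n) (x : α) : c.onParts V (Function.update h i x) =
      Function.update (c.onParts V h) (c.index i) (V (c.partSize (c.index i))
        (Function.update (h ∘ c.emb (c.index i)) (c.invEmbedding i) x)) := by
  funext j
  by_cases hj : j = c.index i
  · subst hj
    rw [Function.update_self, onParts]
    congr 1
    have A : Function.Injective (c.emb (c.index i)) := (c.emb_strictMono _).injective
    have := Function.update_comp_eq_of_injective h A (c.invEmbedding i) x
    rwa [c.emb_invEmbedding] at this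
  · rw [Function.update_of_ne hj, onParts, onParts]
    congr 1
    apply Function.update_comp_eq_of_notMem_range
    rintro ⟨k, hk⟩
    rw [← c.emb_invEmbedding i] at hk
    exact c.emb_ne_emb_of_ne hj hk

theorem exists_length_eq_one (n : ℕ) :
    ∃ c₀ : OrderedFinpartition (n + 1), ∀ c, c.length = 1 ↔ c = c₀ := by
  induction n with
  | zero => exact ⟨default, fun c => ⟨fun _ => Subsingleton.elim (α := OrderedFinpartition 1) _ _,
      fun h => h ▸ rfl⟩⟩
  | succ n ih =>
    obtain ⟨c₀, hc₀⟩ := ih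
    have h0 : c₀.length = 1 := (hc₀ c₀).2 rfl
    refine ⟨c₀.extendMiddle ⟨0, by omega⟩, fun c' => ⟨fun h => ?_, fun h => h ▸ h0⟩⟩
    obtain ⟨⟨c, o⟩, rfl⟩ := (extendEquiv (n + 1)).surjective c'
    cases o with
    | none =>
      have := c.length_pos (Nat.succ_pos n)
      change c.length + 1 = 1 at h
      omega
    | some i =>
      obtain rfl := (hc₀ c).1 h
      have : i = ⟨0, by omega⟩ := Fin.ext (by have := i.2; omega)
      rw [this]; rfl

theorem sum_eq_sum_extend {M : Type*} [AddCommMonoid M] (f : OrderedFinpartition (n + 1) → M) :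
    ∑ c, f c = ∑ c : OrderedFinpartition n, (f c.extendLeft + ∑ i, f (c.extendMiddle i)) := by
  rw [← (extendEquiv n).sum_comp, Fintype.sum_sigma]
  exact Finset.sum_congr rfl fun c _ => Fintype.sum_option _

end OrderedFinpartition

/-! ### Linear equations in the scale -/

namespace DissipativeFamily

variable {X : ℕ → Type u} [∀ r, NormedAddCommGroup (X r)] [∀ r, InnerProductSpace ℝ (X r)]
  {S : HilbertScale X} {Z : Type*} [NormedAddCommGroup Z] [NormedSpace ℝ Z]
  {D : DissipativeFamily S Z}

/-- The path `η` in `X (k + 1)` solves `η' = A(v) η + f`, `η(0) = z`. -/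
structure SolvesLinear (D : DissipativeFamily S Z) (T : ℝ) (v : ℝ → Z) (k : ℕ)
    (η : ℝ → X (k + 1)) (z : X 0) (f : ℝ → X 0) : Prop where
  initial : S.incl (k + 1) (η 0) = z
  deriv : ∀ t ∈ Icc 0 T, ∃ g : X k, S.incl k g = f t ∧
    HasDerivWithinAt (fun s => S.dn k (η s)) (D.A k (v t) (η t) + g) (Icc 0 T) t

namespace SolvesLinear

variable {T M : ℝ} {v v' w w' : ℝ → Z} {k : ℕ} {η θ : ℝ → X (k + 1)} {z y : X 0} {f g : ℝ → X 0}

theorem congr (h : D.SolvesLinear T v k η z f) (hfg : ∀ t ∈ Icc 0 T, f t = g t) :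
    D.SolvesLinear T v k η z g :=
  ⟨h.initial, fun t ht => by rw [← hfg t ht]; exact h.deriv t ht⟩

theorem add (h : D.SolvesLinear T v k η z f) (h' : D.SolvesLinear T v k θ y g) :
    D.SolvesLinear T v k (fun t => η t + θ t) (z + y) (fun t => f t + g t) :=
  ⟨by rw [map_add, h.initial, h'.initial], fun t ht => by
    obtain ⟨a, ha, hd⟩ := h.deriv t ht
    obtain ⟨b, hb, hd'⟩ := h'.deriv t ht
    refine ⟨a + b, by rw [map_add, ha, hb], ?_⟩
    simp only [map_add]
    exact (hd.add hd').congr_deriv (by abel)⟩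

theorem smul (h : D.SolvesLinear T v k η z f) (c : ℝ) :
    D.SolvesLinear T v k (fun t => c • η t) (c • z) (fun t => c • f t) :=
  ⟨by rw [map_smul, h.initial], fun t ht => by
    obtain ⟨a, ha, hd⟩ := h.deriv t ht
    refine ⟨c • a, by rw [map_smul, ha], ?_⟩
    simp only [map_smul]
    exact (hd.const_smul c).congr_deriv (by rw [smul_add])⟩

/-- The difference of solutions along two paths. -/
theorem sub (h : D.SolvesLinear T v k η z f) (h' : D.SolvesLinear T w k θ y g) :
    D.SolvesLinear T v k (fun t => η t - θ t) (z - y)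
      (fun t => f t - g t + S.incl k ((D.A k (v t) - D.A k (w t)) (θ t))) :=
  ⟨by rw [map_sub, h.initial, h'.initial], fun t ht => by
    obtain ⟨a, ha, hd⟩ := h.deriv t ht
    obtain ⟨b, hb, hd'⟩ := h'.deriv t ht
    refine ⟨a - b + (D.A k (v t) - D.A k (w t)) (θ t), by rw [map_add, map_sub, ha, hb], ?_⟩
    simp only [map_sub]
    exact (hd.sub hd').congr_deriv (by rw [sub_apply]; abel)⟩

/-- A solution in `X (k + 1)` is a solution in `X 1`. -/
theorem base (h : D.SolvesLinear T v k η z f) (hk : k < D.N) (hv : ∀ t ∈ Icc 0 T, v t ∈ D.O) :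
    D.SolvesLinear T v 0 (fun t => S.emb (Nat.succ_le_succ (Nat.zero_le k)) (η t)) z f :=
  ⟨(S.incl_emb _ _).trans h.initial, fun t ht => by
    obtain ⟨a, ha, hd⟩ := h.deriv t ht
    refine ⟨f t, S.incl_zero _, ?_⟩
    have h1 := (S.incl k).hasFDerivAt.comp_hasDerivWithinAt t hd
    rw [map_add, ha, incl_A hk (hv t ht)] at h1
    refine h1.congr_of_mem (fun s _ => ?_) ht
    exact (S.emb_trans _ _ _).trans (S.incl_dn k _).symm⟩

end SolvesLinear

variable [∀ r, CompleteSpace (X r)]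

theorem exists_solvesLinear_estimate {k : ℕ} (hk : k < D.N) {M T : ℝ} (hM : 0 ≤ M) :
    ∃ K, 1 ≤ K ∧ ∀ (v v' : ℝ → Z), IsPath D T M v v' → ∀ (η : ℝ → X (k + 1)) (z : X 0)
      (f : ℝ → X 0) (b c : ℝ), D.SolvesLinear T v k η z f → S.NormLE k z b →
      (∀ t ∈ Icc 0 T, S.NormLE k (f t) c) →
      ∀ t ∈ Icc 0 T, S.NormLE k (S.incl (k + 1) (η t)) (K * (b + c * t)) := by
  obtain ⟨C₀, h1, hC⟩ := energy_estimate_classical hk (D := D)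
  refine ⟨C₀ * Real.exp (C₀ * (1 + M) * |T|), one_le_mul_of_one_le_of_one_le h1
    (Real.one_le_exp (by positivity)), fun v v' hv η z f b c h hz hf t ht => ?_⟩
  have hd : ∀ t, ∃ g : X k, t ∈ Icc 0 T → S.incl k g = f t ∧
      HasDerivWithinAt (fun s => S.dn k (η s)) (D.A k (v t) (η t) + g) (Icc 0 T) t := fun t => by
    by_cases ht : t ∈ Icc 0 T
    · obtain ⟨g, hg⟩ := h.deriv t ht
      exact ⟨g, fun _ => hg⟩
    · exact ⟨0, fun h => absurd h ht⟩
  choose g hg using hd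
  have hc : 0 ≤ c := (hf t ht).nonneg
  have := hC M T v v' hM hv η g (fun t => c * t) (fun _ => c) (fun t ht => (hg t ht).2)
    (fun t _ => ((hasDerivAt_id t).const_mul c).hasDerivWithinAt.congr_deriv (mul_one c))
    (fun t ht => S.normLE_incl.1 (by rw [(hg t ht).1]; exact hf t ht)) t ht
  rw [← S.incl_dn, S.normLE_incl]
  refine this.trans ?_
  have hb : ‖S.dn k (η 0)‖ ≤ b := S.normLE_incl.1 (by rw [S.incl_dn, h.initial]; exact hz)
  have h3 : 0 ≤ c * t := mul_nonneg hc ht.1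
  rw [mul_zero, sub_zero]
  refine mul_le_mul (mul_le_mul_of_nonneg_left (Real.exp_le_exp.2 ?_) (by linarith))
    (by linarith) (by positivity) (by positivity)
  exact mul_le_mul_of_nonneg_left (ht.2.trans (le_abs_self T)) (by positivity)

open Classical in
/-- The solution of `y' = A(v) y + f`, `y(0) = z`, in the base space. -/
noncomputable def linearSolution (D : DissipativeFamily S Z) (T : ℝ) (v : ℝ → Z) (z : X 0)
    (f : ℝ → X 0) : ℝ → X 0 :=
  if h : ∃ η, D.SolvesLinear T v 0 η z f then fun t => S.incl 1 (h.choose t) else 0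

theorem SolvesLinear.eq_linearSolution {T M : ℝ} {v v' : ℝ → Z} {k : ℕ} {η : ℝ → X (k + 1)}
    {z : X 0} {f : ℝ → X 0} (h : D.SolvesLinear T v k η z f) (hk : k < D.N)
    (hv : IsPath D T M v v') (hM : 0 ≤ M) {t : ℝ} (ht : t ∈ Icc 0 T) :
    D.linearSolution T v z f t = S.incl (k + 1) (η t) := by
  have h0 := h.base hk hv.mem
  have hex : ∃ η, D.SolvesLinear T v 0 η z f := ⟨_, h0⟩
  rw [linearSolution, dif_pos hex]
  have hsub := hex.choose_spec.sub h0
  obtain ⟨K, -, hK⟩ := exists_solvesLinear_estimate (k := 0) (T := T) D.one_le_N hM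
  have := hK v v' hv _ _ _ 0 0 hsub (by rw [sub_self]; exact S.normLE_zero 0 le_rfl)
    (fun t _ => by simpa using S.normLE_zero 0 le_rfl) t ht
  obtain ⟨y, hy, hy0⟩ := this
  have : y = 0 := by simpa using hy0
  rw [this, map_zero, eq_comm, map_sub, sub_eq_zero] at hy
  rw [hy]
  exact S.incl_emb _ _

end DissipativeFamily

/-! ### Derivatives of the flow with respect to the initial value -/

variable {X : ℕ → Type u} [∀ r, NormedAddCommGroup (X r)] [∀ r, InnerProductSpace ℝ (X r)]

namespace DissipativeFamily

variable {S : HilbertScale X} {p : ℕ}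

/-- The `m`-th derivative of the flow along the path `v`, in the directions `h`: the solution of the
equation obtained from `v' = F(v)` by the formula of Faà di Bruno. -/
noncomputable def variation (D : DissipativeFamily S (X (p + 1))) (F : X (p + 1) → X p)
    (P : ℕ → X 0 →L[ℝ] X (p + 1)) (T : ℝ) (v : ℝ → X (p + 1)) (m : ℕ) (h : Fin m → X 0) : ℝ → X 0 :=
  D.linearSolution T v (if m = 1 then ∑ i, h i else 0) fun t =>
    ∑ c : OrderedFinpartition m, if _hc : 2 ≤ c.length then
      S.derivsHat F P c.length (v t) fun i => variation D F P T v (c.partSize i) (h ∘ c.emb i) t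
    else 0
termination_by m
decreasing_by exact c.partSize_lt _hc i

/-- The terms of order at least two in the equation for the `m`-th derivative of the flow. -/
noncomputable def forcing (D : DissipativeFamily S (X (p + 1))) (F : X (p + 1) → X p)
    (P : ℕ → X 0 →L[ℝ] X (p + 1)) (T : ℝ) (v : ℝ → X (p + 1)) (m : ℕ) (h : Fin m → X 0) (t : ℝ) :
    X 0 :=
  ∑ c : OrderedFinpartition m, if 2 ≤ c.length then
    S.derivsHat F P c.length (v t) (c.onParts (fun m h => D.variation F P T v m h t) h) else 0

theorem variation_eq (D : DissipativeFamily S (X (p + 1))) (F : X (p + 1) → X p)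
    (P : ℕ → X 0 →L[ℝ] X (p + 1)) (T : ℝ) (v : ℝ → X (p + 1)) (m : ℕ) (h : Fin m → X 0) :
    D.variation F P T v m h = D.linearSolution T v (if m = 1 then ∑ i, h i else 0)
      (D.forcing F P T v m h) := by
  rw [variation]
  congr 1

/-- The path `η` in `X (k + 1)` is the `m`-th derivative of the flow. -/
structure IsVariation (D : DissipativeFamily S (X (p + 1))) (F : X (p + 1) → X p)
    (P : ℕ → X 0 →L[ℝ] X (p + 1)) (T : ℝ) (v : ℝ → X (p + 1)) (k m : ℕ) (h : Fin m → X 0) (c : ℝ)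
    (η : ℝ → X (k + 1)) : Prop where
  solves : D.SolvesLinear T v k η (if m = 1 then ∑ i, h i else 0) (D.forcing F P T v m h)
  continuousOn : ContinuousOn η (Icc 0 T)
  eq : ∀ t ∈ Icc 0 T, S.incl (k + 1) (η t) = D.variation F P T v m h t
  bound : ∀ t ∈ Icc 0 T, ‖η t‖ ≤ c * if m = 1 then 1 else t

theorem IsVariation.normLE {D : DissipativeFamily S (X (p + 1))} {F : X (p + 1) → X p}
    {P : ℕ → X 0 →L[ℝ] X (p + 1)} {T : ℝ} {v : ℝ → X (p + 1)} {k m : ℕ} {h : Fin m → X 0} {c : ℝ}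
    {η : ℝ → X (k + 1)} (H : D.IsVariation F P T v k m h c η) {t : ℝ} (ht : t ∈ Icc 0 T) :
    S.NormLE (k + 1) (D.variation F P T v m h t) (c * if m = 1 then 1 else t) :=
  ⟨η t, H.eq t ht, H.bound t ht⟩

end DissipativeFamily

namespace SmoothSystem

variable {S : HilbertScale X} {p : ℕ} {D : DissipativeFamily S (X (p + 1))}
  {F : X (p + 1) → X p} {C : ℝ} {m₀ r₀ : ℕ} {P : ℕ → X 0 →L[ℝ] X (p + 1)} {KP : ℝ}
  [∀ r, CompleteSpace (X r)]

theorem ite_time_le {T t : ℝ} (ht : t ∈ Icc 0 T) (m : ℕ) :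
    (0 : ℝ) ≤ (if m = 1 then 1 else t) ∧ (if m = 1 then 1 else t) ≤ max 1 T := by
  split_ifs
  · exact ⟨zero_le_one, le_max_left _ _⟩
  · exact ⟨ht.1, ht.2.trans (le_max_right _ _)⟩

theorem exists_isVariation (H : SmoothSystem D F C m₀ r₀ P KP) {M T : ℝ} (hM : 0 ≤ M) (hT : 0 ≤ T)
    {r : ℕ} (h1 : r₀ ≤ r) (h2 : r ≤ p + 1) (n : ℕ) (hn : n ≤ m₀) :
    ∃ K, 1 ≤ K ∧ ∀ m, 1 ≤ m → m ≤ n → ∀ v v', DissipativeFamily.IsPath D T M v v' → ContinuousOn v' (Icc 0 T) →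
      ∀ (h : Fin m → X 0) (a : Fin m → ℝ), (∀ j, S.NormLE r (h j) (a j)) →
        ∃ η, D.IsVariation F P T v (r - m) m h (K * ∏ j, a j) η := by
  have hm₀ := H.field.m₀_le
  have hr₀ := H.field.r₀_le
  have hN := H.isDerivative.N_eq
  induction n with
  | zero => exact ⟨1, le_rfl, fun m h1 h2 => by omega⟩
  | succ n ih =>
    obtain ⟨K, hK1, ih⟩ := ih (by omega)
    obtain ⟨C₁, hC₁, hsol⟩ := DissipativeFamily.exists_linear_solution (D := D) (k := r - (n + 1)) (by omega) hM hT
    have hC := H.field.one_le_C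
    set T₁ := max 1 T with hT₁
    have hT₁1 : 1 ≤ T₁ := le_max_left _ _
    set Kf : ℝ := (Finset.univ : Finset (OrderedFinpartition (n + 1))).card •
      (C * (K * T₁) ^ (n + 1)) with hKf
    have hKf0 : 0 ≤ Kf := by positivity
    have hKle : K ≤ K + C₁ * (1 + Kf) := by nlinarith
    refine ⟨K + C₁ * (1 + Kf), hK1.trans hKle, fun m hm1 hmn v v' hv hv' h a ha => ?_⟩
    have hpr : ∀ {m : ℕ} {h : Fin m → X 0} {a : Fin m → ℝ}, (∀ j, S.NormLE r (h j) (a j)) →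
        0 ≤ ∏ j, a j := fun ha => Finset.prod_nonneg fun j _ => (ha j).nonneg
    rcases Nat.lt_or_ge n m with hlt | hle
    swap
    · obtain ⟨η, hη⟩ := ih m hm1 hle v v' hv hv' h a ha
      exact ⟨η, hη.solves, hη.continuousOn, hη.eq, fun t ht => (hη.bound t ht).trans
        (mul_le_mul_of_nonneg_right (mul_le_mul_of_nonneg_right hKle (hpr ha))
          (ite_time_le ht m).1)⟩
    obtain rfl : m = n + 1 := by omega
    have hparts : ∀ c : OrderedFinpartition (n + 1), 2 ≤ c.length → ∀ i,
        ∃ η, D.IsVariation F P T v (r - c.partSize i) (c.partSize i) (h ∘ c.emb i)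
          (K * ∏ j, a (c.emb i j)) η := fun c hc i =>
      ih _ (c.partSize_pos i) (Nat.lt_succ_iff.1 (c.partSize_lt hc i)) v v' hv hv' _ _
        fun j => ha _
    have hfc : S.ContLift (r + 1 - (n + 1)) (D.forcing F P T v (n + 1) h) (Icc 0 T) := by
      refine S.contLift_sum Finset.univ fun c _ => ?_
      by_cases hc : 2 ≤ c.length
      · simp only [hc, if_true]
        refine H.derivsHat_contLift (k := c.partSize) (by omega) (by omega) hc hn c.partSize_pos
          c.sum_partSize hv.mem hv.continuousOn fun i => ?_
        obtain ⟨η, hη⟩ := hparts c hc i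
        rw [show r + 1 - c.partSize i = r - c.partSize i + 1 by have := c.partSize_le i; omega]
        exact ⟨η, hη.continuousOn, hη.eq⟩
      · simp only [hc, if_false]
        simpa using S.contLift_const (s := Icc 0 T) (0 : X (r + 1 - (n + 1)))
    have hfb : ∀ t ∈ Icc 0 T, S.NormLE (r + 1 - (n + 1)) (D.forcing F P T v (n + 1) h t)
        (if n + 1 = 1 then 0 else Kf * ∏ j, a j) := by
      intro t ht
      by_cases hn1 : n + 1 = 1
      · have : D.forcing F P T v (n + 1) h t = 0 := Finset.sum_eq_zero fun c _ => by
          rw [if_neg]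
          have := c.length_le
          omega
        rw [if_pos hn1, this]
        exact S.normLE_zero _ le_rfl
      rw [if_neg hn1, hKf, smul_mul_assoc, ← Finset.sum_const]
      refine S.normLE_sum Finset.univ fun c _ => ?_
      by_cases hc : 2 ≤ c.length
      · rw [if_pos hc]
        refine (H.derivsHat_bound (k := c.partSize) (r := r + 1) (by omega) (by omega) hc hn
          c.partSize_pos c.sum_partSize (hv.mem t ht)
          (a := fun i => K * T₁ * ∏ j, a (c.emb i j)) fun i => ?_).of_le ?_
        · obtain ⟨η, hη⟩ := hparts c hc i
          rw [show r + 1 - c.partSize i = r - c.partSize i + 1 by have := c.partSize_le i; omega]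
          refine (hη.normLE ht).of_le ?_
          rw [mul_right_comm K T₁]
          exact mul_le_mul_of_nonneg_left (ite_time_le ht _).2
            (mul_nonneg (by linarith) (Finset.prod_nonneg fun j _ => (ha _).nonneg))
        · rw [prod_mul_const, c.prod_sigma_eq_prod a, mul_assoc]
          refine mul_le_mul_of_nonneg_left (mul_le_mul_of_nonneg_right ?_ (hpr ha)) (by linarith)
          exact pow_le_pow_right₀ (one_le_mul_of_one_le_of_one_le hK1 hT₁1) c.length_le
      · rw [if_neg hc]
        exact S.normLE_zero _ (mul_nonneg (by positivity) (hpr ha))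
    have hz : S.NormLE (r - (n + 1) + 1) (if n + 1 = 1 then ∑ i, h i else 0)
        (if n + 1 = 1 then ∏ j, a j else 0) := by
      split_ifs with hn1
      · obtain rfl : n = 0 := by omega
        have := ha 0
        simpa [show r - 1 + 1 = r by omega] using this
      · exact S.normLE_zero _ le_rfl
    rw [show r + 1 - (n + 1) = r - (n + 1) + 1 by omega] at hfc hfb
    obtain ⟨x, hx, hxb⟩ := hz
    obtain ⟨f, hf, hfe⟩ := hfc
    obtain ⟨η, hη0, hηc, hηd, hηb⟩ := hsol v v' hv hv' x f hf
    have hs : D.SolvesLinear T v (r - (n + 1)) η (if n + 1 = 1 then ∑ i, h i else 0)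
        (D.forcing F P T v (n + 1) h) :=
      ⟨by rw [hη0, hx], fun t ht => ⟨_, (S.incl_dn _ _).trans (hfe t ht), hηd t ht⟩⟩
    refine ⟨η, hs, hηc, fun t ht => ?_, fun t ht => ?_⟩
    · rw [D.variation_eq, hs.eq_linearSolution (by omega) hv hM ht]
    · have := hηb (fun t => (if n + 1 = 1 then 0 else Kf * ∏ j, a j) * t) (fun _ => _)
        (fun t _ => ((hasDerivAt_id t).const_mul _).hasDerivWithinAt.congr_deriv (mul_one _))
        (fun t ht => S.normLE_incl.1 (by rw [hfe t ht]; exact hfb t ht)) t ht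
      have hp := hpr ha
      have hCp : 0 ≤ C₁ * ∏ j, a j := by positivity
      refine this.trans ?_
      split_ifs at hxb ⊢ with hn1
      · nlinarith [mul_nonneg hCp hKf0, mul_nonneg (show (0 : ℝ) ≤ K by linarith) hp]
      · have h3 : 0 ≤ (K + C₁) * (∏ j, a j) * t :=
          mul_nonneg (mul_nonneg (by linarith) hp) ht.1
        have h4 : C₁ * ‖x‖ ≤ 0 := mul_nonpos_of_nonneg_of_nonpos (by linarith) hxb
        nlinarith
end SmoothSystem

/-! ### Multilinearity and Lipschitz continuity of the derivatives of the flow -/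

variable {X : ℕ → Type u} [∀ r, NormedAddCommGroup (X r)] [∀ r, InnerProductSpace ℝ (X r)]

namespace SmoothSystem

variable {S : HilbertScale X} {p : ℕ} {D : DissipativeFamily S (X (p + 1))}
  {F : X (p + 1) → X p} {C : ℝ} {m₀ r₀ : ℕ} {P : ℕ → X 0 →L[ℝ] X (p + 1)} {KP : ℝ}
  [∀ r, CompleteSpace (X r)]

theorem variation_update_linear (H : SmoothSystem D F C m₀ r₀ P KP) {M T : ℝ} (hM : 0 ≤ M)
    (hT : 0 ≤ T) {r : ℕ} (h1 : r₀ ≤ r) (h2 : r ≤ p + 1) {v v' : ℝ → X (p + 1)}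
    (hv : DissipativeFamily.IsPath D T M v v') (hv' : ContinuousOn v' (Icc 0 T)) {m : ℕ}
    (hm : m ≤ m₀) {h : Fin m → X 0} (hh : ∀ j, h j ∈ S.level r) (i : Fin m) {x y : X 0}
    (hx : x ∈ S.level r) (hy : y ∈ S.level r) (a b : ℝ) {t : ℝ} (ht : t ∈ Icc 0 T) :
    D.variation F P T v m (Function.update h i (a • x + b • y)) t =
      a • D.variation F P T v m (Function.update h i x) t +
        b • D.variation F P T v m (Function.update h i y) t := by
  have hm₀ := H.field.m₀_le
  have hN := H.isDerivative.N_eq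
  obtain ⟨K, -, hK⟩ := H.exists_isVariation hM hT h1 h2 m₀ le_rfl
  have hvar : ∀ {m : ℕ}, 1 ≤ m → m ≤ m₀ → ∀ h : Fin m → X 0, (∀ j, h j ∈ S.level r) →
      ∃ c η, D.IsVariation F P T v (r - m) m h c η := fun hm1 hm h hh => by
    choose w hw using hh
    obtain ⟨η, hη⟩ := hK _ hm1 hm v v' hv hv' h (fun j => ‖w j‖) fun j => ⟨w j, hw j, le_rfl⟩
    exact ⟨_, η, hη⟩
  have hup : ∀ {m : ℕ} {h : Fin m → X 0}, (∀ j, h j ∈ S.level r) → ∀ (i : Fin m) {x : X 0},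
      x ∈ S.level r → ∀ j, Function.update h i x j ∈ S.level r := fun hh i x hx j => by
    by_cases hj : j = i
    · subst hj; rwa [Function.update_self]
    · rw [Function.update_of_ne hj]; exact hh j
  induction m using Nat.strong_induction_on generalizing t with
  | _ m ih =>
    have hm1 : 1 ≤ m := i.pos
    obtain ⟨_, η, hη⟩ := hvar hm1 hm _ (hup hh i hx)
    obtain ⟨_, θ, hθ⟩ := hvar hm1 hm _ (hup hh i hy)
    have hs := (hη.solves.smul a).add (hθ.solves.smul b)
    have hz : a • (if m = 1 then ∑ j, Function.update h i x j else 0) +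
        b • (if m = 1 then ∑ j, Function.update h i y j else 0) =
        if m = 1 then ∑ j, Function.update h i (a • x + b • y) j else 0 := by
      split_ifs with h1
      · subst h1
        obtain rfl : i = 0 := Subsingleton.elim _ _
        simp
      · simp
    rw [hz] at hs
    have := (hs.congr (g := D.forcing F P T v m (Function.update h i (a • x + b • y)))
      fun s hs => ?_).eq_linearSolution (by omega) hv hM ht
    · rw [D.variation_eq, this, map_add, map_smul, map_smul, hη.eq t ht, hθ.eq t ht]
    · simp only [DissipativeFamily.forcing, Finset.smul_sum]
      rw [← Finset.sum_add_distrib]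
      refine Finset.sum_congr rfl fun c _ => ?_
      split_ifs with hc
      swap
      · simp
      have hconv : ∀ {x : X 0}, x ∈ S.level r → S.DerivsConv F P c.length (v s)
          (c.onParts (fun m h => D.variation F P T v m h s) (Function.update h i x))
          (r + 1 - m) := fun hx => by
        refine H.conv (k := c.partSize) (by omega) (by omega) hc hm c.partSize_pos
          c.sum_partSize (hv.mem s hs) fun j => ?_
        obtain ⟨_, η, hη⟩ := hvar (c.partSize_pos j) ((c.partSize_le j).trans hm)
          (Function.update h i _ ∘ c.emb j) fun j => hup hh i hx _
        have := (hη.normLE hs).mem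
        rwa [show r - c.partSize j + 1 = r + 1 - c.partSize j by
          have := c.partSize_le j; omega] at this
      have hx' := hconv hx
      have hy' := hconv hy
      rw [c.onParts_update] at hx' hy' ⊢
      rw [c.onParts_update, c.onParts_update, ← derivsHat_update_linear a b hx' hy',
        ih _ (c.partSize_lt hc _) ((c.partSize_le _).trans hm)
          (h := h ∘ c.emb (c.index i)) (fun j => hh _) _ hs]

theorem exists_variation_lipschitz (H : SmoothSystem D F C m₀ r₀ P KP) {M T : ℝ} (hM : 0 ≤ M)
    (hT : 0 ≤ T) {r : ℕ} (h1 : r₀ ≤ r) (h2 : r ≤ p + 1) (n : ℕ) (hn : n ≤ m₀)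
    (hcase : n ≤ 1 ∨ n < m₀ ∨ r₀ < r ∨ r = p + 1) :
    ∃ K, 0 ≤ K ∧ ∀ m, 1 ≤ m → m ≤ n → ∀ v v' w w', DissipativeFamily.IsPath D T M v v' →
      ContinuousOn v' (Icc 0 T) → DissipativeFamily.IsPath D T M w w' →
      ContinuousOn w' (Icc 0 T) → ∀ d, (∀ t ∈ Icc 0 T, ‖v t - w t‖ ≤ d) →
      ∀ (h : Fin m → X 0) (a : Fin m → ℝ), (∀ j, S.NormLE r (h j) (a j)) → ∀ t ∈ Icc 0 T,
        S.NormLE (r - m) (D.variation F P T v m h t - D.variation F P T w m h t)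
          (K * t * d * ∏ j, a j) := by
  have hm₀ := H.field.m₀_le
  have hN := H.isDerivative.N_eq
  induction n with
  | zero => exact ⟨0, le_rfl, fun m h1 h2 => by omega⟩
  | succ n ih =>
    obtain ⟨K, hK0, ih⟩ := ih (by omega) (by omega)
    obtain ⟨K', hK'1, hvar⟩ := H.exists_isVariation hM hT h1 h2 (n + 1) hn
    obtain ⟨C₁, hC₁, hest⟩ := DissipativeFamily.exists_solvesLinear_estimate (D := D)
      (k := r - (n + 1)) (T := T) (by omega) hM
    have hsub : ∀ c : OrderedFinpartition (n + 1), ∃ Kc, 0 ≤ Kc ∧ (2 ≤ c.length →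
        ∀ u ∈ D.O, ∀ (w w' : Fin c.length → X 0) (a : Fin c.length → ℝ) (η : ℝ), 0 ≤ η →
        (∀ j, S.NormLE (r + 1 - c.partSize j) (w j) (a j)) →
        (∀ j, S.NormLE (r + 1 - c.partSize j) (w' j) (a j)) →
        (∀ j, S.NormLE (r + 1 - (c.partSize j + 1)) (w' j - w j) (η * a j)) →
        S.NormLE (r - (n + 1)) (S.derivsHat F P c.length u w' - S.derivsHat F P c.length u w)
          (Kc * η * ∏ j, a j)) := fun c => by
      by_cases hc : 2 ≤ c.length
      · obtain ⟨Kc, h0, hKc⟩ := H.derivsHat_sub h1 h2 hc hn c.partSize_pos c.sum_partSize (by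
          have := c.length_le; omega)
        exact ⟨Kc, h0, fun _ => hKc⟩
      · exact ⟨0, le_rfl, fun h => absurd h hc⟩
    choose Kc hKc0 hsub using hsub
    have hC := H.field.one_le_C
    have hKP := H.smoothing.one_le
    have hDC := D.one_le_C
    set T₁ := max 1 T with hT₁
    have hT₁1 : 1 ≤ T₁ := le_max_left _ _
    set B := (K + K') * T₁ with hB
    have hB1 : 1 ≤ B := one_le_mul_of_one_le_of_one_le (by linarith) hT₁1
    set Kf : ℝ := (∑ c : OrderedFinpartition (n + 1), (Kc c + KP ^ (c.length + 1) * C) *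
      B ^ c.length) + D.C * B with hKf
    have hKf0 : 0 ≤ Kf := add_nonneg (Finset.sum_nonneg fun c _ => by
      have := hKc0 c; positivity) (by positivity)
    refine ⟨K + C₁ * Kf, by positivity, fun m hm1 hmn v v' w w' hv hv' hw hw' d hd h a ha t ht =>
      ?_⟩
    have hd0 : 0 ≤ d := (norm_nonneg _).trans (hd t ht)
    have ha0 : ∀ j, 0 ≤ a j := fun j => (ha j).nonneg
    have hpr : 0 ≤ ∏ j, a j := Finset.prod_nonneg fun j _ => ha0 j
    have ht0 := ht.1
    rcases Nat.lt_or_ge n m with hlt | hle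
    swap
    · refine (ih m hm1 hle v v' w w' hv hv' hw hw' d hd h a ha t ht).of_le ?_
      gcongr
      have : 0 ≤ C₁ * Kf := by positivity
      linarith
    obtain rfl : m = n + 1 := by omega
    obtain ⟨η, hη⟩ := hvar _ hm1 le_rfl v v' hv hv' h a ha
    obtain ⟨θ, hθ⟩ := hvar _ hm1 le_rfl w w' hw hw' h a ha
    have hs := hη.solves.sub hθ.solves
    rw [sub_self] at hs
    have key := hest v v' hv _ _ _ 0 (Kf * d * ∏ j, a j) hs (S.normLE_zero _ le_rfl)
      (fun t ht => ?_) t ht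
    · rw [map_sub, hη.eq t ht, hθ.eq t ht] at key
      refine key.of_le ?_
      have : 0 ≤ K * t * d * ∏ j, a j := by positivity
      nlinarith
    have hpart : ∀ (c : OrderedFinpartition (n + 1)), 2 ≤ c.length → ∀ (v v' : ℝ → X (p + 1)),
        DissipativeFamily.IsPath D T M v v' → ContinuousOn v' (Icc 0 T) → ∀ i,
        S.NormLE (r + 1 - c.partSize i) (c.onParts (fun m h => D.variation F P T v m h t) h i)
          (B * ∏ j, a (c.emb i j)) := fun c hc v v' hv hv' i => by
      obtain ⟨η, hη⟩ := hvar _ (c.partSize_pos i) (c.partSize_le i) v v' hv hv' (h ∘ c.emb i) _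
        fun j => ha _
      rw [show r + 1 - c.partSize i = r - c.partSize i + 1 by have := c.partSize_le i; omega]
      refine (hη.normLE ht).of_le ?_
      have h3 := ite_time_le ht (c.partSize i)
      have h4 : 0 ≤ ∏ j, a (c.emb i j) := Finset.prod_nonneg fun j _ => ha0 _
      rw [hB, mul_right_comm]
      exact mul_le_mul_of_nonneg_right (mul_le_mul (by linarith) h3.2 h3.1 (by linarith)) h4
    rw [show Kf * d * ∏ j, a j = (∑ c : OrderedFinpartition (n + 1), (Kc c +
      KP ^ (c.length + 1) * C) * B ^ c.length * d * ∏ j, a j) + D.C * B * d * ∏ j, a j by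
        rw [hKf, add_mul, add_mul, Finset.sum_mul, Finset.sum_mul]]
    refine HilbertScale.NormLE.add ?_ ?_
    · rw [DissipativeFamily.forcing, DissipativeFamily.forcing, ← Finset.sum_sub_distrib]
      refine S.normLE_sum _ fun c _ => ?_
      have hKc := hKc0 c
      split_ifs with hc
      swap
      · rw [sub_zero]; exact S.normLE_zero _ (by positivity)
      have e1 := hsub c hc (v t) (hv.mem t ht) _ _ _ d hd0 (hpart c hc w w' hw hw')
        (hpart c hc v v' hv hv') fun i => by
          have := ih _ (c.partSize_pos i) (Nat.lt_succ_iff.1 (c.partSize_lt hc i)) v v' w w' hv hv'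
            hw hw' d hd (h ∘ c.emb i) _ (fun j => ha _) t ht
          rw [Nat.add_sub_add_right]
          refine this.of_le ?_
          have h4 : 0 ≤ ∏ j, a (c.emb i j) := Finset.prod_nonneg fun j _ => ha0 _
          have h5 : K * t ≤ B := mul_le_mul (by linarith) (ht.2.trans (le_max_right _ _)) ht.1
            (by linarith)
          calc K * t * d * ∏ j, a (c.emb i j) ≤ B * d * ∏ j, a (c.emb i j) :=
              mul_le_mul_of_nonneg_right (mul_le_mul_of_nonneg_right h5 hd0) h4
            _ = _ := by ring
      have e2 := H.derivsHat_lipschitz_base (r := r + 1) (by omega) (by omega) hc hn c.partSize_pos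
        c.sum_partSize (hv.mem t ht) (hw.mem t ht) (hpart c hc w w' hw hw')
      rw [show r + 1 - (n + 1) - 1 = r - (n + 1) by omega] at e2
      have e3 := e1.add e2
      rw [sub_add_sub_cancel] at e3
      refine e3.of_le ?_
      rw [prod_mul_const, c.prod_sigma_eq_prod a]
      have h6 : KP ^ (c.length + 1) * C * ‖v t - w t‖ ≤ KP ^ (c.length + 1) * C * d :=
        mul_le_mul_of_nonneg_left (hd t ht) (by positivity)
      have h7 : 0 ≤ B ^ c.length * ∏ j, a j := by positivity
      nlinarith [mul_le_mul_of_nonneg_right h6 h7]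
    · rw [S.normLE_incl]
      refine (ContinuousLinearMap.le_opNorm _ _).trans ?_
      have h3 := ite_time_le ht (n + 1)
      have h4 : ‖θ t‖ ≤ B * ∏ j, a j := (hθ.bound t ht).trans (by
        rw [hB, mul_right_comm]
        exact mul_le_mul_of_nonneg_right (mul_le_mul (by linarith) h3.2 h3.1 (by linarith)) hpr)
      have h5 : ‖D.A (r - (n + 1)) (v t) - D.A (r - (n + 1)) (w t)‖ ≤ D.C * d :=
        (D.A_lipschitz (by omega) (hv.mem t ht) (hw.mem t ht)).trans
          (mul_le_mul_of_nonneg_left (hd t ht) (by linarith))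
      calc _ ≤ D.C * d * (B * ∏ j, a j) := mul_le_mul h5 h4 (norm_nonneg _) (by positivity)
        _ = _ := by ring

end SmoothSystem

/-! ### Second order expansion of the flow -/

variable {X : ℕ → Type u} [∀ r, NormedAddCommGroup (X r)] [∀ r, InnerProductSpace ℝ (X r)]

namespace DissipativeFamily

variable {S : HilbertScale X} {p : ℕ} {D : DissipativeFamily S (X (p + 1))}
  {F : X (p + 1) → X p}

theorem IsDerivativeOf.norm_taylor_le (hF : D.IsDerivativeOf F) {u v : X (p + 1)} (hu : u ∈ D.O)
    (hv : v ∈ D.O) : ‖F v - F u - D.A p u (v - u)‖ ≤ D.C * ‖v - u‖ ^ 2 := by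
  have hs := D.convex.segment_subset hu hv
  have := (convex_segment u v).norm_image_sub_le_of_norm_hasFDerivWithin_le' (φ := D.A p u)
    (fun x hx => (hF.hasFDerivAt x (hs hx)).hasFDerivWithinAt) (C := D.C * ‖v - u‖)
    (fun x hx => (D.A_lipschitz hF.lt (hs hx) hu).trans (mul_le_mul_of_nonneg_left
      (norm_sub_le_of_mem_segment hx) (zero_le_one.trans D.one_le_C)))
    (left_mem_segment ℝ u v) (right_mem_segment ℝ u v)
  rwa [mul_assoc, ← pow_two] at this

theorem SolvesLinear.lower {T : ℝ} {v : ℝ → X (p + 1)} {k : ℕ} {η : ℝ → X (k + 1 + 1)} {z : X 0}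
    {f : ℝ → X 0} (h : D.SolvesLinear T v (k + 1) η z f) (hk : k + 1 < D.N)
    (hv : ∀ t ∈ Icc 0 T, v t ∈ D.O) :
    D.SolvesLinear T v k (fun t => S.dn (k + 1) (η t)) z f :=
  ⟨(S.incl_dn _ _).trans h.initial, fun t ht => by
    obtain ⟨g, hg, hd⟩ := h.deriv t ht
    refine ⟨S.dn k g, (S.incl_dn _ _).trans hg, ?_⟩
    refine ((S.dn k).hasFDerivAt.comp_hasDerivWithinAt t hd).congr_deriv ?_
    rw [map_add, D.compat k hk _ (hv t ht)]⟩

theorem IsVariation.normLE_max {P : ℕ → X 0 →L[ℝ] X (p + 1)} {T : ℝ} {v : ℝ → X (p + 1)}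
    {k m : ℕ} {h : Fin m → X 0} {c : ℝ} {η : ℝ → X (k + 1)}
    (H : D.IsVariation F P T v k m h c η) {t : ℝ} (ht : t ∈ Icc 0 T) (hc : 0 ≤ c) :
    S.NormLE (k + 1) (D.variation F P T v m h t) (c * max 1 T) :=
  (H.normLE ht).of_le (mul_le_mul_of_nonneg_left (SmoothSystem.ite_time_le ht m).2 hc)

end DissipativeFamily

namespace SmoothSystem

variable {S : HilbertScale X} {p : ℕ} {D : DissipativeFamily S (X (p + 1))}
  {F : X (p + 1) → X p} {C : ℝ} {m₀ r₀ : ℕ} {P : ℕ → X 0 →L[ℝ] X (p + 1)} {KP : ℝ}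
  [∀ r, CompleteSpace (X r)]

theorem exists_variation_top (H : SmoothSystem D F C m₀ r₀ P KP) {M T : ℝ} (hM : 0 ≤ M)
    (hT : 0 ≤ T) : ∃ K, 1 ≤ K ∧ ∀ m k, 1 ≤ m → m ≤ m₀ → k + m = p + 1 → ∀ v v',
      DissipativeFamily.IsPath D T M v v' → ContinuousOn v' (Icc 0 T) →
      ∀ (h : Fin m → X 0) (a : Fin m → ℝ), (∀ j, S.NormLE (p + 1) (h j) (a j)) →
        ∃ η, D.IsVariation F P T v k m h (K * ∏ j, a j) η := by
  obtain ⟨K, hK1, hK⟩ := H.exists_isVariation hM hT H.field.r₀_le le_rfl m₀ le_rfl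
  refine ⟨K, hK1, fun m k hm hm₀ hk => ?_⟩
  obtain rfl : k = p + 1 - m := by omega
  exact hK m hm hm₀

theorem exists_flow_taylor (H : SmoothSystem D F C m₀ r₀ P KP) {M T : ℝ} (hM : 0 ≤ M)
    (hT : 0 ≤ T) : ∃ K, 0 ≤ K ∧ ∀ v v' w w', D.IsFlow F T v v' → (∀ t ∈ Icc 0 T, ‖v' t‖ ≤ M) →
      D.IsFlow F T w w' → (∀ t ∈ Icc 0 T, ‖w' t‖ ≤ M) → ∀ d, (∀ t ∈ Icc 0 T, ‖v t - w t‖ ≤ d) →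
      ∀ t ∈ Icc 0 T, S.NormLE p (S.incl (p + 1) (v t - w t) -
        D.variation F P T w 1 (fun _ => S.incl (p + 1) (v 0 - w 0)) t) (K * d ^ 2) := by
  have hF := H.isDerivative
  obtain ⟨K, hK1, hK⟩ := H.exists_variation_top hM hT
  obtain ⟨C₁, hC₁, hest⟩ := DissipativeFamily.exists_solvesLinear_estimate (D := D) (T := T) hF.lt
    hM
  have hDC := D.one_le_C
  have hm₀ := H.field.one_le
  refine ⟨C₁ * (D.C * T), by positivity, fun v v' w w' hv hvM hw hwM d hd t ht => ?_⟩
  obtain ⟨η, hη⟩ := hK 1 p le_rfl hm₀ rfl w w' (hw.isPath hwM) hw.continuousOn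
    (fun _ => S.incl (p + 1) (v 0 - w 0)) (fun _ => ‖v 0 - w 0‖) fun _ => S.normLE_incl.2 le_rfl
  have hforc : ∀ t, D.forcing F P T w 1 (fun _ => S.incl (p + 1) (v 0 - w 0)) t = 0 := fun t =>
    Finset.sum_eq_zero fun c _ => by
      rw [if_neg]
      have := c.length_le
      omega
  have hs : D.SolvesLinear T w p (fun t => v t - w t - η t) 0
      (fun t => S.incl p (F (v t) - F (w t) - D.A p (w t) (v t - w t))) := by
    refine ⟨?_, fun t ht => ⟨_, rfl, ?_⟩⟩
    · rw [map_sub, hη.solves.initial]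
      simp
    · obtain ⟨g, hg, hd⟩ := hη.solves.deriv t ht
      rw [hforc] at hg
      obtain rfl : g = 0 := S.incl_injective p (by rw [hg, map_zero])
      simp only [map_sub]
      refine ((((S.dn p).hasFDerivAt.comp_hasDerivWithinAt t (hv.deriv t ht)).sub
        ((S.dn p).hasFDerivAt.comp_hasDerivWithinAt t (hw.deriv t ht))).sub hd).congr_deriv ?_
      rw [← hv.eq t ht, ← hw.eq t ht]
      abel
  have key := hest w w' (hw.isPath hwM) _ _ _ 0 (D.C * d ^ 2) hs (S.normLE_zero _ le_rfl)
    (fun t ht => S.normLE_incl.2 ((hF.norm_taylor_le (hw.mem t ht) (hv.mem t ht)).trans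
      (mul_le_mul_of_nonneg_left (pow_le_pow_left₀ (norm_nonneg _) (hd t ht) 2) (by linarith)))) t ht
  rw [map_sub, hη.eq t ht] at key
  refine key.of_le ?_
  have : C₁ * (D.C * d ^ 2) * t ≤ C₁ * (D.C * d ^ 2) * T :=
    mul_le_mul_of_nonneg_left ht.2 (by positivity)
  linarith

theorem exists_variation_taylor (H : SmoothSystem D F C m₀ r₀ P KP) {M T : ℝ} (hM : 0 ≤ M)
    (hT : 0 ≤ T) (n : ℕ) (hn : n + 1 ≤ m₀) : ∃ K, 0 ≤ K ∧ ∀ m, 1 ≤ m → m ≤ n → ∀ v v' w w',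
      D.IsFlow F T v v' → (∀ t ∈ Icc 0 T, ‖v' t‖ ≤ M) →
      D.IsFlow F T w w' → (∀ t ∈ Icc 0 T, ‖w' t‖ ≤ M) → ∀ d, (∀ t ∈ Icc 0 T, ‖v t - w t‖ ≤ d) →
      ∀ (h : Fin m → X 0) (a : Fin m → ℝ), (∀ j, S.NormLE (p + 1) (h j) (a j)) →
      ∀ t ∈ Icc 0 T, S.NormLE (p - m) (D.variation F P T v m h t - D.variation F P T w m h t -
        D.variation F P T w (m + 1) (Fin.cons (S.incl (p + 1) (v 0 - w 0)) h) t)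
          (K * d ^ 2 * ∏ j, a j) := by
  have hm₀ := H.field.m₀_le
  have hr₀ := H.field.r₀_le
  have hN := H.isDerivative.N_eq
  induction n with
  | zero => exact ⟨0, le_rfl, fun m h1 h2 => by omega⟩
  | succ n ih =>
    obtain ⟨K, hK0, ih⟩ := ih (by omega)
    obtain ⟨K₁, hK₁, hvar⟩ := H.exists_variation_top hM hT
    obtain ⟨K₂, hK₂, hlip⟩ := H.exists_variation_lipschitz hM hT hr₀ le_rfl m₀ le_rfl
      (Or.inr (Or.inr (Or.inr rfl)))
    obtain ⟨K₃, hK₃, hbase⟩ := H.exists_flow_taylor hM hT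
    obtain ⟨C₁, hC₁, hest⟩ := DissipativeFamily.exists_solvesLinear_estimate (D := D)
      (k := p - (n + 1)) (T := T) (by omega) hM
    choose Kb hKb0 hKb using fun c : OrderedFinpartition (n + 1) => H.derivsHat_taylor_base
      (c.length_pos n.succ_pos) hn c.partSize_pos c.sum_partSize
    have htay : ∀ c : OrderedFinpartition (n + 1), ∃ Kc, 0 ≤ Kc ∧ (2 ≤ c.length →
        ∀ u ∈ D.O, ∀ (w w' μ : Fin c.length → X 0) (a : Fin c.length → ℝ) (η : ℝ), 0 ≤ η →
      (∀ j, S.NormLE (p + 2 - c.partSize j) (w j) (a j)) →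
      (∀ j, S.NormLE (p + 2 - c.partSize j) (w' j) (a j)) →
      (∀ j, μ j ∈ S.level (p + 2 - (c.partSize j + 1))) →
      (∀ j, S.NormLE (p + 2 - (c.partSize j + 1)) (w' j - w j) (η * a j)) →
      (∀ j, S.NormLE (p + 2 - (c.partSize j + 2)) (w' j - w j - μ j) (η ^ 2 * a j)) →
      S.NormLE (p - (n + 1)) (S.derivsHat F P c.length u w' - S.derivsHat F P c.length u w -
        ∑ j, S.derivsHat F P c.length u (Function.update w j (μ j))) (Kc * η ^ 2 * ∏ j, a j)) :=
      fun c => by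
        by_cases hc : 2 ≤ c.length
        · obtain ⟨Kc, h0, hKc⟩ := H.derivsHat_taylor hc hn c.partSize_pos c.sum_partSize
          exact ⟨Kc, h0, fun _ => hKc⟩
        · exact ⟨0, le_rfl, fun h => absurd h hc⟩
    choose Kc hKc0 hKc using htay
    set B := (1 + K + K₁ + K₂ + K₃) * max 1 T with hB
    have hT1 : 1 ≤ max 1 T := le_max_left _ _
    have hB0 : 1 + K + K₁ + K₂ + K₃ ≤ B := le_mul_of_one_le_right (by positivity) hT1
    have hB1 : 1 ≤ B := by linarith
    have hBB : B ≤ B ^ 2 := le_self_pow₀ hB1 two_ne_zero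
    set Kf : ℝ := ∑ c : OrderedFinpartition (n + 1), (Kb c + Kc c) * B ^ 2 * B ^ c.length with hKf
    have hKf0 : 0 ≤ Kf := Finset.sum_nonneg fun c _ => by
      have := hKb0 c; have := hKc0 c; positivity
    refine ⟨K + C₁ * (Kf * T), by positivity,
      fun m hm1 hmn v v' w w' hv hvM hw hwM d hd h a ha t ht => ?_⟩
    have hpv := hv.isPath hvM
    have hpw := hw.isPath hwM
    have hd0 : 0 ≤ d := (norm_nonneg _).trans (hd t ht)
    have ha0 : ∀ j, 0 ≤ a j := fun j => (ha j).nonneg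
    have hpr : 0 ≤ ∏ j, a j := Finset.prod_nonneg fun j _ => ha0 j
    rcases Nat.lt_or_ge n m with hlt | hle
    swap
    · refine (ih m hm1 hle v v' w w' hv hvM hw hwM d hd h a ha t ht).of_le ?_
      have : 0 ≤ C₁ * (Kf * T) := by positivity
      have h3 : 0 ≤ d ^ 2 * ∏ j, a j := by positivity
      nlinarith
    obtain rfl : m = n + 1 := by omega
    set k := p - (n + 1) with hk
    set δ := S.incl (p + 1) (v 0 - w 0) with hδ
    have hδd : S.NormLE (p + 1) δ d := S.normLE_incl.2 (hd 0 ⟨le_rfl, ht.1.trans ht.2⟩)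
    have hcons : ∀ {m : ℕ} {h : Fin m → X 0} {a : Fin m → ℝ}, (∀ j, S.NormLE (p + 1) (h j) (a j)) →
        ∀ j, S.NormLE (p + 1) ((Fin.cons δ h : Fin (m + 1) → X 0) j)
          ((Fin.cons d a : Fin (m + 1) → ℝ) j) := fun ha => Fin.cases hδd ha
    obtain ⟨η, hη⟩ := hvar (n + 1) (k + 1) hm1 (by omega) (by omega) v v' hpv hv.continuousOn h a ha
    obtain ⟨θ, hθ⟩ := hvar (n + 1) (k + 1) hm1 (by omega) (by omega) w w' hpw hw.continuousOn h a ha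
    obtain ⟨ζ, hζ⟩ := hvar (n + 1 + 1) k (by omega) hn (by omega) w w' hpw hw.continuousOn
      (Fin.cons δ h) _ (hcons ha)
    have hs := (((hθ.solves.lower (by omega) hpw.mem).sub
      (hη.solves.lower (by omega) hpv.mem)).smul (-1)).sub hζ.solves
    have hz : (-1 : ℝ) • ((if n + 1 = 1 then ∑ i, h i else 0) - if n + 1 = 1 then ∑ i, h i else 0) -
        (if n + 1 + 1 = 1 then ∑ i, (Fin.cons δ h : Fin (n + 1 + 1) → X 0) i else 0) = 0 := by
      rw [if_neg (show ¬ n + 1 + 1 = 1 by omega)]; simp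
    rw [hz] at hs
    have key := hest w w' hpw _ _ _ 0 (Kf * d ^ 2 * ∏ j, a j) hs (S.normLE_zero _ le_rfl)
      (fun t ht => ?_) t ht
    · rw [map_sub, map_smul, map_sub, S.incl_dn, S.incl_dn, hη.eq t ht, hθ.eq t ht, hζ.eq t ht,
        neg_one_smul, neg_sub] at key
      refine key.of_le ?_
      have h3 : C₁ * (Kf * d ^ 2 * ∏ j, a j) * t ≤ C₁ * (Kf * d ^ 2 * ∏ j, a j) * T :=
        mul_le_mul_of_nonneg_left ht.2 (by positivity)
      have : 0 ≤ K * d ^ 2 * ∏ j, a j := by positivity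
      nlinarith
    set V := fun m h => D.variation F P T v m h t with hV
    set W := fun m h => D.variation F P T w m h t with hW
    set y : X (k + 1) := S.dn (k + 1) (η t) with hy
    have hyV : S.incl (k + 1) y = V (n + 1) h := by rw [hy, S.incl_dn, hη.eq t ht]
    obtain ⟨c₀, hc₀⟩ := OrderedFinpartition.exists_length_eq_one n
    have hsplit : S.incl k ((D.A k (v t) - D.A k (w t)) y) = ∑ c : OrderedFinpartition (n + 1),
        if c.length = 1 then S.incl k ((D.A k (v t) - D.A k (w t)) y) else 0 := by
      simp only [hc₀, Finset.sum_ite_eq', Finset.mem_univ, if_true]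
    have hμ : S.NormLE (p + 1) (W 1 fun _ => δ) (B * d) := by
      obtain ⟨ξ, hξ⟩ := hvar 1 p le_rfl (by omega) rfl w w' hpw hw.continuousOn (fun _ => δ)
        (fun _ => d) fun _ => hδd
      refine (hξ.normLE_max ht (by simpa using mul_nonneg (by linarith) hd0)).of_le ?_
      rw [hB, mul_right_comm, Fin.prod_univ_one]
      exact mul_le_mul_of_nonneg_right (mul_le_mul_of_nonneg_right (by linarith) (by linarith)) hd0
    have hpart : ∀ (v v' : ℝ → X (p + 1)), D.IsPath T M v v' → ContinuousOn v' (Icc 0 T) →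
        ∀ (c : OrderedFinpartition (n + 1)) i, S.NormLE (p + 2 - c.partSize i)
          (c.onParts (fun m h => D.variation F P T v m h t) h i) (B * ∏ j, a (c.emb i j)) :=
      fun v v' hv hv' c i => by
        have := c.partSize_le i
        obtain ⟨ξ, hξ⟩ := hvar (c.partSize i) (p + 1 - c.partSize i) (c.partSize_pos i) (by omega)
          (by omega) v v' hv hv' (h ∘ c.emb i) _ fun j => ha _
        rw [show p + 2 - c.partSize i = p + 1 - c.partSize i + 1 by omega]
        have h4 : 0 ≤ ∏ j, a (c.emb i j) := Finset.prod_nonneg fun j _ => ha0 _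
        refine (hξ.normLE_max ht (by positivity)).of_le ?_
        rw [hB, mul_right_comm]
        exact mul_le_mul_of_nonneg_right (mul_le_mul_of_nonneg_right (by linarith) (by linarith)) h4
    have hdiff : ∀ (c : OrderedFinpartition (n + 1)) i, S.NormLE (p + 2 - (c.partSize i + 1))
        (c.onParts V h i - c.onParts W h i) (B * d * (B * ∏ j, a (c.emb i j))) := fun c i => by
      have := hlip (c.partSize i) (c.partSize_pos i) ((c.partSize_le i).trans (by omega)) v v' w w'
        hpv hv.continuousOn hpw hw.continuousOn d hd (h ∘ c.emb i) _ (fun j => ha _) t ht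
      have h4 : 0 ≤ ∏ j, a (c.emb i j) := Finset.prod_nonneg fun j _ => ha0 _
      rw [show p + 2 - (c.partSize i + 1) = p + 1 - c.partSize i by omega]
      refine this.of_le ?_
      have h5 : K₂ * t ≤ B := mul_le_mul (by linarith) (ht.2.trans (le_max_right _ _)) ht.1
        (by linarith)
      calc K₂ * t * d * ∏ j, a (c.emb i j) ≤ B ^ 2 * d * ∏ j, a (c.emb i j) :=
          mul_le_mul_of_nonneg_right (mul_le_mul_of_nonneg_right (h5.trans hBB) hd0) h4
        _ = _ := by ring
    have hsum : (-1 : ℝ) • (D.forcing F P T w (n + 1) h t - D.forcing F P T v (n + 1) h t +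
        S.incl k ((D.A k (w t) - D.A k (v t)) y)) -
        D.forcing F P T w (n + 1 + 1) (Fin.cons δ h) t +
        S.incl k ((D.A k (w t) - D.A k (w t)) (ζ t)) = ∑ c : OrderedFinpartition (n + 1),
        ((((if 2 ≤ c.length then S.derivsHat F P c.length (v t) (c.onParts V h) else 0) +
          if c.length = 1 then S.incl k ((D.A k (v t) - D.A k (w t)) y) else 0) -
          (if 2 ≤ c.length then S.derivsHat F P c.length (w t) (c.onParts W h) else 0)) -
          (S.derivsHat F P (c.length + 1) (w t) (Fin.cons (W 1 fun _ => δ) (c.onParts W h)) +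
          ∑ i, if 2 ≤ c.length then S.derivsHat F P c.length (w t) (Function.update (c.onParts W h) i
            (W (c.partSize i + 1) (Fin.cons δ (h ∘ c.emb i)))) else 0)) := by
      have hf : D.forcing F P T w (n + 1 + 1) (Fin.cons δ h) t =
          ∑ c : OrderedFinpartition (n + 1),
          (S.derivsHat F P (c.length + 1) (w t) (Fin.cons (W 1 fun _ => δ) (c.onParts W h)) +
          ∑ i, if 2 ≤ c.length then S.derivsHat F P c.length (w t) (Function.update (c.onParts W h) i
            (W (c.partSize i + 1) (Fin.cons δ (h ∘ c.emb i)))) else 0) := by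
        rw [DissipativeFamily.forcing, OrderedFinpartition.sum_eq_sum_extend]
        refine Finset.sum_congr rfl fun c _ => ?_
        have h2 : 2 ≤ c.extendLeft.length := Nat.succ_le_succ (c.length_pos n.succ_pos)
        rw [if_pos h2, OrderedFinpartition.onParts_extendLeft]
        congr 1
        refine Finset.sum_congr rfl fun i _ => ?_
        rw [OrderedFinpartition.onParts_extendMiddle]
        rfl
      rw [hf]
      simp only [Finset.sum_sub_distrib, Finset.sum_add_distrib]
      rw [← hsplit, sub_self, zero_apply, map_zero, add_zero, ← neg_sub (D.A k (v t)), neg_apply, map_neg,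
        neg_one_smul]
      simp only [DissipativeFamily.forcing, hV, hW]
      abel
    refine (congrArg (fun z => S.NormLE k z _) hsum).mpr ?_
    rw [show Kf * d ^ 2 * ∏ j, a j = ∑ c : OrderedFinpartition (n + 1),
      (Kb c + Kc c) * B ^ 2 * B ^ c.length * d ^ 2 * ∏ j, a j by
        rw [hKf, Finset.sum_mul, Finset.sum_mul]]
    refine S.normLE_sum _ fun c _ => ?_
    have hd2 : ∀ z : ℝ, 0 ≤ z → z ≤ B ^ 2 → z * d ^ 2 ≤ (B * d) ^ 2 := fun z _ hz => by
      rw [mul_pow]; exact mul_le_mul_of_nonneg_right hz (sq_nonneg d)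
    have eb := fun cw cv => hKb c (w t) (hw.mem t ht) (v t) (hv.mem t ht) (c.onParts W h)
      (c.onParts V h) (W 1 fun _ => δ) _ (B * d) (by positivity) cw cv
      (hpart w w' hpw hw.continuousOn c) (hpart v v' hpv hv.continuousOn c) (hdiff c)
      ((hd t ht).trans (le_mul_of_one_le_left hd0 hB1)) hμ
      ((hbase v v' w w' hv hvM hw hwM d hd t ht).of_le (hd2 _ hK₃ (by linarith)))
    have hpa : (Kb c + Kc c) * B ^ 2 * B ^ c.length * d ^ 2 * ∏ j, a j =
        Kb c * (B * d) ^ 2 * ∏ i, (B * ∏ j, a (c.emb i j)) +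
          Kc c * (B * d) ^ 2 * ∏ i, (B * ∏ j, a (c.emb i j)) := by
      rw [prod_mul_const, c.prod_sigma_eq_prod a]; ring
    rw [hpa]
    by_cases hc : 2 ≤ c.length
    · have hconv : ∀ (u : ℝ → X (p + 1)), u t ∈ D.O → ∀ v v', D.IsPath T M v v' →
          ContinuousOn v' (Icc 0 T) → S.DerivsConv F P c.length (u t)
            (c.onParts (fun m h => D.variation F P T v m h t) h) (p - (n + 1)) :=
        fun u hu v v' hv hv' => by
          have := H.conv (r := p + 2) (by omega) le_rfl hc (by omega) c.partSize_pos c.sum_partSize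
            hu fun j => (hpart v v' hv hv' c j).mem
          exact ⟨S.level_mono (by omega) this.1, this.2⟩
      have e1 := eb (hconv w (hw.mem t ht) v v' hpv hv.continuousOn)
        (hconv v (hv.mem t ht) v v' hpv hv.continuousOn)
      have e2 := hKc c hc (w t) (hw.mem t ht) (c.onParts W h) (c.onParts V h)
        (fun i => W (c.partSize i + 1) (Fin.cons δ (h ∘ c.emb i))) _ (B * d) (by positivity)
        (hpart w w' hpw hw.continuousOn c) (hpart v v' hpv hv.continuousOn c) (fun i => ?_)
        (hdiff c) fun i => ?_
      · refine (congrArg (fun z => S.NormLE k z _) ?_).mpr (e1.add e2)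
        simp only [hc, if_true, show c.length ≠ 1 by omega, if_false]
        abel
      · have := c.partSize_lt hc i
        obtain ⟨ξ, hξ⟩ := hvar (c.partSize i + 1) (p - c.partSize i) (by omega) (by omega)
          (by omega) w w' hpw hw.continuousOn (Fin.cons δ (h ∘ c.emb i)) _ (hcons fun j => ha _)
        rw [show p + 2 - (c.partSize i + 1) = p - c.partSize i + 1 by omega]
        exact (hξ.normLE ht).mem
      · have h4 : 0 ≤ ∏ j, a (c.emb i j) := Finset.prod_nonneg fun j _ => ha0 _
        have := ih (c.partSize i) (c.partSize_pos i) (Nat.lt_succ_iff.1 (c.partSize_lt hc i))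
          v v' w w' hv hvM hw hwM d hd (h ∘ c.emb i) _ (fun j => ha _) t ht
        rw [Nat.add_sub_add_right]
        refine this.of_le (mul_le_mul (hd2 _ hK0 (by linarith)) ?_ h4 (by positivity))
        exact le_mul_of_one_le_left h4 hB1
    · have hl : c.length = 1 := by have := c.length_pos n.succ_pos; omega
      have hy1 : ∀ i, c.onParts V h i = S.incl (k + 1) y := fun i => by
        rw [c.onParts_of_length_eq_one hl, hyV]
      have cv := H.conv_one (k := k) (by omega) (hv.mem t ht) y hl hy1
      have cw := H.conv_one (k := k) (by omega) (hw.mem t ht) y hl hy1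
      have e1 := eb cw.2 cv.2
      rw [cv.1, cw.1] at e1
      have e2 := e1.add (S.normLE_zero k (c := Kc c * (B * d) ^ 2 * ∏ i, (B * ∏ j, a (c.emb i j)))
        (mul_nonneg (mul_nonneg (hKc0 c) (sq_nonneg _)) (Finset.prod_nonneg fun i _ =>
          mul_nonneg (by linarith) (Finset.prod_nonneg fun j _ => ha0 _))))
      refine (congrArg (fun z => S.NormLE k z _) ?_).mpr e2
      simp only [hl, show ¬ 2 ≤ 1 by omega, if_true, if_false, Finset.sum_const_zero, add_zero,
        zero_add, sub_zero, sub_apply, map_sub]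

end SmoothSystem

/-! ### Differentiability of the solution map -/

variable {X : ℕ → Type u} [∀ r, NormedAddCommGroup (X r)] [∀ r, InnerProductSpace ℝ (X r)]

theorem HilbertScale.exists_multilinearMap {S : HilbertScale X} {m r q : ℕ}
    {g : (Fin m → X 0) → X 0} {c : ℝ} (hc : 0 ≤ c)
    (hg : ∀ h : Fin m → X 0, (∀ j, h j ∈ S.level r) → ∀ (i : Fin m) (x y : X 0),
      x ∈ S.level r → y ∈ S.level r → ∀ a b : ℝ, g (Function.update h i (a • x + b • y)) =
        a • g (Function.update h i x) + b • g (Function.update h i y))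
    (hb : ∀ (h : Fin m → X 0) (a : Fin m → ℝ), (∀ j, S.NormLE r (h j) (a j)) →
      S.NormLE q (g h) (c * ∏ j, a j)) :
    ∃ L : ContinuousMultilinearMap ℝ (fun _ : Fin m => X r) (X q),
      (∀ w, S.incl q (L w) = g fun j => S.incl r (w j)) ∧ ‖L‖ ≤ c := by
  choose φ hφ hφb using fun w : Fin m → X r =>
    hb (fun j => S.incl r (w j)) (fun j => ‖w j‖) fun j => S.normLE_incl.2 le_rfl
  have hu : ∀ (w : Fin m → X r) (i : Fin m) (x y : X r) (a b : ℝ),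
      φ (Function.update w i (a • x + b • y)) =
        a • φ (Function.update w i x) + b • φ (Function.update w i y) := fun w i x y a b => by
    have e : ∀ x : X r, (fun j => S.incl r (Function.update w i x j)) =
        Function.update (fun j => S.incl r (w j)) i (S.incl r x) := fun x =>
      Function.comp_update (S.incl r) w i x
    apply S.incl_injective q
    rw [map_add, map_smul, map_smul, hφ, hφ, hφ, e, e, e, map_add, map_smul, map_smul]
    exact hg _ (fun j => S.incl_mem_level _) i _ _ (S.incl_mem_level _) (S.incl_mem_level _) a b
  refine ⟨(MultilinearMap.mk' φ (fun w i x y => ?_) fun w i a x => ?_).mkContinuous c hφb, hφ,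
    MultilinearMap.mkContinuous_norm_le _ hc _⟩
  · simpa using hu w i x y 1 1
  · simpa using hu w i x x a 0

theorem EvolutionData.uniqueDiffOn_initialSet (S : HilbertScale X) (E : EvolutionData X)
    (us : X E.n) (ε R₁ : ℝ) : UniqueDiffOn ℝ (E.initialSet S us ε R₁) := by
  rintro x ⟨hx, x', hx', rfl⟩
  refine ⟨(S.emb_denseRange (Nat.sub_le E.n 1)).mono ?_, subset_closure ⟨hx, x', hx', rfl⟩⟩
  rintro _ ⟨z, rfl⟩
  refine Submodule.subset_span (mem_tangentConeAt_of_add_smul_mem (l := 𝓝[≠] 0) tendsto_id ?_)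
  have h1 : Tendsto (fun c : ℝ => x' + c • z) (𝓝[≠] 0) (𝓝 x') := by
    have : Continuous fun c : ℝ => x' + c • z := by fun_prop
    simpa using (this.tendsto 0).mono_left nhdsWithin_le_nhds
  have h2 := ((E.down S).continuous.tendsto x').comp h1
  filter_upwards [h1.eventually (isOpen_ball.mem_nhds hx'),
    h2.eventually (isOpen_ball.mem_nhds hx)] with c hc1 hc2
  have e : E.down S (x' + c • z) = E.down S x' + c • S.emb (Nat.sub_le E.n 1) z := by
    rw [map_add, map_smul]; rfl
  exact ⟨e ▸ hc2, _, hc1, e⟩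

/-- Solutions of `v' = F(v)` with initial values in `I`, bounded and Lipschitz continuous in the
initial value. -/
structure DissipativeFamily.IsFlowFamily {S : HilbertScale X} {p : ℕ}
    (D : DissipativeFamily S (X (p + 1))) (F : X (p + 1) → X p) (I : Set (X (p + 1)))
    (T M K : ℝ) (v w : X (p + 1) → ℝ → X (p + 1)) : Prop where
  T_nonneg : 0 ≤ T
  M_nonneg : 0 ≤ M
  K_nonneg : 0 ≤ K
  isFlow : ∀ x ∈ I, D.IsFlow F T (v x) (w x)
  bound : ∀ x ∈ I, ∀ t ∈ Icc 0 T, ‖w x t‖ ≤ M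
  initial : ∀ x ∈ I, v x 0 = x
  lipschitz : ∀ x ∈ I, ∀ y ∈ I, ∀ t ∈ Icc 0 T, ‖v x t - v y t‖ ≤ K * ‖x - y‖

namespace SmoothSystem

variable {S : HilbertScale X} {p : ℕ} {D : DissipativeFamily S (X (p + 1))}
  {F : X (p + 1) → X p} {C : ℝ} {m₀ r₀ : ℕ} {P : ℕ → X 0 →L[ℝ] X (p + 1)} {KP : ℝ}
  {I : Set (X (p + 1))} {T M K : ℝ} {v w : X (p + 1) → ℝ → X (p + 1)}

/-- The derivatives of the flow at time `t` with respect to the initial value, including the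
derivative of order zero. -/
noncomputable def jet (D : DissipativeFamily S (X (p + 1))) (F : X (p + 1) → X p)
    (P : ℕ → X 0 →L[ℝ] X (p + 1)) (T : ℝ) (v : X (p + 1) → ℝ → X (p + 1)) (t : ℝ) :
    (m : ℕ) → X (p + 1) → (Fin m → X 0) → X 0
  | 0, x, _ => S.incl (p + 1) (v x t)
  | m + 1, x, h => D.variation F P T (v x) (m + 1) h t

variable [∀ r, CompleteSpace (X r)]

theorem jet_lipschitz (H : SmoothSystem D F C m₀ r₀ P KP)
    (Φ : D.IsFlowFamily F I T M K v w) {t : ℝ} (ht : t ∈ Icc 0 T) :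
    ∃ B, 0 ≤ B ∧ ∀ m ≤ m₀, ∀ x ∈ I, ∀ y ∈ I, ∀ (h : Fin m → X 0) (a : Fin m → ℝ),
      (∀ j, S.NormLE (p + 1) (h j) (a j)) →
      S.NormLE (p + 1 - m) (jet D F P T v t m x h - jet D F P T v t m y h)
        (B * ‖x - y‖ * ∏ j, a j) := by
  obtain ⟨B, hB, hlip⟩ := H.exists_variation_lipschitz Φ.M_nonneg Φ.T_nonneg H.field.r₀_le le_rfl
    m₀ le_rfl (Or.inr (Or.inr (Or.inr rfl)))
  have hK := Φ.K_nonneg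
  have ht0 := ht.1
  refine ⟨K + B * t * K, by positivity, fun m hm x hx y hy h a ha => ?_⟩
  have hpr : 0 ≤ ∏ j, a j := Finset.prod_nonneg fun j _ => (ha j).nonneg
  have h1 : 0 ≤ K * ‖x - y‖ * ∏ j, a j := by positivity
  have h2 : 0 ≤ B * t * (K * ‖x - y‖) * ∏ j, a j := by positivity
  cases m with
  | zero =>
    rw [jet, jet, ← map_sub, Nat.sub_zero, S.normLE_incl]
    refine (Φ.lipschitz x hx y hy t ht).trans ?_
    simp only [Finset.univ_eq_empty, Finset.prod_empty, mul_one] at h2 ⊢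
    linarith
  | succ m =>
    refine (hlip _ (by omega) hm _ _ _ _ ((Φ.isFlow x hx).isPath (Φ.bound x hx))
      (Φ.isFlow x hx).continuousOn ((Φ.isFlow y hy).isPath (Φ.bound y hy))
      (Φ.isFlow y hy).continuousOn _ (Φ.lipschitz x hx y hy) h a ha t ht).of_le ?_
    linarith

theorem jet_taylor (H : SmoothSystem D F C m₀ r₀ P KP)
    (Φ : D.IsFlowFamily F I T M K v w) {t : ℝ} (ht : t ∈ Icc 0 T) :
    ∃ B, 0 ≤ B ∧ ∀ m, m + 1 ≤ m₀ → ∀ x ∈ I, ∀ y ∈ I, ∀ (h : Fin m → X 0) (a : Fin m → ℝ),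
      (∀ j, S.NormLE (p + 1) (h j) (a j)) →
      S.NormLE (p - m) (jet D F P T v t m y h - jet D F P T v t m x h -
        jet D F P T v t (m + 1) x (Fin.cons (S.incl (p + 1) (y - x)) h))
        (B * ‖y - x‖ ^ 2 * ∏ j, a j) := by
  obtain ⟨B, hB, hbase⟩ := H.exists_flow_taylor Φ.M_nonneg Φ.T_nonneg
  obtain ⟨B', hB', htay⟩ := H.exists_variation_taylor Φ.M_nonneg Φ.T_nonneg (m₀ - 1) (by
    have := H.field.one_le; omega)
  refine ⟨(B + B') * K ^ 2, by positivity, fun m hm x hx y hy h a ha => ?_⟩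
  have hpr : 0 ≤ ∏ j, a j := Finset.prod_nonneg fun j _ => (ha j).nonneg
  have h1 : 0 ≤ B * (K * ‖y - x‖) ^ 2 * ∏ j, a j := by positivity
  have h2 : 0 ≤ B' * (K * ‖y - x‖) ^ 2 * ∏ j, a j := by positivity
  have h3 : (B + B') * K ^ 2 * ‖y - x‖ ^ 2 * ∏ j, a j = B * (K * ‖y - x‖) ^ 2 * ∏ j, a j +
    B' * (K * ‖y - x‖) ^ 2 * ∏ j, a j := by ring
  rw [h3]
  cases m with
  | zero =>
    have := hbase _ _ _ _ (Φ.isFlow y hy) (Φ.bound y hy) (Φ.isFlow x hx) (Φ.bound x hx) _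
      (Φ.lipschitz y hy x hx) t ht
    rw [Φ.initial x hx, Φ.initial y hy, map_sub] at this
    rw [jet, jet, jet, show (Fin.cons (S.incl (p + 1) (y - x)) h : Fin (0 + 1) → X 0) =
      fun _ => S.incl (p + 1) (y - x) from
        funext fun i => Fin.cases rfl (fun j => j.elim0) i]
    refine this.of_le ?_
    simp only [Finset.univ_eq_empty, Finset.prod_empty, mul_one] at h2 ⊢
    linarith
  | succ m =>
    have := htay (m + 1) (by omega) (by omega) _ _ _ _ (Φ.isFlow y hy) (Φ.bound y hy)
      (Φ.isFlow x hx) (Φ.bound x hx) _ (Φ.lipschitz y hy x hx) h a ha t ht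
    rw [Φ.initial x hx, Φ.initial y hy] at this
    exact this.of_le (by linarith)

theorem exists_derivative (H : SmoothSystem D F C m₀ r₀ P KP)
    (Φ : D.IsFlowFamily F I T M K v w) {r : ℕ} (h1 : r₀ ≤ r) (h2 : r ≤ p + 1) :
    ∃ B, 1 ≤ B ∧ ∀ m, 1 ≤ m → m ≤ m₀ → ∀ t ∈ Icc 0 T, ∀ x ∈ I,
      ∃ L : ContinuousMultilinearMap ℝ (fun _ : Fin m => X r) (X (r - m + 1)),
        (∀ h, S.incl (r - m + 1) (L h) = D.variation F P T (v x) m (fun j => S.incl r (h j)) t) ∧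
        ‖L‖ ≤ B * if m = 1 then 1 else t := by
  obtain ⟨B, hB1, hB⟩ := H.exists_isVariation Φ.M_nonneg Φ.T_nonneg h1 h2 m₀ le_rfl
  refine ⟨B, hB1, fun m hm hm₀ t ht x hx => ?_⟩
  have hv := (Φ.isFlow x hx).isPath (Φ.bound x hx)
  have hc := (Φ.isFlow x hx).continuousOn
  refine S.exists_multilinearMap (g := fun h => D.variation F P T (v x) m h t)
    (mul_nonneg (by linarith) (ite_time_le ht m).1)
    (fun h hh i y z hy hz a b => H.variation_update_linear Φ.M_nonneg Φ.T_nonneg h1 h2 hv hc hm₀ hh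
      i hy hz a b ht) fun h a ha => ?_
  obtain ⟨η, hη⟩ := hB m hm hm₀ _ _ hv hc h a ha
  rw [mul_right_comm]
  exact hη.normLE ht

theorem exists_taylorSeries (H : SmoothSystem D F C m₀ r₀ P KP)
    (Φ : D.IsFlowFamily F I T M K v w) {t : ℝ} (ht : t ∈ Icc 0 T) {m : ℕ} (hm : m ≤ m₀) :
    ∃ G : X (p + 1) → FormalMultilinearSeries ℝ (X (p + 1)) (X (p + 1 - m)),
      HasFTaylorSeriesUpToOn m (fun x => S.emb (Nat.sub_le (p + 1) m) (v x t)) G I ∧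
      (∀ x ∈ I, ∀ h, S.incl (p + 1 - m) (G x m h) =
        jet D F P T v t m x fun j => S.incl (p + 1) (h j)) ∧
      ∃ K : NNReal, LipschitzOnWith K (G · m) I := by
  have hr₀ := H.field.r₀_le
  have hm₀ := H.field.m₀_le
  obtain ⟨B, hB1, hB⟩ := H.exists_derivative Φ hr₀ le_rfl
  have hex : ∀ (x : X (p + 1)) (j : ℕ), ∃ L : ContinuousMultilinearMap ℝ
      (fun _ : Fin j => X (p + 1)) (X (p + 1 - m)), x ∈ I → j ≤ m → ∀ h,
      S.incl (p + 1 - m) (L h) = jet D F P T v t j x fun i => S.incl (p + 1) (h i) := by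
    intro x j
    by_cases hxj : x ∈ I ∧ j ≤ m
    swap
    · exact ⟨0, fun h1 h2 => absurd ⟨h1, h2⟩ hxj⟩
    obtain ⟨hx, hj⟩ := hxj
    cases j with
    | zero =>
      exact ⟨ContinuousMultilinearMap.uncurry0 ℝ _ (S.emb (Nat.sub_le (p + 1) m) (v x t)),
        fun _ _ h => S.incl_emb _ _⟩
    | succ j =>
      obtain ⟨L, hL, -⟩ := hB (j + 1) (by omega) (by omega) t ht x hx
      exact ⟨(S.emb (show p + 1 - m ≤ p + 1 - (j + 1) + 1 by omega)).compContinuousMultilinearMap L,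
        fun _ _ h => (S.incl_emb _ _).trans (hL h)⟩
  choose G hG using hex
  obtain ⟨Bl, hBl0, hBl⟩ := H.jet_lipschitz Φ ht
  obtain ⟨Bt, hBt0, hBt⟩ := H.jet_taylor Φ ht
  have hlip : ∀ j ≤ m, LipschitzOnWith Bl.toNNReal (G · j) I := fun j hj =>
    LipschitzOnWith.of_dist_le_mul fun x hx y hy => by
      rw [dist_eq_norm, dist_eq_norm, Real.coe_toNNReal _ hBl0]
      refine ContinuousMultilinearMap.opNorm_le_bound (by positivity) fun h => ?_
      rw [← S.normLE_incl (q := p + 1 - m), sub_apply, map_sub, hG x j hx hj, hG y j hy hj]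
      exact (hBl j (hj.trans hm) x hx y hy _ _ fun i => S.normLE_incl.2 le_rfl).down (by omega)
  refine ⟨G, ⟨fun x hx => ?_, fun j hj x hx => ?_, fun j hj =>
    (hlip j (by exact_mod_cast hj)).continuousOn⟩, fun x hx h => hG x m hx le_rfl h, _, hlip m le_rfl⟩
  · apply S.incl_injective
    exact (hG x 0 hx (Nat.zero_le _) 0).trans (S.incl_emb _ _).symm
  · have hj : j < m := by exact_mod_cast hj
    refine HasFDerivWithinAt.of_isLittleO ?_
    refine Asymptotics.IsBigO.trans_isLittleO (g := fun y => ‖y - x‖ ^ 2)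
      (Asymptotics.IsBigO.of_bound Bt ?_)
      ((Asymptotics.isLittleO_pow_sub_sub x one_lt_two).mono nhdsWithin_le_nhds)
    filter_upwards [self_mem_nhdsWithin] with y hy
    rw [norm_pow, norm_norm]
    refine ContinuousMultilinearMap.opNorm_le_bound (by positivity) fun h => ?_
    rw [← S.normLE_incl (q := p + 1 - m), sub_apply, sub_apply, map_sub, map_sub, hG y j hy hj.le,
      hG x j hx hj.le, ContinuousMultilinearMap.curryLeft_apply, hG x (j + 1) hx hj]
    have e : (fun i => S.incl (p + 1) ((Fin.cons (y - x) h : Fin (j + 1) → X (p + 1)) i)) =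
        Fin.cons (S.incl (p + 1) (y - x)) fun i => S.incl (p + 1) (h i) :=
      funext fun i => Fin.cases rfl (fun _ => rfl) i
    rw [e]
    exact (hBt j (by omega) x hx y hy _ _ fun i => S.normLE_incl.2 le_rfl).down (by omega)

end SmoothSystem

variable {X : ℕ → Type u} [∀ r, NormedAddCommGroup (X r)] [∀ r, InnerProductSpace ℝ (X r)]

section Translation

variable {S : HilbertScale X} {p : ℕ} {two_le_n : 2 ≤ p + 2} {O : Set (X (p + 1))}
  {F : X (p + 1) → X p} {A : (r : ℕ) → X (p + 1) → (X r →L[ℝ] X (r - 1))}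
  {L : X (p + 1) → (X 0 →L[ℝ] X 0 →L[ℝ] ℝ)} {ω a CL : ℝ} {one_le_CL : 1 ≤ CL} {C : ℝ}
  {one_le_C : 1 ≤ C} [∀ r, CompleteSpace (X r)]

theorem EvolutionData.exists_smoothSystem {m₀ r₀ : ℕ} {us : X (p + 2)} {R₁ ε T M₀ M₂ : ℝ}
    {U : ℝ → X (p + 1) → X (p + 2)}
    (h1 : (⟨p + 2, two_le_n, O, F, A, L, ω, a, CL, one_le_CL, C, one_le_C⟩ : EvolutionData X).B1 S)
    (h2 : (⟨p + 2, two_le_n, O, F, A, L, ω, a, CL, one_le_CL, C, one_le_C⟩ : EvolutionData X).B2 S)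
    (h3 : (⟨p + 2, two_le_n, O, F, A, L, ω, a, CL, one_le_CL, C, one_le_C⟩ : EvolutionData X).B3 S)
    (h5 : (⟨p + 2, two_le_n, O, F, A, L, ω, a, CL, one_le_CL, C, one_le_C⟩ :
      EvolutionData X).B5 S m₀ r₀)
    (hU : (⟨p + 2, two_le_n, O, F, A, L, ω, a, CL, one_le_CL, C, one_le_C⟩ :
      EvolutionData X).IsSolutionMap S us R₁ ε T M₀ M₂ U) :
    ∃ (D : DissipativeFamily S (X (p + 1))) (P : ℕ → X 0 →L[ℝ] X (p + 1)) (KP M : ℝ)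
      (w : X (p + 1) → ℝ → X (p + 1)), SmoothSystem D F C m₀ r₀ P KP ∧
      D.IsFlowFamily F ((⟨p + 2, two_le_n, O, F, A, L, ω, a, CL, one_le_CL, C, one_le_C⟩ :
        EvolutionData X).initialSet S us ε R₁) T M M₂ (fun x t => S.dn (p + 1) (U t x)) w := by
  set Q := toQuasilinearEquation h1 h2 h3 with hQ
  set b := S.dn (p + 1) us with hb
  have hε := hU.ε_pos
  have hbO : ball b (2 * ε) ⊆ Q.O := hU.ball_subset
  obtain ⟨P, KP, hP⟩ := (Q.ballFamily b (2 * ε) hbO).exists_isSmoothing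
    (mem_ball_self (by linarith) : b ∈ ball b (2 * ε))
  obtain ⟨M, hM, hMb⟩ := Q.exists_bound_Fn hbO M₀
  have hfield : SmoothField S F O C m₀ r₀ := ⟨h1.isOpen, one_le_C, h5.one_le, h5.m₀_le, h5.r₀_le,
    h5.contDiffOn, h5.bound, h5.lipschitz⟩
  have hflow := fun x hx => Q.isFlow_of_C1 hbO hU.T_pos (fun t ht => (hU.mem x hx t ht).1)
    (hU.isSolution x hx).contDiffOn (hU.isSolution x hx).eq
  refine ⟨Q.ballFamily b (2 * ε) hbO, P, KP, M, _,
    ⟨hfield.mono isOpen_ball hbO, Q.family_isDerivativeOf isOpen_ball (convex_ball _ _) hbO, hP⟩,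
    hU.T_pos.le, hM.le, hU.M₂_pos.le, hflow, fun x hx t ht => ?_, hU.initial, hU.lipschitz⟩
  have hm := hU.mem x hx t ht
  have e : S.dn p (derivWithin (fun t => S.dn (p + 1) (U t x)) (Icc 0 T) t) =
      S.dn p (Q.Fn (U t x)) := ((hflow x hx).eq t ht).symm.trans (Q.dn_Fn _ (hbO hm.1)).symm
  have e' : derivWithin (fun t => S.dn (p + 1) (U t x)) (Icc 0 T) t = Q.Fn (U t x) :=
    S.dn_injective p e
  exact e' ▸ hMb _ hm.1 hm.2

end Translation

variable {X : ℕ → Type u} [∀ r, NormedAddCommGroup (X r)] [∀ r, InnerProductSpace ℝ (X r)]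
  [∀ r, CompleteSpace (X r)] {S : HilbertScale X} {p : ℕ} {D : DissipativeFamily S (X (p + 1))}
  {F : X (p + 1) → X p} {C : ℝ} {m₀ r₀ : ℕ} {P : ℕ → X 0 →L[ℝ] X (p + 1)} {KP : ℝ}
  {I : Set (X (p + 1))} {T M K : ℝ} {v w : X (p + 1) → ℝ → X (p + 1)}

/-- The regularity of a flow with respect to the initial value. -/
theorem SmoothSystem.regularity (H : SmoothSystem D F C m₀ r₀ P KP)
    (Φ : D.IsFlowFamily F I T M K v w) (hud : UniqueDiffOn ℝ I) :
    (∀ t ∈ Icc 0 T, ∀ m : ℕ, 1 ≤ m → m ≤ m₀ →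
        ContDiffOn ℝ m (fun x => S.emb (Nat.sub_le (p + 1) m) (v x t)) I ∧
        ∃ K : NNReal, LipschitzOnWith K
          (iteratedFDerivWithin ℝ m (fun x => S.emb (Nat.sub_le (p + 1) m) (v x t)) I)
          I) ∧
      ∃ C : ℝ, 0 < C ∧ ∀ m r : ℕ, 1 ≤ m → m ≤ m₀ → r₀ ≤ r → r ≤ p + 1 →
        ∃ D : ℝ → X (p + 1) →
            ContinuousMultilinearMap ℝ (fun _ : Fin m => X r) (X (r - m + 1)),
          (∀ t ∈ Icc 0 T, ∀ x ∈ I,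
            S.Extends (D t x)
              (iteratedFDerivWithin ℝ m (fun x => S.emb (Nat.sub_le (p + 1) m) (v x t)) I x)) ∧
          (∀ x ∈ I, ∀ w : Fin m → X r,
            ContinuousOn (fun t => D t x w) (Icc 0 T)) ∧
          (∀ t ∈ Icc 0 T, ∀ x ∈ I,
            ‖D t x‖ ≤ if m = 1 then C else C * t) ∧
          ((m = 1 ∨ m < m₀ ∨ r₀ < r ∨ r₀ = p + 1) →
            ∀ t ∈ Icc 0 T, ∀ x ∈ I, ∀ y ∈ I,
              ‖(S.emb (Nat.le_succ (r - m))).compContinuousMultilinearMap (D t x - D t y)‖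
                ≤ C * t * ‖x - y‖) := by
  have hK₀ := Φ.K_nonneg
  have hpath := fun x hx => (Φ.isFlow x hx).isPath (Φ.bound x hx)
  have hm₀ : m₀ ≤ r₀ := H.field.m₀_le
  have hDU : ∀ t ∈ Icc 0 T, ∀ m : ℕ, 1 ≤ m → m ≤ m₀ →
      ContDiffOn ℝ m (fun x => S.emb (Nat.sub_le (p + 1) m) (v x t)) I ∧
      (∃ K : NNReal, LipschitzOnWith K
          (iteratedFDerivWithin ℝ m (fun x => S.emb (Nat.sub_le (p + 1) m) (v x t)) I)
        I) ∧
      ∀ x ∈ I, ∀ h, S.incl (p + 1 - m)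
        (iteratedFDerivWithin ℝ m (fun x => S.emb (Nat.sub_le (p + 1) m) (v x t)) I x h) =
        D.variation F P T (v x) m (fun j => S.incl (p + 1) (h j)) t := by
    intro t ht m hm1 hm
    obtain ⟨G, hG, hGe, K, hK⟩ := H.exists_taylorSeries Φ ht hm
    have e : ∀ x ∈ I, G x m =
      iteratedFDerivWithin ℝ m (fun x => S.emb (Nat.sub_le (p + 1) m) (v x t)) I x :=
      fun x hx => hG.eq_iteratedFDerivWithin_of_uniqueDiffOn le_rfl hud hx
    refine ⟨hG.contDiffOn, ⟨K, fun x hx y hy => ?_⟩, fun x hx h => ?_⟩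
    · rw [← e x hx, ← e y hy]; exact hK hx hy
    · rw [← e x hx]
      refine (hGe x hx h).trans ?_
      cases m with
      | zero => omega
      | succ m => rfl
  refine ⟨fun t ht m hm1 hm => ⟨(hDU t ht m hm1 hm).1, (hDU t ht m hm1 hm).2.1⟩, ?_⟩
  have hbound : ∀ r, ∃ B, 1 ≤ B ∧ (r₀ ≤ r → r ≤ p + 1 → ∀ m, 1 ≤ m → m ≤ m₀ → ∀ t ∈ Icc 0 T,
      ∀ x ∈ I,
      ∃ L : ContinuousMultilinearMap ℝ (fun _ : Fin m => X r) (X (r - m + 1)),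
        (∀ h, S.incl (r - m + 1) (L h) = D.variation F P T (v x) m
          (fun j => S.incl r (h j)) t) ∧ ‖L‖ ≤ B * if m = 1 then 1 else t) := fun r => by
    by_cases hr : r₀ ≤ r ∧ r ≤ p + 1
    · obtain ⟨B, hB1, hB⟩ := H.exists_derivative Φ hr.1 hr.2
      exact ⟨B, hB1, fun _ _ => hB⟩
    · exact ⟨1, le_rfl, fun h1 h2 => absurd ⟨h1, h2⟩ hr⟩
  choose B hB1 hB using hbound
  have hlip : ∀ r m, ∃ B, 0 ≤ B ∧ (r₀ ≤ r → r ≤ p + 1 → 1 ≤ m → m ≤ m₀ →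
      (m = 1 ∨ m < m₀ ∨ r₀ < r ∨ r₀ = p + 1) → ∀ x ∈ I,
      ∀ y ∈ I, ∀ (h : Fin m → X 0) (a : Fin m → ℝ),
      (∀ j, S.NormLE r (h j) (a j)) → ∀ t ∈ Icc 0 T, S.NormLE (r - m)
        (D.variation F P T (v x) m h t -
          D.variation F P T (v y) m h t)
        (B * t * (K * ‖x - y‖) * ∏ j, a j)) := fun r m => by
    by_cases hr : r₀ ≤ r ∧ r ≤ p + 1 ∧ 1 ≤ m ∧ m ≤ m₀ ∧ (m = 1 ∨ m < m₀ ∨ r₀ < r ∨ r₀ = p + 1)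
    · obtain ⟨h1, h2, h3, h4, h5⟩ := hr
      obtain ⟨B, hB0, hB⟩ := H.exists_variation_lipschitz Φ.M_nonneg Φ.T_nonneg h1 h2 m h4 (by omega)
      exact ⟨B, hB0, fun _ _ _ _ _ x hx y hy => hB m h3 le_rfl _ _ _ _ (hpath x hx)
        (Φ.isFlow x hx).continuousOn (hpath y hy) (Φ.isFlow y hy).continuousOn _
        (Φ.lipschitz x hx y hy)⟩
    · exact ⟨0, le_rfl, fun h1 h2 h3 h4 h5 => absurd ⟨h1, h2, h3, h4, h5⟩ hr⟩
  choose Bl hBl0 hBl using hlip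
  have hterm : ∀ r m, 0 ≤ Bl r m * K := fun r m => mul_nonneg (hBl0 r m) hK₀
  have hterm' : ∀ r, 1 ≤ B r + ∑ m ∈ Finset.range (m₀ + 1), Bl r m * K := fun r => by
    have := Finset.sum_nonneg fun m (_ : m ∈ Finset.range (m₀ + 1)) => hterm r m
    linarith [hB1 r]
  set Cm := ∑ r ∈ Finset.range (p + 2), (B r + ∑ m ∈ Finset.range (m₀ + 1), Bl r m * K) with hCm
  have hle : ∀ r, r ≤ p + 1 → B r + ∑ m ∈ Finset.range (m₀ + 1), Bl r m * K ≤ Cm := fun r hr =>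
    Finset.single_le_sum (f := fun r => B r + ∑ m ∈ Finset.range (m₀ + 1), Bl r m * K)
      (fun r _ => zero_le_one.trans (hterm' r)) (Finset.mem_range.2 (by omega))
  refine ⟨Cm, by linarith [hterm' 0, hle 0 (Nat.zero_le _)], fun m r hm1 hm hr₀ hr => ?_⟩
  have hr : r ≤ p + 1 := hr
  have hBC : B r ≤ Cm := by
    have := Finset.sum_nonneg fun m (_ : m ∈ Finset.range (m₀ + 1)) => hterm r m
    linarith [hle r hr]
  have hBlC : Bl r m * K ≤ Cm := by
    have := Finset.single_le_sum (f := fun m => Bl r m * K) (fun m _ => hterm r m)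
      (Finset.mem_range.2 (Nat.lt_succ_of_le hm))
    linarith [hle r hr, hB1 r]
  have hex : ∀ (t : ℝ) (x : X (p + 1)),
      ∃ L : ContinuousMultilinearMap ℝ (fun _ : Fin m => X r) (X (r - m + 1)), t ∈ Icc 0 T →
        x ∈ I → (∀ h, S.incl (r - m + 1) (L h) =
          D.variation F P T (v x) m (fun j => S.incl r (h j)) t) ∧
        ‖L‖ ≤ B r * if m = 1 then 1 else t := fun t x => by
    by_cases h : t ∈ Icc 0 T ∧ x ∈ I
    · obtain ⟨L, hL⟩ := hB r hr₀ hr m hm1 hm t h.1 x h.2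
      exact ⟨L, fun _ _ => hL⟩
    · exact ⟨0, fun h1 h2 => absurd ⟨h1, h2⟩ h⟩
  choose G hG using hex
  refine ⟨G, fun t ht x hx h w hw => ?_, fun x hx h => ?_, fun t ht x hx => ?_,
    fun hcase t ht x hx y hy => ?_⟩
  · refine ((hG t x ht hx).1 h).trans (Eq.trans ?_ ((hDU t ht m hm1 hm).2.2 x hx w).symm)
    rw [funext hw]
  · obtain ⟨K, -, hK⟩ := H.exists_isVariation Φ.M_nonneg Φ.T_nonneg hr₀ hr m₀ le_rfl
    obtain ⟨η, hη⟩ := hK m hm1 hm _ _ (hpath x hx) (Φ.isFlow x hx).continuousOn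
      (fun j => S.incl r (h j)) (fun j => ‖h j‖) fun j => S.normLE_incl.2 le_rfl
    refine hη.continuousOn.congr fun t ht => ?_
    apply S.incl_injective
    rw [(hG t x ht hx).1, hη.eq t ht]
  · refine (hG t x ht hx).2.trans ?_
    split_ifs
    · rwa [mul_one]
    · exact mul_le_mul_of_nonneg_right hBC ht.1
  · have hC0 : 0 ≤ Cm := (hterm r m).trans hBlC
    have ht0 := ht.1
    refine ContinuousMultilinearMap.opNorm_le_bound (by positivity) fun h => ?_
    have := hBl r m hr₀ hr hm1 hm hcase x hx y hy (fun j => S.incl r (h j)) (fun j => ‖h j‖)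
      (fun j => S.normLE_incl.2 le_rfl) t ht
    rw [← S.normLE_incl (q := r - m), ContinuousLinearMap.compContinuousMultilinearMap_coe,
      Function.comp_apply, S.incl_emb, sub_apply, map_sub, (hG t x ht hx).1, (hG t y ht hy).1]
    refine this.of_le (mul_le_mul_of_nonneg_right ?_ (Finset.prod_nonneg fun j _ => norm_nonneg _))
    calc Bl r m * t * (K * ‖x - y‖) = Bl r m * K * (t * ‖x - y‖) := by ring
      _ ≤ Cm * (t * ‖x - y‖) := mul_le_mul_of_nonneg_right hBlC (by positivity)
      _ = _ := by ring

theorem theoremT {X : ℕ → Type u} [∀ r, NormedAddCommGroup (X r)]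
    [∀ r, InnerProductSpace ℝ (X r)] [∀ r, CompleteSpace (X r)]
    (S : HilbertScale X) (E : EvolutionData X) (m₀ r₀ : ℕ) (us : X E.n) (R₁ : ℝ)
    (hB1 : E.B1 S) (hB2 : E.B2 S) (hB3 : E.B3 S) (hB4 : E.B4 S us) (hB5 : E.B5 S m₀ r₀)
    (hus : us ∈ E.On S) (hR₁ : ‖us‖ < R₁) :
    -- the solution map exists
    (∃ (ε T M₀ M₂ : ℝ) (U : ℝ → X (E.n - 1) → X E.n), E.IsSolutionMap S us R₁ ε T M₀ M₂ U) ∧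
    -- and each such solution map is smooth
    ∀ (ε T M₀ M₂ : ℝ) (U : ℝ → X (E.n - 1) → X E.n), E.IsSolutionMap S us R₁ ε T M₀ M₂ U →
      -- it is of class `C^{m,1}` with values in `X (n - 1 - m)`
      (∀ t ∈ Icc 0 T, ∀ m : ℕ, 1 ≤ m → m ≤ m₀ →
        ContDiffOn ℝ m (E.solutionMap S U m t) (E.initialSet S us ε R₁) ∧
        ∃ K : NNReal, LipschitzOnWith K (E.DU S U (E.initialSet S us ε R₁) m t)
          (E.initialSet S us ε R₁)) ∧
      ∃ C : ℝ, 0 < C ∧ ∀ m r : ℕ, 1 ≤ m → m ≤ m₀ → r₀ ≤ r → r ≤ E.n - 1 →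
        -- its `m`-th derivative extends to bounded operators from `(X r)^m` to `X (r - m + 1)`
        ∃ D : ℝ → X (E.n - 1) →
            ContinuousMultilinearMap ℝ (fun _ : Fin m => X r) (X (r - m + 1)),
          (∀ t ∈ Icc 0 T, ∀ x ∈ E.initialSet S us ε R₁,
            S.Extends (D t x) (E.DU S U (E.initialSet S us ε R₁) m t x)) ∧
          -- strong continuity in time
          (∀ x ∈ E.initialSet S us ε R₁, ∀ w : Fin m → X r,
            ContinuousOn (fun t => D t x w) (Icc 0 T)) ∧
          -- bounds
          (∀ t ∈ Icc 0 T, ∀ x ∈ E.initialSet S us ε R₁,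
            ‖D t x‖ ≤ if m = 1 then C else C * t) ∧
          -- Lipschitz dependence on the initial value, one degree lower
          ((m = 1 ∨ m < m₀ ∨ r₀ < r ∨ r₀ = E.n - 1) →
            ∀ t ∈ Icc 0 T, ∀ x ∈ E.initialSet S us ε R₁, ∀ y ∈ E.initialSet S us ε R₁,
              ‖(S.emb (Nat.le_succ (r - m))).compContinuousMultilinearMap (D t x - D t y)‖
                ≤ C * t * ‖x - y‖) := by
  obtain ⟨n, two_le_n, O, F, A, L, ω, a, CL, one_le_CL, C, one_le_C⟩ := E
  obtain ⟨p, rfl⟩ := Nat.exists_eq_add_of_le' two_le_n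
  refine ⟨EvolutionData.exists_solutionMap hB1 hB2 hB3 hB4 hus, fun ε T M₀ M₂ U hU => ?_⟩
  obtain ⟨D, P, KP, M, w, H, Φ⟩ := EvolutionData.exists_smoothSystem hB1 hB2 hB3 hB5 hU
  exact H.regularity Φ (EvolutionData.uniqueDiffOn_initialSet S _ us ε R₁)
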